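/- Let $T\ge 0$, $d\in\mathbb N$, and let $(\Omega,\mathcal F,\mathbb P)$ be a probability space carrying a standard $\mathbb R^d$-valued Brownian motion $(B_t)_{t\in[0,T]}$. Let $(\mathcal F_t)_{t\in[0,T]}$ be the natural filtration of $B$, augmented by the $\mathbb P$-negligible events, and assume $\mathcal F=\mathcal F_T$. Let $$\mathcal X=\Big\{\exp\Big(\int_0^T h(s)\cdot dB_s-\tfrac12\int_0^T|h(s)|^2ds\Big)\;:\;h\in L^2([0,T];\mathbb R^d)\Big\}$$ be the set of stochastic exponentials. Let $b:[0,T]\times\mathbb R^d\to\mathbb R^d$ satisfy * $b\in L^2_{loc}([0,T]\times\mathbb R^d)$; * the distributional divergence in space satisfies $\operatorname{div} b\in L^1([0,T];L^\infty(\mathbb R^d))$; * there is $R>0$ such that $\dfrac{b(t,x)}{1+|x|}\in L^1([0,T];L^\infty(\mathbb R^d\setminus B_R))$, where $B_R=\{|x|\le R\}$; and let $u_0\in L^2(\mathbb R^d)\cap L^\infty(\mathbb R^d)$. Consider the stochastic transport equation, in the Stratonovich sense, $$\partial_t u(t,x,\omega)+\Big(b(t,x)+\frac{dB_t}{dt}(\omega)\Big)\cdot\nabla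 u(t,x,\omega)=0,\qquad u|_{t=0}=u_0. \tag{1}$$ A stochastic process $u\in L^2\cap L^\infty(\Omega\times[0,T]\times\mathbb R^d)$ is called a *quasiregular weak solution* of (1) if 1. (weak solution) for every $\varphi\in C_c^\infty(\mathbb R^d)$ the process $\int u(t,x)\varphi(x)\,dx$ has a modification that is a continuous $\mathcal F_t$-semimartingale, and for all $t\in[0,T]$, $\mathbb P$-almost surely, $$\int_{\mathbb R^d} u(t,x)\varphi(x)\,dx=\int_{\mathbb R^d} u_0\varphi\,dx+\int_0^t\!\!\int_{\mathbb R^d} u(s,x)\,b^i(s,x)\,\partial_i\varphi(x)\,dx\,ds+\int_0^t\!\!\int_{\mathbb R^d} \operatorname{div}b(s,x)\,u(s,x)\,\varphi(x)\,dx\,ds+\int_0^t\!\!\int_{\mathbb R^d} u(s,x)\,\partial_i\varphi(x)\,dx\circ dB^i_s$$ (summation over the repeated index $i$); 2. (regularity in mean) for every $F\in\mathcal X$ the deterministic function $V(t,x)=\mathbb E[u(t,x)F]$ is measurable and (essentially) bounded and belongs to $L^2([0,T];H^1(\mathbb R^d))\cap C([0,T];L^2(\mathbb R^d))$. Then quasiregular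 weak solutions of (1) are unique: if $u$ and $v$ are two quasiregular weak solutions with the same initial datum $u_0$, then $u=v$ almost everywhere in $\Omega\times[0,T]\times\mathbb R^d$. -/

import Mathlib

open MeasureTheory ProbabilityTheory Filter Topology Set
open scoped NNReal ENNReal

noncomputable section

namespace StochTransport

/-- Euclidean space `ℝ^d`. -/
abbrev Eucl (d : ℕ) : Type := EuclideanSpace ℝ (Fin d)

/-! ### Function spaces and weak derivatives -/

/-- `φ ∈ C_c^∞(ℝ^d)`. -/
structure IsTestFunction {d : ℕ} (φ : Eucl d → ℝ) : Prop where
  smooth : ContDiff ℝ ((⊤ : ℕ∞) : WithTop ℕ∞) φ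
  compactSupport : HasCompactSupport φ

/-- The partial derivative `∂_i φ`. -/
def partialD {d : ℕ} (i : Fin d) (φ : Eucl d → ℝ) (x : Eucl d) : ℝ :=
  fderiv ℝ φ x (EuclideanSpace.single i 1)

/-- Lebesgue measure on the time interval `[0, T]`. -/
def timeMeasure (T : ℝ≥0) : Measure ℝ := volume.restrict (Icc 0 (T : ℝ))

/-- `b ∈ L²_loc([0, T] × ℝ^d ; ℝ^d)`. -/
def MemL2Loc {d : ℕ} (T : ℝ≥0) (b : ℝ → Eucl d → Eucl d) : Prop :=
  ∀ K : Set (Eucl d), IsCompact K →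
    MemLp (fun z : ℝ × Eucl d => b z.1 z.2) 2 ((timeMeasure T).prod (volume.restrict K))

/-- `f ∈ L¹(0, T; L^∞(μ))`. -/
def MemL1Linfty {d : ℕ} {E : Type*} [NormedAddCommGroup E] (T : ℝ≥0) (μ : Measure (Eucl d))
    (f : ℝ → Eucl d → E) : Prop :=
  AEStronglyMeasurable (fun z : ℝ × Eucl d => f z.1 z.2) ((timeMeasure T).prod μ) ∧
    ∫⁻ t, eLpNorm (f t) ∞ μ ∂(timeMeasure T) < ∞

/-- `g` is the distributional divergence of the vector field `f` on `ℝ^d`. -/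
def IsWeakDivergence {d : ℕ} (f : Eucl d → Eucl d) (g : Eucl d → ℝ) : Prop :=
  ∀ φ : Eucl d → ℝ, IsTestFunction φ →
    ∫ x, ∑ i, f x i * partialD i φ x = -∫ x, g x * φ x

/-- `G` is the distributional gradient of the function `f` on `ℝ^d`. -/
def IsWeakGradient {d : ℕ} (f : Eucl d → ℝ) (G : Eucl d → Eucl d) : Prop :=
  ∀ φ : Eucl d → ℝ, IsTestFunction φ → ∀ i : Fin d,
    ∫ x, f x * partialD i φ x = -∫ x, G x i * φ x

/-- `V ∈ L²([0, T]; H¹(ℝ^d))`. -/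
def MemL2H1 {d : ℕ} (T : ℝ≥0) (V : ℝ → Eucl d → ℝ) : Prop :=
  MemLp (fun z : ℝ × Eucl d => V z.1 z.2) 2 ((timeMeasure T).prod volume) ∧
    ∃ G : ℝ → Eucl d → Eucl d,
      MemLp (fun z : ℝ × Eucl d => G z.1 z.2) 2 ((timeMeasure T).prod volume) ∧
      ∀ᵐ t ∂(timeMeasure T), IsWeakGradient (V t) (G t)

/-- `V ∈ C([0, T]; L²(ℝ^d))`: the class of `V` has a representative that is a continuous map
from `[0, T]` to `L²(ℝ^d)`. -/
def MemCL2 {d : ℕ} (T : ℝ≥0) (V : ℝ → Eucl d → ℝ) : Prop :=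
  ∃ W : ℝ → Lp ℝ 2 (volume : Measure (Eucl d)),
    ContinuousOn W (Icc 0 (T : ℝ)) ∧ ∀ᵐ t ∂(timeMeasure T), V t =ᵐ[volume] W t

/-! ### Brownian motion and its filtration -/

section Probability

variable {Ω : Type*} [mΩ : MeasurableSpace Ω] {d : ℕ}

/-- The σ-algebra generated by `B_s`, for `s ≤ t` and `s ≤ T`. -/
abbrev past (B : ℝ≥0 → Ω → Eucl d) (T t : ℝ≥0) : MeasurableSpace Ω :=
  ⨆ s : Iic (min t T), MeasurableSpace.comap (B s) inferInstance

/-- `(B_t)`, `t ∈ [0, T]`, is a standard `d`-dimensional Brownian motion on `(Ω, P)`. The values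
of `B` at times after `T` play no role. -/
structure IsBrownianMotionOn (B : ℝ≥0 → Ω → Eucl d) (T : ℝ≥0) (P : Measure Ω) : Prop where
  measurable : ∀ t ≤ T, Measurable (B t)
  zero : ∀ᵐ ω ∂P, B 0 ω = 0
  law : ∀ s t : ℝ≥0, s ≤ t → t ≤ T →
    P.map (fun ω (i : Fin d) => B t ω i - B s ω i) = Measure.pi fun _ => gaussianReal 0 (t - s)
  indep : ∀ s t : ℝ≥0, s ≤ t → t ≤ T →
    Indep (past B T s) (MeasurableSpace.comap (fun ω => B t ω - B s ω) inferInstance) P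
  continuous : ∀ᵐ ω ∂P, ContinuousOn (fun t => B t ω) (Iic T)

/-- The natural filtration of `(B_t)`, `t ∈ [0, T]`, augmented by the `P`-negligible events; it is
constant in time from `T` on. An event belongs to the σ-algebra of time `t` when it is `P`-almost
surely equal to one in the σ-algebra generated by `B_s`, `s ≤ t`. -/
def brownianFiltration (B : ℝ≥0 → Ω → Eucl d) (T : ℝ≥0) (P : Measure Ω) : Filtration ℝ≥0 mΩ where
  seq t := mΩ ⊓ eventuallyMeasurableSpace (past B T t) (ae P)
  mono' := by
    intro s t hst
    refine le_inf inf_le_left (inf_le_right.trans ?_)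
    have hle : past B T s ≤ past B T t := by
      refine iSup_le fun r => ?_
      exact le_iSup (fun r : Iic (min t T) => MeasurableSpace.comap (B r) inferInstance)
        ⟨r.1, le_trans r.2 (min_le_min_right T hst)⟩
    rintro A ⟨A', hA', hAA'⟩
    exact ⟨A', hle _ hA', hAA'⟩
  le' _ := inf_le_left

/-- `X` is, on `[0, T]`, a continuous semimartingale for the filtration `ℱ`: it is the sum of a
continuous local martingale and of a continuous adapted process with paths of bounded
variation. -/
def IsContSemimartingale (ℱ : Filtration ℝ≥0 mΩ) (T : ℝ≥0) (P : Measure Ω)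
    (X : ℝ≥0 → Ω → ℝ) : Prop :=
  ∃ M A : ℝ≥0 → Ω → ℝ,
    (∀ᵐ ω ∂P, Continuous fun t => M t ω) ∧
    Locally (fun N => Martingale N ℱ P) ℱ M P ∧
    StronglyAdapted ℱ A ∧
    (∀ᵐ ω ∂P, ContinuousOn (fun t => A t ω) (Iic T) ∧
      BoundedVariationOn (fun t => A t ω) (Iic T)) ∧
    ∀ᵐ ω ∂P, ∀ t ≤ T, X t ω = M t ω + A t ω

/-! ### Stochastic integrals -/

/-- `∑_{k < n} ½ (Y_{π(k+1)} + Y_{π(k)}) (Z_{π(k+1)} - Z_{π(k)})`. -/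
def stratonovichSum (Y Z : ℝ≥0 → Ω → ℝ) (n : ℕ) (π : ℕ → ℝ≥0) (ω : Ω) : ℝ :=
  ∑ k ∈ Finset.range n,
    (Y (π (k + 1)) ω + Y (π k) ω) / 2 * (Z (π (k + 1)) ω - Z (π k) ω)

/-- `S = ∫₀ᵗ Y_s ∘ dZ_s` (Fisk–Stratonovich integral): along every sequence of partitions
`0 = π_n(0) ≤ π_n(1) ≤ ⋯ ≤ π_n(N_n) = t` whose mesh tends to zero, the symmetric Riemann sums
converge to `S` in probability. -/
def IsStratonovichIntegral (P : Measure Ω) (Y Z : ℝ≥0 → Ω → ℝ) (t : ℝ≥0) (S : Ω → ℝ) : Prop :=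
  ∀ (N : ℕ → ℕ) (π : ℕ → ℕ → ℝ≥0),
    (∀ n, Monotone (π n) ∧ π n 0 = 0 ∧ π n (N n) = t) →
    Tendsto (fun n => (Finset.range (N n)).sup fun k => π n (k + 1) - π n k) atTop (𝓝 0) →
    TendstoInMeasure P (fun n => stratonovichSum Y Z (N n) (π n)) atTop S

/-- The step function `∑_{k < n} c_k 1_{(π(k), π(k+1)]}` on the time axis. -/
def stepFunction (n : ℕ) (π : ℕ → ℝ≥0) (c : ℕ → Eucl d) (s : ℝ) : Eucl d :=
  ∑ k ∈ Finset.range n, (Ioc (π k : ℝ) (π (k + 1) : ℝ)).indicator (fun _ => c k) s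

/-- The stochastic integral `∑_{k < n} c_k · (B_{π(k+1)} - B_{π(k)})` of a step function. -/
def stepIntegral (B : ℝ≥0 → Ω → Eucl d) (n : ℕ) (π : ℕ → ℝ≥0) (c : ℕ → Eucl d) (ω : Ω) : ℝ :=
  ∑ k ∈ Finset.range n, inner ℝ (c k) (B (π (k + 1)) ω - B (π k) ω)

/-- `I = ∫₀ᵀ h(s) · dB_s` for a deterministic `h ∈ L²([0, T]; ℝ^d)`: `I` is the limit in `L²(Ω)` of
the integrals of step functions that converge to `h` in `L²([0, T]; ℝ^d)`. -/
def IsWienerIntegral (B : ℝ≥0 → Ω → Eucl d) (T : ℝ≥0) (P : Measure Ω)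
    (h : ℝ → Eucl d) (I : Ω → ℝ) : Prop :=
  AEStronglyMeasurable I P ∧
  ∃ (N : ℕ → ℕ) (π : ℕ → ℕ → ℝ≥0) (c : ℕ → ℕ → Eucl d),
    (∀ n, Monotone (π n) ∧ π n (N n) ≤ T) ∧
    Tendsto (fun n => eLpNorm (fun s => stepFunction (N n) (π n) (c n) s - h s) 2 (timeMeasure T))
      atTop (𝓝 0) ∧
    Tendsto (fun n => eLpNorm (fun ω => stepIntegral B (N n) (π n) (c n) ω - I ω) 2 P)
      atTop (𝓝 0)

/-- The set of stochastic exponentials `exp (∫₀ᵀ h · dB - ½ ∫₀ᵀ |h|² ds)`, `h ∈ L²([0, T]; ℝ^d)`. -/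
def stochasticExponentials (B : ℝ≥0 → Ω → Eucl d) (T : ℝ≥0) (P : Measure Ω) : Set (Ω → ℝ) :=
  {F | ∃ (h : ℝ → Eucl d) (I : Ω → ℝ), MemLp h 2 (timeMeasure T) ∧ IsWienerIntegral B T P h I ∧
    F = fun ω => Real.exp (I ω - 1 / 2 * ∫ s, ‖h s‖ ^ 2 ∂(timeMeasure T))}

/-! ### Quasiregular weak solutions -/

/-- Quasiregular weak solutions `u = u(ω, t, x)` of the Cauchy problem for
`∂_t u + (b + dB/dt) · ∇u = 0`, `u|_{t=0} = u₀`, in the Stratonovich sense. The function `divb` is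
the divergence of `b`. -/
structure IsQuasiregularSolution (P : Measure Ω) (T : ℝ≥0) (B : ℝ≥0 → Ω → Eucl d)
    (b : ℝ → Eucl d → Eucl d) (divb : ℝ → Eucl d → ℝ) (u₀ : Eucl d → ℝ)
    (u : Ω → ℝ → Eucl d → ℝ) : Prop where
  memLp_two : MemLp (fun z : Ω × ℝ × Eucl d => u z.1 z.2.1 z.2.2) 2
    (P.prod ((timeMeasure T).prod volume))
  memLp_top : MemLp (fun z : Ω × ℝ × Eucl d => u z.1 z.2.1 z.2.2) ∞
    (P.prod ((timeMeasure T).prod volume))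
  /-- `∫ u(t, x) φ(x) dx` has a modification that is a continuous semimartingale for the Brownian
  filtration. -/
  semimartingale : ∀ φ : Eucl d → ℝ, IsTestFunction φ →
    ∃ X : ℝ≥0 → Ω → ℝ, IsContSemimartingale (brownianFiltration B T P) T P X ∧
      ∀ t ≤ T, X t =ᵐ[P] fun ω => ∫ x, u ω t x * φ x
  /-- The weak formulation of the equation, with a Stratonovich integral. -/
  equation : ∀ φ : Eucl d → ℝ, IsTestFunction φ → ∀ t ≤ T,
    ∃ S : Fin d → Ω → ℝ,
      (∀ i, IsStratonovichIntegral P (fun s ω => ∫ x, u ω s x * partialD i φ x)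
        (fun s ω => B s ω i) t (S i)) ∧
      ∀ᵐ ω ∂P,
        ∫ x, u ω t x * φ x
          = (∫ x, u₀ x * φ x)
            + (∫ s in (0 : ℝ)..t, ∫ x, u ω s x * ∑ i, b s x i * partialD i φ x)
            + (∫ s in (0 : ℝ)..t, ∫ x, divb s x * u ω s x * φ x)
            + ∑ i, S i ω
  /-- Regularity in mean of `V(t, x) = E[u(t, x) F]`, for every stochastic exponential `F`. -/
  regular_in_mean : ∀ F ∈ stochasticExponentials B T P,
    MemLp (fun z : ℝ × Eucl d => ∫ ω, u ω z.1 z.2 * F ω ∂P) ∞ ((timeMeasure T).prod volume) ∧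
    MemL2H1 T (fun t x => ∫ ω, u ω t x * F ω ∂P) ∧
    MemCL2 T (fun t x => ∫ ω, u ω t x * F ω ∂P)

end Probability

end StochTransport

end

/-!
A bounded process is determined by its means against stochastic exponentials, and the means of a
quasiregular solution solve a deterministic parabolic equation that has at most one solution.

**The equation in mean.** Let `F` be the exponential of a step function `h` on a dyadic grid of
`[0, T]`; such exponentials are explicit functions of finitely many Brownian increments
(`stepExp`). The mean `V(t, x) = E[u(t, x) F]` is a weak solution of
`∂_t V + (b + h) · ∇V = ½ ΔV` (`IsQuasiregularSolution.mean_equation`). Indeed, along the dyadic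
grids the symmetric Riemann sums of `∫ W_i ∘ dB^i`, with `W_i = ∫ u ∂_i φ dx`, are the Itô sums plus
half of the covariation sums of `W_i` and `B^i`. The equation tested with `∂_i φ` says that `W_i` is
itself a drift plus Stratonovich integrals, of the functions `∫ u ∂_j ∂_i φ dx`, so that the
covariation of `W_i` and `B^i` is `∫ (∫ u ∂_i ∂_i φ dx) dt` (`tendsto_covariation`); this is the
origin of `½ ΔV`. The mean of `F` times an Itô sum is computed exactly, since weighting with `F`
shifts the Gaussian law of the increments (`integral_stepExp_mul_incr`); this is the origin of
`h · ∇V`. The semimartingale assumption enters through the boundedness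
in probability of the quadratic variations of the `∫ u ∂_j ∂_i φ dx`: it shows that, on a coarse
grid, the increments of `W_i` differ from their drift and principal part by residuals whose squares
have a sum that tends to zero (`tendsto_block_cross`). The convergence is only in probability, but
since `u` is bounded the Itô sums are bounded in `L²`, which allows the passage to the limit in the
means.

**Uniqueness of the means.** By regularity in mean the difference `V` of two such means is bounded
and belongs to `L²(0, T; H¹) ∩ C([0, T]; L²)`. Thus `b · ∇V` is an integrable function on bounded
sets, and the equation can be mollified in space without any commutator estimate: the mollified
equation is an equation between locally integrable functions, and its energy identity, localized by
a cutoff, passes to the limit (`IsParabolicSolution.local_energy_le`). The growth of `b` allows the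
removal of the cutoff (`IsParabolicSolution.energy_le_integral`), since `|b| |∇χ|` is dominated by
the integrable `k(t)` when `χ` is a cutoff at scale `N`. What is left is
`‖V(t)‖² ≤ ∫₀ᵗ ‖div b(s)‖_∞ ‖V(s)‖² ds`, and Grönwall's lemma gives `V = 0`
(`IsParabolicSolution.ae_eq_zero`, `IsQuasiregularSolution.ae_meanField_eq`).

**From the means to the processes.** A finite measure that is absolutely continuous with respect to
`P` is determined on the Brownian σ-algebra by its integrals of the exponentials `F`
(`measure_eq_of_integral_stepExp_eq`): these give the moment generating function, hence the law, of
the vector of increments on each dyadic grid, and by continuity of the paths the increments generate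
the σ-algebra up to null sets. Applied to the densities given by `u` and `v`, made positive by the
addition of a constant, this shows `u = v` (`ae_eq_of_integral_stepExp_mul_eq`).

For `T = 0` there is nothing to prove, as Lebesgue measure on `{0}` vanishes.
-/


open MeasureTheory ProbabilityTheory Filter Topology Set
open scoped NNReal ENNReal

noncomputable section

namespace StochTransport

/-! ### Mollification -/

section Mollifier

variable {d : ℕ}

/-- A smooth bump around the origin, supported in the ball of radius `1 / (n + 1)`. -/
def mollBump (d n : ℕ) : ContDiffBump (0 : Eucl d) where
  rIn := 1 / (2 * ((n : ℝ) + 1))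
  rOut := 1 / ((n : ℝ) + 1)
  rIn_pos := by positivity
  rIn_lt_rOut := by
    apply one_div_lt_one_div_of_lt <;> nlinarith [(Nat.cast_nonneg n : (0 : ℝ) ≤ n)]

/-- The standard mollifier `ρ_n`: nonnegative, smooth, even, of integral one, supported in the
ball of radius `1 / (n + 1)`. -/
def moll (d n : ℕ) : Eucl d → ℝ := (mollBump d n).normed volume

/-- The mollification `ρ_n * f`. -/
def mollify (n : ℕ) (f : Eucl d → ℝ) (x : Eucl d) : ℝ := ∫ y, moll d n (x - y) * f y

lemma moll_nonneg (n : ℕ) (x : Eucl d) : 0 ≤ moll d n x := ContDiffBump.nonneg_normed _ x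

lemma integral_moll (n : ℕ) : ∫ x, moll d n x = 1 := ContDiffBump.integral_normed _

lemma moll_contDiff (n : ℕ) {k : ℕ∞} : ContDiff ℝ k (moll d n) := ContDiffBump.contDiff_normed _

lemma moll_hasCompactSupport (n : ℕ) : HasCompactSupport (moll d n) :=
  ContDiffBump.hasCompactSupport_normed _

lemma moll_continuous (n : ℕ) : Continuous (moll d n) := (moll_contDiff (k := 0) n).continuous

lemma moll_integrable (n : ℕ) : Integrable (moll d n) :=
  (moll_continuous n).integrable_of_hasCompactSupport (moll_hasCompactSupport n)

lemma norm_lt_one_of_moll_ne_zero {n : ℕ} {x : Eucl d} (h : moll d n x ≠ 0) : ‖x‖ < 1 := by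
  have h1 : x ∈ Function.support ((mollBump d n).normed volume) := h
  rw [ContDiffBump.support_normed_eq, mem_ball_zero_iff] at h1
  refine h1.trans_le ?_
  change 1 / ((n : ℝ) + 1) ≤ 1
  rw [div_le_one (by positivity)]
  linarith [(Nat.cast_nonneg n : (0 : ℝ) ≤ n)]

lemma moll_isTestFunction (n : ℕ) : IsTestFunction (moll d n) :=
  ⟨moll_contDiff n, moll_hasCompactSupport n⟩

lemma IsTestFunction.comp_const_sub {φ : Eucl d → ℝ} (hφ : IsTestFunction φ) (x : Eucl d) :
    IsTestFunction (fun y => φ (x - y)) :=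
  ⟨hφ.smooth.comp (contDiff_const.sub contDiff_id),
    hφ.compactSupport.comp_homeomorph (Homeomorph.subLeft x)⟩

lemma IsTestFunction.differentiable {φ : Eucl d → ℝ} (hφ : IsTestFunction φ) :
    Differentiable ℝ φ :=
  hφ.smooth.differentiable (by simp)

lemma IsTestFunction.continuous {φ : Eucl d → ℝ} (hφ : IsTestFunction φ) : Continuous φ :=
  hφ.smooth.continuous

lemma IsTestFunction.integrable {φ : Eucl d → ℝ} (hφ : IsTestFunction φ) : Integrable φ :=
  hφ.continuous.integrable_of_hasCompactSupport hφ.compactSupport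

lemma IsTestFunction.partialD {φ : Eucl d → ℝ} (hφ : IsTestFunction φ) (i : Fin d) :
    IsTestFunction (partialD i φ) where
  smooth := by
    have h : ContDiff ℝ ((⊤ : ℕ∞) : WithTop ℕ∞) (fderiv ℝ φ) := hφ.smooth.fderiv_right (by simp)
    exact h.clm_apply contDiff_const
  compactSupport := hφ.compactSupport.fderiv_apply (𝕜 := ℝ) _

lemma IsTestFunction.exists_bound {φ : Eucl d → ℝ} (hφ : IsTestFunction φ) :
    ∃ C, 0 ≤ C ∧ ∀ x, |φ x| ≤ C := by
  obtain ⟨C, hC⟩ := hφ.compactSupport.exists_bound_of_continuous hφ.continuous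
  exact ⟨C, (norm_nonneg _).trans (hC 0), hC⟩

/-- A radius outside of which a test function vanishes. -/
lemma IsTestFunction.exists_radius {φ : Eucl d → ℝ} (hφ : IsTestFunction φ) :
    ∃ r : ℝ, 0 ≤ r ∧ ∀ x, r < ‖x‖ → φ x = 0 := by
  obtain ⟨r, hr⟩ := hφ.compactSupport.isCompact.isBounded.subset_closedBall (0 : Eucl d)
  refine ⟨max r 0, le_max_right _ _, fun x hx => ?_⟩
  by_contra h
  have := hr (subset_tsupport _ h)
  rw [mem_closedBall_zero_iff] at this
  exact absurd (this.trans (le_max_left _ _)) (not_le.2 hx)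

lemma partialD_comp_const_sub {φ : Eucl d → ℝ} (hφ : Differentiable ℝ φ) (i : Fin d)
    (x y : Eucl d) : partialD i (fun y => φ (x - y)) y = -partialD i φ (x - y) := by
  unfold StochTransport.partialD
  have h1 : HasFDerivAt (fun y : Eucl d => x - y) (-ContinuousLinearMap.id ℝ (Eucl d)) y := by
    simpa using (hasFDerivAt_id y).const_sub x
  have := ((hφ (x - y)).hasFDerivAt.comp y h1).fderiv
  change (fderiv ℝ (φ ∘ fun y => x - y) y) _ = _
  rw [this]
  simp

lemma partialD_mul {f g : Eucl d → ℝ} (hf : Differentiable ℝ f) (hg : Differentiable ℝ g)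
    (i : Fin d) (x : Eucl d) :
    partialD i (fun y => f y * g y) x = partialD i f x * g x + f x * partialD i g x := by
  unfold StochTransport.partialD
  rw [fderiv_fun_mul (hf x) (hg x)]
  simp only [add_apply, smul_apply, smul_eq_mul]
  ring

lemma mollify_eq_convolution (n : ℕ) (f : Eucl d → ℝ) (x : Eucl d) :
    mollify n f x =
      convolution ((mollBump d n).normed volume) f (ContinuousLinearMap.lsmul ℝ ℝ) volume x := by
  rw [convolution_lsmul_swap]
  rfl

lemma ae_tendsto_mollify {f : Eucl d → ℝ} (hf : LocallyIntegrable f) :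
    ∀ᵐ x, Tendsto (fun n => mollify n f x) atTop (𝓝 (f x)) := by
  have h0 : Tendsto (fun n => (mollBump d n).rOut) atTop (𝓝 0) :=
    tendsto_one_div_add_atTop_nhds_zero_nat
  have h1 : ∀ᶠ n in atTop, (mollBump d n).rOut ≤ 2 * (mollBump d n).rIn := by
    refine Eventually.of_forall fun n => le_of_eq ?_
    change 1 / ((n : ℝ) + 1) = 2 * (1 / (2 * ((n : ℝ) + 1)))
    field_simp
  filter_upwards [ContDiffBump.ae_convolution_tendsto_right_of_locallyIntegrable h0 h1 hf]
    with x hx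
  simpa only [mollify_eq_convolution] using hx

lemma tendsto_mollify_of_continuous {f : Eucl d → ℝ} (hf : Continuous f) (x : Eucl d) :
    Tendsto (fun n => mollify n f x) atTop (𝓝 (f x)) := by
  have h0 : Tendsto (fun n => (mollBump d n).rOut) atTop (𝓝 0) :=
    tendsto_one_div_add_atTop_nhds_zero_nat
  simpa only [mollify_eq_convolution] using
    ContDiffBump.convolution_tendsto_right_of_continuous (μ := volume) h0 hf x

lemma integral_moll_sub (n : ℕ) (x : Eucl d) : ∫ y, moll d n (x - y) = 1 := by
  rw [integral_sub_left_eq_self (moll d n) volume x, integral_moll]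

lemma integrable_moll_sub (n : ℕ) (x : Eucl d) : Integrable fun y => moll d n (x - y) :=
  (moll_integrable n).comp_sub_left x

lemma abs_mollify_le {f : Eucl d → ℝ} {C : ℝ} (hf : ∀ᵐ x, |f x| ≤ C) (n : ℕ) (x : Eucl d) :
    |mollify n f x| ≤ C := by
  have h := norm_integral_le_of_norm_le (f := fun y => moll d n (x - y) * f y)
    ((integrable_moll_sub n x).mul_const C) (by
      filter_upwards [hf] with y hy
      rw [norm_mul, Real.norm_of_nonneg (moll_nonneg _ _)]
      exact mul_le_mul_of_nonneg_left hy (moll_nonneg _ _))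
  rwa [integral_mul_const, integral_moll_sub, one_mul] at h

lemma contDiff_mollify {f : Eucl d → ℝ} (hf : LocallyIntegrable f) (n : ℕ) {k : ℕ∞} :
    ContDiff ℝ k (mollify n f) := by
  have := HasCompactSupport.contDiff_convolution_left (ContinuousLinearMap.lsmul ℝ ℝ)
    (moll_hasCompactSupport n) (moll_contDiff (d := d) (k := k) n) hf
  convert this using 1
  ext x
  exact mollify_eq_convolution n f x

lemma differentiable_mollify {f : Eucl d → ℝ} (hf : LocallyIntegrable f) (n : ℕ) :
    Differentiable ℝ (mollify n f) :=
  (contDiff_mollify hf n (k := 1)).differentiable (by simp)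

/-- A convolution is differentiated by differentiating the kernel. -/
lemma partialD_integral_sub {η f : Eucl d → ℝ} (hη : IsTestFunction η) (hf : LocallyIntegrable f)
    (i : Fin d) (x : Eucl d) :
    partialD i (fun x => ∫ y, η (x - y) * f y) x = ∫ y, partialD i η (x - y) * f y := by
  have hη1 : ContDiff ℝ 1 η := hη.smooth.of_le (by exact_mod_cast le_top)
  have h := HasCompactSupport.hasFDerivAt_convolution_left (ContinuousLinearMap.lsmul ℝ ℝ)
    hη.compactSupport hη1 hf x
  have h2 : (fun x => ∫ y, η (x - y) * f y) =
      convolution η f (ContinuousLinearMap.lsmul ℝ ℝ) volume := by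
    ext x
    rw [convolution_lsmul_swap]
    rfl
  unfold StochTransport.partialD
  rw [h2, h.fderiv, convolution_eq_swap]
  have hint : Integrable (fun t => (ContinuousLinearMap.precompL (Eucl d)
      (ContinuousLinearMap.lsmul ℝ ℝ)) (fderiv ℝ η (x - t)) (f t)) volume := by
    have := (hη.compactSupport.fderiv (𝕜 := ℝ)).convolutionExists_left
      (ContinuousLinearMap.precompL (Eucl d) (ContinuousLinearMap.lsmul ℝ ℝ))
      (hη1.continuous_fderiv (by simp)) hf x
    exact this.integrable_swap
  rw [ContinuousLinearMap.integral_apply hint]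
  rfl

lemma partialD_mollify {f : Eucl d → ℝ} (hf : LocallyIntegrable f) (n : ℕ) (i : Fin d)
    (x : Eucl d) :
    partialD i (mollify n f) x = ∫ y, partialD i (moll d n) (x - y) * f y :=
  partialD_integral_sub (moll_isTestFunction n) hf i x

lemma partialD_partialD_mollify {f : Eucl d → ℝ} (hf : LocallyIntegrable f) (n : ℕ) (i : Fin d)
    (x : Eucl d) :
    partialD i (partialD i (mollify n f)) x
      = ∫ y, partialD i (partialD i (moll d n)) (x - y) * f y := by
  rw [show partialD i (mollify n f) = fun x => ∫ y, partialD i (moll d n) (x - y) * f y from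
    funext fun x => partialD_mollify hf n i x]
  exact partialD_integral_sub ((moll_isTestFunction n).partialD i) hf i x

/-- Mollification exchanges the weak gradient for the classical one. -/
lemma partialD_mollify_of_isWeakGradient {f : Eucl d → ℝ} {G : Eucl d → Eucl d}
    (hf : LocallyIntegrable f) (hG : IsWeakGradient f G) (n : ℕ) (i : Fin d) (x : Eucl d) :
    partialD i (mollify n f) x = mollify n (fun y => G y i) x := by
  have h := hG _ ((moll_isTestFunction n).comp_const_sub x) i
  simp only [partialD_comp_const_sub (moll_isTestFunction n).differentiable] at h
  rw [partialD_mollify hf, mollify]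
  simp only [mul_neg, integral_neg, neg_inj] at h
  simp only [mul_comm] at h ⊢
  exact h

lemma aestronglyMeasurable_comp_sub {f : Eucl d → ℝ} (hf : AEStronglyMeasurable f) :
    AEStronglyMeasurable (fun p : Eucl d × Eucl d => f (p.1 - p.2))
      ((volume : Measure (Eucl d)).prod volume) :=
  hf.comp_quasiMeasurePreserving (quasiMeasurePreserving_sub_of_right_invariant volume volume)

lemma lintegral_enorm_moll (n : ℕ) : ∫⁻ z, ENNReal.ofReal (moll d n z) = 1 := by
  rw [← ofReal_integral_eq_lintegral_ofReal (moll_integrable n)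
    (Eventually.of_forall (moll_nonneg n)), integral_moll, ENNReal.ofReal_one]

lemma mollify_eq_integral_sub (n : ℕ) (f : Eucl d → ℝ) (x : Eucl d) :
    mollify n f x = ∫ z, moll d n z * f (x - z) := by
  rw [← integral_sub_left_eq_self (fun z => moll d n z * f (x - z)) volume x]
  simp [mollify]

/-- Mollification is a contraction of `L^p`, by Jensen's inequality and Tonelli's theorem. -/
lemma eLpNorm_mollify_le {f : Eucl d → ℝ} {p : ℝ≥0∞} (hp1 : 1 ≤ p) (hp : p ≠ ∞)
    (hf : AEStronglyMeasurable f) (n : ℕ) :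
    eLpNorm (mollify n f) p volume ≤ eLpNorm f p volume := by
  set ν : Measure (Eucl d) := volume.withDensity (fun z => ENNReal.ofReal (moll d n z)) with hν
  have hm : Measurable fun z => ENNReal.ofReal (moll d n z) :=
    (moll_continuous n).measurable.ennreal_ofReal
  have : IsProbabilityMeasure ν := ⟨by
    rw [hν, withDensity_apply _ MeasurableSet.univ, Measure.restrict_univ,
      lintegral_enorm_moll]⟩
  have hp0 : p ≠ 0 := (zero_lt_one.trans_le hp1).ne'
  have hpr : 0 < p.toReal := ENNReal.toReal_pos hp0 hp
  have hac : ν ≪ volume := withDensity_absolutelyContinuous _ _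
  have hslice : ∀ x, AEStronglyMeasurable (fun z => f (x - z)) ν := fun x =>
    (hf.comp_quasiMeasurePreserving
      (quasiMeasurePreserving_sub_left_of_right_invariant volume x)).mono_ac hac
  have hpt : ∀ x, ‖mollify n f x‖ₑ ^ p.toReal ≤ ∫⁻ z, ‖f (x - z)‖ₑ ^ p.toReal ∂ν := by
    intro x
    have h1 : ‖mollify n f x‖ₑ ≤ eLpNorm (fun z => f (x - z)) 1 ν := by
      rw [eLpNorm_one_eq_lintegral_enorm, mollify_eq_integral_sub]
      refine (enorm_integral_le_lintegral_enorm _).trans (le_of_eq ?_)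
      rw [hν, lintegral_withDensity_eq_lintegral_mul_non_measurable _ hm
        (Eventually.of_forall fun _ => ENNReal.ofReal_lt_top)]
      refine lintegral_congr fun z => ?_
      rw [enorm_mul, Real.enorm_of_nonneg (moll_nonneg n z)]
      rfl
    have h2 := h1.trans (eLpNorm_le_eLpNorm_of_exponent_le hp1 (hslice x))
    calc ‖mollify n f x‖ₑ ^ p.toReal
        ≤ (eLpNorm (fun z => f (x - z)) p ν) ^ p.toReal := by gcongr
      _ = _ := by
        rw [eLpNorm_eq_lintegral_rpow_enorm_toReal hp0 hp, ← ENNReal.rpow_mul, one_div,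
          inv_mul_cancel₀ hpr.ne', ENNReal.rpow_one]
  rw [eLpNorm_eq_lintegral_rpow_enorm_toReal hp0 hp, eLpNorm_eq_lintegral_rpow_enorm_toReal hp0 hp]
  refine ENNReal.rpow_le_rpow ?_ (by positivity)
  calc ∫⁻ x, ‖mollify n f x‖ₑ ^ p.toReal
      ≤ ∫⁻ x, ∫⁻ z, ‖f (x - z)‖ₑ ^ p.toReal ∂ν := lintegral_mono hpt
    _ = ∫⁻ z, (∫⁻ x, ‖f (x - z)‖ₑ ^ p.toReal) ∂ν := by
      refine lintegral_lintegral_swap ?_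
      have := (aestronglyMeasurable_comp_sub hf).mono_ac
        (Measure.AbsolutelyContinuous.prod (Measure.AbsolutelyContinuous.refl volume) hac)
      exact (this.enorm.pow_const _)
    _ = ∫⁻ _z : Eucl d, (∫⁻ x, ‖f x‖ₑ ^ p.toReal) ∂ν := by
      refine lintegral_congr fun z => ?_
      exact lintegral_sub_right_eq_self (fun x => ‖f x‖ₑ ^ p.toReal) z
    _ = ∫⁻ x, ‖f x‖ₑ ^ p.toReal := by simp

lemma integrable_moll_mul {f : Eucl d → ℝ} (hf : LocallyIntegrable f) (n : ℕ) (x : Eucl d) :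
    Integrable fun y => moll d n (x - y) * f y := by
  have := ((moll_hasCompactSupport n).convolutionExists_left (ContinuousLinearMap.lsmul ℝ ℝ)
    (moll_continuous (d := d) n) hf) x
  exact this.integrable_swap

lemma mollify_sub {f g : Eucl d → ℝ} (hf : LocallyIntegrable f) (hg : LocallyIntegrable g)
    (n : ℕ) : mollify n (f - g) = mollify n f - mollify n g := by
  ext x
  simp only [mollify, Pi.sub_apply, mul_sub]
  exact integral_sub (integrable_moll_mul hf n x) (integrable_moll_mul hg n x)

lemma continuous_mollify {f : Eucl d → ℝ} (hf : LocallyIntegrable f) (n : ℕ) :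
    Continuous (mollify n f) :=
  (contDiff_mollify hf n (k := 0)).continuous

/-- If `f` vanishes outside of the ball of radius `r`, then `ρ_n * f` vanishes outside of the
ball of radius `r + 1`. -/
lemma mollify_eq_zero {f : Eucl d → ℝ} {r : ℝ} (hf : ∀ x, r < ‖x‖ → f x = 0) (n : ℕ)
    {x : Eucl d} (hx : r + 1 < ‖x‖) : mollify n f x = 0 := by
  refine integral_eq_zero_of_ae (Eventually.of_forall fun y => ?_)
  by_cases h : moll d n (x - y) = 0
  · simp [h]
  · have h1 := norm_lt_one_of_moll_ne_zero h
    have h2 : r < ‖y‖ := by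
      have := norm_sub_norm_le x y
      linarith
    simp [hf y h2]

/-- Mollifications converge in `L^p`, for `1 ≤ p < ∞`. -/
lemma tendsto_eLpNorm_mollify_sub {f : Eucl d → ℝ} {p : ℝ≥0∞} (hp1 : 1 ≤ p) (hp : p ≠ ∞)
    (hf : MemLp f p) :
    Tendsto (fun n => eLpNorm (mollify n f - f) p volume) atTop (𝓝 0) := by
  have hp0 : p ≠ 0 := (zero_lt_one.trans_le hp1).ne'
  have hpr : 0 < p.toReal := ENNReal.toReal_pos hp0 hp
  have hcase : ∀ g : Eucl d → ℝ, Continuous g → HasCompactSupport g →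
      Tendsto (fun n => eLpNorm (mollify n g - g) p volume) atTop (𝓝 0) := by
    intro g hg hgc
    obtain ⟨C, hC⟩ := hgc.exists_bound_of_continuous hg
    obtain ⟨r, hr⟩ := hgc.isCompact.isBounded.subset_closedBall (0 : Eucl d)
    have hg0 : ∀ x, r < ‖x‖ → g x = 0 := fun x hx => by
      by_contra h
      have := hr (subset_tsupport _ h)
      rw [mem_closedBall_zero_iff] at this
      exact absurd this (not_le.2 hx)
    set K : Set (Eucl d) := Metric.closedBall 0 (r + 1)
    have hbound : ∀ n x, ‖mollify n g x - g x‖ₑ ≤ K.indicator (fun _ => ENNReal.ofReal (2 * C)) x := by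
      intro n x
      by_cases hx : x ∈ K
      · rw [indicator_of_mem hx, ← ofReal_norm]
        apply ENNReal.ofReal_le_ofReal
        refine (norm_sub_le _ _).trans ?_
        have := abs_mollify_le (Eventually.of_forall hC) n x
        rw [two_mul]
        exact add_le_add this (hC x)
      · have hx' : r + 1 < ‖x‖ := by simpa [K] using hx
        rw [mollify_eq_zero hg0 n hx', hg0 x (by linarith)]
        simp
    have hlim : Tendsto (fun n => ∫⁻ x, ‖(mollify n g - g) x‖ₑ ^ p.toReal) atTop
        (𝓝 (∫⁻ _x : Eucl d, 0)) := by
      refine tendsto_lintegral_of_dominated_convergence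
        (fun x => K.indicator (fun _ => ENNReal.ofReal (2 * C) ^ p.toReal) x) ?_ ?_ ?_ ?_
      · intro n
        exact (((continuous_mollify hg.locallyIntegrable n).sub hg).measurable.enorm.pow_const _)
      · intro n
        refine Eventually.of_forall fun x => ?_
        have := ENNReal.rpow_le_rpow (hbound n x) hpr.le
        refine this.trans (le_of_eq ?_)
        by_cases hx : x ∈ K <;> simp [hx, hpr]
      · rw [lintegral_indicator_const measurableSet_closedBall]
        exact ENNReal.mul_ne_top (ENNReal.rpow_ne_top_of_nonneg hpr.le ENNReal.ofReal_ne_top)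
          measure_closedBall_lt_top.ne
      · refine Eventually.of_forall fun x => ?_
        have h := (tendsto_mollify_of_continuous hg x).sub_const (g x)
        rw [sub_self] at h
        have h2 := (h.enorm.ennrpow_const p.toReal)
        simpa [hpr] using h2
    simp only [lintegral_zero] at hlim
    have := hlim.ennrpow_const (1 / p.toReal)
    rw [ENNReal.zero_rpow_of_pos (by positivity)] at this
    refine this.congr fun n => ?_
    rw [eLpNorm_eq_lintegral_rpow_enorm_toReal hp0 hp]
  rw [ENNReal.tendsto_nhds_zero]
  intro ε hε
  have hε3 : ε / 3 ≠ 0 := (ENNReal.div_pos hε.ne' (by simp)).ne'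
  obtain ⟨g, hgc, hfg, hg, hgp⟩ := hf.exists_hasCompactSupport_eLpNorm_sub_le hp hε3
  filter_upwards [(ENNReal.tendsto_nhds_zero.1 (hcase g hg hgc)) (ε / 3) (pos_iff_ne_zero.2 hε3)]
    with n hn
  have hlf := hf.locallyIntegrable hp1
  have hlg := hg.locallyIntegrable (μ := (volume : Measure (Eucl d)))
  have hdec : mollify n f - f = mollify n (f - g) + (mollify n g - g) + (g - f) := by
    rw [mollify_sub hlf hlg]
    abel
  have hm1 : AEStronglyMeasurable (mollify n (f - g)) volume :=
    (continuous_mollify (hlf.sub hlg) n).aestronglyMeasurable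
  have hm2 : AEStronglyMeasurable (mollify n g - g) volume :=
    ((continuous_mollify hlg n).sub hg).aestronglyMeasurable
  have hm3 : AEStronglyMeasurable (f - g) volume := hf.1.sub hgp.1
  rw [hdec]
  calc _ ≤ eLpNorm (mollify n (f - g)) p volume + eLpNorm (mollify n g - g) p volume
        + eLpNorm (g - f) p volume :=
      (eLpNorm_add_le (hm1.add hm2) (hgp.1.sub hf.1) hp1).trans
        (add_le_add_left (eLpNorm_add_le hm1 hm2 hp1) _)
    _ ≤ ε / 3 + ε / 3 + ε / 3 := by
      gcongr
      · exact (eLpNorm_mollify_le hp1 hp hm3 n).trans hfg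
      · rwa [eLpNorm_sub_comm]
    _ = ε := ENNReal.add_thirds ε

end Mollifier

/-! ### Integration by parts at a fixed time -/

section FixedTime

variable {d : ℕ}

/-- `∫ k_n w_n → ∫ k w` when `k_n → k` in `L¹` and `w_n → w` boundedly almost everywhere. -/
lemma tendsto_integral_mul_of_L1 {α : Type*} [MeasurableSpace α] {μ : Measure α}
    {k : ℕ → α → ℝ} {k' : α → ℝ} {w : ℕ → α → ℝ} {w' : α → ℝ} {C : ℝ}
    (hk : ∀ n, Integrable (k n) μ) (hk' : Integrable k' μ)
    (hlim : Tendsto (fun n => eLpNorm (k n - k') 1 μ) atTop (𝓝 0))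
    (hw : ∀ n, AEStronglyMeasurable (w n) μ) (hwC : ∀ n, ∀ᵐ x ∂μ, |w n x| ≤ C)
    (hwlim : ∀ᵐ x ∂μ, Tendsto (fun n => w n x) atTop (𝓝 (w' x))) :
    Tendsto (fun n => ∫ x, k n x * w n x ∂μ) atTop (𝓝 (∫ x, k' x * w' x ∂μ)) := by
  have h1 : Tendsto (fun n => ∫ x, k' x * w n x ∂μ) atTop (𝓝 (∫ x, k' x * w' x ∂μ)) := by
    refine tendsto_integral_of_dominated_convergence (fun x => ‖k' x‖ * C)
      (fun n => hk'.1.mul (hw n)) (hk'.norm.mul_const C) (fun n => ?_) ?_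
    · filter_upwards [hwC n] with x hx
      rw [norm_mul]
      exact mul_le_mul_of_nonneg_left hx (norm_nonneg _)
    · filter_upwards [hwlim] with x hx using hx.const_mul _
  have hint : ∀ n (f : α → ℝ), Integrable f μ → Integrable (fun x => f x * w n x) μ :=
    fun n f hf => hf.mul_bdd (hw n) (hwC n)
  have h2 : Tendsto (fun n => ∫ x, (k n - k') x * w n x ∂μ) atTop (𝓝 0) := by
    have hb : ∀ n, ‖∫ x, (k n - k') x * w n x ∂μ‖ ≤ (eLpNorm (k n - k') 1 μ).toReal * C := by
      intro n
      have := norm_integral_le_of_norm_le (μ := μ) (f := fun x => (k n - k') x * w n x)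
        (((hk n).sub hk').norm.mul_const C) (by
          filter_upwards [hwC n] with x hx
          rw [norm_mul]
          exact mul_le_mul_of_nonneg_left hx (norm_nonneg _))
      rw [integral_mul_const] at this
      rwa [eLpNorm_one_eq_lintegral_enorm, ← integral_norm_eq_lintegral_enorm
        ((hk n).sub hk').1]
    refine squeeze_zero_norm hb ?_
    have := ((ENNReal.tendsto_toReal ENNReal.zero_ne_top).comp hlim).mul_const C
    simpa using this
  have h3 := h2.add h1
  rw [zero_add] at h3
  refine h3.congr fun n => ?_
  rw [← integral_add (hint n _ ((hk n).sub hk')) (hint n _ hk')]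
  congr 1
  ext x
  simp only [Pi.sub_apply]
  ring

lemma MemLp.coord {α : Type*} [MeasurableSpace α] {μ : Measure α} {p : ℝ≥0∞}
    {f : α → Eucl d} (hf : MemLp f p μ) (i : Fin d) : MemLp (fun x => f x i) p μ :=
  (EuclideanSpace.proj i : Eucl d →L[ℝ] ℝ).comp_memLp' hf

lemma integral_partialD {φ : Eucl d → ℝ} (hφ : IsTestFunction φ) (i : Fin d) :
    ∫ x, partialD i φ x = 0 := by
  have h1 := integral_mul_fderiv_eq_neg_fderiv_mul_of_integrable (μ := volume)
    (f := fun _ : Eucl d => (1 : ℝ)) (g := φ) (v := EuclideanSpace.single i 1) (by simp)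
    (by simp only [one_mul]; exact (hφ.partialD i).integrable) (by simpa using hφ.integrable)
    (fun x _ => by fun_prop) (fun x _ => hφ.differentiable x)
  simp only [one_mul, fderiv_fun_const, Pi.zero_apply, zero_apply, zero_mul, integral_zero,
    neg_zero] at h1
  exact h1

lemma IsTestFunction.mul {φ : Eucl d → ℝ} (hφ : IsTestFunction φ) {f : Eucl d → ℝ}
    (hf : ContDiff ℝ ((⊤ : ℕ∞) : WithTop ℕ∞) f) : IsTestFunction (fun x => f x * φ x) :=
  ⟨hf.mul hφ.smooth, hφ.compactSupport.mul_left⟩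

/-- A function in `L²` of every ball, times a test function, is in `L²`. -/
lemma MemLp.mul_testFunction {f : Eucl d → ℝ} {p : ℝ≥0∞}
    (hf : ∀ r : ℝ, MemLp f p (volume.restrict (Metric.closedBall 0 r)))
    {χ : Eucl d → ℝ} (hχ : IsTestFunction χ) : MemLp (fun x => f x * χ x) p volume := by
  obtain ⟨r, -, hr⟩ := hχ.exists_radius
  obtain ⟨M, -, hM⟩ := hχ.exists_bound
  have h1 : MemLp (fun x => χ x * f x) p (volume.restrict (Metric.closedBall 0 r)) :=
    (hf r).mul (p := ∞) (memLp_top_of_bound hχ.continuous.aestronglyMeasurable M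
      (Eventually.of_forall hM))
  rw [← memLp_indicator_iff_restrict measurableSet_closedBall] at h1
  refine h1.ae_eq (Eventually.of_forall fun x => ?_)
  by_cases hx : x ∈ Metric.closedBall (0 : Eucl d) r
  · simp [indicator_of_mem hx, mul_comm]
  · have : χ x = 0 := hr x (by simpa using hx)
    simp [indicator_of_notMem hx, this]

lemma locallyIntegrable_of_bound {f : Eucl d → ℝ} {C : ℝ} (hf : AEStronglyMeasurable f)
    (hC : ∀ᵐ x, |f x| ≤ C) : LocallyIntegrable f := by
  rw [locallyIntegrable_iff]
  intro K hK
  exact Measure.integrableOn_of_bounded hK.measure_lt_top.ne hf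
    (ae_restrict_of_ae hC)

/-- The weak formulation of `div b = g` may be tested with `V W χ`, for bounded functions `V`, `W`
with a square integrable weak gradient and a test function `χ`. -/
lemma integral_inner_gradient_mul {b G H : Eucl d → Eucl d} {g V W χ : Eucl d → ℝ} {C m : ℝ}
    (hb : ∀ r : ℝ, MemLp b 2 (volume.restrict (Metric.closedBall 0 r)))
    (hg : AEStronglyMeasurable g) (hgm : ∀ᵐ x, |g x| ≤ m) (hbg : IsWeakDivergence b g)
    (hV : AEStronglyMeasurable V) (hVC : ∀ᵐ x, |V x| ≤ C)
    (hW : AEStronglyMeasurable W) (hWC : ∀ᵐ x, |W x| ≤ C)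
    (hG : MemLp G 2) (hVG : IsWeakGradient V G) (hH : MemLp H 2) (hWH : IsWeakGradient W H)
    (hχ : IsTestFunction χ) :
    ∑ i, ∫ x, b x i * (G x i * W x + V x * H x i) * χ x
      = -(∫ x, g x * (V x * W x * χ x)) - ∑ i, ∫ x, V x * W x * (b x i * partialD i χ x) := by
  have hC0 : 0 ≤ C := by
    obtain ⟨x, hx⟩ := hVC.exists
    exact (abs_nonneg _).trans hx
  have hVl := locallyIntegrable_of_bound hV hVC
  have hWl := locallyIntegrable_of_bound hW hWC
  have hVd := fun n => differentiable_mollify hVl n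
  have hWd := fun n => differentiable_mollify hWl n
  have hψ : ∀ n, IsTestFunction (fun x => mollify n V x * mollify n W x * χ x) := fun n =>
    hχ.mul ((contDiff_mollify hVl n).mul (contDiff_mollify hWl n))
  have hder : ∀ n i x, partialD i (fun x => mollify n V x * mollify n W x * χ x) x
      = mollify n (fun y => G y i) x * (mollify n W x * χ x)
        + mollify n (fun y => H y i) x * (mollify n V x * χ x)
        + mollify n V x * mollify n W x * partialD i χ x := by
    intro n i x
    rw [partialD_mul (f := fun x => mollify n V x * mollify n W x)
      ((hVd n).mul (hWd n)) hχ.differentiable, partialD_mul (hVd n) (hWd n),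
      partialD_mollify_of_isWeakGradient hVl hVG, partialD_mollify_of_isWeakGradient hWl hWH]
    ring
  have hVlim := ae_tendsto_mollify hVl
  have hWlim := ae_tendsto_mollify hWl
  have hVc := fun n => continuous_mollify hVl n
  have hWc := fun n => continuous_mollify hWl n
  have hbχ : ∀ i, MemLp (fun x => b x i * χ x) 2 volume := fun i =>
    MemLp.mul_testFunction (fun r => MemLp.coord (hb r) i) hχ
  have hL1 : ∀ (f : Eucl d → ℝ) i, MemLp f 2 →
      (∀ n, Integrable (fun x => b x i * χ x * mollify n f x)) ∧
      Integrable (fun x => b x i * χ x * f x) ∧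
      Tendsto (fun n => eLpNorm ((fun x => b x i * χ x * mollify n f x)
        - fun x => b x i * χ x * f x) 1 volume) atTop (𝓝 0) := by
    intro f i hf
    have hfl := hf.locallyIntegrable (by norm_num)
    have hmoll : ∀ n, MemLp (mollify n f) 2 := fun n =>
      ⟨(continuous_mollify hfl n).aestronglyMeasurable,
        (eLpNorm_mollify_le (by norm_num) (by norm_num) hf.1 n).trans_lt hf.2⟩
    refine ⟨fun n => (hbχ i).integrable_mul (hmoll n), (hbχ i).integrable_mul hf, ?_⟩
    have h := tendsto_eLpNorm_mollify_sub (p := 2) (by norm_num) (by norm_num) hf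
    have h2 := ENNReal.Tendsto.const_mul (a := eLpNorm (fun x => b x i * χ x) 2 volume) h
      (Or.inr (hbχ i).2.ne)
    rw [mul_zero] at h2
    refine tendsto_of_tendsto_of_tendsto_of_le_of_le tendsto_const_nhds h2
      (fun _ => zero_le) (fun n => ?_)
    have h3 := eLpNorm_smul_le_mul_eLpNorm (p := 2) (q := 2) (r := 1) (μ := volume)
      (f := mollify n f - f) (φ := fun x => b x i * χ x) ((hmoll n).sub hf).1 (hbχ i).1
    refine le_trans (le_of_eq ?_) h3
    congr 1
    ext x
    simp only [Pi.sub_apply, Pi.smul_apply', smul_eq_mul]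
    ring
  have hVC' := fun n => abs_mollify_le hVC n
  have hWC' := fun n => abs_mollify_le hWC n
  have hVW : ∀ n x, |mollify n V x * mollify n W x| ≤ C * C := fun n x => by
    rw [abs_mul]
    exact mul_le_mul (hVC' n x) (hWC' n x) (abs_nonneg _) hC0
  -- the limits of the three terms of `b · ∇ (V_n W_n χ)`
  have hlim1 : ∀ i, Tendsto (fun n => ∫ x, b x i * χ x * mollify n (fun y => G y i) x
      * mollify n W x) atTop (𝓝 (∫ x, b x i * χ x * G x i * W x)) := fun i =>
    tendsto_integral_mul_of_L1 (hL1 _ i (MemLp.coord hG i)).1 (hL1 _ i (MemLp.coord hG i)).2.1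
      (hL1 _ i (MemLp.coord hG i)).2.2 (fun n => (hWc n).aestronglyMeasurable)
      (fun n => Eventually.of_forall (hWC' n)) hWlim
  have hlim2 : ∀ i, Tendsto (fun n => ∫ x, b x i * χ x * mollify n (fun y => H y i) x
      * mollify n V x) atTop (𝓝 (∫ x, b x i * χ x * H x i * V x)) := fun i =>
    tendsto_integral_mul_of_L1 (hL1 _ i (MemLp.coord hH i)).1 (hL1 _ i (MemLp.coord hH i)).2.1
      (hL1 _ i (MemLp.coord hH i)).2.2 (fun n => (hVc n).aestronglyMeasurable)
      (fun n => Eventually.of_forall (hVC' n)) hVlim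
  have hbound : ∀ k : Eucl d → ℝ, Integrable k →
      (∀ n, Integrable (fun x => k x * (mollify n V x * mollify n W x))) ∧
      Tendsto (fun n => ∫ x, k x * (mollify n V x * mollify n W x)) atTop
        (𝓝 (∫ x, k x * (V x * W x))) := by
    intro k hk
    refine ⟨fun n => hk.mul_bdd (c := C * C) ((hVc n).mul (hWc n)).aestronglyMeasurable
      (Eventually.of_forall (hVW n)), ?_⟩
    refine tendsto_integral_mul_of_L1 (fun _ => hk) hk (by simp)
      (fun n => ((hVc n).mul (hWc n)).aestronglyMeasurable)
      (fun n => Eventually.of_forall (hVW n)) ?_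
    filter_upwards [hVlim, hWlim] with x h1 h2 using h1.mul h2
  have hb1 : ∀ i (η : Eucl d → ℝ), IsTestFunction η → Integrable fun x => b x i * η x :=
    fun i η hη => by
      rw [← memLp_one_iff_integrable]
      have hfin : ∀ r : ℝ,
          IsFiniteMeasure ((volume : Measure (Eucl d)).restrict (Metric.closedBall 0 r)) :=
        fun r => isFiniteMeasure_restrict.2 measure_closedBall_lt_top.ne
      exact MemLp.mul_testFunction (fun r => (MemLp.coord (hb r) i).mono_exponent (by norm_num)) hη
  have hg1 : Integrable fun x => g x * χ x := by
    have := hχ.integrable.mul_bdd (c := m) hg hgm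
    exact this.congr (Eventually.of_forall fun x => mul_comm _ _)
  -- the definition of the divergence, tested with `V_n W_n χ`
  have hsplit : ∀ n, ∑ i, ((∫ x, b x i * χ x * mollify n (fun y => G y i) x * mollify n W x)
      + (∫ x, b x i * χ x * mollify n (fun y => H y i) x * mollify n V x)
      + ∫ x, b x i * partialD i χ x * (mollify n V x * mollify n W x))
      = -∫ x, g x * χ x * (mollify n V x * mollify n W x) := by
    intro n
    have hI1 : ∀ i, Integrable fun x => b x i * χ x * mollify n (fun y => G y i) x * mollify n W x :=
      fun i => ((hL1 _ i (MemLp.coord hG i)).1 n).mul_bdd (hWc n).aestronglyMeasurable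
        (Eventually.of_forall (hWC' n))
    have hI2 : ∀ i, Integrable fun x => b x i * χ x * mollify n (fun y => H y i) x * mollify n V x :=
      fun i => ((hL1 _ i (MemLp.coord hH i)).1 n).mul_bdd (hVc n).aestronglyMeasurable
        (Eventually.of_forall (hVC' n))
    have hI3 : ∀ i, Integrable fun x =>
        b x i * partialD i χ x * (mollify n V x * mollify n W x) :=
      fun i => (hbound _ (hb1 i _ (hχ.partialD i))).1 n
    have h := hbg _ (hψ n)
    have e1 : (fun x => g x * χ x * (mollify n V x * mollify n W x))
        = fun x => g x * (mollify n V x * mollify n W x * χ x) := by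
      ext x; ring
    have e2 : (fun x => ∑ i, b x i * partialD i (fun x => mollify n V x * mollify n W x * χ x) x)
        = fun x => ∑ i, (b x i * χ x * mollify n (fun y => G y i) x * mollify n W x
          + b x i * χ x * mollify n (fun y => H y i) x * mollify n V x
          + b x i * partialD i χ x * (mollify n V x * mollify n W x)) := by
      ext x
      refine Finset.sum_congr rfl fun i _ => ?_
      rw [hder]
      ring
    rw [e1, ← h, e2, integral_finsetSum]
    · refine Finset.sum_congr rfl fun i _ => ?_
      rw [integral_add _ (hI3 i), integral_add (hI1 i) (hI2 i)]
      exact (hI1 i).add (hI2 i)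
    · intro i _
      exact ((hI1 i).add (hI2 i)).add (hI3 i)
  have hR := (hbound _ hg1).2.neg
  have hL := tendsto_finsetSum Finset.univ fun i _ =>
    ((hlim1 i).add (hlim2 i)).add (hbound _ (hb1 i _ (hχ.partialD i))).2
  have hfin := tendsto_nhds_unique (hL.congr hsplit) hR
  have e3 : ∑ i, ∫ x, b x i * (G x i * W x + V x * H x i) * χ x
      = ∑ i, ((∫ x, b x i * χ x * G x i * W x) + ∫ x, b x i * χ x * H x i * V x) := by
    refine Finset.sum_congr rfl fun i _ => ?_
    rw [← integral_add
      ((hL1 _ i (MemLp.coord hG i)).2.1.mul_bdd (c := C) hW hWC)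
      ((hL1 _ i (MemLp.coord hH i)).2.1.mul_bdd (c := C) hV hVC)]
    congr 1
    ext x
    ring
  have e4 : ∑ i, ∫ x, V x * W x * (b x i * partialD i χ x)
      = ∑ i, ∫ x, b x i * partialD i χ x * (V x * W x) := by
    simp only [mul_comm]
  have e5 : ∫ x, g x * (V x * W x * χ x) = ∫ x, g x * χ x * (V x * W x) := by
    congr 1
    ext x
    ring
  rw [Finset.sum_add_distrib] at hfin
  rw [e3, e4, e5]
  linarith

lemma partialD_add {f g : Eucl d → ℝ} (hf : Differentiable ℝ f) (hg : Differentiable ℝ g)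
    (i : Fin d) (x : Eucl d) :
    partialD i (fun y => f y + g y) x = partialD i f x + partialD i g x := by
  unfold StochTransport.partialD
  rw [fderiv_fun_add (hf x) (hg x)]
  rfl

/-- `∫ χ V ΔV ≤ ½ ∫ V² Δχ` for a smooth function `V` and a test function `χ ≥ 0`: the missing
term is `∫ χ |∇V|²`. -/
lemma integral_mul_laplacian_le {V χ : Eucl d → ℝ}
    (hV : ContDiff ℝ ((⊤ : ℕ∞) : WithTop ℕ∞) V) (hχ : IsTestFunction χ) (hχ0 : ∀ x, 0 ≤ χ x) :
    ∫ x, χ x * (V x * ∑ i, partialD i (partialD i V) x)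
      ≤ 1 / 2 * ∫ x, V x ^ 2 * ∑ i, partialD i (partialD i χ) x := by
  have hDs : ∀ (f : Eucl d → ℝ) i, ContDiff ℝ ((⊤ : ℕ∞) : WithTop ℕ∞) f →
      ContDiff ℝ ((⊤ : ℕ∞) : WithTop ℕ∞) (partialD i f) := fun f i hf => by
    have h : ContDiff ℝ ((⊤ : ℕ∞) : WithTop ℕ∞) (fderiv ℝ f) := hf.fderiv_right (by simp)
    exact h.clm_apply contDiff_const
  have hdiff : ∀ f : Eucl d → ℝ, ContDiff ℝ ((⊤ : ℕ∞) : WithTop ℕ∞) f → Differentiable ℝ f :=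
    fun f hf => hf.differentiable (by simp)
  have hparts : ∀ (f η : Eucl d → ℝ) i, ContDiff ℝ ((⊤ : ℕ∞) : WithTop ℕ∞) f →
      IsTestFunction η → ∫ x, partialD i f x * η x = -∫ x, f x * partialD i η x := by
    intro f η i hf hη
    have h1 := integral_mul_fderiv_eq_neg_fderiv_mul_of_integrable (μ := volume) (f := f) (g := η)
      (v := EuclideanSpace.single i 1) (hη.mul (hDs f i hf)).integrable
      ((hη.partialD i).mul hf).integrable (hη.mul hf).integrable
      (fun x _ => hdiff f hf x) (fun x _ => hη.differentiable x)
    rw [eq_neg_iff_add_eq_zero, add_comm, ← eq_neg_iff_add_eq_zero]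
    exact h1
  have hV2 : ContDiff ℝ ((⊤ : ℕ∞) : WithTop ℕ∞) fun x => V x * V x := hV.mul hV
  have hterm : ∀ i, ∫ x, χ x * (V x * partialD i (partialD i V) x)
      ≤ 1 / 2 * ∫ x, V x ^ 2 * partialD i (partialD i χ) x := by
    intro i
    have e1 : ∫ x, V x ^ 2 * partialD i (partialD i χ) x
        = ∫ x, partialD i (partialD i fun x => V x * V x) x * χ x := by
      rw [hparts _ _ i (hDs _ i hV2) hχ, hparts _ _ i hV2 (hχ.partialD i), neg_neg]
      simp only [sq]
    have e2 : ∀ x, partialD i (partialD i fun x => V x * V x) x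
        = 2 * (V x * partialD i (partialD i V) x) + 2 * partialD i V x ^ 2 := by
      intro x
      have : partialD i (fun x => V x * V x) = fun x => partialD i V x * V x + V x * partialD i V x :=
        funext fun y => partialD_mul (hdiff V hV) (hdiff V hV) i y
      rw [this]
      have hD := hdiff _ (hDs V i hV)
      have h2 := partialD_add (f := fun x => partialD i V x * V x)
        (g := fun x => V x * partialD i V x) (hD.mul (hdiff V hV)) ((hdiff V hV).mul hD) i x
      rw [h2, partialD_mul hD (hdiff V hV), partialD_mul (hdiff V hV) hD]
      ring
    rw [e1, ← integral_const_mul]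
    refine integral_mono ?_ ?_ fun x => ?_
    · have := (hχ.mul (hV.mul (hDs _ i (hDs _ i hV)))).integrable
      simpa only [mul_comm] using this
    · exact ((hχ.mul (hDs _ i (hDs _ i hV2))).integrable).const_mul _
    · simp only [e2]
      nlinarith [mul_nonneg (hχ0 x) (sq_nonneg (partialD i V x))]
  have hI1 : ∀ i, Integrable fun x => χ x * (V x * partialD i (partialD i V) x) := fun i => by
    have := (hχ.mul (hV.mul (hDs _ i (hDs _ i hV)))).integrable
    simpa only [mul_comm] using this
  have hI2 : ∀ i, Integrable fun x => V x ^ 2 * partialD i (partialD i χ) x := fun i =>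
    (((hχ.partialD i).partialD i).mul (hV.pow 2)).integrable
  simp only [Finset.mul_sum]
  rw [integral_finsetSum _ fun i _ => hI1 i, integral_finsetSum _ fun i _ => hI2 i,
    Finset.mul_sum]
  exact Finset.sum_le_sum fun i _ => hterm i

/-- The pairing with `φ` of the right-hand side of
`∂_t V = -b · ∇V + ½ ΔV`, in distributional form; `g` is the divergence of `b`. -/
def parabolicForm (b : Eucl d → Eucl d) (g V φ : Eucl d → ℝ) : ℝ :=
  ∫ y, V y * (∑ i, b y i * partialD i φ y + g y * φ y
    + 1 / 2 * ∑ i, partialD i (partialD i φ) y)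

/-- Tested with the mollifier, the right-hand side of the parabolic equation is
`-(b · ∇V)_n + ½ Δ V_n`. -/
lemma parabolicForm_moll {b G : Eucl d → Eucl d} {g V : Eucl d → ℝ} {C m : ℝ}
    (hb : ∀ r : ℝ, MemLp b 2 (volume.restrict (Metric.closedBall 0 r)))
    (hg : AEStronglyMeasurable g) (hgm : ∀ᵐ x, |g x| ≤ m) (hbg : IsWeakDivergence b g)
    (hV : AEStronglyMeasurable V) (hVC : ∀ᵐ x, |V x| ≤ C)
    (hG : MemLp G 2) (hVG : IsWeakGradient V G) (n : ℕ) (x : Eucl d) :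
    parabolicForm b g V (fun y => moll d n (x - y))
      = -mollify n (fun y => ∑ i, b y i * G y i) x
        + 1 / 2 * ∑ i, partialD i (partialD i (mollify n V)) x := by
  have hC1 : ∀ᵐ x, |V x| ≤ max C 1 := hVC.mono fun x hx => hx.trans (le_max_left _ _)
  have hone : ∀ᵐ x : Eucl d, |(1 : ℝ)| ≤ max C 1 := Eventually.of_forall fun x => by simp
  have hVl := locallyIntegrable_of_bound hV hVC
  have hφ := (moll_isTestFunction (d := d) n).comp_const_sub x
  have hgrad1 : IsWeakGradient (fun _ : Eucl d => (1 : ℝ)) (fun _ => 0) := by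
    intro φ hφ i
    simpa using integral_partialD hφ i
  have key := integral_inner_gradient_mul hb hg hgm hbg hV hC1
    (aestronglyMeasurable_const (b := (1 : ℝ))) hone hG hVG MemLp.zero' hgrad1 hφ
  have hbφ : ∀ i (η : Eucl d → ℝ), IsTestFunction η → MemLp (fun x => b x i * η x) 2 volume :=
    fun i η hη => MemLp.mul_testFunction (fun r => MemLp.coord (hb r) i) hη
  have hI1 : ∀ i, Integrable fun y => V y * (b y i * partialD i (fun y => moll d n (x - y)) y) :=
    fun i => by
      have h1 : Integrable fun y => b y i * partialD i (fun y => moll d n (x - y)) y := by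
        rw [← memLp_one_iff_integrable]
        have hfin : ∀ r : ℝ,
            IsFiniteMeasure ((volume : Measure (Eucl d)).restrict (Metric.closedBall 0 r)) :=
          fun r => isFiniteMeasure_restrict.2 measure_closedBall_lt_top.ne
        exact MemLp.mul_testFunction
          (fun r => (MemLp.coord (hb r) i).mono_exponent (by norm_num)) (hφ.partialD i)
      exact h1.bdd_mul hV hVC
  have hI2 : Integrable fun y => V y * (g y * moll d n (x - y)) :=
    (hφ.integrable.bdd_mul hg hgm).bdd_mul hV hVC
  have hI3 : ∀ i, Integrable fun y =>
      V y * partialD i (partialD i (fun y => moll d n (x - y))) y :=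
    fun i => ((hφ.partialD i).partialD i).integrable.bdd_mul hV hVC
  have hI4 : ∀ i, Integrable fun y => b y i * G y i * moll d n (x - y) := fun i => by
    have := (hbφ i _ hφ).integrable_mul (MemLp.coord hG i)
    refine this.congr (Eventually.of_forall fun y => ?_)
    simp only [Pi.mul_apply]
    ring
  have e0 : parabolicForm b g V (fun y => moll d n (x - y))
      = ∑ i, (∫ y, V y * (b y i * partialD i (fun y => moll d n (x - y)) y))
        + (∫ y, V y * (g y * moll d n (x - y)))
        + 1 / 2 * ∑ i, ∫ y, V y * partialD i (partialD i (fun y => moll d n (x - y))) y := by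
    have hS : Integrable fun y =>
        ∑ i, V y * (b y i * partialD i (fun y => moll d n (x - y)) y) :=
      integrable_finsetSum _ fun i _ => hI1 i
    have hS' : Integrable fun y =>
        ∑ i, V y * (b y i * partialD i (fun y => moll d n (x - y)) y)
          + V y * (g y * moll d n (x - y)) := hS.add hI2
    have hS'' : Integrable fun y =>
        1 / 2 * ∑ i, V y * partialD i (partialD i (fun y => moll d n (x - y))) y :=
      (integrable_finsetSum _ fun i _ => hI3 i).const_mul _
    rw [← integral_finsetSum _ fun i _ => hI1 i, ← integral_finsetSum _ fun i _ => hI3 i,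
      ← integral_const_mul, ← integral_add hS hI2, ← integral_add hS' hS'']
    unfold parabolicForm
    congr 1
    ext y
    simp only [← Finset.mul_sum]
    ring
  have e1 : mollify n (fun y => ∑ i, b y i * G y i) x
      = ∑ i, ∫ y, b y i * G y i * moll d n (x - y) := by
    rw [← integral_finsetSum _ fun i _ => hI4 i]
    unfold mollify
    congr 1
    ext y
    rw [mul_comm, Finset.sum_mul]
  have e2 : ∀ i, ∫ y, V y * partialD i (partialD i (fun y => moll d n (x - y))) y
      = partialD i (partialD i (mollify n V)) x := by
    intro i
    rw [partialD_partialD_mollify hVl]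
    congr 1
    ext y
    have h1 : partialD i (fun y => moll d n (x - y)) = fun y => -partialD i (moll d n) (x - y) :=
      funext fun y => partialD_comp_const_sub (moll_isTestFunction n).differentiable i x y
    have h2 : partialD i (fun y => -partialD i (moll d n) (x - y)) y
        = - partialD i (fun y => partialD i (moll d n) (x - y)) y := by
      change fderiv ℝ (fun y => -partialD i (moll d n) (x - y)) y _ = _
      rw [fderiv_fun_neg]
      rfl
    rw [h1, h2, partialD_comp_const_sub ((moll_isTestFunction n).partialD i).differentiable]
    ring
  simp only [mul_one, PiLp.zero_apply, mul_zero, add_zero] at key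
  rw [e0, e1, Finset.sum_congr rfl fun i _ => e2 i, key]
  have e3 : ∫ y, g y * (V y * moll d n (x - y)) = ∫ y, V y * (g y * moll d n (x - y)) := by
    congr 1
    ext y
    ring
  rw [e3]
  ring

lemma mollify_indicator {f : Eucl d → ℝ} {r : ℝ} (n : ℕ) {x : Eucl d} (hx : ‖x‖ ≤ r) :
    mollify n ((Metric.closedBall 0 (r + 1)).indicator f) x = mollify n f x := by
  refine integral_congr_ae (Eventually.of_forall fun y => ?_)
  by_cases h : moll d n (x - y) = 0
  · simp [h]
  · have h1 := norm_lt_one_of_moll_ne_zero h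
    have h2 : y ∈ Metric.closedBall (0 : Eucl d) (r + 1) := by
      rw [mem_closedBall_zero_iff]
      have := norm_sub_norm_le y x
      rw [norm_sub_rev] at this
      linarith
    simp only [indicator_of_mem h2]

lemma integral_abs_mollify_le {f : Eucl d → ℝ} (hf : Integrable f) (n : ℕ) :
    Integrable (mollify n f) ∧ ∫ x, |mollify n f x| ≤ ∫ x, |f x| := by
  have h := eLpNorm_mollify_le le_rfl (by norm_num) hf.1 n
  have hm : Integrable (mollify n f) := by
    rw [← memLp_one_iff_integrable]
    exact ⟨(continuous_mollify hf.locallyIntegrable n).aestronglyMeasurable,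
      h.trans_lt (memLp_one_iff_integrable.2 hf).2⟩
  refine ⟨hm, ?_⟩
  simp only [← Real.norm_eq_abs]
  rw [integral_norm_eq_lintegral_enorm hm.1, integral_norm_eq_lintegral_enorm hf.1,
    ← eLpNorm_one_eq_lintegral_enorm, ← eLpNorm_one_eq_lintegral_enorm]
  exact ENNReal.toReal_mono (memLp_one_iff_integrable.2 hf).2.ne h

end FixedTime

/-! ### The energy inequality -/

section Energy

variable {d : ℕ}

lemma abs_integral_le_of_abs_le {α : Type*} [MeasurableSpace α] {μ : Measure α} {f g : α → ℝ}
    (hg : Integrable g μ) (h : ∀ᵐ x ∂μ, |f x| ≤ g x) : |∫ x, f x ∂μ| ≤ ∫ x, g x ∂μ :=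
  norm_integral_le_of_norm_le (f := f) hg h

instance (T : ℝ≥0) : IsFiniteMeasure (timeMeasure T) :=
  isFiniteMeasure_restrict.2 measure_Icc_lt_top.ne

lemma ae_timeMeasure_mem (T : ℝ≥0) : ∀ᵐ t ∂(timeMeasure T), t ∈ Icc 0 (T : ℝ) :=
  ae_restrict_mem measurableSet_Icc

lemma timeMeasure_restrict_Ioc {T : ℝ≥0} {t : ℝ} (ht : t ≤ T) :
    (timeMeasure T).restrict (Ioc 0 t) = volume.restrict (Ioc 0 t) := by
  rw [timeMeasure, Measure.restrict_restrict measurableSet_Ioc]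
  congr 1
  exact inter_eq_left.2 fun s hs => ⟨hs.1.le, hs.2.trans ht⟩

lemma integral_interval_eq_timeMeasure {T : ℝ≥0} {t : ℝ} (ht : t ∈ Icc 0 (T : ℝ)) (f : ℝ → ℝ) :
    ∫ s in (0 : ℝ)..t, f s = ∫ s in Ioc 0 t, f s ∂(timeMeasure T) := by
  rw [intervalIntegral.integral_of_le ht.1, timeMeasure_restrict_Ioc ht.2]

/-- The chain rule for the square of an absolutely continuous function, in integrated form. -/
lemma sq_eq_integral_of_ae_eq_integral {T : ℝ≥0} {f v : ℝ → ℝ}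
    (hf : Integrable f (timeMeasure T))
    (hv : ∀ᵐ t ∂(timeMeasure T), v t = ∫ s in (0 : ℝ)..t, f s) :
    ∀ᵐ t ∂(timeMeasure T), v t ^ 2 = ∫ s in Ioc 0 t, 2 * (v s * f s) ∂(timeMeasure T) := by
  filter_upwards [hv, ae_timeMeasure_mem T] with t ht htT
  have hfi : IntervalIntegrable f volume 0 t := by
    rw [intervalIntegrable_iff_integrableOn_Ioc_of_le htT.1, IntegrableOn,
      ← timeMeasure_restrict_Ioc htT.2]
    exact hf.restrict
  have hac := hfi.absolutelyContinuousOnInterval_intervalIntegral (left_mem_uIcc)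
  have h := hac.integral_deriv_mul_eq_sub hac
  simp only [intervalIntegral.integral_same, mul_zero, sub_zero] at h
  rw [ht, sq, ← h, ← integral_interval_eq_timeMeasure htT]
  refine intervalIntegral.integral_congr_ae ?_
  have hv' : ∀ᵐ s, s ∈ Icc 0 (T : ℝ) → v s = ∫ r in (0 : ℝ)..s, f r :=
    (ae_restrict_iff' measurableSet_Icc).1 hv
  filter_upwards [hfi.ae_hasDerivAt_integral, hv'] with s hs hs' hst
  have hst' : s ∈ uIcc 0 t := uIoc_subset_uIcc hst
  rw [(hs hst' 0 left_mem_uIcc).deriv, hs' ?_]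
  · ring
  · rw [uIoc_of_le htT.1] at hst
    exact ⟨hst.1.le, hst.2.trans htT.2⟩

lemma measurable_integral_kernel {η : Eucl d → ℝ} (hη : Continuous η) {f : ℝ → Eucl d → ℝ}
    (hf : Measurable fun z : ℝ × Eucl d => f z.1 z.2) :
    Measurable fun z : ℝ × Eucl d => ∫ y, η (z.2 - y) * f z.1 y := by
  have : StronglyMeasurable fun p : (ℝ × Eucl d) × Eucl d => η (p.1.2 - p.2) * f p.1.1 p.2 := by
    refine Measurable.stronglyMeasurable (Measurable.mul ?_ ?_)
    · exact hη.measurable.comp (by fun_prop)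
    · exact hf.comp (by fun_prop : Measurable fun p : (ℝ × Eucl d) × Eucl d => (p.1.1, p.2))
  exact this.integral_prod_right'.measurable

lemma measurable_integral_Ioc {T : ℝ≥0} {f : ℝ → Eucl d → ℝ}
    (hf : Measurable fun z : ℝ × Eucl d => f z.1 z.2) :
    Measurable fun z : Eucl d × ℝ => ∫ s in Ioc 0 z.2, f s z.1 ∂(timeMeasure T) := by
  have : StronglyMeasurable fun p : (Eucl d × ℝ) × ℝ =>
      {q : (Eucl d × ℝ) × ℝ | q.2 ∈ Ioc 0 q.1.2}.indicator (fun q => f q.2 q.1.1) p := by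
    refine Measurable.stronglyMeasurable (Measurable.indicator ?_ ?_)
    · exact hf.comp (by fun_prop : Measurable fun p : (Eucl d × ℝ) × ℝ => (p.2, p.1.1))
    · exact (measurableSet_lt measurable_const measurable_snd).inter
        (measurableSet_le measurable_snd (by fun_prop))
  have h2 := (this.integral_prod_right' (ν := timeMeasure T)).measurable
  convert h2 using 2 with z
  rw [← integral_indicator measurableSet_Ioc]
  rfl

/-- A bounded solution `V` of `∂_t V + b · ∇V = ½ ΔV` with zero initial datum, with `V` in
`L²(0, T; H¹) ∩ L^∞(0, T; L²)`, spatial gradient `G`, and `g = div b`. All functions are given by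
measurable representatives; the divergence is dominated by `m`, and `b` grows at most like
`k(t) (1 + |x|)` at infinity, with `m` and `k` integrable in time. -/
structure IsParabolicSolution (T : ℝ≥0) (b G : ℝ → Eucl d → Eucl d) (g V : ℝ → Eucl d → ℝ)
    (m k : ℝ → ℝ) (C R E : ℝ) : Prop where
  measurable_b : Measurable fun z : ℝ × Eucl d => b z.1 z.2
  measurable_G : Measurable fun z : ℝ × Eucl d => G z.1 z.2
  measurable_g : Measurable fun z : ℝ × Eucl d => g z.1 z.2
  measurable_V : Measurable fun z : ℝ × Eucl d => V z.1 z.2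
  abs_V_le : ∀ t x, |V t x| ≤ C
  memLp_b : ∀ r : ℝ, MemLp (fun z : ℝ × Eucl d => b z.1 z.2) 2
    ((timeMeasure T).prod (volume.restrict (Metric.closedBall 0 r)))
  memLp_G : MemLp (fun z : ℝ × Eucl d => G z.1 z.2) 2 ((timeMeasure T).prod volume)
  memLp_V : MemLp (fun z : ℝ × Eucl d => V z.1 z.2) 2 ((timeMeasure T).prod volume)
  gradient : ∀ᵐ t ∂(timeMeasure T), IsWeakGradient (V t) (G t)
  divergence : ∀ᵐ t ∂(timeMeasure T), IsWeakDivergence (b t) (g t)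
  integrable_m : Integrable m (timeMeasure T)
  abs_g_le : ∀ᵐ t ∂(timeMeasure T), ∀ᵐ x, |g t x| ≤ m t
  integrable_k : Integrable k (timeMeasure T)
  growth : ∀ᵐ t ∂(timeMeasure T), ∀ᵐ x, R < ‖x‖ → ‖b t x‖ ≤ k t * (1 + ‖x‖)
  energy_le : ∀ᵐ t ∂(timeMeasure T), ∫ x, V t x ^ 2 ≤ E
  equation : ∀ φ : Eucl d → ℝ, IsTestFunction φ → ∀ᵐ t ∂(timeMeasure T),
    ∫ x, V t x * φ x = ∫ s in (0 : ℝ)..t, parabolicForm (b s) (g s) (V s) φ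

/-- The function `b · ∇V` at time `s`, restricted to the ball of radius `r`. -/
def advection (b G : ℝ → Eucl d → Eucl d) (r s : ℝ) : Eucl d → ℝ :=
  (Metric.closedBall 0 r).indicator fun x => ∑ i, b s x i * G s x i

/-- The upper bound for the time derivative of `∫ χ V_n²`, for the mollified solution `V_n`:
`-2 ∫ χ V_n (b · ∇V)_n + ½ ∫ V_n² Δχ`. -/
def energyRate (b G : ℝ → Eucl d → Eucl d) (V : ℝ → Eucl d → ℝ) (χ : Eucl d → ℝ) (r : ℝ) (n : ℕ)
    (s : ℝ) : ℝ :=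
  -2 * (∫ x, χ x * (mollify n (V s) x * mollify n (advection b G (r + 1) s) x))
    + 1 / 2 * ∫ x, mollify n (V s) x ^ 2 * ∑ i, partialD i (partialD i χ) x

namespace IsParabolicSolution

variable {T : ℝ≥0} {b G : ℝ → Eucl d → Eucl d} {g V : ℝ → Eucl d → ℝ} {m k : ℝ → ℝ} {C R E : ℝ}

lemma ae_memLp_slice {F : Type*} [NormedAddCommGroup F] [MeasurableSpace F] [BorelSpace F]
    [SecondCountableTopology F] {f : ℝ → Eucl d → F} {ν : Measure (Eucl d)} [SFinite ν]
    (hf : Measurable fun z : ℝ × Eucl d => f z.1 z.2)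
    (h : MemLp (fun z : ℝ × Eucl d => f z.1 z.2) 2 ((timeMeasure T).prod ν)) :
    ∀ᵐ t ∂(timeMeasure T), MemLp (f t) 2 ν := by
  have h1 := (memLp_two_iff_integrable_sq_norm h.1).1 h
  filter_upwards [h1.prod_right_ae] with t ht
  have : AEStronglyMeasurable (f t) ν := (hf.comp measurable_prodMk_left).aestronglyMeasurable
  exact (memLp_two_iff_integrable_sq_norm this).2 ht

variable (h : IsParabolicSolution T b G g V m k C R E)
include h

lemma ae_memLp_b : ∀ᵐ t ∂(timeMeasure T),
    ∀ r : ℝ, MemLp (b t) 2 (volume.restrict (Metric.closedBall 0 r)) := by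
  have h1 : ∀ᵐ t ∂(timeMeasure T),
      ∀ n : ℕ, MemLp (b t) 2 (volume.restrict (Metric.closedBall 0 (n : ℝ))) :=
    ae_all_iff.2 fun n => ae_memLp_slice h.measurable_b (h.memLp_b n)
  filter_upwards [h1] with t ht r
  obtain ⟨n, hn⟩ := exists_nat_ge r
  exact (ht n).mono_measure
    (Measure.restrict_mono (Metric.closedBall_subset_closedBall hn) le_rfl)

lemma measurable_V_slice (t : ℝ) : Measurable (V t) := h.measurable_V.comp measurable_prodMk_left

lemma measurable_g_slice (t : ℝ) : Measurable (g t) := h.measurable_g.comp measurable_prodMk_left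

lemma locallyIntegrable_V (t : ℝ) : LocallyIntegrable (V t) :=
  locallyIntegrable_of_bound (h.measurable_V_slice t).aestronglyMeasurable
    (Eventually.of_forall (h.abs_V_le t))

lemma measurable_advection (r : ℝ) :
    Measurable fun z : ℝ × Eucl d => advection b G r z.1 z.2 := by
  have h1 : Measurable fun z : ℝ × Eucl d => ∑ i, b z.1 z.2 i * G z.1 z.2 i := by
    refine Finset.measurable_sum _ fun i _ => Measurable.mul ?_ ?_
    · exact (EuclideanSpace.proj i : Eucl d →L[ℝ] ℝ).continuous.measurable.comp h.measurable_b
    · exact (EuclideanSpace.proj i : Eucl d →L[ℝ] ℝ).continuous.measurable.comp h.measurable_G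
  have h2 := h1.indicator
    (measurableSet_closedBall.preimage measurable_snd : MeasurableSet
      (Prod.snd ⁻¹' (Metric.closedBall (0 : Eucl d) r) : Set (ℝ × Eucl d)))
  exact h2

/-- `b · ∇V` is integrable on `[0, T] × B_r`. -/
lemma integrable_advection (r : ℝ) :
    Integrable (fun z : ℝ × Eucl d => advection b G r z.1 z.2) ((timeMeasure T).prod volume) := by
  have h1 : Integrable (fun z : ℝ × Eucl d => ∑ i, b z.1 z.2 i * G z.1 z.2 i)
      ((timeMeasure T).prod (volume.restrict (Metric.closedBall 0 r))) := by
    refine integrable_finsetSum _ fun i _ => ?_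
    refine (MemLp.coord (h.memLp_b r) i).integrable_mul (MemLp.coord (h.memLp_G.mono_measure ?_) i)
    exact Measure.prod_mono le_rfl Measure.restrict_le_self
  have h2 : (timeMeasure T).prod (volume.restrict (Metric.closedBall (0 : Eucl d) r))
      = ((timeMeasure T).prod volume).restrict (univ ×ˢ Metric.closedBall 0 r) := by
    rw [← Measure.prod_restrict, Measure.restrict_univ]
  rw [h2] at h1
  have h3 := (integrable_indicator_iff
    (MeasurableSet.univ.prod measurableSet_closedBall)).2 h1
  refine h3.congr (Eventually.of_forall fun z => ?_)
  simp only [advection, indicator]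
  congr 1
  simp

/-- The mollified solution satisfies the mollified equation, at each point of the ball `B_r`. -/
lemma mollify_eq_integral (n : ℕ) (r : ℝ) (x : Eucl d) (hx : ‖x‖ ≤ r) :
    ∀ᵐ t ∂(timeMeasure T), mollify n (V t) x = ∫ s in (0 : ℝ)..t,
      (-mollify n (advection b G (r + 1) s) x
      + 1 / 2 * ∑ i, ∫ y, partialD i (partialD i (moll d n)) (x - y) * V s y) := by
  have hslice : ∀ᵐ s ∂(timeMeasure T), parabolicForm (b s) (g s) (V s) (fun y => moll d n (x - y))
      = -mollify n (advection b G (r + 1) s) x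
      + 1 / 2 * ∑ i, ∫ y, partialD i (partialD i (moll d n)) (x - y) * V s y := by
    filter_upwards [h.ae_memLp_b, ae_memLp_slice h.measurable_G h.memLp_G, h.gradient,
      h.divergence, h.abs_g_le] with s hb hG hgrad hdiv hg
    rw [parabolicForm_moll hb (h.measurable_g_slice s).aestronglyMeasurable hg hdiv
      (h.measurable_V_slice s).aestronglyMeasurable (Eventually.of_forall (h.abs_V_le s)) hG hgrad,
      advection, mollify_indicator n hx]
    simp only [partialD_partialD_mollify (h.locallyIntegrable_V s)]
  filter_upwards [h.equation _ ((moll_isTestFunction n).comp_const_sub x), ae_timeMeasure_mem T]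
    with t ht htT
  rw [integral_interval_eq_timeMeasure htT] at ht ⊢
  rw [mollify]
  simp only [mul_comm (moll d n _)]
  rw [ht]
  exact integral_congr_ae (ae_restrict_of_ae hslice)

lemma integrable_integral_abs_advection (r : ℝ) :
    Integrable (fun s => ∫ x, |advection b G r s x|) (timeMeasure T) :=
  (h.integrable_advection r).norm.integral_prod_left

lemma measurable_energyRate {χ : Eucl d → ℝ} (hχ : IsTestFunction χ) (r : ℝ) (n : ℕ) :
    Measurable (energyRate b G V χ r n) := by
  have hHnm : Measurable fun z : ℝ × Eucl d => mollify n (advection b G (r + 1) z.1) z.2 :=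
    measurable_integral_kernel (moll_continuous n) (h.measurable_advection _)
  have hVnm : Measurable fun z : ℝ × Eucl d => mollify n (V z.1) z.2 :=
    measurable_integral_kernel (moll_continuous n) h.measurable_V
  have hΔ : Continuous fun x => ∑ i, partialD i (partialD i χ) x :=
    continuous_finsetSum _ fun i _ => ((hχ.partialD i).partialD i).continuous
  have h1 : StronglyMeasurable fun z : ℝ × Eucl d =>
      χ z.2 * (mollify n (V z.1) z.2 * mollify n (advection b G (r + 1) z.1) z.2) :=
    ((hχ.continuous.measurable.comp measurable_snd).mul (hVnm.mul hHnm)).stronglyMeasurable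
  have h2 : StronglyMeasurable fun z : ℝ × Eucl d =>
      mollify n (V z.1) z.2 ^ 2 * ∑ i, partialD i (partialD i χ) z.2 :=
    ((hVnm.pow_const 2).mul (hΔ.measurable.comp measurable_snd)).stronglyMeasurable
  exact (h1.integral_prod_right'.measurable.const_mul _).add
    (h2.integral_prod_right'.measurable.const_mul _)

lemma exists_energyRate_bound {χ : Eucl d → ℝ} (hχ : IsTestFunction χ) (r : ℝ) :
    ∃ B : ℝ → ℝ, Integrable B (timeMeasure T) ∧
      ∀ᵐ s ∂(timeMeasure T), ∀ n, |energyRate b G V χ r n s| ≤ B s := by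
  obtain ⟨X, hX0, hX⟩ := hχ.exists_bound
  have hC0 : 0 ≤ C := (abs_nonneg _).trans (h.abs_V_le 0 0)
  set D : ℝ := ∫ x, |∑ i, partialD i (partialD i χ) x|
  have hΔ : Integrable fun x => ∑ i, partialD i (partialD i χ) x :=
    integrable_finsetSum _ fun i _ => ((hχ.partialD i).partialD i).integrable
  refine ⟨fun s => 2 * (X * C * ∫ x, |advection b G (r + 1) s x|) + 1 / 2 * (C ^ 2 * D),
    (((h.integrable_integral_abs_advection (r + 1)).const_mul (X * C)).const_mul 2).add
      (integrable_const _), ?_⟩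
  filter_upwards [(h.integrable_advection (r + 1)).prod_right_ae] with s hs n
  have hVn : ∀ x, |mollify n (V s) x| ≤ C := fun x =>
    abs_mollify_le (Eventually.of_forall (h.abs_V_le s)) n x
  obtain ⟨hm1, hm2⟩ := integral_abs_mollify_le hs n
  refine (abs_add_le _ _).trans (add_le_add ?_ ?_)
  · rw [abs_mul, abs_neg, abs_two]
    refine mul_le_mul_of_nonneg_left ?_ zero_le_two
    refine le_trans ?_ (mul_le_mul_of_nonneg_left hm2 (mul_nonneg hX0 hC0))
    rw [← integral_const_mul]
    refine abs_integral_le_of_abs_le (hm1.abs.const_mul _) (Eventually.of_forall fun x => ?_)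
    rw [abs_mul, abs_mul, mul_assoc]
    exact mul_le_mul (hX x) (mul_le_mul_of_nonneg_right (hVn x) (abs_nonneg _))
      (mul_nonneg (abs_nonneg _) (abs_nonneg _)) hX0
  · rw [abs_mul, abs_of_pos (by norm_num : (0 : ℝ) < 1 / 2)]
    refine mul_le_mul_of_nonneg_left ?_ (by norm_num)
    rw [← integral_const_mul]
    refine abs_integral_le_of_abs_le (hΔ.abs.const_mul _) (Eventually.of_forall fun x => ?_)
    rw [abs_mul, abs_pow]
    exact mul_le_mul_of_nonneg_right (pow_le_pow_left₀ (abs_nonneg _) (hVn x) 2) (abs_nonneg _)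

lemma integrable_energyRate {χ : Eucl d → ℝ} (hχ : IsTestFunction χ) (r : ℝ) (n : ℕ) :
    Integrable (energyRate b G V χ r n) (timeMeasure T) := by
  obtain ⟨B, hB, hB'⟩ := h.exists_energyRate_bound hχ r
  exact hB.mono' (h.measurable_energyRate hχ r n).aestronglyMeasurable
    (hB'.mono fun s hs => hs n)

/-- The energy of the mollified solution, localized by a test function `χ ≥ 0`. -/
lemma energy_mollify_le {χ : Eucl d → ℝ} (hχ : IsTestFunction χ) (hχ0 : ∀ x, 0 ≤ χ x) {r : ℝ}
    (hr : ∀ x, r < ‖x‖ → χ x = 0) (n : ℕ) :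
    ∀ᵐ t ∂(timeMeasure T), ∫ x, χ x * mollify n (V t) x ^ 2 ≤
      ∫ s in Ioc 0 t, energyRate b G V χ r n s ∂(timeMeasure T) := by
  set H : ℝ → Eucl d → ℝ := advection b G (r + 1) with hH
  set K : Fin d → Eucl d → ℝ := fun i => partialD i (partialD i (moll d n)) with hK
  have hKt : ∀ i, IsTestFunction (K i) := fun i => ((moll_isTestFunction n).partialD i).partialD i
  set α : ℝ → Eucl d → ℝ := fun s x =>
    -mollify n (H s) x + 1 / 2 * ∑ i, ∫ y, K i (x - y) * V s y with hα
  have hHm : Measurable fun z : ℝ × Eucl d => H z.1 z.2 := h.measurable_advection _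
  have hVnm : Measurable fun z : ℝ × Eucl d => mollify n (V z.1) z.2 :=
    measurable_integral_kernel (moll_continuous n) h.measurable_V
  have hHnm : Measurable fun z : ℝ × Eucl d => mollify n (H z.1) z.2 :=
    measurable_integral_kernel (moll_continuous n) hHm
  have hαm : Measurable fun z : ℝ × Eucl d => α z.1 z.2 := by
    refine hHnm.neg.add (Measurable.const_mul (Finset.measurable_sum _ fun i _ => ?_) _)
    exact measurable_integral_kernel (hKt i).continuous h.measurable_V
  have hHint : ∀ᵐ s ∂(timeMeasure T), Integrable (H s) :=
    (h.integrable_advection (r + 1)).prod_right_ae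
  have hC0 : 0 ≤ C := (abs_nonneg _).trans (h.abs_V_le 0 0)
  obtain ⟨M, hM0, hM⟩ := (moll_isTestFunction (d := d) n).exists_bound
  obtain ⟨X, hX0, hX⟩ := hχ.exists_bound
  set A : ℝ → ℝ := fun s => M * (∫ x, |H s x|) + 1 / 2 * ∑ i, C * ∫ y, |K i y| with hA
  have hAint : Integrable A (timeMeasure T) :=
    ((h.integrable_integral_abs_advection (r + 1)).const_mul M).add (integrable_const _)
  have hαA : ∀ᵐ s ∂(timeMeasure T), ∀ x, |α s x| ≤ A s := by
    filter_upwards [hHint] with s hs x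
    refine (abs_add_le _ _).trans (add_le_add ?_ ?_)
    · rw [abs_neg, ← integral_const_mul]
      refine norm_integral_le_of_norm_le (f := fun y => moll d n (x - y) * H s y)
        (hs.abs.const_mul M) (Eventually.of_forall fun y => ?_)
      rw [norm_mul]
      exact mul_le_mul_of_nonneg_right (hM _) (abs_nonneg _)
    · rw [abs_mul, abs_of_pos (by norm_num : (0 : ℝ) < 1 / 2)]
      refine mul_le_mul_of_nonneg_left ((Finset.abs_sum_le_sum_abs _ _).trans
        (Finset.sum_le_sum fun i _ => ?_)) (by norm_num)
      have h1 : Integrable fun y => |K i (x - y)| := ((hKt i).comp_const_sub x).integrable.abs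
      have h2 := norm_integral_le_of_norm_le (h1.const_mul C)
        (f := fun y => K i (x - y) * V s y) (Eventually.of_forall fun y => by
          rw [norm_mul, mul_comm]
          exact mul_le_mul_of_nonneg_right (h.abs_V_le s y) (abs_nonneg _))
      rw [integral_const_mul, integral_sub_left_eq_self (fun y => |K i y|) volume x] at h2
      exact h2
  have hVn : ∀ s x, |mollify n (V s) x| ≤ C := fun s x =>
    abs_mollify_le (Eventually.of_forall (h.abs_V_le s)) n x
  have hpoint : ∀ x, ‖x‖ ≤ r → ∀ᵐ t ∂(timeMeasure T), mollify n (V t) x ^ 2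
      = ∫ s in Ioc 0 t, 2 * (mollify n (V s) x * α s x) ∂(timeMeasure T) := by
    intro x hx
    refine sq_eq_integral_of_ae_eq_integral ?_ (h.mollify_eq_integral n r x hx)
    refine hAint.mono' (hαm.comp measurable_prodMk_right).aestronglyMeasurable ?_
    filter_upwards [hαA] with s hs using hs x
  have hswap : ∀ᵐ t ∂(timeMeasure T), ∀ᵐ x, ‖x‖ ≤ r → mollify n (V t) x ^ 2
      = ∫ s in Ioc 0 t, 2 * (mollify n (V s) x * α s x) ∂(timeMeasure T) := by
    have hms : MeasurableSet {p : Eucl d × ℝ | ‖p.1‖ ≤ r → mollify n (V p.2) p.1 ^ 2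
        = ∫ s in Ioc 0 p.2, 2 * (mollify n (V s) p.1 * α s p.1) ∂(timeMeasure T)} := by
      have h1 : MeasurableSet {p : Eucl d × ℝ | ‖p.1‖ ≤ r} :=
        measurableSet_le measurable_fst.norm measurable_const
      have h2 : MeasurableSet {p : Eucl d × ℝ | mollify n (V p.2) p.1 ^ 2
          = ∫ s in Ioc 0 p.2, 2 * (mollify n (V s) p.1 * α s p.1) ∂(timeMeasure T)} := by
        refine measurableSet_eq_fun ((hVnm.comp measurable_swap).pow_const 2) ?_
        exact measurable_integral_Ioc (f := fun s x => 2 * (mollify n (V s) x * α s x))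
          ((hVnm.mul hαm).const_mul 2)
      exact h1.imp h2
    exact (Measure.ae_ae_comm hms).1
      (Eventually.of_forall fun x => by
        by_cases hx : ‖x‖ ≤ r
        · exact (hpoint x hx).mono fun t ht _ => ht
        · exact Eventually.of_forall fun t ht => absurd ht hx)
  filter_upwards [hswap] with t ht
  have hprod : Integrable (fun p : Eucl d × ℝ =>
      χ p.1 * (2 * (mollify n (V p.2) p.1 * α p.2 p.1)))
      (volume.prod ((timeMeasure T).restrict (Ioc 0 t))) := by
    have hdom : Integrable (fun p : Eucl d × ℝ => |χ p.1| * (2 * C * A p.2))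
        (volume.prod ((timeMeasure T).restrict (Ioc 0 t))) :=
      hχ.integrable.abs.mul_prod (hAint.restrict.const_mul (2 * C))
    refine hdom.mono' ?_ ?_
    · exact ((hχ.continuous.measurable.comp measurable_fst).mul
        (((hVnm.mul hαm).comp measurable_swap).const_mul 2)).aestronglyMeasurable
    · have h1 : ∀ᵐ p : Eucl d × ℝ ∂(volume.prod ((timeMeasure T).restrict (Ioc 0 t))),
          ∀ x, |α p.2 x| ≤ A p.2 :=
        Measure.quasiMeasurePreserving_snd.ae (ae_restrict_of_ae hαA)
      filter_upwards [h1] with p hp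
      rw [norm_mul, norm_mul, norm_mul]
      simp only [Real.norm_eq_abs, abs_two]
      refine mul_le_mul_of_nonneg_left ?_ (abs_nonneg _)
      have := mul_le_mul (hVn p.2 p.1) (hp p.1) (abs_nonneg _) hC0
      linarith
  have e1 : ∫ x, χ x * mollify n (V t) x ^ 2 = ∫ x, ∫ s in Ioc 0 t,
      χ x * (2 * (mollify n (V s) x * α s x)) ∂(timeMeasure T) := by
    refine integral_congr_ae ?_
    filter_upwards [ht] with x hx
    rw [integral_const_mul]
    by_cases hxr : ‖x‖ ≤ r
    · rw [hx hxr]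
    · rw [hr x (not_le.1 hxr)]
      simp
  -- the chain rule in time at fixed `x`, then Tonelli
  rw [e1, integral_integral_swap hprod]
  refine integral_mono_ae hprod.integral_prod_right (h.integrable_energyRate hχ r n).restrict ?_
  filter_upwards [ae_restrict_of_ae hHint] with s hs
  have hVs := h.locallyIntegrable_V s
  have hVc : ContDiff ℝ ((⊤ : ℕ∞) : WithTop ℕ∞) (mollify n (V s)) := contDiff_mollify hVs n
  have hHc : ContDiff ℝ ((⊤ : ℕ∞) : WithTop ℕ∞) (mollify n (H s)) :=
    contDiff_mollify hs.locallyIntegrable n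
  -- the dissipation `-∫ χ |∇V_n|²` is nonpositive, which leaves the term in `Δχ`
  have hlap := integral_mul_laplacian_le hVc hχ hχ0
  have hΔc : Continuous fun x => ∑ i, partialD i (partialD i (mollify n (V s))) x := by
    refine continuous_finsetSum _ fun i _ => ?_
    have h1 : ∀ f : Eucl d → ℝ, ContDiff ℝ ((⊤ : ℕ∞) : WithTop ℕ∞) f →
        ContDiff ℝ ((⊤ : ℕ∞) : WithTop ℕ∞) (partialD i f) := fun f hf => by
      have h2 : ContDiff ℝ ((⊤ : ℕ∞) : WithTop ℕ∞) (fderiv ℝ f) := hf.fderiv_right (by simp)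
      exact h2.clm_apply contDiff_const
    exact (h1 _ (h1 _ hVc)).continuous
  have hI : ∀ f : Eucl d → ℝ, Continuous f → Integrable fun x => χ x * f x := fun f hf =>
    (hχ.continuous.mul hf).integrable_of_hasCompactSupport hχ.compactSupport.mul_right
  have e2 : ∫ x, χ x * (2 * (mollify n (V s) x * α s x))
      = -2 * (∫ x, χ x * (mollify n (V s) x * mollify n (H s) x))
        + ∫ x, χ x * (mollify n (V s) x * ∑ i, partialD i (partialD i (mollify n (V s))) x) := by
    have hI1 : Integrable fun x => -2 * (χ x * (mollify n (V s) x * mollify n (H s) x)) :=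
      (hI _ (hVc.continuous.mul hHc.continuous)).const_mul _
    have hI2 : Integrable fun x =>
        χ x * (mollify n (V s) x * ∑ i, partialD i (partialD i (mollify n (V s))) x) :=
      hI _ (hVc.continuous.mul hΔc)
    rw [← integral_const_mul, ← integral_add hI1 hI2]
    congr 1
    ext x
    simp only [hα, hK, partialD_partialD_mollify hVs]
    ring
  change ∫ x, χ x * (2 * (mollify n (V s) x * α s x)) ≤ _
  rw [e2, energyRate]
  exact add_le_add_right hlap _

/-- The local energy inequality. -/
lemma local_energy_le {χ : Eucl d → ℝ} (hχ : IsTestFunction χ) (hχ0 : ∀ x, 0 ≤ χ x) :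
    ∀ᵐ t ∂(timeMeasure T), ∫ x, χ x * V t x ^ 2 ≤
      ∫ s in Ioc 0 t, ((∫ x, g s x * (V s x * V s x * χ x))
        + (∑ i, ∫ x, V s x * V s x * (b s x i * partialD i χ x))
        + 1 / 2 * ∫ x, V s x ^ 2 * ∑ i, partialD i (partialD i χ) x) ∂(timeMeasure T) := by
  obtain ⟨r, hr0, hr⟩ := hχ.exists_radius
  obtain ⟨X, hX0, hX⟩ := hχ.exists_bound
  obtain ⟨B, hB, hB'⟩ := h.exists_energyRate_bound hχ r
  have hΔ : Integrable fun x => ∑ i, partialD i (partialD i χ) x :=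
    integrable_finsetSum _ fun i _ => ((hχ.partialD i).partialD i).integrable
  have hVn : ∀ n s x, |mollify n (V s) x| ≤ C := fun n s x =>
    abs_mollify_le (Eventually.of_forall (h.abs_V_le s)) n x
  have hVnsq : ∀ n s x, |mollify n (V s) x ^ 2| ≤ C ^ 2 := fun n s x => by
    rw [abs_pow]
    exact pow_le_pow_left₀ (abs_nonneg _) (hVn n s x) 2
  have hVc := fun n s => continuous_mollify (h.locallyIntegrable_V s) n
  have hVlim := fun s => ae_tendsto_mollify (h.locallyIntegrable_V s)
  have hsq : ∀ (f : Eucl d → ℝ) s, Integrable f →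
      Tendsto (fun n => ∫ x, f x * mollify n (V s) x ^ 2) atTop (𝓝 (∫ x, f x * V s x ^ 2)) :=
    fun f s hf => tendsto_integral_mul_of_L1 (fun _ => hf) hf (by simp)
      (fun n => ((hVc n s).pow 2).aestronglyMeasurable)
      (fun n => Eventually.of_forall (hVnsq n s)) ((hVlim s).mono fun x hx => hx.pow 2)
  -- the limit of the rate, at a fixed time
  have hlim : ∀ᵐ s ∂(timeMeasure T), Tendsto (fun n => energyRate b G V χ r n s) atTop
      (𝓝 ((∫ x, g s x * (V s x * V s x * χ x))
        + (∑ i, ∫ x, V s x * V s x * (b s x i * partialD i χ x))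
        + 1 / 2 * ∫ x, V s x ^ 2 * ∑ i, partialD i (partialD i χ) x)) := by
    filter_upwards [(h.integrable_advection (r + 1)).prod_right_ae, h.ae_memLp_b,
      ae_memLp_slice h.measurable_G h.memLp_G, h.gradient, h.divergence, h.abs_g_le]
      with s hH hb hG hgrad hdiv hg
    change Integrable (advection b G (r + 1) s) at hH
    have hVs := (h.measurable_V_slice s).aestronglyMeasurable (μ := volume)
    have hV1 : ∀ᵐ x, |V s x| ≤ C := Eventually.of_forall (h.abs_V_le s)
    have hmain : Tendsto (fun n => ∫ x, χ x * (mollify n (V s) x *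
        mollify n (advection b G (r + 1) s) x)) atTop
        (𝓝 (∫ x, χ x * advection b G (r + 1) s x * V s x)) := by
      have h1 : Tendsto (fun n => ∫ x, χ x * mollify n (advection b G (r + 1) s) x *
          mollify n (V s) x) atTop (𝓝 (∫ x, χ x * advection b G (r + 1) s x * V s x)) := by
        have hχi : ∀ f : Eucl d → ℝ, Integrable f → Integrable fun x => χ x * f x := fun f hf =>
          hf.bdd_mul hχ.continuous.aestronglyMeasurable (Eventually.of_forall hX)
        refine tendsto_integral_mul_of_L1 (fun n => hχi _ (integral_abs_mollify_le hH n).1)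
          (hχi _ hH) ?_ (fun n => (hVc n s).aestronglyMeasurable)
          (fun n => Eventually.of_forall (hVn n s)) (hVlim s)
        have h2 := tendsto_eLpNorm_mollify_sub (p := 1) le_rfl (by norm_num)
          (memLp_one_iff_integrable.2 hH)
        have h3 := ENNReal.Tendsto.const_mul (a := ENNReal.ofReal X) h2
          (Or.inr ENNReal.ofReal_ne_top)
        rw [mul_zero] at h3
        refine tendsto_of_tendsto_of_tendsto_of_le_of_le tendsto_const_nhds h3
          (fun _ => zero_le) (fun n => ?_)
        refine eLpNorm_le_mul_eLpNorm_of_ae_le_mul (Eventually.of_forall fun x => ?_) 1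
        simp only [Pi.sub_apply]
        rw [← mul_sub, norm_mul]
        exact mul_le_mul_of_nonneg_right (hX x) (norm_nonneg _)
      refine h1.congr fun n => ?_
      congr 1
      ext x
      ring
    -- `2 V b · ∇V = b · ∇(V²)`, and the derivative is moved onto `b` and `χ`
    have hparts := integral_inner_gradient_mul hb (h.measurable_g_slice s).aestronglyMeasurable hg
      hdiv hVs hV1 hVs hV1 hG hgrad hG hgrad hχ
    have hIi : ∀ i, Integrable fun x => b s x i * (G s x i * V s x + V s x * G s x i) * χ x :=
      fun i => by
        have h1 := (MemLp.mul_testFunction (fun r => MemLp.coord (hb r) i) hχ).integrable_mul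
          (MemLp.coord hG i)
        refine ((h1.bdd_mul hVs hV1).const_mul 2).congr (Eventually.of_forall fun x => ?_)
        simp only [Pi.mul_apply]
        ring
    have e1 : -2 * ∫ x, χ x * advection b G (r + 1) s x * V s x
        = (∫ x, g s x * (V s x * V s x * χ x))
          + ∑ i, ∫ x, V s x * V s x * (b s x i * partialD i χ x) := by
      have e2 : 2 * ∫ x, χ x * advection b G (r + 1) s x * V s x
          = ∑ i, ∫ x, b s x i * (G s x i * V s x + V s x * G s x i) * χ x := by
        rw [← integral_finsetSum _ fun i _ => hIi i, ← integral_const_mul]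
        congr 1
        ext x
        by_cases hx : x ∈ Metric.closedBall (0 : Eucl d) (r + 1)
        · simp only [advection, indicator_of_mem hx, Finset.mul_sum, Finset.sum_mul]
          refine Finset.sum_congr rfl fun i _ => ?_
          ring
        · have : χ x = 0 := hr x (by
            rw [mem_closedBall_zero_iff, not_le] at hx
            linarith)
          simp [this]
      linarith
    have h2 := hsq _ s hΔ
    have h3 := (hmain.const_mul (-2)).add (h2.const_mul (1 / 2))
    rw [e1] at h3
    simp only [mul_comm (_ ^ 2) (∑ i, partialD i (partialD i χ) _), energyRate]
    exact h3
  filter_upwards [ae_all_iff.2 fun n => h.energy_mollify_le hχ hχ0 hr n] with t ht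
  refine le_of_tendsto_of_tendsto' (hsq χ t hχ.integrable) ?_ ht
  refine tendsto_integral_of_dominated_convergence B
    (fun n => (h.measurable_energyRate hχ r n).aestronglyMeasurable) hB.restrict
    (fun n => ae_restrict_of_ae (hB'.mono fun s hs => hs n)) (ae_restrict_of_ae hlim)

end IsParabolicSolution

end Energy

/-! ### Uniqueness for the parabolic equation -/

section Uniqueness

variable {d : ℕ}

/-- A smooth function equal to `1` on the unit ball and to `0` outside of the ball of radius `2`. -/
def baseCutoff (d : ℕ) : ContDiffBump (0 : Eucl d) := ⟨1, 2, one_pos, one_lt_two⟩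

/-- The cutoff at radius `N`. -/
def cutoff (d : ℕ) (N : ℝ) (x : Eucl d) : ℝ := baseCutoff d (N⁻¹ • x)

lemma baseCutoff_isTestFunction : IsTestFunction (baseCutoff d : Eucl d → ℝ) :=
  ⟨(baseCutoff d).contDiff, (baseCutoff d).hasCompactSupport⟩

lemma isTestFunction_comp_smul {φ : Eucl d → ℝ} (hφ : IsTestFunction φ) {c : ℝ} (hc : c ≠ 0) :
    IsTestFunction (fun x => φ (c • x)) :=
  ⟨hφ.smooth.comp (contDiff_const_smul c), hφ.compactSupport.comp_smul hc⟩

lemma partialD_comp_smul {φ : Eucl d → ℝ} (hφ : Differentiable ℝ φ) (c : ℝ) (i : Fin d)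
    (x : Eucl d) : partialD i (fun x => φ (c • x)) x = c * partialD i φ (c • x) := by
  unfold partialD
  have h1 : HasFDerivAt (fun y : Eucl d => c • y) (c • ContinuousLinearMap.id ℝ (Eucl d)) x :=
    (hasFDerivAt_id x).const_smul c
  have := ((hφ (c • x)).hasFDerivAt.comp x h1).fderiv
  change (fderiv ℝ (φ ∘ fun y => c • y) x) _ = _
  rw [this]
  simp

lemma cutoff_isTestFunction {N : ℝ} (hN : 0 < N) : IsTestFunction (cutoff d N) :=
  isTestFunction_comp_smul baseCutoff_isTestFunction (inv_ne_zero hN.ne')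

lemma partialD_cutoff (N : ℝ) (i : Fin d) (x : Eucl d) :
    partialD i (cutoff d N) x = N⁻¹ * partialD i (baseCutoff d) (N⁻¹ • x) :=
  partialD_comp_smul baseCutoff_isTestFunction.differentiable _ i x

lemma partialD_partialD_cutoff (N : ℝ) (i : Fin d) (x : Eucl d) :
    partialD i (partialD i (cutoff d N)) x
      = N⁻¹ * (N⁻¹ * partialD i (partialD i (baseCutoff d)) (N⁻¹ • x)) := by
  have h1 : partialD i (cutoff d N) = fun x => N⁻¹ * partialD i (baseCutoff d) (N⁻¹ • x) :=
    funext fun x => partialD_cutoff N i x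
  have hd := (baseCutoff_isTestFunction (d := d)).partialD i
  rw [h1]
  rw [← partialD_comp_smul hd.differentiable]
  have h2 : Differentiable ℝ fun x => partialD i (baseCutoff d) (N⁻¹ • x) :=
    hd.differentiable.comp (by fun_prop : Differentiable ℝ fun x : Eucl d => N⁻¹ • x)
  change fderiv ℝ (fun x => N⁻¹ * partialD i (baseCutoff d) (N⁻¹ • x)) x _ = _
  rw [fderiv_const_mul (h2 x)]
  rfl

lemma baseCutoff_eventuallyEq_one {z : Eucl d} (hz : ‖z‖ < 1) :
    (baseCutoff d : Eucl d → ℝ) =ᶠ[𝓝 z] fun _ => 1 :=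
  (baseCutoff d).eventuallyEq_one_of_mem_ball (by simpa [baseCutoff] using hz)

lemma partialD_baseCutoff_eventuallyEq_zero {z : Eucl d} (hz : ‖z‖ < 1) (i : Fin d) :
    partialD i (baseCutoff d) =ᶠ[𝓝 z] fun _ => 0 := by
  filter_upwards [(baseCutoff_eventuallyEq_one hz).fderiv (𝕜 := ℝ)] with y hy
  rw [partialD, hy]
  simp

lemma partialD_baseCutoff_eq_zero_of_lt {z : Eucl d} (hz : 2 < ‖z‖) (i : Fin d) :
    partialD i (baseCutoff d) z = 0 := by
  have h1 : z ∉ tsupport (baseCutoff d : Eucl d → ℝ) := by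
    rw [(baseCutoff d).tsupport_eq, mem_closedBall_zero_iff]
    exact not_le.2 hz
  have h2 : fderiv ℝ (baseCutoff d : Eucl d → ℝ) z = 0 :=
    image_eq_zero_of_notMem_tsupport fun h => h1 (tsupport_fderiv_subset ℝ h)
  rw [partialD, h2]
  rfl

lemma norm_inv_smul_lt_one {N : ℝ} (hN : 0 < N) {x : Eucl d} (hx : ‖x‖ < N) : ‖N⁻¹ • x‖ < 1 := by
  rw [norm_smul, norm_inv, Real.norm_of_nonneg hN.le, inv_mul_lt_one₀ hN]
  exact hx

lemma cutoff_eq_one {N : ℝ} (hN : 0 < N) {x : Eucl d} (hx : ‖x‖ < N) : cutoff d N x = 1 :=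
  (baseCutoff_eventuallyEq_one (norm_inv_smul_lt_one hN hx)).self_of_nhds

lemma partialD_cutoff_eq_zero {N : ℝ} (hN : 0 < N) {x : Eucl d} (hx : ‖x‖ < N) (i : Fin d) :
    partialD i (cutoff d N) x = 0 := by
  rw [partialD_cutoff, (partialD_baseCutoff_eventuallyEq_zero
    (norm_inv_smul_lt_one hN hx) i).self_of_nhds, mul_zero]

lemma partialD_partialD_cutoff_eq_zero {N : ℝ} (hN : 0 < N) {x : Eucl d} (hx : ‖x‖ < N)
    (i : Fin d) : partialD i (partialD i (cutoff d N)) x = 0 := by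
  rw [partialD_partialD_cutoff]
  have := (partialD_baseCutoff_eventuallyEq_zero (norm_inv_smul_lt_one hN hx) i).fderiv (𝕜 := ℝ)
  have h2 : partialD i (partialD i (baseCutoff d)) (N⁻¹ • x) = 0 := by
    conv_lhs => rw [partialD]
    rw [this.self_of_nhds]
    simp
  rw [h2]
  ring

lemma cutoff_nonneg (N : ℝ) (x : Eucl d) : 0 ≤ cutoff d N x := (baseCutoff d).nonneg

lemma cutoff_le_one (N : ℝ) (x : Eucl d) : cutoff d N x ≤ 1 := (baseCutoff d).le_one

lemma exists_partialD_baseCutoff_bound (d : ℕ) : ∃ M, 0 ≤ M ∧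
    (∀ (i : Fin d) x, |partialD i (baseCutoff d) x| ≤ M) ∧
    ∀ (i : Fin d) x, |partialD i (partialD i (baseCutoff d)) x| ≤ M := by
  choose A hA hA' using fun i => ((baseCutoff_isTestFunction (d := d)).partialD i).exists_bound
  choose B hB hB' using
    fun i => (((baseCutoff_isTestFunction (d := d)).partialD i).partialD i).exists_bound
  refine ⟨∑ i, (A i + B i), Finset.sum_nonneg fun i _ => add_nonneg (hA i) (hB i),
    fun i x => (hA' i x).trans ?_, fun i x => (hB' i x).trans ?_⟩
  · exact (le_add_of_nonneg_right (hB i)).trans (Finset.single_le_sum (f := fun i => A i + B i)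
      (fun i _ => add_nonneg (hA i) (hB i)) (Finset.mem_univ i))
  · exact (le_add_of_nonneg_left (hA i)).trans (Finset.single_le_sum (f := fun i => A i + B i)
      (fun i _ => add_nonneg (hA i) (hB i)) (Finset.mem_univ i))

/-- Grönwall's lemma with an integrable coefficient. -/
lemma ae_eq_zero_of_le_integral_mul {T : ℝ≥0} {m e : ℝ → ℝ} {E : ℝ}
    (hm : Integrable m (timeMeasure T)) (hm0 : ∀ t, 0 ≤ m t)
    (hem : AEStronglyMeasurable e (timeMeasure T)) (he0 : ∀ t, 0 ≤ e t)
    (heE : ∀ᵐ t ∂(timeMeasure T), e t ≤ E)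
    (h : ∀ᵐ t ∂(timeMeasure T), e t ≤ ∫ s in Ioc 0 t, m s * e s ∂(timeMeasure T)) :
    ∀ᵐ t ∂(timeMeasure T), e t = 0 := by
  have hme : Integrable (fun s => m s * e s) (timeMeasure T) :=
    hm.mul_bdd (c := E) hem (heE.mono fun t ht => by
      rwa [Real.norm_of_nonneg (he0 t)])
  set J : ℝ → ℝ := fun t => ∫ s in (0 : ℝ)..t, m s * e s with hJ
  have hon : ∀ {f : ℝ → ℝ}, Integrable f (timeMeasure T) → ∀ a b, a ∈ Icc 0 (T : ℝ) →
      b ∈ Icc 0 (T : ℝ) → IntervalIntegrable f volume a b := by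
    intro f hf a b ha hb
    have h1 : IntegrableOn f (Icc 0 (T : ℝ)) := hf
    rw [intervalIntegrable_iff]
    exact h1.mono_set (uIoc_subset_uIcc.trans (uIcc_subset_Icc ha hb))
  have hJcont : ContinuousOn J (Icc 0 (T : ℝ)) := by
    have h1 : IntegrableOn (fun s => m s * e s) (uIcc 0 (T : ℝ)) := by
      rw [uIcc_of_le T.coe_nonneg]
      exact hme
    have := intervalIntegral.continuousOn_primitive_interval h1
    rwa [uIcc_of_le T.coe_nonneg] at this
  have h0T : (0 : ℝ) ∈ Icc 0 (T : ℝ) := ⟨le_rfl, T.coe_nonneg⟩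
  have hJmono : ∀ a b, a ∈ Icc 0 (T : ℝ) → b ∈ Icc 0 (T : ℝ) → a ≤ b → J a ≤ J b := by
    intro a b ha hb hab
    have h1 := intervalIntegral.integral_add_adjacent_intervals (hon hme 0 a h0T ha)
      (hon hme a b ha hb)
    have h2 : 0 ≤ ∫ s in a..b, m s * e s :=
      intervalIntegral.integral_nonneg hab fun s _ => mul_nonneg (hm0 s) (he0 s)
    simp only [hJ]
    linarith
  have heJ : ∀ᵐ t, t ∈ Icc 0 (T : ℝ) → e t ≤ J t := by
    rw [← ae_restrict_iff' measurableSet_Icc]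
    change ∀ᵐ t ∂(timeMeasure T), _
    filter_upwards [h, ae_timeMeasure_mem T] with t ht htT
    change e t ≤ ∫ s in (0 : ℝ)..t, m s * e s
    rwa [integral_interval_eq_timeMeasure htT]
  -- `J` vanishes at `0`, and stays zero beyond any time up to which it vanishes: on a short interval
  -- `J z ≤ J z * ∫ m ≤ J z / 2`. No exponential is needed.
  have hsub : Icc 0 (T : ℝ) ⊆ {t | J t = 0} := by
    refine IsClosed.Icc_subset_of_forall_mem_nhdsWithin ?_ (by simp [hJ]) ?_
    · rw [inter_comm]
      exact hJcont.preimage_isClosed_of_isClosed isClosed_Icc isClosed_singleton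
    · rintro x ⟨hx, hx0, hxT⟩
      have hxI : x ∈ Icc 0 (T : ℝ) := ⟨hx0, hxT.le⟩
      have hcont : ContinuousOn (fun t => ∫ s in x..t, m s) (Icc x T) := by
        have h1 : IntegrableOn m (uIcc x (T : ℝ)) := by
          rw [uIcc_of_le hxT.le]
          exact (show IntegrableOn m (Icc 0 (T : ℝ)) volume from hm).mono_set
            (Icc_subset_Icc_left hx0)
        have := intervalIntegral.continuousOn_primitive_interval h1
        rwa [uIcc_of_le hxT.le] at this
      have hsmall : ∀ᶠ t in 𝓝[>] x, ∫ s in x..t, m s < 1 / 2 := by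
        have h1 := hcont x ⟨le_rfl, hxT.le⟩
        have h2 : Tendsto (fun t => ∫ s in x..t, m s) (𝓝[>] x) (𝓝 0) := by
          have h3 : Tendsto (fun t => ∫ s in x..t, m s) (𝓝[Icc x T] x) (𝓝 0) := by
            simpa [ContinuousWithinAt] using h1
          refine h3.mono_left ?_
          rw [← nhdsWithin_Ioc_eq_nhdsGT hxT]
          exact nhdsWithin_mono _ Ioc_subset_Icc_self
        exact h2.eventually_lt_const (by norm_num)
      filter_upwards [hsmall, Ioc_mem_nhdsGT hxT] with z hz hzI
      have hzT : z ∈ Icc 0 (T : ℝ) := ⟨hx0.trans hzI.1.le, hzI.2⟩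
      have hJz0 : 0 ≤ J z := by
        have := hJmono 0 z h0T hzT hzT.1
        simpa [hJ] using this
      have e1 : J z = ∫ s in x..z, m s * e s := by
        have h1 := intervalIntegral.integral_add_adjacent_intervals (hon hme 0 x h0T hxI)
          (hon hme x z hxI hzT)
        have h2 : J x = 0 := hx
        simp only [hJ] at h2 ⊢
        linarith
      have e2 : ∫ s in x..z, m s * e s ≤ ∫ s in x..z, m s * J z := by
        refine intervalIntegral.integral_mono_ae_restrict hzI.1.le (hon hme x z hxI hzT)
          ((hon hm x z hxI hzT).mul_const _) ?_
        rw [EventuallyLE, ae_restrict_iff' measurableSet_Icc]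
        filter_upwards [heJ] with s hs hsI
        have hsT : s ∈ Icc 0 (T : ℝ) := ⟨hx0.trans hsI.1, hsI.2.trans hzI.2⟩
        exact mul_le_mul_of_nonneg_left ((hs hsT).trans (hJmono s z hsT hzT hsI.2)) (hm0 s)
      rw [intervalIntegral.integral_mul_const] at e2
      change J z = 0
      nlinarith
  filter_upwards [h, ae_timeMeasure_mem T] with t ht htT
  have h1 : J t = 0 := hsub htT
  rw [hJ] at h1
  rw [← integral_interval_eq_timeMeasure htT] at ht
  exact le_antisymm (ht.trans h1.le) (he0 t)

namespace IsParabolicSolution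

variable {T : ℝ≥0} {b G : ℝ → Eucl d → Eucl d} {g V : ℝ → Eucl d → ℝ} {m k : ℝ → ℝ} {C R E : ℝ}

/-- The energy inequality, obtained from its local version by removing the cutoff. -/
lemma energy_le_integral (h : IsParabolicSolution T b G g V m k C R E) :
    ∀ᵐ t ∂(timeMeasure T), ∫ x, V t x ^ 2 ≤
      ∫ s in Ioc 0 t, |m s| * (∫ x, V s x ^ 2) ∂(timeMeasure T) := by
  obtain ⟨M, hM0, hM1, hM2⟩ := exists_partialD_baseCutoff_bound d
  set N : ℕ → ℝ := fun n => n + 1 + |R| with hN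
  have hN1 : ∀ n, 1 ≤ N n := fun n => by
    have := abs_nonneg R
    have : (0 : ℝ) ≤ n := Nat.cast_nonneg n
    simp only [hN]
    linarith
  have hN0 : ∀ n, 0 < N n := fun n => zero_lt_one.trans_le (hN1 n)
  have hNR : ∀ n, R < N n := fun n => by
    have h1 := le_abs_self R
    have : (0 : ℝ) ≤ n := Nat.cast_nonneg n
    simp only [hN]
    linarith
  have hNinv : ∀ n, (N n)⁻¹ ≤ 1 := fun n => inv_le_one_of_one_le₀ (hN1 n)
  have hNinv0 : ∀ n, 0 ≤ (N n)⁻¹ := fun n => inv_nonneg.2 (hN0 n).le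
  have hNlim : ∀ x : Eucl d, ∀ᶠ n in atTop, ‖x‖ < N n := fun x => by
    obtain ⟨n0, hn0⟩ := exists_nat_gt ‖x‖
    filter_upwards [eventually_ge_atTop n0] with n hn
    have : (n0 : ℝ) ≤ n := by exact_mod_cast hn
    have := abs_nonneg R
    simp only [hN]
    linarith
  have hVm := fun s => (h.measurable_V_slice s)
  -- the rate of the local energy inequality is the integral of a function dominated by `V²`
  set F : ℕ → ℝ → Eucl d → ℝ := fun n s x => V s x ^ 2 * (g s x * cutoff d (N n) x
    + (∑ i, b s x i * partialD i (cutoff d (N n)) x)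
    + 1 / 2 * ∑ i, partialD i (partialD i (cutoff d (N n))) x) with hF
  set D : ℝ → ℝ := fun s => |m s| + d * (3 * M * |k s|) + 1 / 2 * (d * M) with hD
  have hslice : ∀ᵐ s ∂(timeMeasure T), MemLp (V s) 2 :=
    ae_memLp_slice h.measurable_V h.memLp_V
  have hp2 : ∀ n i (x : Eucl d), |partialD i (partialD i (cutoff d (N n))) x| ≤ M := fun n i x => by
    rw [partialD_partialD_cutoff, abs_mul, abs_mul, abs_of_nonneg (hNinv0 n)]
    have h1 := hM2 i ((N n)⁻¹ • x)
    have h2 := mul_le_mul (hNinv n) h1 (abs_nonneg _) zero_le_one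
    have h3 := mul_le_mul (hNinv n) h2 (mul_nonneg (hNinv0 n) (abs_nonneg _)) zero_le_one
    simpa using h3
  have hpiece : ∀ᵐ s ∂(timeMeasure T), ∀ᵐ x, ∀ n, |g s x * cutoff d (N n) x| ≤ |m s| ∧
      ∀ i, |b s x i * partialD i (cutoff d (N n)) x| ≤ 3 * M * |k s| := by
    filter_upwards [h.abs_g_le, h.growth] with s hg hgr
    filter_upwards [hg, hgr] with x hgx hbx n
    constructor
    · rw [abs_mul, abs_of_nonneg (cutoff_nonneg _ _)]
      exact (mul_le_of_le_one_right (abs_nonneg _) (cutoff_le_one _ _)).trans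
        (hgx.trans (le_abs_self _))
    · intro i
      have hr0 : 0 ≤ 3 * M * |k s| := by positivity
      rcases lt_or_ge ‖x‖ (N n) with hx | hx
      · rw [partialD_cutoff_eq_zero (hN0 n) hx, mul_zero, abs_zero]
        exact hr0
      rcases lt_or_ge (2 * N n) ‖x‖ with hx2 | hx2
      · have : 2 < ‖(N n)⁻¹ • x‖ := by
          rw [norm_smul, norm_inv, Real.norm_of_nonneg (hN0 n).le, lt_inv_mul_iff₀ (hN0 n)]
          linarith
        rw [partialD_cutoff, partialD_baseCutoff_eq_zero_of_lt this, mul_zero, mul_zero, abs_zero]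
        exact hr0
      -- on the annulus `N ≤ |x| ≤ 2 N`, linear growth of `b` is compensated by `|∇χ_N| ≤ M / N`
      · have h1 : |b s x i| ≤ |k s| * (3 * N n) := by
          have h2 := (PiLp.norm_apply_le (b s x) i).trans (hbx ((hNR n).trans_le hx))
          rw [Real.norm_eq_abs] at h2
          refine h2.trans ?_
          have h3 := hN1 n
          exact mul_le_mul (le_abs_self _) (by linarith) (by positivity) (abs_nonneg _)
        rw [abs_mul, partialD_cutoff, abs_mul, abs_of_nonneg (hNinv0 n)]
        calc |b s x i| * ((N n)⁻¹ * |partialD i (baseCutoff d) ((N n)⁻¹ • x)|)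
            ≤ |k s| * (3 * N n) * ((N n)⁻¹ * M) := by
              refine mul_le_mul h1 ?_ (mul_nonneg (hNinv0 n) (abs_nonneg _)) ?_
              · exact mul_le_mul_of_nonneg_left (hM1 i _) (hNinv0 n)
              · have := hN0 n
                positivity
          _ = 3 * M * |k s| := by
              have := (hN0 n).ne'
              field_simp
  have hFD : ∀ᵐ s ∂(timeMeasure T), ∀ᵐ x, ∀ n, |F n s x| ≤ D s * V s x ^ 2 := by
    filter_upwards [hpiece] with s hs
    filter_upwards [hs] with x hx n
    rw [hF, abs_mul, abs_of_nonneg (sq_nonneg _), mul_comm]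
    refine mul_le_mul_of_nonneg_right ?_ (sq_nonneg _)
    refine (abs_add_le _ _).trans (add_le_add ((abs_add_le _ _).trans (add_le_add (hx n).1 ?_)) ?_)
    · refine (Finset.abs_sum_le_sum_abs _ _).trans
        ((Finset.sum_le_sum fun i _ => (hx n).2 i).trans ?_)
      simp
    · rw [abs_mul, abs_of_pos (by norm_num : (0 : ℝ) < 1 / 2)]
      refine mul_le_mul_of_nonneg_left ((Finset.abs_sum_le_sum_abs _ _).trans
        ((Finset.sum_le_sum fun i _ => hp2 n i x).trans ?_)) (by norm_num)
      simp
  have hFmeas : ∀ n, Measurable fun z : ℝ × Eucl d => F n z.1 z.2 := by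
    intro n
    have hχ := cutoff_isTestFunction (d := d) (hN0 n)
    have hb' : ∀ i, Measurable fun z : ℝ × Eucl d => b z.1 z.2 i := fun i =>
      (EuclideanSpace.proj i : Eucl d →L[ℝ] ℝ).continuous.measurable.comp h.measurable_b
    refine (h.measurable_V.pow_const 2).mul (((h.measurable_g.mul
      (hχ.continuous.measurable.comp measurable_snd)).add
      (Finset.measurable_sum _ fun i _ => (hb' i).mul
        ((hχ.partialD i).continuous.measurable.comp measurable_snd))).add
      (Measurable.const_mul (Finset.measurable_sum _ fun i _ =>
        ((hχ.partialD i).partialD i).continuous.measurable.comp measurable_snd) _))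
  have hrate : ∀ᵐ s ∂(timeMeasure T), ∀ n,
      (∫ x, g s x * (V s x * V s x * cutoff d (N n) x))
        + (∑ i, ∫ x, V s x * V s x * (b s x i * partialD i (cutoff d (N n)) x))
        + 1 / 2 * (∫ x, V s x ^ 2 * ∑ i, partialD i (partialD i (cutoff d (N n))) x)
      = ∫ x, F n s x := by
    filter_upwards [hslice, hpiece, h.ae_memLp_b] with s hVs hs hbs n
    have hχ := cutoff_isTestFunction (d := d) (hN0 n)
    have hsq : Integrable fun x => V s x ^ 2 := hVs.integrable_sq
    have hI1 : Integrable fun x => V s x ^ 2 * (g s x * cutoff d (N n) x) :=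
      hsq.mul_bdd (c := |m s|)
        ((h.measurable_g_slice s).mul hχ.continuous.measurable).aestronglyMeasurable
        (hs.mono fun x hx => (hx n).1)
    have hbi : ∀ i, Measurable fun x => b s x i := fun i =>
      (EuclideanSpace.proj i : Eucl d →L[ℝ] ℝ).continuous.measurable.comp
        (h.measurable_b.comp measurable_prodMk_left)
    have hI2 : ∀ i, Integrable fun x => V s x ^ 2 * (b s x i * partialD i (cutoff d (N n)) x) :=
      fun i => hsq.mul_bdd (c := 3 * M * |k s|)
        ((hbi i).mul (hχ.partialD i).continuous.measurable).aestronglyMeasurable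
        (hs.mono fun x hx => (hx n).2 i)
    have hI2' : Integrable fun x => ∑ i, V s x ^ 2 * (b s x i * partialD i (cutoff d (N n)) x) :=
      integrable_finsetSum _ fun i _ => hI2 i
    have hI3 : Integrable fun x =>
        1 / 2 * (V s x ^ 2 * ∑ i, partialD i (partialD i (cutoff d (N n))) x) := by
      simp only [Finset.mul_sum]
      refine integrable_finsetSum _ fun i _ => Integrable.const_mul ?_ _
      exact hsq.mul_bdd (c := M) ((hχ.partialD i).partialD i).continuous.aestronglyMeasurable
        (Eventually.of_forall fun x => hp2 n i x)
    have e1 : ∫ x, F n s x = ∫ x, (V s x ^ 2 * (g s x * cutoff d (N n) x)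
        + ∑ i, V s x ^ 2 * (b s x i * partialD i (cutoff d (N n)) x))
        + 1 / 2 * (V s x ^ 2 * ∑ i, partialD i (partialD i (cutoff d (N n))) x) := by
      congr 1
      ext x
      simp only [hF, ← Finset.mul_sum]
      ring
    have hI12 : Integrable fun x => V s x ^ 2 * (g s x * cutoff d (N n) x)
        + ∑ i, V s x ^ 2 * (b s x i * partialD i (cutoff d (N n)) x) := hI1.add hI2'
    rw [e1, integral_add hI12 hI3, integral_add hI1 hI2', integral_const_mul,
      integral_finsetSum _ fun i _ => hI2 i]
    congr 3
    · ext x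
      ring
    · ext i
      congr 1
      ext x
      ring
  have hDint : Integrable D (timeMeasure T) :=
    (h.integrable_m.abs.add ((h.integrable_k.abs.const_mul (3 * M)).const_mul (d : ℝ))).add
      (integrable_const _)
  have hD0 : ∀ s, 0 ≤ D s := fun s => by positivity
  have hlim : ∀ᵐ s ∂(timeMeasure T), Tendsto (fun n => ∫ x, F n s x) atTop
      (𝓝 (∫ x, V s x ^ 2 * g s x)) := by
    filter_upwards [hslice, hFD] with s hVs hs
    refine tendsto_integral_of_dominated_convergence (fun x => D s * V s x ^ 2)
      (fun n => ((hFmeas n).comp measurable_prodMk_left).aestronglyMeasurable)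
      (hVs.integrable_sq.const_mul _) (fun n => hs.mono fun x hx => hx n) ?_
    refine Eventually.of_forall fun x => tendsto_const_nhds.congr' ?_
    filter_upwards [hNlim x] with n hn
    simp only [hF, cutoff_eq_one (hN0 n) hn, partialD_cutoff_eq_zero (hN0 n) hn,
      partialD_partialD_cutoff_eq_zero (hN0 n) hn]
    simp
  have hlocal := ae_all_iff.2 fun n => h.local_energy_le (cutoff_isTestFunction (hN0 n))
    (cutoff_nonneg (d := d) (N n))
  have hEint : ∀ᵐ s ∂(timeMeasure T), ∀ n, |∫ x, F n s x| ≤ D s * E := by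
    filter_upwards [hslice, hFD, h.energy_le] with s hVs hs hE n
    have h1 := abs_integral_le_of_abs_le (hVs.integrable_sq.const_mul (D s))
      (hs.mono fun x hx => hx n)
    rw [integral_const_mul] at h1
    exact h1.trans (mul_le_mul_of_nonneg_left hE (hD0 s))
  filter_upwards [hlocal, hslice] with t ht hVt
  have hL : Tendsto (fun n => ∫ x, cutoff d (N n) x * V t x ^ 2) atTop
      (𝓝 (∫ x, V t x ^ 2)) := by
    refine tendsto_integral_of_dominated_convergence (fun x => V t x ^ 2) (fun n => ?_)
      hVt.integrable_sq (fun n => Eventually.of_forall fun x => ?_)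
      (Eventually.of_forall fun x => tendsto_const_nhds.congr' ?_)
    · exact ((cutoff_isTestFunction (hN0 n)).continuous.measurable.mul
        ((hVm t).pow_const 2)).aestronglyMeasurable
    · rw [Real.norm_of_nonneg (mul_nonneg (cutoff_nonneg _ _) (sq_nonneg _))]
      exact mul_le_of_le_one_left (sq_nonneg _) (cutoff_le_one _ _)
    · filter_upwards [hNlim x] with n hn
      rw [cutoff_eq_one (hN0 n) hn, one_mul]
  have hR : Tendsto (fun n => ∫ s in Ioc 0 t, (∫ x, F n s x) ∂(timeMeasure T)) atTop
      (𝓝 (∫ s in Ioc 0 t, (∫ x, V s x ^ 2 * g s x) ∂(timeMeasure T))) :=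
    tendsto_integral_of_dominated_convergence (fun s => D s * E)
      (fun n => (hFmeas n).stronglyMeasurable.integral_prod_right'.aestronglyMeasurable)
      (hDint.mul_const E).restrict (fun n => ae_restrict_of_ae (hEint.mono fun s hs => hs n))
      (ae_restrict_of_ae hlim)
  have hle := le_of_tendsto_of_tendsto' hL hR fun n => (ht n).trans (le_of_eq
    (integral_congr_ae (ae_restrict_of_ae (hrate.mono fun s hs => hs n))))
  have hgV : ∀ᵐ s ∂(timeMeasure T), |∫ x, V s x ^ 2 * g s x| ≤ |m s| * ∫ x, V s x ^ 2 := by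
    filter_upwards [hslice, h.abs_g_le] with s hVs hg
    rw [← integral_const_mul]
    refine abs_integral_le_of_abs_le (hVs.integrable_sq.const_mul _) ?_
    filter_upwards [hg] with x hx
    rw [abs_mul, abs_of_nonneg (sq_nonneg _), mul_comm]
    exact mul_le_mul_of_nonneg_right (hx.trans (le_abs_self _)) (sq_nonneg _)
  have hrhs : Integrable (fun s => |m s| * ∫ x, V s x ^ 2) (timeMeasure T) := by
    refine h.integrable_m.abs.mul_bdd (c := E) ?_ ?_
    · exact (h.measurable_V.pow_const 2).stronglyMeasurable.integral_prod_right'.aestronglyMeasurable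
    · filter_upwards [h.energy_le] with s hs
      rwa [Real.norm_of_nonneg (integral_nonneg fun x => sq_nonneg _)]
  refine hle.trans (integral_mono_ae ?_ hrhs.restrict ?_)
  · refine (hrhs.mono' ?_ hgV).restrict
    exact ((h.measurable_V.pow_const 2).mul
      h.measurable_g).stronglyMeasurable.integral_prod_right'.aestronglyMeasurable
  · exact ae_restrict_of_ae (hgV.mono fun s hs => (le_abs_self _).trans hs)

/-- A bounded solution of the parabolic equation with zero initial datum vanishes. -/
theorem ae_eq_zero (h : IsParabolicSolution T b G g V m k C R E) :
    ∀ᵐ z : ℝ × Eucl d ∂((timeMeasure T).prod volume), V z.1 z.2 = 0 := by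
  have hE := ae_eq_zero_of_le_integral_mul (e := fun t => ∫ x, V t x ^ 2) h.integrable_m.abs
    (fun t => abs_nonneg _)
    (h.measurable_V.pow_const 2).stronglyMeasurable.integral_prod_right'.aestronglyMeasurable
    (fun t => integral_nonneg fun x => sq_nonneg _) h.energy_le h.energy_le_integral
  have hms : MeasurableSet {z : ℝ × Eucl d | V z.1 z.2 = 0} :=
    h.measurable_V (measurableSet_singleton 0)
  rw [Measure.ae_prod_iff_ae_ae hms]
  filter_upwards [hE, ae_memLp_slice h.measurable_V h.memLp_V] with t ht hVt
  have := (integral_eq_zero_iff_of_nonneg (fun x => sq_nonneg _) hVt.integrable_sq).1 ht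
  filter_upwards [this] with x hx
  simpa using hx

end IsParabolicSolution

end Uniqueness

/-! ### Convergence in probability and tightness -/

section InMeasure

variable {Ω : Type*} [mΩ : MeasurableSpace Ω] {P : Measure Ω}

/-- Boundedness in probability of a sequence of real random variables. -/
def IsTightSeq (P : Measure Ω) (Q : ℕ → Ω → ℝ) : Prop :=
  ∀ η : ℝ≥0∞, 0 < η → ∃ l : ℝ, 0 < l ∧ ∀ n, P {ω | l ≤ |Q n ω|} ≤ η

/-- Convergence to zero in probability. -/
lemma tendstoInMeasure_zero_iff {X : ℕ → Ω → ℝ} :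
    TendstoInMeasure P X atTop (fun _ => 0) ↔
      ∀ ε : ℝ, 0 < ε → Tendsto (fun n => P {ω | ε ≤ |X n ω|}) atTop (𝓝 0) := by
  rw [tendstoInMeasure_iff_norm]
  simp

lemma tendstoInMeasure_sub_iff {X : ℕ → Ω → ℝ} {Y : Ω → ℝ} :
    TendstoInMeasure P X atTop Y ↔
      TendstoInMeasure P (fun n ω => X n ω - Y ω) atTop (fun _ => 0) := by
  rw [tendstoInMeasure_iff_norm, tendstoInMeasure_iff_norm]
  simp

lemma tendsto_zero_of_abs_le {X Y : ℕ → Ω → ℝ}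
    (hY : TendstoInMeasure P Y atTop (fun _ => 0)) (h : ∀ n, ∀ᵐ ω ∂P, |X n ω| ≤ |Y n ω|) :
    TendstoInMeasure P X atTop (fun _ => 0) := by
  rw [tendstoInMeasure_zero_iff] at hY ⊢
  intro ε hε
  refine tendsto_of_tendsto_of_tendsto_of_le_of_le tendsto_const_nhds (hY ε hε)
    (fun _ => zero_le) (fun n => measure_mono_ae ?_)
  filter_upwards [h n] with ω hω hX
  exact le_trans hX hω

lemma tendsto_zero_add {X Y : ℕ → Ω → ℝ} (hX : TendstoInMeasure P X atTop (fun _ => 0))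
    (hY : TendstoInMeasure P Y atTop (fun _ => 0)) :
    TendstoInMeasure P (fun n ω => X n ω + Y n ω) atTop (fun _ => 0) := by
  rw [tendstoInMeasure_zero_iff] at hX hY ⊢
  intro ε hε
  have h := (hX (ε / 2) (by positivity)).add (hY (ε / 2) (by positivity))
  rw [add_zero] at h
  refine tendsto_of_tendsto_of_tendsto_of_le_of_le tendsto_const_nhds h
    (fun _ => zero_le) (fun n => (measure_mono ?_).trans (measure_union_le _ _))
  intro ω hω
  simp only [mem_union, mem_ofPred_eq] at hω ⊢
  by_contra! hcon
  have := abs_add_le (X n ω) (Y n ω)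
  linarith [hcon.1, hcon.2]

lemma tendsto_zero_const_mul {X : ℕ → Ω → ℝ} (c : ℝ)
    (hX : TendstoInMeasure P X atTop (fun _ => 0)) :
    TendstoInMeasure P (fun n ω => c * X n ω) atTop (fun _ => 0) := by
  rcases eq_or_ne c 0 with rfl | hc
  · rw [tendstoInMeasure_zero_iff]
    intro ε hε
    simp [not_le.2 hε]
  rw [tendstoInMeasure_zero_iff] at hX ⊢
  intro ε hε
  refine (hX (ε / |c|) (by positivity)).congr fun n => ?_
  congr 1
  ext ω
  simp only [mem_ofPred_eq]
  rw [abs_mul, div_le_iff₀ (abs_pos.2 hc), mul_comm]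

lemma tendsto_zero_sum {ι : Type*} (s : Finset ι) {X : ι → ℕ → Ω → ℝ}
    (hX : ∀ i ∈ s, TendstoInMeasure P (X i) atTop (fun _ => 0)) :
    TendstoInMeasure P (fun n ω => ∑ i ∈ s, X i n ω) atTop (fun _ => 0) := by
  classical
  induction s using Finset.induction_on with
  | empty =>
    rw [tendstoInMeasure_zero_iff]
    intro ε hε
    simp [not_le.2 hε]
  | insert a s ha ih =>
    simp only [Finset.sum_insert ha]
    exact tendsto_zero_add (hX a (Finset.mem_insert_self _ _))
      (ih fun i hi => hX i (Finset.mem_insert_of_mem hi))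

lemma tendstoInMeasure_sub {X X' : ℕ → Ω → ℝ} {Y Y' : Ω → ℝ}
    (hX : TendstoInMeasure P X atTop Y) (hX' : TendstoInMeasure P X' atTop Y') :
    TendstoInMeasure P (fun n ω => X n ω - X' n ω) atTop (fun ω => Y ω - Y' ω) := by
  rw [tendstoInMeasure_sub_iff] at hX hX' ⊢
  refine tendsto_zero_of_abs_le (tendsto_zero_add hX (tendsto_zero_const_mul (-1) hX'))
    fun n => Eventually.of_forall fun ω => le_of_eq ?_
  congr 1
  ring

lemma tendstoInMeasure_sum {ι : Type*} (s : Finset ι) {X : ι → ℕ → Ω → ℝ} {Y : ι → Ω → ℝ}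
    (hX : ∀ i ∈ s, TendstoInMeasure P (X i) atTop (Y i)) :
    TendstoInMeasure P (fun n ω => ∑ i ∈ s, X i n ω) atTop (fun ω => ∑ i ∈ s, Y i ω) := by
  rw [tendstoInMeasure_sub_iff]
  refine tendsto_zero_of_abs_le (tendsto_zero_sum s
    fun i hi => tendstoInMeasure_sub_iff.1 (hX i hi)) fun n => Eventually.of_forall fun ω => ?_
  rw [Finset.sum_sub_distrib]

lemma measure_ge_le_integral_div {X : Ω → ℝ} (hX : Integrable X P) (hX0 : 0 ≤ X) {ε : ℝ}
    (hε : 0 < ε) : P {ω | ε ≤ |X ω|} ≤ ENNReal.ofReal ((∫ ω, X ω ∂P) / ε) := by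
  have h1 := mul_meas_ge_le_lintegral₀ (μ := P) hX.1.aemeasurable.ennreal_ofReal
    (ENNReal.ofReal ε)
  rw [← ofReal_integral_eq_lintegral_ofReal hX (Eventually.of_forall hX0)] at h1
  rw [ENNReal.ofReal_div_of_pos hε, ENNReal.le_div_iff_mul_le
    (Or.inl (by simpa using hε)) (Or.inl ENNReal.ofReal_ne_top), mul_comm]
  refine le_trans (mul_le_mul_right (measure_mono fun ω hω => ?_) _) h1
  simp only [mem_ofPred_eq, abs_of_nonneg (hX0 ω)] at hω ⊢
  exact ENNReal.ofReal_le_ofReal hω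

lemma tendsto_zero_of_integral {X : ℕ → Ω → ℝ} (hX : ∀ n, Integrable (X n) P)
    (hX0 : ∀ n, 0 ≤ X n) (h : Tendsto (fun n => ∫ ω, X n ω ∂P) atTop (𝓝 0)) :
    TendstoInMeasure P X atTop (fun _ => 0) := by
  rw [tendstoInMeasure_zero_iff]
  intro ε hε
  have h2 := ENNReal.tendsto_ofReal (h.div_const ε)
  rw [zero_div, ENNReal.ofReal_zero] at h2
  exact tendsto_of_tendsto_of_tendsto_of_le_of_le tendsto_const_nhds h2
    (fun _ => zero_le) (fun n => measure_ge_le_integral_div (hX n) (hX0 n) hε)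

lemma tendsto_zero_of_sq {X : ℕ → Ω → ℝ}
    (h : TendstoInMeasure P (fun n ω => X n ω ^ 2) atTop (fun _ => 0)) :
    TendstoInMeasure P X atTop (fun _ => 0) := by
  rw [tendstoInMeasure_zero_iff] at h ⊢
  intro ε hε
  refine (h (ε ^ 2) (by positivity)).congr fun n => ?_
  congr 1
  ext ω
  simp only [mem_ofPred_eq, abs_pow]
  rw [pow_le_pow_iff_left₀ hε.le (abs_nonneg _) two_ne_zero]

lemma isTightSeq_of_integral_le {Q : ℕ → Ω → ℝ} {K : ℝ} (hQ : ∀ n, Integrable (Q n) P)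
    (hQ0 : ∀ n, 0 ≤ Q n) (h : ∀ n, ∫ ω, Q n ω ∂P ≤ K) : IsTightSeq P Q := by
  intro η hη
  obtain ⟨l, hl0, hl⟩ : ∃ l : ℝ, 0 < l ∧ ENNReal.ofReal (K / l) ≤ η := by
    have h1 : Tendsto (fun l : ℝ => ENNReal.ofReal (K / l)) atTop (𝓝 0) := by
      have := ENNReal.tendsto_ofReal (tendsto_const_nhds (x := K).div_atTop tendsto_id)
      simpa using this
    exact ((eventually_gt_atTop 0).and (h1.eventually_le_const hη)).exists
  exact ⟨l, hl0, fun n => (measure_ge_le_integral_div (hQ n) (hQ0 n) hl0).trans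
    ((ENNReal.ofReal_le_ofReal (by gcongr; exact h n)).trans hl)⟩

lemma IsTightSeq.mono {Q Q' : ℕ → Ω → ℝ} (hQ : IsTightSeq P Q)
    (h : ∀ n, ∀ᵐ ω ∂P, |Q' n ω| ≤ |Q n ω|) : IsTightSeq P Q' := by
  intro η hη
  obtain ⟨l, hl0, hl⟩ := hQ η hη
  refine ⟨l, hl0, fun n => (measure_mono_ae ?_).trans (hl n)⟩
  filter_upwards [h n] with ω hω hX
  exact le_trans hX hω

lemma IsTightSeq.add {Q Q' : ℕ → Ω → ℝ} (hQ : IsTightSeq P Q) (hQ' : IsTightSeq P Q') :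
    IsTightSeq P fun n ω => Q n ω + Q' n ω := by
  intro η hη
  have hη2 : 0 < η / 2 := ENNReal.half_pos hη.ne'
  obtain ⟨l, hl0, hl⟩ := hQ _ hη2
  obtain ⟨l', hl0', hl'⟩ := hQ' _ hη2
  refine ⟨l + l', by positivity, fun n => ?_⟩
  calc P {ω | l + l' ≤ |Q n ω + Q' n ω|}
      ≤ P ({ω | l ≤ |Q n ω|} ∪ {ω | l' ≤ |Q' n ω|}) := by
        refine measure_mono fun ω hω => ?_
        simp only [mem_union, mem_ofPred_eq] at hω ⊢
        by_contra! hcon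
        have := abs_add_le (Q n ω) (Q' n ω)
        linarith [hcon.1, hcon.2]
    _ ≤ η / 2 + η / 2 := (measure_union_le _ _).trans (add_le_add (hl n) (hl' n))
    _ = η := ENNReal.add_halves η

lemma IsTightSeq.sq {Q : ℕ → Ω → ℝ} (hQ : IsTightSeq P Q) :
    IsTightSeq P fun n ω => Q n ω ^ 2 := by
  intro η hη
  obtain ⟨l, hl0, hl⟩ := hQ η hη
  refine ⟨l ^ 2, by positivity, fun n => (measure_mono fun ω hω => ?_).trans (hl n)⟩
  simp only [mem_ofPred_eq, abs_pow] at hω ⊢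
  exact (pow_le_pow_iff_left₀ hl0.le (abs_nonneg _) two_ne_zero).1 hω

/-- `X_n → 0` in probability when `X_n² ≤ Y_n Q_n`, with `Y_n → 0` in probability and `Q_n`
bounded in probability. -/
lemma tendsto_zero_of_sq_le_mul {X Y Q : ℕ → Ω → ℝ}
    (hY : TendstoInMeasure P Y atTop (fun _ => 0)) (hQ : IsTightSeq P Q)
    (h : ∀ n, ∀ᵐ ω ∂P, X n ω ^ 2 ≤ |Y n ω| * |Q n ω|) :
    TendstoInMeasure P X atTop (fun _ => 0) := by
  rw [tendstoInMeasure_zero_iff] at hY ⊢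
  intro ε hε
  rw [ENNReal.tendsto_nhds_zero]
  intro η hη
  have hη2 : 0 < η / 2 := ENNReal.half_pos hη.ne'
  obtain ⟨l, hl0, hl⟩ := hQ _ hη2
  filter_upwards [ENNReal.tendsto_nhds_zero.1 (hY (ε ^ 2 / l) (by positivity)) _ hη2] with n hn
  calc P {ω | ε ≤ |X n ω|}
      ≤ P ({ω | ε ^ 2 / l ≤ |Y n ω|} ∪ {ω | l ≤ |Q n ω|}) := by
        refine measure_mono_ae ?_
        filter_upwards [h n] with ω hω hX
        have hX' : ε ≤ |X n ω| := hX
        change ε ^ 2 / l ≤ |Y n ω| ∨ l ≤ |Q n ω|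
        by_contra! hcon
        have h1 : ε ^ 2 ≤ X n ω ^ 2 := by
          rw [← sq_abs (X n ω)]
          exact pow_le_pow_left₀ hε.le hX' 2
        have h2 : |Y n ω| * |Q n ω| < ε ^ 2 / l * l :=
          mul_lt_mul'' hcon.1 hcon.2 (abs_nonneg _) (abs_nonneg _)
        rw [div_mul_cancel₀ _ hl0.ne'] at h2
        linarith
    _ ≤ η / 2 + η / 2 := (measure_union_le _ _).trans (add_le_add hn (hl n))
    _ = η := ENNReal.add_halves η

end InMeasure

/-! ### Gaussian vectors -/

section Gaussian

variable {d : ℕ}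

/-- The law of a centred Gaussian vector with covariance `v • 1`. -/
def gaussPi (d : ℕ) (v : ℝ≥0) : Measure (Fin d → ℝ) := Measure.pi fun _ => gaussianReal 0 v

instance (v : ℝ≥0) : IsProbabilityMeasure (gaussPi d v) := by unfold gaussPi; infer_instance

lemma integral_prod_gaussPi (v : ℝ≥0) (f : Fin d → ℝ → ℝ) :
    ∫ x, ∏ j, f j (x j) ∂(gaussPi d v) = ∏ j, ∫ y, f j y ∂(gaussianReal 0 v) :=
  integral_fintype_prod_eq_prod f

lemma measurePreserving_eval_gaussPi (v : ℝ≥0) (i : Fin d) :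
    MeasurePreserving (fun x : Fin d → ℝ => x i) (gaussPi d v) (gaussianReal 0 v) :=
  measurePreserving_eval (fun _ => gaussianReal 0 v) i

lemma memLp_coord_gaussPi (v : ℝ≥0) (i : Fin d) {p : ℝ≥0∞} (hp : p ≠ ∞) :
    MemLp (fun x : Fin d → ℝ => x i) p (gaussPi d v) :=
  (memLp_id_gaussianReal' (μ := 0) (v := v) p hp).comp_measurePreserving
    (measurePreserving_eval_gaussPi v i)

lemma integral_coord_gaussPi (v : ℝ≥0) (i : Fin d) {f : ℝ → ℝ} (hf : Measurable f) :
    ∫ x, f (x i) ∂(gaussPi d v) = ∫ y, f y ∂(gaussianReal 0 v) := by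
  rw [← (measurePreserving_eval_gaussPi v i).map_eq,
    integral_map (measurable_pi_apply i).aemeasurable hf.aestronglyMeasurable]

lemma integral_sq_gaussianReal (v : ℝ≥0) : ∫ y, y ^ 2 ∂(gaussianReal 0 v) = v := by
  have h := variance_fun_id_gaussianReal (μ := 0) (v := v)
  rw [variance_eq_integral (by fun_prop)] at h
  simpa [integral_id_gaussianReal] using h

/-- The fourth moment of the standard Gaussian law. -/
def fourthMoment : ℝ := ∫ y, y ^ 4 ∂(gaussianReal 0 1)

lemma fourthMoment_nonneg : 0 ≤ fourthMoment := integral_nonneg fun y => by positivity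

lemma integral_pow_four_gaussianReal (v : ℝ≥0) :
    ∫ y, y ^ 4 ∂(gaussianReal 0 v) = fourthMoment * v ^ 2 := by
  have h := gaussianReal_map_const_mul (μ := 0) (v := 1) (Real.sqrt v)
  have hv : NNReal.mk (Real.sqrt v ^ 2) (sq_nonneg _) * 1 = v := by
    rw [mul_one]
    ext
    exact Real.sq_sqrt v.coe_nonneg
  rw [mul_zero, hv] at h
  rw [← h, integral_map (by fun_prop) (by fun_prop), fourthMoment, ← integral_mul_const]
  congr 1
  ext y
  have : Real.sqrt v ^ 4 = (v : ℝ) ^ 2 := by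
    rw [show (4 : ℕ) = 2 * 2 from rfl, pow_mul, Real.sq_sqrt v.coe_nonneg]
  rw [mul_pow, this, mul_comm]

lemma integral_exp_gaussianReal (v : ℝ≥0) (c : ℝ) :
    ∫ y, Real.exp (c * y - c ^ 2 * v / 2) ∂(gaussianReal 0 v) = 1 := by
  have h := congr_fun (mgf_fun_id_gaussianReal (μ := 0) (v := v)) c
  simp only [mgf] at h
  simp only [sub_eq_add_neg, Real.exp_add]
  rw [integral_mul_const, h, ← Real.exp_add,
    show (0 : ℝ) * c + v * c ^ 2 / 2 + -(c ^ 2 * v / 2) = 0 by ring, Real.exp_zero]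

lemma integral_mul_exp_gaussianReal (v : ℝ≥0) (c : ℝ) :
    ∫ y, Real.exp (c * y - c ^ 2 * v / 2) * y ∂(gaussianReal 0 v) = c * v := by
  have h1 : HasDerivAt (mgf id (gaussianReal 0 v))
      (∫ y, id y * Real.exp (c * id y) ∂(gaussianReal 0 v)) c :=
    hasDerivAt_mgf (by rw [integrableExpSet_id_gaussianReal]; simp)
  have h2 : HasDerivAt (mgf id (gaussianReal 0 v)) (Real.exp (v * c ^ 2 / 2) * (v * c)) c := by
    rw [mgf_id_gaussianReal]
    have h3 : HasDerivAt (fun t : ℝ => 0 * t + v * t ^ 2 / 2) (v * c) c := by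
      have := ((hasDerivAt_pow 2 c).const_mul (v : ℝ)).div_const 2
      simp only [zero_mul, zero_add]
      refine this.congr_deriv ?_
      push_cast
      ring
    have := h3.exp
    simpa using this
  have h4 := h1.unique h2
  have h5 : ∀ y : ℝ, Real.exp (c * y - c ^ 2 * v / 2) * y
      = Real.exp (-(c ^ 2 * v / 2)) * (id y * Real.exp (c * id y)) := fun y => by
    rw [sub_eq_add_neg, Real.exp_add]
    simp only [id]
    ring
  simp only [h5]
  rw [integral_const_mul, h4, ← mul_assoc, ← Real.exp_add]
  have : -(c ^ 2 * v / 2) + v * c ^ 2 / 2 = (0 : ℝ) := by ring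
  rw [this, Real.exp_zero]
  ring

/-- `E[x_i x_j] = v δ_{ij}`. -/
lemma integral_mul_coord_gaussPi (v : ℝ≥0) (i j : Fin d) :
    ∫ x, x i * x j ∂(gaussPi d v) = if i = j then (v : ℝ) else 0 := by
  classical
  split_ifs with h
  · subst h
    rw [← integral_sq_gaussianReal v, ← integral_coord_gaussPi v i (by fun_prop)]
    simp only [sq]
  have h1 := integral_prod_gaussPi (d := d) v
    fun k y => (if k = i then y else 1) * (if k = j then y else 1)
  simp only [Finset.prod_mul_distrib, Finset.prod_ite_eq', Finset.mem_univ, if_true] at h1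
  rw [h1, Finset.prod_eq_zero (Finset.mem_univ i)]
  simp [h]

/-- The centred product of two coordinates. -/
def centredProd (v : ℝ≥0) (i j : Fin d) (x : Fin d → ℝ) : ℝ :=
  x i * x j - if i = j then (v : ℝ) else 0

lemma measurable_centredProd (v : ℝ≥0) (i j : Fin d) : Measurable (centredProd v i j) := by
  unfold centredProd
  fun_prop

lemma centredProd_sq_le (v : ℝ≥0) (i j : Fin d) (x : Fin d → ℝ) :
    centredProd v i j x ^ 2 ≤ x i ^ 4 + x j ^ 4 + 2 * (v : ℝ) ^ 2 := by
  have h1 : (if i = j then (v : ℝ) else 0) ^ 2 ≤ (v : ℝ) ^ 2 := by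
    split_ifs <;> simp
  unfold centredProd
  nlinarith [sq_nonneg (x i * x j + if i = j then (v : ℝ) else 0), sq_nonneg (x i ^ 2 - x j ^ 2)]

lemma integrable_pow_four_gaussPi (v : ℝ≥0) (i : Fin d) :
    Integrable (fun x : Fin d → ℝ => x i ^ 4) (gaussPi d v) := by
  have := (memLp_coord_gaussPi v i (p := (4 : ℕ)) (by simp)).integrable_norm_pow (by norm_num)
  refine this.congr (Eventually.of_forall fun x => ?_)
  simp only [Real.norm_eq_abs]
  exact Even.pow_abs (by decide) _

lemma memLp_centredProd (v : ℝ≥0) (i j : Fin d) :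
    MemLp (centredProd v i j) 2 (gaussPi d v) := by
  rw [memLp_two_iff_integrable_sq (measurable_centredProd v i j).aestronglyMeasurable]
  refine (((integrable_pow_four_gaussPi v i).add (integrable_pow_four_gaussPi v j)).add
    (integrable_const (2 * (v : ℝ) ^ 2))).mono'
    ((measurable_centredProd v i j).pow_const 2).aestronglyMeasurable
    (Eventually.of_forall fun x => ?_)
  rw [Real.norm_eq_abs, abs_of_nonneg (sq_nonneg _)]
  exact centredProd_sq_le v i j x

lemma integral_centredProd (v : ℝ≥0) (i j : Fin d) :
    ∫ x, centredProd v i j x ∂(gaussPi d v) = 0 := by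
  have h : Integrable (fun x : Fin d → ℝ => x i * x j) (gaussPi d v) :=
    (memLp_coord_gaussPi v i (p := 2) (by simp)).integrable_mul
      (memLp_coord_gaussPi v j (p := 2) (by simp))
  unfold centredProd
  rw [integral_sub h (integrable_const _), integral_mul_coord_gaussPi]
  simp

lemma integral_centredProd_sq_le (v : ℝ≥0) (i j : Fin d) :
    ∫ x, centredProd v i j x ^ 2 ∂(gaussPi d v) ≤ (2 * fourthMoment + 2) * v ^ 2 := by
  have hi := integrable_pow_four_gaussPi (d := d) v i
  have hj := integrable_pow_four_gaussPi (d := d) v j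
  have hij : Integrable (fun x : Fin d → ℝ => x i ^ 4 + x j ^ 4) (gaussPi d v) := hi.add hj
  calc ∫ x, centredProd v i j x ^ 2 ∂(gaussPi d v)
      ≤ ∫ x, (x i ^ 4 + x j ^ 4 + 2 * (v : ℝ) ^ 2) ∂(gaussPi d v) :=
        integral_mono (memLp_centredProd v i j).integrable_sq (hij.add (integrable_const _))
          (centredProd_sq_le v i j)
    _ = (2 * fourthMoment + 2) * v ^ 2 := by
        rw [integral_add hij (integrable_const _), integral_add hi hj,
          integral_coord_gaussPi v i (f := fun y => y ^ 4) (by fun_prop),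
          integral_coord_gaussPi v j (f := fun y => y ^ 4) (by fun_prop),
          integral_pow_four_gaussianReal]
        simp
        ring

/-- The density of the Gaussian vector shifted by `v c`. -/
def gaussExp (v : ℝ≥0) (c x : Fin d → ℝ) : ℝ :=
  Real.exp (∑ j, (c j * x j - c j ^ 2 * v / 2))

lemma integral_gaussExp (v : ℝ≥0) (c : Fin d → ℝ) : ∫ x, gaussExp v c x ∂(gaussPi d v) = 1 := by
  simp only [gaussExp, Real.exp_sum]
  rw [integral_prod_gaussPi v fun j y => Real.exp (c j * y - c j ^ 2 * v / 2)]
  simp [integral_exp_gaussianReal]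

lemma measurable_gaussExp (v : ℝ≥0) (c : Fin d → ℝ) : Measurable (gaussExp v c) := by
  unfold gaussExp
  fun_prop

lemma integral_gaussExp_mul (v : ℝ≥0) (c : Fin d → ℝ) (i : Fin d) :
    ∫ x, gaussExp v c x * x i ∂(gaussPi d v) = c i * v := by
  classical
  have h1 := integral_prod_gaussPi (d := d) v
    fun j y => Real.exp (c j * y - c j ^ 2 * v / 2) * (if j = i then y else 1)
  simp only [Finset.prod_mul_distrib, Finset.prod_ite_eq', Finset.mem_univ, if_true,
    ← Real.exp_sum] at h1
  simp only [gaussExp]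
  rw [h1, Finset.prod_eq_single i]
  · simp only [if_true]
    exact integral_mul_exp_gaussianReal v (c i)
  · intro j _ hj
    simp only [if_neg hj, mul_one]
    exact integral_exp_gaussianReal v (c j)
  · simp

end Gaussian

/-! ### Dyadic grids -/

section Grid

variable {T : ℝ≥0}

/-- The `k`-th point of the dyadic grid of level `n` on `[0, T]`. -/
def gridPt (T : ℝ≥0) (n k : ℕ) : ℝ≥0 := k * T / 2 ^ n

/-- The mesh of the dyadic grid of level `n` on `[0, T]`. -/
def mesh (T : ℝ≥0) (n : ℕ) : ℝ≥0 := T / 2 ^ n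

@[simp] lemma gridPt_zero (n : ℕ) : gridPt T n 0 = 0 := by simp [gridPt]

lemma gridPt_last (n : ℕ) : gridPt T n (2 ^ n) = T := by
  unfold gridPt
  push_cast
  field_simp

lemma gridPt_mono (n : ℕ) : Monotone (gridPt T n) := fun a b h => by
  unfold gridPt
  gcongr

lemma gridPt_le {n k : ℕ} (h : k ≤ 2 ^ n) : gridPt T n k ≤ T :=
  (gridPt_mono n h).trans_eq (gridPt_last n)

lemma gridPt_succ (n k : ℕ) : gridPt T n (k + 1) = gridPt T n k + mesh T n := by
  unfold gridPt mesh
  push_cast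
  ring

lemma gridPt_succ_sub (n k : ℕ) : gridPt T n (k + 1) - gridPt T n k = mesh T n := by
  rw [gridPt_succ, add_tsub_cancel_left]

lemma coe_gridPt_succ_sub (n k : ℕ) :
    (gridPt T n (k + 1) : ℝ) - gridPt T n k = mesh T n := by
  rw [gridPt_succ]
  push_cast
  ring

lemma gridPt_refine (n j k : ℕ) : gridPt T (n + j) (k * 2 ^ j) = gridPt T n k := by
  unfold gridPt
  push_cast
  rw [pow_add]
  field_simp

lemma two_pow_mul_mesh (n : ℕ) : (2 : ℝ) ^ n * mesh T n = T := by
  unfold mesh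
  push_cast
  field_simp

lemma tendsto_mesh (T : ℝ≥0) : Tendsto (mesh T) atTop (𝓝 0) := by
  have h : Tendsto (fun n : ℕ => (T : ℝ) * (1 / 2) ^ n) atTop (𝓝 (T * 0)) :=
    (tendsto_pow_atTop_nhds_zero_of_lt_one (by norm_num) (by norm_num)).const_mul _
  rw [← NNReal.tendsto_coe]
  simp only [mul_zero] at h
  refine h.congr fun n => ?_
  unfold mesh
  push_cast
  rw [one_div, inv_pow, div_eq_mul_inv]

/-- Regrouping of a sum over a grid into blocks of length `N`. -/
lemma sum_range_mul_eq (f : ℕ → ℝ) (K N : ℕ) :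
    ∑ l ∈ Finset.range (K * N), f l
      = ∑ k ∈ Finset.range K, ∑ l ∈ Finset.Ico (k * N) ((k + 1) * N), f l := by
  induction K with
  | zero => simp
  | succ K ih =>
    rw [Finset.sum_range_succ, ← ih, Finset.sum_range_add_sum_Ico]
    exact Nat.mul_le_mul_right N (Nat.le_succ K)

end Grid

/-! ### Brownian increments -/

lemma measurable_coord_sub {Ω : Type*} {m : MeasurableSpace Ω} {d : ℕ} {f g : Ω → Eucl d}
    (hf : Measurable f) (hg : Measurable g) : Measurable fun ω (i : Fin d) => f ω i - g ω i := by
  refine measurable_pi_iff.2 fun i => ?_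
  have hc : Measurable fun x : Eucl d => x i := by fun_prop
  exact (hc.comp hf).sub (hc.comp hg)

/-- The increment of `B` over the `k`-th interval of the dyadic grid of level `n`. -/
def incr {Ω : Type*} {d : ℕ} (B : ℝ≥0 → Ω → Eucl d) (T : ℝ≥0) (n k : ℕ) (ω : Ω) (i : Fin d) : ℝ :=
  B (gridPt T n (k + 1)) ω i - B (gridPt T n k) ω i

/-- The density `exp (∫ h · dB - ½ ∫ |h|²)` for a step function `h` on a dyadic grid, restricted to
the intervals of index in `s`. -/
def stepExp {Ω : Type*} {d : ℕ} (B : ℝ≥0 → Ω → Eucl d) (T : ℝ≥0) (n : ℕ) (c : ℕ → Fin d → ℝ)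
    (s : Finset ℕ) (ω : Ω) : ℝ :=
  ∏ k ∈ s, gaussExp (mesh T n) (c k) (incr B T n k ω)

section Increments

variable {Ω : Type*} [mΩ : MeasurableSpace Ω] {d : ℕ} {P : Measure Ω} {T : ℝ≥0}
  {B : ℝ≥0 → Ω → Eucl d}

lemma past_le_brownianFiltration (hB : IsBrownianMotionOn B T P) (t : ℝ≥0) :
    past B T t ≤ brownianFiltration B T P t := by
  refine le_inf (iSup_le fun s => ?_) ?_
  · exact (hB.measurable _ (s.2.trans (min_le_right _ _))).comap_le
  · exact fun A hA => ⟨A, hA, EventuallyEq.rfl⟩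

lemma measurable_brownianFiltration (hB : IsBrownianMotionOn B T P) {s t : ℝ≥0} (hst : s ≤ t)
    (hsT : s ≤ T) : Measurable[brownianFiltration B T P t] (B s) := by
  refine Measurable.mono ?_ (past_le_brownianFiltration hB t) le_rfl
  exact Measurable.of_comap_le (le_iSup
    (fun r : Iic (min t T) => MeasurableSpace.comap (B r) inferInstance) ⟨s, le_min hst hsT⟩)

lemma indep_brownianFiltration (hB : IsBrownianMotionOn B T P) {s t : ℝ≥0} (hst : s ≤ t)
    (htT : t ≤ T) :
    Indep (brownianFiltration B T P s)
      (MeasurableSpace.comap (fun ω => B t ω - B s ω) inferInstance) P := by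
  rw [Indep_iff]
  intro A C hA hC
  obtain ⟨-, A', hA', hAA'⟩ := hA
  have h1 := (Indep_iff _ _ _).1 (hB.indep s t hst htT) A' C hA' hC
  rw [measure_congr hAA', ← h1]
  exact measure_congr (hAA'.inter EventuallyEq.rfl)

variable {n k : ℕ}

lemma measurable_incr_filtration (hB : IsBrownianMotionOn B T P) (hk : k < 2 ^ n) {t : ℝ≥0}
    (ht : gridPt T n (k + 1) ≤ t) : Measurable[brownianFiltration B T P t] (incr B T n k) := by
  have h1 := measurable_brownianFiltration hB ht (gridPt_le hk)
  have h2 := measurable_brownianFiltration hB ((gridPt_mono n (Nat.le_succ k)).trans ht)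
    (gridPt_le hk.le)
  exact measurable_coord_sub h1 h2

lemma measurable_incr (hB : IsBrownianMotionOn B T P) (hk : k < 2 ^ n) :
    Measurable (incr B T n k) :=
  (measurable_incr_filtration hB hk le_rfl).mono ((brownianFiltration B T P).le _) le_rfl

lemma measurePreserving_incr (hB : IsBrownianMotionOn B T P) (hk : k < 2 ^ n) :
    MeasurePreserving (incr B T n k) P (gaussPi d (mesh T n)) := by
  refine ⟨measurable_incr hB hk, ?_⟩
  have := hB.law (gridPt T n k) (gridPt T n (k + 1)) (gridPt_mono n (Nat.le_succ k)) (gridPt_le hk)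
  rw [gridPt_succ_sub] at this
  exact this

lemma integral_comp_incr (hB : IsBrownianMotionOn B T P) (hk : k < 2 ^ n) {f : (Fin d → ℝ) → ℝ}
    (hf : Measurable f) :
    ∫ ω, f (incr B T n k ω) ∂P = ∫ x, f x ∂(gaussPi d (mesh T n)) := by
  rw [← (measurePreserving_incr hB hk).map_eq,
    integral_map (measurable_incr hB hk).aemeasurable hf.aestronglyMeasurable]

/-- The increment over a dyadic interval is independent of the past of that interval. -/
lemma integral_mul_comp_incr (hB : IsBrownianMotionOn B T P) (hk : k < 2 ^ n)
    {g : Ω → ℝ} (hg : StronglyMeasurable[brownianFiltration B T P (gridPt T n k)] g)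
    {f : (Fin d → ℝ) → ℝ} (hf : Measurable f) :
    ∫ ω, g ω * f (incr B T n k ω) ∂P = (∫ ω, g ω ∂P) * ∫ x, f x ∂(gaussPi d (mesh T n)) := by
  have hind := indep_brownianFiltration hB (gridPt_mono (T := T) n (Nat.le_succ k)) (gridPt_le hk)
  have hI : IndepFun g (fun ω => f (incr B T n k ω)) P := by
    rw [IndepFun_iff_Indep]
    refine indep_of_indep_of_le_left (indep_of_indep_of_le_right hind ?_) hg.measurable.comap_le
    have hm : Measurable fun x : Eucl d => f fun i => x i :=
      hf.comp (measurable_pi_iff.2 fun i => by fun_prop)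
    rintro _ ⟨S, hS, rfl⟩
    exact ⟨_, hm hS, rfl⟩
  rw [← integral_comp_incr hB hk hf]
  exact hI.integral_fun_mul_eq_mul_integral
    (hg.mono ((brownianFiltration B T P).le _)).aestronglyMeasurable
    (hf.comp (measurable_incr hB hk)).aestronglyMeasurable

lemma memLp_comp_incr (hB : IsBrownianMotionOn B T P) (hk : k < 2 ^ n) {f : (Fin d → ℝ) → ℝ}
    {p : ℝ≥0∞} (hf : MemLp f p (gaussPi d (mesh T n))) :
    MemLp (fun ω => f (incr B T n k ω)) p P :=
  hf.comp_measurePreserving (measurePreserving_incr hB hk)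

lemma stronglyMeasurable_comp_incr (hB : IsBrownianMotionOn B T P) (hk : k < 2 ^ n) {t : ℝ≥0}
    (ht : gridPt T n (k + 1) ≤ t) {f : (Fin d → ℝ) → ℝ} (hf : Measurable f) :
    StronglyMeasurable[brownianFiltration B T P t] fun ω => f (incr B T n k ω) :=
  Measurable.stronglyMeasurable (mα := brownianFiltration B T P t)
    (hf.comp (measurable_incr_filtration hB hk ht))

/-- A discrete stochastic integral with bounded adapted integrand is square integrable. -/
lemma memLp_sum_mul_incr (hB : IsBrownianMotionOn B T P) {f : (Fin d → ℝ) → ℝ}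
    (hf2 : MemLp f 2 (gaussPi d (mesh T n))) {a : ℕ → Ω → ℝ} {C : ℝ}
    (s : Finset ℕ) (hs : ∀ k ∈ s, k < 2 ^ n) (ha : ∀ k ∈ s, AEStronglyMeasurable (a k) P)
    (hC : ∀ k ∈ s, ∀ ω, |a k ω| ≤ C) :
    MemLp (fun ω => ∑ k ∈ s, a k ω * f (incr B T n k ω)) 2 P := by
  refine memLp_finsetSum s fun k hk => ?_
  have h := memLp_comp_incr hB (hs k hk) hf2
  refine (h.const_mul C).of_le ((ha k hk).mul h.1) (Eventually.of_forall fun ω => ?_)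
  rw [norm_mul, norm_mul]
  exact mul_le_mul_of_nonneg_right ((hC k hk ω).trans (le_abs_self C)) (norm_nonneg _)

/-- Orthogonality of the terms of a discrete stochastic integral. -/
lemma integral_sum_mul_incr_sq [IsProbabilityMeasure P] (hB : IsBrownianMotionOn B T P)
    {f : (Fin d → ℝ) → ℝ}
    (hf : Measurable f) (hf2 : MemLp f 2 (gaussPi d (mesh T n)))
    (hf0 : ∫ x, f x ∂(gaussPi d (mesh T n)) = 0) {a : ℕ → Ω → ℝ} {C : ℝ} (s : Finset ℕ)
    (hs : ∀ k ∈ s, k < 2 ^ n)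
    (ha : ∀ k ∈ s, StronglyMeasurable[brownianFiltration B T P (gridPt T n k)] (a k))
    (hC : ∀ k ∈ s, ∀ ω, |a k ω| ≤ C) :
    ∫ ω, (∑ k ∈ s, a k ω * f (incr B T n k ω)) ^ 2 ∂P
      = ∑ k ∈ s, (∫ ω, a k ω ^ 2 ∂P) * ∫ x, f x ^ 2 ∂(gaussPi d (mesh T n)) := by
  have hae : ∀ k, StronglyMeasurable[brownianFiltration B T P (gridPt T n k)] (a k) →
      AEStronglyMeasurable (a k) P :=
    fun k h => (h.mono ((brownianFiltration B T P).le _)).aestronglyMeasurable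
  induction s using Finset.induction_on_max with
  | empty => simp
  | insert K s hK ih =>
    have hKs : K ∉ s := fun h => lt_irrefl _ (hK K h)
    have hsub : ∀ k ∈ s, k ∈ insert K s := fun k hk => Finset.mem_insert_of_mem hk
    have hKm : K ∈ insert K s := Finset.mem_insert_self K s
    specialize ih (fun k hk => hs k (hsub k hk)) (fun k hk => ha k (hsub k hk))
      (fun k hk => hC k (hsub k hk))
    have hS : StronglyMeasurable[brownianFiltration B T P (gridPt T n K)]
        fun ω => ∑ k ∈ s, a k ω * f (incr B T n k ω) := by
      refine Finset.stronglyMeasurable_fun_sum s fun k hk => ?_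
      have hkK : k < K := hK k hk
      refine StronglyMeasurable.mul ((ha k (hsub k hk)).mono
        ((brownianFiltration B T P).mono (gridPt_mono n hkK.le))) ?_
      exact stronglyMeasurable_comp_incr hB (hs k (hsub k hk)) (gridPt_mono n hkK) hf
    have hS2 := memLp_sum_mul_incr (a := a) hB hf2 s (fun k hk => hs k (hsub k hk))
      (fun k hk => hae k (ha k (hsub k hk))) (fun k hk => hC k (hsub k hk))
    have hK2 : MemLp (fun ω => a K ω * f (incr B T n K ω)) 2 P := by
      have := memLp_sum_mul_incr (a := a) hB hf2 {K} (fun k hk => by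
        rw [Finset.mem_singleton.1 hk]; exact hs K hKm) (fun k hk => by
        rw [Finset.mem_singleton.1 hk]; exact hae K (ha K hKm)) (fun k hk => by
        rw [Finset.mem_singleton.1 hk]; exact hC K hKm)
      simpa using this
    have hcross : ∫ ω, (∑ k ∈ s, a k ω * f (incr B T n k ω))
        * (a K ω * f (incr B T n K ω)) ∂P = 0 := by
      have := integral_mul_comp_incr hB (hs K hKm) (hS.mul (ha K hKm)) hf
      rw [hf0, mul_zero] at this
      rw [← this]
      refine integral_congr_ae (Eventually.of_forall fun ω => ?_)
      simp only [Pi.mul_apply]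
      ring
    have hsq : ∫ ω, (a K ω * f (incr B T n K ω)) ^ 2 ∂P
        = (∫ ω, a K ω ^ 2 ∂P) * ∫ x, f x ^ 2 ∂(gaussPi d (mesh T n)) := by
      have h := integral_mul_comp_incr hB (hs K hKm) ((ha K hKm).pow 2) (hf.pow_const 2)
      simp only [Pi.pow_apply] at h
      rw [← h]
      simp only [mul_pow]
    have i1 : Integrable (fun ω => (∑ k ∈ s, a k ω * f (incr B T n k ω)) ^ 2) P :=
      hS2.integrable_sq
    have i2 : Integrable (fun ω => (a K ω * f (incr B T n K ω)) ^ 2) P := hK2.integrable_sq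
    have i3 : Integrable (fun ω => 2 * ((∑ k ∈ s, a k ω * f (incr B T n k ω))
        * (a K ω * f (incr B T n K ω)))) P := (hS2.integrable_mul hK2).const_mul 2
    have i13 : Integrable (fun ω => (∑ k ∈ s, a k ω * f (incr B T n k ω)) ^ 2
        + 2 * ((∑ k ∈ s, a k ω * f (incr B T n k ω)) * (a K ω * f (incr B T n K ω)))) P :=
      i1.add i3
    rw [Finset.sum_insert hKs, ← ih, ← hsq]
    calc ∫ ω, (∑ k ∈ insert K s, a k ω * f (incr B T n k ω)) ^ 2 ∂P
        = ∫ ω, ((∑ k ∈ s, a k ω * f (incr B T n k ω)) ^ 2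
          + 2 * ((∑ k ∈ s, a k ω * f (incr B T n k ω)) * (a K ω * f (incr B T n K ω)))
          + (a K ω * f (incr B T n K ω)) ^ 2) ∂P := by
          refine integral_congr_ae (Eventually.of_forall fun ω => ?_)
          simp only [Finset.sum_insert hKs]
          ring
      _ = _ := by
          rw [integral_add i13 i2, integral_add i1 i3, integral_const_mul, hcross]
          ring

/-- The variance of a discrete stochastic integral against one component of `B`. -/
lemma integral_sum_mul_incr_coord_sq [IsProbabilityMeasure P] (hB : IsBrownianMotionOn B T P)
    (i : Fin d) {a : ℕ → Ω → ℝ} {C : ℝ} (s : Finset ℕ)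
    (hs : ∀ k ∈ s, k < 2 ^ n)
    (ha : ∀ k ∈ s, StronglyMeasurable[brownianFiltration B T P (gridPt T n k)] (a k))
    (hC : ∀ k ∈ s, ∀ ω, |a k ω| ≤ C) :
    ∫ ω, (∑ k ∈ s, a k ω * incr B T n k ω i) ^ 2 ∂P
      = ∑ k ∈ s, (∫ ω, a k ω ^ 2 ∂P) * mesh T n := by
  have h := integral_sum_mul_incr_sq hB (f := fun x => x i) (measurable_pi_apply i)
    (memLp_coord_gaussPi _ i (by simp))
    (by rw [integral_coord_gaussPi (f := fun y => y) _ i measurable_id, integral_id_gaussianReal])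
    s hs ha hC
  rw [h]
  refine Finset.sum_congr rfl fun k _ => ?_
  rw [integral_coord_gaussPi (f := fun y => y ^ 2) _ i (by fun_prop), integral_sq_gaussianReal]

lemma stronglyMeasurable_stepExp (hB : IsBrownianMotionOn B T P) (c : ℕ → Fin d → ℝ)
    {s : Finset ℕ} {K : ℕ} (hK : K ≤ 2 ^ n) (hs : ∀ k ∈ s, k < K) :
    StronglyMeasurable[brownianFiltration B T P (gridPt T n K)] (stepExp B T n c s) := by
  refine Finset.stronglyMeasurable_fun_prod s fun k hk => ?_
  exact stronglyMeasurable_comp_incr hB ((hs k hk).trans_le hK) (gridPt_mono n (hs k hk))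
    (measurable_gaussExp _ _)

/-- The density of the future does not change the expectation of an event of the past. -/
lemma integral_mul_stepExp_Ico (hB : IsBrownianMotionOn B T P) (c : ℕ → Fin d → ℝ) {K : ℕ}
    (hkK : k ≤ K) (hK : K ≤ 2 ^ n) {H : Ω → ℝ}
    (hH : StronglyMeasurable[brownianFiltration B T P (gridPt T n k)] H) :
    ∫ ω, H ω * stepExp B T n c (Finset.Ico k K) ω ∂P = ∫ ω, H ω ∂P := by
  induction K, hkK using Nat.le_induction with
  | base => simp [stepExp]
  | succ K hkK ih =>
    rw [← ih (Nat.le_of_succ_le hK)]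
    have hm : StronglyMeasurable[brownianFiltration B T P (gridPt T n K)]
        fun ω => H ω * stepExp B T n c (Finset.Ico k K) ω :=
      (hH.mono ((brownianFiltration B T P).mono (gridPt_mono n hkK))).mul
        (stronglyMeasurable_stepExp hB c (Nat.le_of_succ_le hK)
          fun j hj => (Finset.mem_Ico.1 hj).2)
    have h := integral_mul_comp_incr hB hK hm (measurable_gaussExp (mesh T n) (c K))
    rw [integral_gaussExp, mul_one] at h
    rw [← h]
    refine integral_congr_ae (Eventually.of_forall fun ω => ?_)
    simp only [stepExp]
    rw [Finset.prod_Ico_succ_top hkK, mul_assoc]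

/-- Under the density of a step function with value `c` on the `k`-th interval, the increment over
that interval has conditional mean `c` times the mesh given the past. -/
lemma integral_stepExp_mul_incr (hB : IsBrownianMotionOn B T P) (c : ℕ → Fin d → ℝ)
    (hk : k < 2 ^ n) {G : Ω → ℝ}
    (hG : StronglyMeasurable[brownianFiltration B T P (gridPt T n k)] G) (i : Fin d) :
    ∫ ω, stepExp B T n c (Finset.range (2 ^ n)) ω * (G ω * incr B T n k ω i) ∂P
      = (c k i * mesh T n) * ∫ ω, stepExp B T n c (Finset.range (2 ^ n)) ω * G ω ∂P := by
  have hsplit : ∀ K ≤ 2 ^ n, ∀ ω, stepExp B T n c (Finset.range (2 ^ n)) ω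
      = stepExp B T n c (Finset.range K) ω * stepExp B T n c (Finset.Ico K (2 ^ n)) ω :=
    fun K hK ω => (Finset.prod_range_mul_prod_Ico _ hK).symm
  have hpast := stronglyMeasurable_stepExp hB c hk.le (s := Finset.range k)
    fun j hj => Finset.mem_range.1 hj
  have hpG : StronglyMeasurable[brownianFiltration B T P (gridPt T n k)]
      fun ω => stepExp B T n c (Finset.range k) ω * G ω := hpast.mul hG
  have h2 : ∫ ω, stepExp B T n c (Finset.range (2 ^ n)) ω * G ω ∂P
      = ∫ ω, stepExp B T n c (Finset.range k) ω * G ω ∂P := by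
    rw [← integral_mul_stepExp_Ico hB c hk.le le_rfl hpG]
    refine integral_congr_ae (Eventually.of_forall fun ω => ?_)
    simp only [hsplit k hk.le ω]
    ring
  have hcoord : Measurable fun x : Fin d → ℝ => gaussExp (mesh T n) (c k) x * x i :=
    (measurable_gaussExp _ _).mul (measurable_pi_apply i)
  have hm : StronglyMeasurable[brownianFiltration B T P (gridPt T n (k + 1))]
      fun ω => (stepExp B T n c (Finset.range k) ω * G ω)
        * (gaussExp (mesh T n) (c k) (incr B T n k ω) * incr B T n k ω i) :=
    (hpG.mono ((brownianFiltration B T P).mono (gridPt_mono n (Nat.le_succ k)))).mul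
      (stronglyMeasurable_comp_incr hB hk le_rfl hcoord)
  have h3 := integral_mul_comp_incr hB hk hpG hcoord
  rw [integral_gaussExp_mul, ← h2, ← integral_mul_stepExp_Ico hB c hk le_rfl hm] at h3
  rw [mul_comm, ← h3]
  refine integral_congr_ae (Eventually.of_forall fun ω => ?_)
  simp only [hsplit (k + 1) hk ω]
  simp only [stepExp]
  rw [Finset.prod_range_succ]
  ring

lemma memLp_stepExp [IsProbabilityMeasure P] (hB : IsBrownianMotionOn B T P)
    (c : ℕ → Fin d → ℝ) : MemLp (stepExp B T n c (Finset.range (2 ^ n))) 2 P := by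
  have hmeas : ∀ c : ℕ → Fin d → ℝ, AEStronglyMeasurable
      (stepExp B T n c (Finset.range (2 ^ n))) P := fun c =>
    ((stronglyMeasurable_stepExp hB c le_rfl fun j hj => Finset.mem_range.1 hj).mono
      ((brownianFiltration B T P).le _)).aestronglyMeasurable
  have hint : ∀ c : ℕ → Fin d → ℝ, Integrable (stepExp B T n c (Finset.range (2 ^ n))) P := by
    intro c
    refine integrable_of_integral_eq_one ?_
    have h := integral_mul_stepExp_Ico (n := n) hB c (Nat.zero_le _) le_rfl
      (stronglyMeasurable_const (b := (1 : ℝ)))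
    rw [integral_const, probReal_univ, smul_eq_mul, mul_one] at h
    simp only [one_mul] at h
    rw [Finset.range_eq_Ico]
    exact h
  rw [memLp_two_iff_integrable_sq (hmeas c)]
  refine ((hint fun k j => 2 * c k j).const_mul
    (Real.exp (∑ k ∈ Finset.range (2 ^ n), ∑ j, c k j ^ 2 * mesh T n))).congr
    (Eventually.of_forall fun ω => ?_)
  simp only [stepExp, gaussExp]
  rw [← Real.exp_sum, ← Real.exp_sum, ← Real.exp_add, ← Real.exp_nat_mul,
    ← Finset.sum_add_distrib, Finset.mul_sum]
  congr 1
  refine Finset.sum_congr rfl fun k _ => ?_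
  rw [← Finset.sum_add_distrib, Finset.mul_sum]
  refine Finset.sum_congr rfl fun j _ => ?_
  push_cast
  ring

end Increments

/-! ### Truncation -/

/-- The projection of the real line onto `[-m, m]`. -/
def clip (m x : ℝ) : ℝ := max (-m) (min x m)

lemma continuous_clip (m : ℝ) : Continuous (clip m) := by
  unfold clip
  fun_prop

lemma abs_clip_le {m : ℝ} (hm : 0 ≤ m) (x : ℝ) : |clip m x| ≤ m := by
  unfold clip
  rw [abs_le]
  exact ⟨le_max_left _ _, max_le (by linarith) (min_le_right _ _)⟩

lemma clip_of_abs_le {m x : ℝ} (hx : |x| ≤ m) : clip m x = x := by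
  obtain ⟨h1, h2⟩ := abs_le.1 hx
  unfold clip
  rw [min_eq_left h2, max_eq_right h1]

lemma abs_clip_sub_le (m x y : ℝ) : |clip m x - clip m y| ≤ |x - y| := by
  unfold clip
  refine (abs_max_sub_max_le_max _ _ _ _).trans (max_le (by simp) ?_)
  exact (abs_min_sub_min_le_max _ _ _ _).trans (max_le le_rfl (by simp))

/-- The Bregman divergence of the Huber function `H(x) = 2 x p(x) - p(x)²`, where `p` is the
projection onto `[-m, m]`. -/
lemma huber_bregman_nonneg {m : ℝ} (hm : 0 ≤ m) (x y : ℝ) :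
    0 ≤ (clip m y - clip m x) * (2 * y - clip m y - clip m x) := by
  have up : ∀ z, -m < clip m z → clip m z ≤ z := fun z hz => by
    unfold clip at hz ⊢
    rcases max_choice (-m) (min z m) with h | h
    · exact absurd (h ▸ hz) (lt_irrefl _)
    · exact h.trans_le (min_le_left _ _)
  have down : ∀ z, clip m z < m → z ≤ clip m z := fun z hz => by
    unfold clip at hz ⊢
    rcases min_choice z m with h | h
    · exact h.symm.le.trans (le_max_right _ _)
    · linarith [le_max_right (-m) (min z m)]
  have bx := abs_le.1 (abs_clip_le hm x)
  have byy := abs_le.1 (abs_clip_le hm y)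
  rcases lt_trichotomy (clip m x) (clip m y) with h | h | h
  · have := up y (by linarith)
    exact mul_nonneg (by linarith) (by linarith)
  · rw [h]
    simp
  · have := down y (by linarith)
    exact mul_nonneg_of_nonpos_of_nonpos (by linarith) (by linarith)

lemma huber_le {m : ℝ} (hm : 0 ≤ m) (x : ℝ) :
    2 * x * clip m x - clip m x ^ 2 ≤ 2 * m * |x| := by
  have h1 : x * clip m x ≤ |x| * m := by
    refine (le_abs_self _).trans ?_
    rw [abs_mul]
    exact mul_le_mul_of_nonneg_left (abs_clip_le hm x) (abs_nonneg x)
  nlinarith [sq_nonneg (clip m x)]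

lemma huber_nonneg {m : ℝ} (hm : 0 ≤ m) (x : ℝ) :
    0 ≤ 2 * x * clip m x - clip m x ^ 2 := by
  have h := huber_bregman_nonneg hm 0 x
  have h0 : clip m 0 = 0 := clip_of_abs_le (by simpa using hm)
  rw [h0] at h
  nlinarith

/-! ### Quadratic variation of continuous semimartingales -/

/-- The sum of the squared increments of `X` over the dyadic grid of level `n`. -/
def quadVar {Ω : Type*} (X : ℝ≥0 → Ω → ℝ) (T : ℝ≥0) (n : ℕ) (ω : Ω) : ℝ :=
  ∑ k ∈ Finset.range (2 ^ n), (X (gridPt T n (k + 1)) ω - X (gridPt T n k) ω) ^ 2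

lemma quadVar_nonneg {Ω : Type*} (X : ℝ≥0 → Ω → ℝ) (T : ℝ≥0) (n : ℕ) (ω : Ω) :
    0 ≤ quadVar X T n ω := Finset.sum_nonneg fun _ _ => sq_nonneg _

lemma stoppedProcess_indicator_of_lt {Ω : Type*} {M : ℝ≥0 → Ω → ℝ} {τ : Ω → WithTop ℝ≥0} {t : ℝ≥0} {ω : Ω}
    (h : (t : WithTop ℝ≥0) < τ ω) :
    stoppedProcess (fun i => {ω | ⊥ < τ ω}.indicator (M i)) τ t ω = M t ω := by
  have hmem : ω ∈ {ω | ⊥ < τ ω} := lt_of_le_of_lt bot_le h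
  simp only [stoppedProcess, min_eq_left h.le]
  rw [WithTop.untopA_eq_untop WithTop.coe_ne_top, WithTop.untop_coe]
  exact indicator_of_mem hmem _

section QuadVar

variable {Ω : Type*} [mΩ : MeasurableSpace Ω] {P : Measure Ω} {ℱ : Filtration ℝ≥0 mΩ}
  {T : ℝ≥0}

/-- A local martingale has adapted versions. -/
lemma exists_adapted_of_locally {M : ℝ≥0 → Ω → ℝ}
    (hM : Locally (fun N => Martingale N ℱ P) ℱ M P) (t : ℝ≥0) :
    ∃ M' : Ω → ℝ, StronglyMeasurable[ℱ t] M' ∧ M t =ᵐ[P] M' := by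
  obtain ⟨τ, hτ, hmart⟩ := hM
  refine ⟨fun ω => limUnder atTop fun n =>
    stoppedProcess (fun i => {ω | ⊥ < τ n ω}.indicator (M i)) (τ n) t ω,
    @StronglyMeasurable.limUnder _ _ _ (ℱ t) _ _ _ _ _ _ _ fun n => (hmart n).1 t, ?_⟩
  filter_upwards [hτ.tendsto_top] with ω hω
  refine (Tendsto.limUnder_eq ?_).symm
  refine tendsto_const_nhds.congr' ?_
  filter_upwards [hω.eventually (lt_mem_nhds (WithTop.coe_lt_top t))] with n hn
  exact (stoppedProcess_indicator_of_lt hn).symm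

lemma aemeasurable_of_exists_adapted {f : Ω → ℝ} {t : ℝ≥0}
    (h : ∃ f' : Ω → ℝ, StronglyMeasurable[ℱ t] f' ∧ f =ᵐ[P] f') : AEMeasurable f P := by
  obtain ⟨f', h1, h2⟩ := h
  exact ⟨f', (h1.mono (ℱ.le t)).measurable, h2⟩

variable [IsProbabilityMeasure P]

/-- A countable family which is almost surely bounded is uniformly bounded outside of a set of small
probability. -/
lemma exists_measure_not_abs_le {ι : Type*} [Countable ι] {f : ι → Ω → ℝ}
    (hf : ∀ i, AEMeasurable (f i) P) (hb : ∀ᵐ ω ∂P, ∃ m : ℝ, ∀ i, |f i ω| ≤ m) {η : ℝ≥0∞}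
    (hη : 0 < η) : ∃ m : ℝ, 0 ≤ m ∧ P {ω | ¬ ∀ i, |f i ω| ≤ m} ≤ η := by
  let S : ℕ → Set Ω := fun m => {ω | ¬ ∀ i, |f i ω| ≤ m}
  have hSeq : ∀ m, S m = (⋂ i, {ω | |f i ω| ≤ m})ᶜ := fun m => by
    ext ω
    simp [S]
  have hS : ∀ m, NullMeasurableSet (S m) P := fun m => by
    rw [hSeq]
    refine (NullMeasurableSet.iInter fun i => ?_).compl
    exact nullMeasurableSet_le (continuous_abs.measurable.comp_aemeasurable (hf i)) aemeasurable_const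
  have hanti : Antitone S := fun a b hab ω hω h => hω fun i =>
    (h i).trans (Nat.cast_le.2 hab)
  have h0 : P (⋂ m, S m) = 0 := by
    refine measure_eq_zero_iff_ae_notMem.2 ?_
    filter_upwards [hb] with ω hω hmem
    obtain ⟨m, hm⟩ := hω
    obtain ⟨N, hN⟩ := exists_nat_ge m
    exact mem_iInter.1 hmem N fun i => (hm i).trans hN
  have ht := tendsto_measure_iInter_atTop hS hanti ⟨0, measure_ne_top _ _⟩
  rw [h0] at ht
  obtain ⟨N, hN⟩ := (ht.eventually_le_const hη).exists
  exact ⟨N, Nat.cast_nonneg N, hN⟩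

lemma integral_mul_martingale_sub {N : ℝ≥0 → Ω → ℝ} (hN : Martingale N ℱ P) {s t : ℝ≥0}
    (hst : s ≤ t) {a : Ω → ℝ} (ha : StronglyMeasurable[ℱ s] a) {C : ℝ} (hC : ∀ ω, |a ω| ≤ C) :
    ∫ ω, a ω * (N t ω - N s ω) ∂P = 0 := by
  have hi : Integrable (fun ω => N t ω - N s ω) P := (hN.integrable t).sub (hN.integrable s)
  have h1 := condExp_stronglyMeasurable_mul_of_bound (ℱ.le s) ha hi C (Eventually.of_forall hC)
  have h2 : P[fun ω => N t ω - N s ω | ℱ s] =ᵐ[P] 0 := by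
    have h3 := condExp_sub (hN.integrable t) (hN.integrable s) (ℱ s)
    refine h3.trans ?_
    filter_upwards [hN.2 s t hst, hN.2 s s le_rfl] with ω h4 h5
    simp [h4, h5]
  have h6 : ∫ ω, (a * fun ω => N t ω - N s ω) ω ∂P = 0 := by
    rw [← integral_condExp (ℱ.le s), integral_congr_ae h1]
    have : (a * P[fun ω => N t ω - N s ω | ℱ s]) =ᵐ[P] 0 := by
      filter_upwards [h2] with ω hω
      simp [hω]
    rw [integral_congr_ae this]
    simp
  exact h6

/-- The truncated quadratic variation of a martingale, in the sense of the Bregman divergence of the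
Huber function, is controlled by the first moment of its final value. -/
lemma integral_huber_sum_le {N : ℝ≥0 → Ω → ℝ} (hN : Martingale N ℱ P) {m : ℝ} (hm : 0 ≤ m)
    {π : ℕ → ℝ≥0} (hπ : Monotone π) (K : ℕ) :
    Integrable (fun ω => ∑ k ∈ Finset.range K, (clip m (N (π (k + 1)) ω) - clip m (N (π k) ω))
        * (2 * N (π (k + 1)) ω - clip m (N (π (k + 1)) ω) - clip m (N (π k) ω))) P ∧
      ∫ ω, ∑ k ∈ Finset.range K, (clip m (N (π (k + 1)) ω) - clip m (N (π k) ω))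
        * (2 * N (π (k + 1)) ω - clip m (N (π (k + 1)) ω) - clip m (N (π k) ω)) ∂P
      ≤ 2 * m * ∫ ω, |N (π K) ω| ∂P := by
  have hcm : ∀ t, StronglyMeasurable[ℱ t] fun ω => clip m (N t ω) := fun t =>
    (continuous_clip m).comp_stronglyMeasurable (hN.1 t)
  have hcb : ∀ t ω, |clip m (N t ω)| ≤ m := fun t ω => abs_clip_le hm _
  have hci : ∀ t, Integrable (fun ω => clip m (N t ω)) P := fun t =>
    Integrable.of_bound ((hcm t).mono (ℱ.le t)).aestronglyMeasurable m
      (Eventually.of_forall (hcb t))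
  have hNc : ∀ s t, Integrable (fun ω => N s ω * clip m (N t ω)) P := fun s t =>
    (hN.integrable s).mul_bdd (c := m) ((hcm t).mono (ℱ.le t)).aestronglyMeasurable
      (Eventually.of_forall (hcb t))
  have hcc : ∀ t, Integrable (fun ω => clip m (N t ω) ^ 2) P := fun t => by
    simpa only [sq] using (hci t).mul_bdd (c := m) ((hcm t).mono (ℱ.le t)).aestronglyMeasurable
      (Eventually.of_forall (hcb t))
  have hH : ∀ t, Integrable (fun ω => 2 * N t ω * clip m (N t ω) - clip m (N t ω) ^ 2) P :=
    fun t => by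
      simp only [mul_assoc]
      exact ((hNc t t).const_mul 2).sub (hcc t)
  have hM : ∀ s t, Integrable (fun ω => clip m (N s ω) * (N t ω - N s ω)) P := fun s t =>
    ((hN.integrable t).sub (hN.integrable s)).bdd_mul (c := m)
      ((hcm s).mono (ℱ.le s)).aestronglyMeasurable (Eventually.of_forall (hcb s))
  -- The Bregman divergences telescope, up to martingale increments.
  have hterm : ∀ ω, ∑ k ∈ Finset.range K, (clip m (N (π (k + 1)) ω) - clip m (N (π k) ω))
        * (2 * N (π (k + 1)) ω - clip m (N (π (k + 1)) ω) - clip m (N (π k) ω))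
      = ((2 * N (π K) ω * clip m (N (π K) ω) - clip m (N (π K) ω) ^ 2)
        - (2 * N (π 0) ω * clip m (N (π 0) ω) - clip m (N (π 0) ω) ^ 2))
        - ∑ k ∈ Finset.range K, 2 * (clip m (N (π k) ω) * (N (π (k + 1)) ω - N (π k) ω)) := by
    intro ω
    rw [← Finset.sum_range_sub
      fun k => 2 * N (π k) ω * clip m (N (π k) ω) - clip m (N (π k) ω) ^ 2,
      ← Finset.sum_sub_distrib]
    refine Finset.sum_congr rfl fun k _ => ?_
    ring
  simp only [hterm]
  have i1 : Integrable (fun ω => (2 * N (π K) ω * clip m (N (π K) ω) - clip m (N (π K) ω) ^ 2)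
      - (2 * N (π 0) ω * clip m (N (π 0) ω) - clip m (N (π 0) ω) ^ 2)) P := (hH _).sub (hH _)
  have i2 : ∀ k ∈ Finset.range K, Integrable
      (fun ω => 2 * (clip m (N (π k) ω) * (N (π (k + 1)) ω - N (π k) ω))) P :=
    fun k _ => (hM _ _).const_mul 2
  refine ⟨i1.sub (integrable_finsetSum _ i2), ?_⟩
  rw [integral_sub i1 (integrable_finsetSum _ i2), integral_finsetSum _ i2,
    integral_sub (hH _) (hH _), Finset.sum_eq_zero fun k _ => ?_, sub_zero]
  · have h1 : ∫ ω, (2 * N (π K) ω * clip m (N (π K) ω) - clip m (N (π K) ω) ^ 2) ∂P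
        ≤ ∫ ω, 2 * m * |N (π K) ω| ∂P :=
      integral_mono (hH _) ((hN.integrable _).abs.const_mul _) fun ω => huber_le hm _
    rw [integral_const_mul] at h1
    have h2 : 0 ≤ ∫ ω, (2 * N (π 0) ω * clip m (N (π 0) ω) - clip m (N (π 0) ω) ^ 2) ∂P :=
      integral_nonneg fun ω => huber_nonneg hm _
    linarith
  · rw [integral_const_mul, integral_mul_martingale_sub hN (hπ (Nat.le_succ k)) (hcm _) (hcb _),
      mul_zero]

lemma exists_measure_le_stopping {τ : ℕ → Ω → WithTop ℝ≥0} (hτ : IsLocalizingSequence ℱ τ P)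
    (t : ℝ≥0) {η : ℝ≥0∞} (hη : 0 < η) : ∃ n, P {ω | τ n ω ≤ t} ≤ η := by
  have h : Tendsto (fun n => P {ω | τ n ω ≤ t}) atTop (𝓝 (P ∅)) := by
    refine tendsto_measure_of_ae_tendsto_indicator_of_isFiniteMeasure atTop MeasurableSet.empty
      (fun n => ℱ.le t _ (hτ.isStoppingTime n t)) ?_
    filter_upwards [hτ.tendsto_top] with ω hω
    filter_upwards [hω.eventually (lt_mem_nhds (WithTop.coe_lt_top t))] with n hn
    exact iff_of_false (not_le.2 hn) (notMem_empty ω)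
  rw [measure_empty] at h
  exact (h.eventually_le_const hη).exists

/-- The dyadic quadratic variations of a continuous local martingale are bounded in probability. -/
lemma isTightSeq_quadVar_of_locally {M : ℝ≥0 → Ω → ℝ}
    (hcont : ∀ᵐ ω ∂P, Continuous fun t => M t ω)
    (hM : Locally (fun N => Martingale N ℱ P) ℱ M P) : IsTightSeq P (quadVar M T) := by
  have hmeas : ∀ t, AEMeasurable (M t) P := fun t =>
    aemeasurable_of_exists_adapted (exists_adapted_of_locally hM t)
  obtain ⟨τ, hτ, hmart⟩ := hM
  intro η hη
  have hη3 : 0 < η / 3 := ENNReal.div_pos hη.ne' (by simp)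
  obtain ⟨j, hj⟩ := exists_measure_le_stopping hτ T hη3
  obtain ⟨m, hm0, hm⟩ := exists_measure_not_abs_le (P := P) (f := fun q : ℕ × ℕ => M (min T (gridPt T q.1 q.2)))
    (fun q => hmeas _) (by
      filter_upwards [hcont] with ω hω
      obtain ⟨c, hc⟩ := (isCompact_Icc (a := (0 : ℝ≥0)) (b := T)).exists_bound_of_continuousOn
        hω.continuousOn
      exact ⟨c, fun q => hc _ ⟨zero_le, min_le_left _ _⟩⟩) hη3
  set N := stoppedProcess (fun i => {ω | ⊥ < τ j ω}.indicator (M i)) (τ j) with hN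
  obtain ⟨l, hl0, hl⟩ : ∃ l : ℝ, 0 < l ∧
      ENNReal.ofReal ((2 * m * ∫ ω, |N T ω| ∂P) / l) ≤ η / 3 := by
    have h1 : Tendsto (fun l : ℝ => ENNReal.ofReal ((2 * m * ∫ ω, |N T ω| ∂P) / l)) atTop (𝓝 0) := by
      have := ENNReal.tendsto_ofReal
        (tendsto_const_nhds (x := 2 * m * ∫ ω, |N T ω| ∂P).div_atTop tendsto_id)
      simpa using this
    exact ((eventually_gt_atTop 0).and (h1.eventually_le_const hη3)).exists
  -- Off a small event, `M` is not stopped before `T` and stays in `[-m, m]`, where the Bregman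
  -- divergence of the Huber function is the squared increment.
  refine ⟨l, hl0, fun n => ?_⟩
  obtain ⟨hi, hle⟩ := integral_huber_sum_le (hmart j) hm0 (gridPt_mono (T := T) n) (2 ^ n)
  rw [gridPt_last] at hle
  have h3 := measure_ge_le_integral_div hi
    (fun ω => Finset.sum_nonneg fun k _ => huber_bregman_nonneg hm0 _ _) hl0
  calc P {ω | l ≤ |quadVar M T n ω|}
      ≤ P (({ω | τ j ω ≤ T} ∪ {ω | ¬ ∀ q : ℕ × ℕ, |M (min T (gridPt T q.1 q.2)) ω| ≤ m}) ∪
          {ω | l ≤ |∑ k ∈ Finset.range (2 ^ n),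
            (clip m (N (gridPt T n (k + 1)) ω) - clip m (N (gridPt T n k) ω))
              * (2 * N (gridPt T n (k + 1)) ω - clip m (N (gridPt T n (k + 1)) ω)
                - clip m (N (gridPt T n k) ω))|}) := by
        refine measure_mono fun ω hω => ?_
        by_contra hcon
        rw [mem_union, mem_union, not_or, not_or] at hcon
        obtain ⟨⟨h4, h5⟩, h6⟩ := hcon
        have h5' : ∀ q : ℕ × ℕ, |M (min T (gridPt T q.1 q.2)) ω| ≤ m := not_not.1 h5
        have h4' : (T : WithTop ℝ≥0) < τ j ω := not_le.1 h4
        refine h6 ?_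
        rw [mem_ofPred_eq] at hω ⊢
        refine le_trans hω (le_of_eq ?_)
        have key : ∀ k ≤ 2 ^ n, N (gridPt T n k) ω = M (gridPt T n k) ω ∧
            clip m (M (gridPt T n k) ω) = M (gridPt T n k) ω := by
          intro k hk
          refine ⟨stoppedProcess_indicator_of_lt (lt_of_le_of_lt ?_ h4'), clip_of_abs_le ?_⟩
          · exact WithTop.coe_le_coe.2 (gridPt_le hk)
          · have := h5' (n, k)
            rwa [min_eq_right (gridPt_le hk)] at this
        congr 1
        refine Finset.sum_congr rfl fun k hk => ?_
        have hk' := Finset.mem_range.1 hk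
        rw [(key k hk'.le).1, (key (k + 1) hk').1, (key k hk'.le).2, (key (k + 1) hk').2]
        ring
    _ ≤ (η / 3 + η / 3) + η / 3 := by
        refine (measure_union_le _ _).trans (add_le_add ((measure_union_le _ _).trans
          (add_le_add hj hm)) (h3.trans (le_trans ?_ hl)))
        exact ENNReal.ofReal_le_ofReal (div_le_div_of_nonneg_right hle hl0.le)
    _ = η := ENNReal.add_thirds η

/-- The dyadic quadratic variations of a process with paths of bounded variation are bounded in
probability. -/
lemma isTightSeq_quadVar_of_boundedVariation {A : ℝ≥0 → Ω → ℝ}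
    (hmeas : ∀ t, AEMeasurable (A t) P)
    (hA : ∀ᵐ ω ∂P, BoundedVariationOn (fun t => A t ω) (Iic T)) : IsTightSeq P (quadVar A T) := by
  intro η hη
  obtain ⟨m, hm0, hm⟩ := exists_measure_not_abs_le (P := P) (f := quadVar A T)
    (fun n => Finset.aemeasurable_fun_sum _ fun k _ => ((hmeas _).sub (hmeas _)).pow_const 2) (by
      filter_upwards [hA] with ω hω
      refine ⟨(eVariationOn (fun t => A t ω) (Iic T)).toReal ^ 2, fun n => ?_⟩
      rw [abs_of_nonneg (quadVar_nonneg _ _ _ _)]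
      have h1 : ∑ k ∈ Finset.range (2 ^ n), |A (gridPt T n (k + 1)) ω - A (gridPt T n k) ω|
          ≤ (eVariationOn (fun t => A t ω) (Iic T)).toReal := by
        have h2 := eVariationOn.sum_le_of_monotoneOn_Iic (f := fun t => A t ω) (s := Iic T)
          (n := 2 ^ n) (u := gridPt T n) ((gridPt_mono n).monotoneOn _) fun i hi => gridPt_le hi
        have h3 := ENNReal.toReal_mono hω h2
        rw [ENNReal.toReal_sum fun k _ => edist_ne_top _ _] at h3
        refine le_of_eq_of_le (Finset.sum_congr rfl fun k _ => ?_) h3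
        rw [edist_dist, ENNReal.toReal_ofReal dist_nonneg, Real.dist_eq]
      have h4 : quadVar A T n ω
          ≤ (∑ k ∈ Finset.range (2 ^ n), |A (gridPt T n (k + 1)) ω - A (gridPt T n k) ω|) ^ 2 := by
        unfold quadVar
        simp only [← sq_abs (A _ ω - A _ ω)]
        exact Finset.sum_sq_le_sq_sum_of_nonneg fun k _ => abs_nonneg _
      exact h4.trans (pow_le_pow_left₀ (Finset.sum_nonneg fun k _ => abs_nonneg _) h1 2)) hη
  refine ⟨m + 1, by positivity, fun n => (measure_mono fun ω hω h => ?_).trans hm⟩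
  have h1 : m + 1 ≤ |quadVar A T n ω| := hω
  linarith [h n]

end QuadVar

/-! ### Bounded regular processes -/

section Regular

variable {Ω : Type*} [mΩ : MeasurableSpace Ω] {P : Measure Ω} {ℱ : Filtration ℝ≥0 mΩ} {T : ℝ≥0}

/-- An adapted process on `[0, T]`, bounded by `C`, continuous in `L²(Ω)`, whose quadratic variations
along dyadic grids are bounded in probability. -/
structure IsRegularProcess (P : Measure Ω) (ℱ : Filtration ℝ≥0 mΩ) (T : ℝ≥0) (C : ℝ)
    (X : ℝ≥0 → Ω → ℝ) : Prop where
  adapted : ∀ t ≤ T, StronglyMeasurable[ℱ t] (X t)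
  abs_le : ∀ t ω, |X t ω| ≤ C
  continuous : ∀ ε : ℝ, 0 < ε → ∃ δ : ℝ, 0 < δ ∧ ∀ s t : ℝ≥0, s ≤ T → t ≤ T → dist s t < δ →
    ∫ ω, (X t ω - X s ω) ^ 2 ∂P ≤ ε
  tight : IsTightSeq P (quadVar X T)

lemma IsRegularProcess.aestronglyMeasurable {C : ℝ} {X : ℝ≥0 → Ω → ℝ}
    (hX : IsRegularProcess P ℱ T C X) {t : ℝ≥0} (ht : t ≤ T) : AEStronglyMeasurable (X t) P :=
  ((hX.adapted t ht).mono (ℱ.le t)).aestronglyMeasurable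

/-- A continuous semimartingale which is bounded at each time has a bounded regular version. -/
lemma exists_isRegularProcess [IsProbabilityMeasure P] {X : ℝ≥0 → Ω → ℝ}
    (hX : IsContSemimartingale ℱ T P X) {C : ℝ} (hC0 : 0 ≤ C)
    (hC : ∀ t ≤ T, ∀ᵐ ω ∂P, |X t ω| ≤ C) :
    ∃ Z, IsRegularProcess P ℱ T C Z ∧ ∀ t ≤ T, Z t =ᵐ[P] X t := by
  obtain ⟨M, A, hMc, hMl, hA, hAc, hXe⟩ := hX
  choose M' hM' hMM' using exists_adapted_of_locally hMl
  have hZe : ∀ t, (fun ω => clip C (M' t ω + A t ω)) =ᵐ[P] fun ω => clip C (M t ω + A t ω) := by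
    intro t
    filter_upwards [hMM' t] with ω hω
    rw [hω]
  have hZa : ∀ t, StronglyMeasurable[ℱ t] fun ω => clip C (M' t ω + A t ω) := fun t =>
    (continuous_clip C).comp_stronglyMeasurable ((hM' t).add (hA t))
  refine ⟨fun t ω => clip C (M' t ω + A t ω), ⟨fun t _ => hZa t, fun t ω => abs_clip_le hC0 _,
    fun ε hε => ?_, ?_⟩, fun t ht => ?_⟩
  -- uniform continuity in `L²`, by dominated convergence and compactness of `[0, T]²`
  · let g : ℝ≥0 × ℝ≥0 → ℝ := fun q =>
      ∫ ω, (clip C (M q.2 ω + A q.2 ω) - clip C (M q.1 ω + A q.1 ω)) ^ 2 ∂P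
    have hg : ContinuousOn g (Icc 0 T ×ˢ Icc 0 T) := by
      refine continuousOn_of_dominated (bound := fun _ => (2 * C) ^ 2) (fun q _ => ?_)
        (fun q _ => ?_) (integrable_const _) ?_
      · have h1 : ∀ t, AEStronglyMeasurable (fun ω => clip C (M t ω + A t ω)) P := fun t =>
          (((hZa t).mono (ℱ.le t)).aestronglyMeasurable).congr (hZe t)
        exact ((h1 _).sub (h1 _)).pow 2
      · refine Eventually.of_forall fun ω => ?_
        rw [Real.norm_eq_abs, abs_pow]
        refine pow_le_pow_left₀ (abs_nonneg _) ((abs_sub _ _).trans ?_) 2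
        linarith [abs_clip_le hC0 (M q.2 ω + A q.2 ω), abs_clip_le hC0 (M q.1 ω + A q.1 ω)]
      · filter_upwards [hMc, hAc] with ω h1 h2
        have h3 : ContinuousOn (fun t => clip C (M t ω + A t ω)) (Icc 0 T) :=
          (continuous_clip C).comp_continuousOn
            (h1.continuousOn.add (h2.1.mono fun t ht => ht.2))
        have h4 : ContinuousOn (fun q : ℝ≥0 × ℝ≥0 => clip C (M q.2 ω + A q.2 ω))
          (Icc 0 T ×ˢ Icc 0 T) := h3.comp continuousOn_snd fun q hq => hq.2
        have h5 : ContinuousOn (fun q : ℝ≥0 × ℝ≥0 => clip C (M q.1 ω + A q.1 ω))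
          (Icc 0 T ×ˢ Icc 0 T) := h3.comp continuousOn_fst fun q hq => hq.1
        exact (h4.sub h5).pow 2
    have hu := (isCompact_Icc.prod isCompact_Icc).uniformContinuousOn_of_continuous hg
    rw [Metric.uniformContinuousOn_iff] at hu
    obtain ⟨δ, hδ, h⟩ := hu ε hε
    refine ⟨δ, hδ, fun s t hs ht hst => ?_⟩
    have h1 := h (s, t) ⟨⟨zero_le, hs⟩, zero_le, ht⟩ (s, s) ⟨⟨zero_le, hs⟩, zero_le, hs⟩ (by
      rw [Prod.dist_eq]
      simp only [dist_self]
      rw [dist_comm]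
      exact max_lt hδ hst)
    have h2 : g (s, s) = 0 := by simp [g]
    rw [h2, Real.dist_eq, sub_zero] at h1
    refine le_trans (le_of_eq ?_) ((le_abs_self _).trans h1.le)
    refine integral_congr_ae ?_
    filter_upwards [hZe s, hZe t] with ω h3 h4
    rw [h3, h4]
  · have hM2 := isTightSeq_quadVar_of_locally (T := T) hMc hMl
    have hA2 := isTightSeq_quadVar_of_boundedVariation (P := P) (T := T)
      (fun t => ((hA t).mono (ℱ.le t)).measurable.aemeasurable) (hAc.mono fun ω h => h.2)
    refine ((hM2.add hM2).add (hA2.add hA2)).mono fun n => ?_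
    have hall : ∀ᵐ ω ∂P, ∀ k, clip C (M' (gridPt T n k) ω + A (gridPt T n k) ω)
        = clip C (M (gridPt T n k) ω + A (gridPt T n k) ω) := ae_all_iff.2 fun k => hZe _
    filter_upwards [hall] with ω hω
    have h0 := quadVar_nonneg M T n ω
    have h0' := quadVar_nonneg A T n ω
    rw [abs_of_nonneg (quadVar_nonneg _ T n ω), abs_of_nonneg (by positivity)]
    unfold quadVar
    rw [← Finset.sum_add_distrib, ← Finset.sum_add_distrib, ← Finset.sum_add_distrib]
    refine Finset.sum_le_sum fun k _ => ?_
    beta_reduce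
    rw [hω, hω, ← sq_abs]
    refine (pow_le_pow_left₀ (abs_nonneg _) (abs_clip_sub_le C _ _) 2).trans ?_
    rw [sq_abs]
    nlinarith [sq_nonneg ((M (gridPt T n (k + 1)) ω - M (gridPt T n k) ω)
      - (A (gridPt T n (k + 1)) ω - A (gridPt T n k) ω))]
  · filter_upwards [hZe t, hXe, hC t ht] with ω h1 h2 h3
    rw [h1, ← h2 t ht, clip_of_abs_le h3]

end Regular

/-! ### Blocks of increments -/

section Block

variable {Ω : Type*} [mΩ : MeasurableSpace Ω] {d : ℕ} {P : Measure Ω} {T : ℝ≥0}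
  {B : ℝ≥0 → Ω → Eucl d}

lemma IsTightSeq.comp {Q : ℕ → Ω → ℝ} (hQ : IsTightSeq P Q) (f : ℕ → ℕ) :
    IsTightSeq P fun n => Q (f n) := fun η hη => by
  obtain ⟨l, hl0, hl⟩ := hQ η hη
  exact ⟨l, hl0, fun n => hl (f n)⟩

/-- The indices at level `m + j` of the intervals contained in the `k`-th interval of level `m`. -/
def block (j k : ℕ) : Finset ℕ := Finset.Ico (k * 2 ^ j) ((k + 1) * 2 ^ j)

lemma card_block (j k : ℕ) : (block j k).card = 2 ^ j := by
  unfold block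
  rw [Nat.card_Ico, Nat.succ_mul, Nat.add_sub_cancel_left]

lemma lt_of_mem_block {m j k l : ℕ} (hk : k < 2 ^ m) (hl : l ∈ block j k) : l < 2 ^ (m + j) := by
  rw [pow_add]
  exact (Finset.mem_Ico.1 hl).2.trans_le (Nat.mul_le_mul_right _ hk)

lemma sum_block (f : ℕ → ℝ) (m j : ℕ) :
    ∑ l ∈ Finset.range (2 ^ (m + j)), f l = ∑ k ∈ Finset.range (2 ^ m), ∑ l ∈ block j k, f l := by
  rw [pow_add, sum_range_mul_eq]
  rfl

lemma gridPt_le_of_mem_block {m j k l : ℕ} (hl : l ∈ block j k) :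
    gridPt T m k ≤ gridPt T (m + j) l := by
  rw [← gridPt_refine m j k]
  exact gridPt_mono _ (Finset.mem_Ico.1 hl).1

lemma dist_gridPt_of_mem_block {m j k l : ℕ} (hl : l ∈ block j k) :
    dist (gridPt T m k) (gridPt T (m + j) l) ≤ mesh T m := by
  have h1 : (gridPt T m k : ℝ) ≤ gridPt T (m + j) l := by exact_mod_cast gridPt_le_of_mem_block hl
  have h2 : (gridPt T (m + j) l : ℝ) ≤ gridPt T m (k + 1) := by
    rw [← gridPt_refine m j (k + 1)]
    exact_mod_cast gridPt_mono _ (Finset.mem_Ico.1 hl).2.le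
  have h3 := coe_gridPt_succ_sub (T := T) m k
  rw [NNReal.dist_eq, abs_le]
  constructor <;> linarith [(mesh T m).coe_nonneg]

lemma two_pow_mul_mesh_add (m j : ℕ) : (2 : ℝ) ^ j * mesh T (m + j) = mesh T m := by
  unfold mesh
  push_cast
  rw [pow_add]
  field_simp

lemma integrable_incr_pow_four (hB : IsBrownianMotionOn B T P) {n k : ℕ} (hk : k < 2 ^ n)
    (i : Fin d) : Integrable (fun ω => incr B T n k ω i ^ 4) P :=
  (measurePreserving_incr hB hk).integrable_comp_of_integrable (integrable_pow_four_gaussPi _ i)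

lemma memLp_incr (hB : IsBrownianMotionOn B T P) {n k : ℕ} (hk : k < 2 ^ n) (i : Fin d) :
    MemLp (fun ω => incr B T n k ω i) 2 P :=
  memLp_comp_incr hB hk (memLp_coord_gaussPi _ i (by simp))

lemma integral_incr_sq (hB : IsBrownianMotionOn B T P) {n k : ℕ} (hk : k < 2 ^ n) (i : Fin d) :
    ∫ ω, incr B T n k ω i ^ 2 ∂P = mesh T n := by
  rw [integral_comp_incr hB hk (f := fun x => x i ^ 2) (by fun_prop),
    integral_coord_gaussPi (f := fun y => y ^ 2) _ i (by fun_prop), integral_sq_gaussianReal]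

lemma integral_incr_pow_four (hB : IsBrownianMotionOn B T P) {n k : ℕ} (hk : k < 2 ^ n)
    (i : Fin d) : ∫ ω, incr B T n k ω i ^ 4 ∂P = fourthMoment * mesh T n ^ 2 := by
  rw [integral_comp_incr hB hk (f := fun x => x i ^ 4) (by fun_prop),
    integral_coord_gaussPi (f := fun y => y ^ 4) _ i (by fun_prop), integral_pow_four_gaussianReal]

lemma isTightSeq_sum_incr_sq (hB : IsBrownianMotionOn B T P) (i : Fin d) :
    IsTightSeq P fun n ω => ∑ k ∈ Finset.range (2 ^ n), incr B T n k ω i ^ 2 := by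
  have hi : ∀ n, ∀ k ∈ Finset.range (2 ^ n), Integrable (fun ω => incr B T n k ω i ^ 2) P :=
    fun n k hk => (memLp_incr hB (Finset.mem_range.1 hk) i).integrable_sq
  refine isTightSeq_of_integral_le (K := T) (fun n => integrable_finsetSum _ (hi n))
    (fun n ω => Finset.sum_nonneg fun k _ => sq_nonneg _) fun n => ?_
  rw [integral_finsetSum _ (hi n), Finset.sum_congr rfl fun k hk =>
    integral_incr_sq hB (Finset.mem_range.1 hk) i]
  simp only [Finset.sum_const, Finset.card_range, nsmul_eq_mul]
  push_cast
  rw [two_pow_mul_mesh]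

/-- Freezing the integrand at the left end of the coarse intervals: the block errors are small by
`L²`-continuity and the Itô isometry. -/
lemma tendsto_block_adapted [IsProbabilityMeasure P] (hB : IsBrownianMotionOn B T P) {C : ℝ}
    {W : ℝ≥0 → Ω → ℝ} (hW : IsRegularProcess P (brownianFiltration B T P) T C W) (J : ℕ → ℕ)
    (i : Fin d) :
    TendstoInMeasure P (fun m ω => ∑ k ∈ Finset.range (2 ^ m), (∑ l ∈ block (J m) k,
      (W (gridPt T (m + J m) l) ω - W (gridPt T m k) ω) * incr B T (m + J m) l ω i) ^ 2)
      atTop (fun _ => 0) := by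
  have hadapt : ∀ m k, k < 2 ^ m → ∀ l ∈ block (J m) k,
      StronglyMeasurable[brownianFiltration B T P (gridPt T (m + J m) l)]
        fun ω => W (gridPt T (m + J m) l) ω - W (gridPt T m k) ω := fun m k hk l hl =>
    (hW.adapted _ (gridPt_le (lt_of_mem_block hk hl).le)).sub
      ((hW.adapted _ (gridPt_le hk.le)).mono
        ((brownianFiltration B T P).mono (gridPt_le_of_mem_block hl)))
  have hbd : ∀ m k, ∀ l ∈ block (J m) k, ∀ ω,
      |W (gridPt T (m + J m) l) ω - W (gridPt T m k) ω| ≤ 2 * C := fun m k l _ ω => by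
    refine (abs_sub _ _).trans ?_
    linarith [hW.abs_le (gridPt T (m + J m) l) ω, hW.abs_le (gridPt T m k) ω]
  have hint : ∀ m, ∀ k ∈ Finset.range (2 ^ m), Integrable (fun ω => (∑ l ∈ block (J m) k,
      (W (gridPt T (m + J m) l) ω - W (gridPt T m k) ω) * incr B T (m + J m) l ω i) ^ 2) P := by
    intro m k hk
    have hk' := Finset.mem_range.1 hk
    exact (memLp_sum_mul_incr hB (memLp_coord_gaussPi _ i (by simp)) (block (J m) k)
      (fun l hl => lt_of_mem_block hk' hl)
      (fun l hl => ((hadapt m k hk' l hl).mono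
        ((brownianFiltration B T P).le _)).aestronglyMeasurable) (hbd m k)).integrable_sq
  refine tendsto_zero_of_integral (fun m => integrable_finsetSum _ (hint m))
    (fun m ω => Finset.sum_nonneg fun k _ => sq_nonneg _) ?_
  rw [Metric.tendsto_atTop]
  intro ε hε
  obtain ⟨δ, hδ, hmod⟩ := hW.continuous (ε / (2 * (T + 1))) (by positivity)
  have hmesh := (NNReal.tendsto_coe.2 (tendsto_mesh T)).eventually (gt_mem_nhds hδ)
  obtain ⟨m₀, hm₀⟩ := eventually_atTop.1 hmesh
  refine ⟨m₀, fun m hm => ?_⟩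
  have h1 : ∀ k ∈ Finset.range (2 ^ m), ∫ ω, (∑ l ∈ block (J m) k,
      (W (gridPt T (m + J m) l) ω - W (gridPt T m k) ω) * incr B T (m + J m) l ω i) ^ 2 ∂P
      ≤ ε / (2 * (T + 1)) * mesh T m := by
    intro k hk
    have hk' := Finset.mem_range.1 hk
    rw [integral_sum_mul_incr_coord_sq hB i (block (J m) k) (fun l hl => lt_of_mem_block hk' hl)
      (hadapt m k hk') (hbd m k)]
    calc ∑ l ∈ block (J m) k, (∫ ω, (W (gridPt T (m + J m) l) ω - W (gridPt T m k) ω) ^ 2 ∂P)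
          * mesh T (m + J m)
        ≤ ∑ l ∈ block (J m) k, ε / (2 * (T + 1)) * mesh T (m + J m) := by
          refine Finset.sum_le_sum fun l hl => mul_le_mul_of_nonneg_right ?_ (NNReal.coe_nonneg _)
          exact hmod _ _ (gridPt_le hk'.le) (gridPt_le (lt_of_mem_block hk' hl).le)
            ((dist_gridPt_of_mem_block hl).trans_lt (hm₀ m hm))
      _ = ε / (2 * (T + 1)) * mesh T m := by
          rw [Finset.sum_const, card_block, nsmul_eq_mul, ← two_pow_mul_mesh_add m (J m)]
          push_cast
          ring
  rw [Real.dist_eq, sub_zero, abs_of_nonneg (integral_nonneg fun ω =>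
    Finset.sum_nonneg fun k _ => sq_nonneg _), integral_finsetSum _ (hint m)]
  refine (Finset.sum_le_sum h1).trans_lt ?_
  rw [Finset.sum_const, Finset.card_range, nsmul_eq_mul]
  push_cast
  calc (2 : ℝ) ^ m * (ε / (2 * (T + 1)) * mesh T m)
      = ε / (2 * (T + 1)) * T := by rw [← two_pow_mul_mesh (T := T) m]; ring
    _ < ε := by
        have : (0 : ℝ) < 2 * (T + 1) := by positivity
        rw [div_mul_eq_mul_div, div_lt_iff₀ this]
        nlinarith [T.coe_nonneg]

/-- The symmetric corrections inside the coarse intervals are negligible, because the quadratic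
variation of `W` is bounded in probability. -/
lemma tendsto_block_cross (hB : IsBrownianMotionOn B T P)
    {W : ℝ≥0 → Ω → ℝ} (hW : IsTightSeq P (quadVar W T)) (J : ℕ → ℕ) (i : Fin d) :
    TendstoInMeasure P (fun m ω => ∑ k ∈ Finset.range (2 ^ m), (∑ l ∈ block (J m) k,
      (W (gridPt T (m + J m) (l + 1)) ω - W (gridPt T (m + J m) l) ω)
        * incr B T (m + J m) l ω i) ^ 2) atTop (fun _ => 0) := by
  have hi4 : ∀ m, ∀ k ∈ Finset.range (2 ^ m), ∀ l ∈ block (J m) k,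
      Integrable (fun ω => incr B T (m + J m) l ω i ^ 4) P := fun m k hk l hl =>
    integrable_incr_pow_four hB (lt_of_mem_block (Finset.mem_range.1 hk) hl) i
  -- By the Cauchy-Schwarz inequality in each block, then over the blocks, the square of the sum is
  -- at most the squared quadratic variation of `W` times the following quantity, whose mean is of the
  -- order of the mesh of level `m`.
  have hY : TendstoInMeasure P (fun m ω => ∑ k ∈ Finset.range (2 ^ m),
      2 ^ J m * ∑ l ∈ block (J m) k, incr B T (m + J m) l ω i ^ 4) atTop (fun _ => 0) := by
    have hi : ∀ m, ∀ k ∈ Finset.range (2 ^ m), Integrable (fun ω =>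
        2 ^ J m * ∑ l ∈ block (J m) k, incr B T (m + J m) l ω i ^ 4) P := fun m k hk =>
      (integrable_finsetSum _ (hi4 m k hk)).const_mul _
    refine tendsto_zero_of_integral (fun m => integrable_finsetSum _ (hi m))
      (fun m ω => Finset.sum_nonneg fun k _ => mul_nonneg (by positivity)
        (Finset.sum_nonneg fun l _ => by positivity)) ?_
    have hval : ∀ m, ∫ ω, ∑ k ∈ Finset.range (2 ^ m),
        2 ^ J m * ∑ l ∈ block (J m) k, incr B T (m + J m) l ω i ^ 4 ∂P
        = fourthMoment * T * mesh T m := by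
      intro m
      rw [integral_finsetSum _ (hi m)]
      have h1 : ∀ k ∈ Finset.range (2 ^ m), ∫ ω,
          2 ^ J m * ∑ l ∈ block (J m) k, incr B T (m + J m) l ω i ^ 4 ∂P
          = fourthMoment * mesh T m ^ 2 := by
        intro k hk
        rw [integral_const_mul, integral_finsetSum _ (hi4 m k hk), Finset.sum_congr rfl
          fun l hl => integral_incr_pow_four hB (lt_of_mem_block (Finset.mem_range.1 hk) hl) i,
          Finset.sum_const, card_block, nsmul_eq_mul, ← two_pow_mul_mesh_add m (J m)]
        push_cast
        ring
      rw [Finset.sum_congr rfl h1, Finset.sum_const, Finset.card_range, nsmul_eq_mul]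
      push_cast
      linear_combination fourthMoment * (mesh T m : ℝ) * two_pow_mul_mesh (T := T) m
    simp only [hval]
    have := (NNReal.tendsto_coe.2 (tendsto_mesh T)).const_mul (fourthMoment * T)
    simpa using this
  refine tendsto_zero_of_sq_le_mul hY (hW.comp fun m => m + J m).sq
    fun m => Eventually.of_forall fun ω => ?_
  set a : ℕ → ℝ := fun l => W (gridPt T (m + J m) (l + 1)) ω - W (gridPt T (m + J m) l) ω with ha
  set x : ℕ → ℝ := fun l => incr B T (m + J m) l ω i with hx
  have hqv : quadVar W T (m + J m) ω = ∑ k ∈ Finset.range (2 ^ m), ∑ l ∈ block (J m) k, a l ^ 2 :=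
    sum_block (fun l => a l ^ 2) m (J m)
  have h1 : ∑ k ∈ Finset.range (2 ^ m), (∑ l ∈ block (J m) k, a l * x l) ^ 2
      ≤ ∑ k ∈ Finset.range (2 ^ m),
        (∑ l ∈ block (J m) k, a l ^ 2) * ∑ l ∈ block (J m) k, x l ^ 2 :=
    Finset.sum_le_sum fun k _ => Finset.sum_mul_sq_le_sq_mul_sq _ _ _
  have h2 : ∑ k ∈ Finset.range (2 ^ m), (∑ l ∈ block (J m) k, a l ^ 2) ^ 2
      ≤ quadVar W T (m + J m) ω ^ 2 := by
    rw [hqv]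
    exact Finset.sum_sq_le_sq_sum_of_nonneg fun k _ => Finset.sum_nonneg fun l _ => sq_nonneg _
  have h3 : ∑ k ∈ Finset.range (2 ^ m), (∑ l ∈ block (J m) k, x l ^ 2) ^ 2
      ≤ ∑ k ∈ Finset.range (2 ^ m), 2 ^ J m * ∑ l ∈ block (J m) k, x l ^ 4 := by
    refine Finset.sum_le_sum fun k _ => ?_
    have h4 := sq_sum_le_card_mul_sum_sq (s := block (J m) k) (f := fun l => x l ^ 2)
    rw [card_block] at h4
    push_cast at h4
    simpa only [← pow_mul] using h4
  have h0 : 0 ≤ ∑ k ∈ Finset.range (2 ^ m), (∑ l ∈ block (J m) k, a l * x l) ^ 2 :=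
    Finset.sum_nonneg fun k _ => sq_nonneg _
  have h5 : 0 ≤ ∑ k ∈ Finset.range (2 ^ m), 2 ^ J m * ∑ l ∈ block (J m) k, x l ^ 4 :=
    Finset.sum_nonneg fun k _ => mul_nonneg (by positivity)
      (Finset.sum_nonneg fun l _ => by positivity)
  rw [abs_of_nonneg h5, abs_of_nonneg (sq_nonneg _)]
  calc (∑ k ∈ Finset.range (2 ^ m), (∑ l ∈ block (J m) k, a l * x l) ^ 2) ^ 2
      ≤ (∑ k ∈ Finset.range (2 ^ m),
        (∑ l ∈ block (J m) k, a l ^ 2) * ∑ l ∈ block (J m) k, x l ^ 2) ^ 2 :=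
        pow_le_pow_left₀ h0 h1 2
    _ ≤ _ := Finset.sum_mul_sq_le_sq_mul_sq _ _ _
    _ ≤ quadVar W T (m + J m) ω ^ 2
        * ∑ k ∈ Finset.range (2 ^ m), 2 ^ J m * ∑ l ∈ block (J m) k, x l ^ 4 :=
        mul_le_mul h2 h3 (Finset.sum_nonneg fun k _ => sq_nonneg _) (sq_nonneg _)
    _ = _ := mul_comm _ _

/-- A diagonal choice of levels: finitely many sequences converging in probability can be followed
up to an error which is summable over each level. -/
lemma exists_level_tendsto {e : ℕ → ℕ → ℕ → Ω → ℝ} {ρ : ℕ → ℕ → Ω → ℝ}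
    (h : ∀ m, ∀ k ∈ Finset.range (2 ^ m), TendstoInMeasure P (fun j => e m j k) atTop (ρ m k)) :
    ∃ J : ℕ → ℕ, TendstoInMeasure P (fun m ω => ∑ k ∈ Finset.range (2 ^ m),
      (e m (J m) k ω - ρ m k ω) ^ 2) atTop (fun _ => 0) := by
  -- at level `m` there are `2 ^ m` sequences: an error `2 ^ (-m)` off an event of probability
  -- `4 ^ (-m)` for each of them is summable over the level
  have hex : ∀ m, ∃ j, ∀ k ∈ Finset.range (2 ^ m),
      P {ω | (1 / 2 : ℝ) ^ m ≤ |e m j k ω - ρ m k ω|} ≤ (1 / 4) ^ m := by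
    intro m
    have : ∀ᶠ j in atTop, ∀ k ∈ Finset.range (2 ^ m),
        P {ω | (1 / 2 : ℝ) ^ m ≤ |e m j k ω - ρ m k ω|} ≤ (1 / 4) ^ m := by
      rw [Filter.eventually_all_finset]
      intro k hk
      have h1 := tendstoInMeasure_zero_iff.1 (tendstoInMeasure_sub_iff.1 (h m k hk))
        ((1 / 2 : ℝ) ^ m) (by positivity)
      exact h1.eventually_le_const (ENNReal.pow_pos (by simp) m)
    exact this.exists
  choose J hJ using hex
  refine ⟨J, ?_⟩
  rw [tendstoInMeasure_zero_iff]
  intro ε hε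
  have hlim : Tendsto (fun m : ℕ => ((1 : ℝ≥0∞) / 2) ^ m) atTop (𝓝 0) := by
    refine ENNReal.tendsto_pow_atTop_nhds_zero_of_lt_one ?_
    rw [one_div]
    exact ENNReal.one_half_lt_one
  have hlim' : Tendsto (fun m : ℕ => ((1 : ℝ) / 2) ^ m) atTop (𝓝 0) :=
    tendsto_pow_atTop_nhds_zero_of_lt_one (by norm_num) (by norm_num)
  refine tendsto_of_tendsto_of_tendsto_of_le_of_le' tendsto_const_nhds hlim
    (Eventually.of_forall fun _ => zero_le) ?_
  filter_upwards [hlim'.eventually (gt_mem_nhds hε)] with m hm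
  calc P {ω | ε ≤ |∑ k ∈ Finset.range (2 ^ m), (e m (J m) k ω - ρ m k ω) ^ 2|}
      ≤ P (⋃ k ∈ Finset.range (2 ^ m), {ω | (1 / 2 : ℝ) ^ m ≤ |e m (J m) k ω - ρ m k ω|}) := by
        refine measure_mono fun ω hω => ?_
        by_contra hcon
        simp only [mem_iUnion, mem_ofPred_eq, not_exists, not_le] at hcon
        have h1 : ∑ k ∈ Finset.range (2 ^ m), (e m (J m) k ω - ρ m k ω) ^ 2
            ≤ ∑ k ∈ Finset.range (2 ^ m), ((1 / 2 : ℝ) ^ m) ^ 2 := by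
          refine Finset.sum_le_sum fun k hk => ?_
          rw [← sq_abs]
          exact pow_le_pow_left₀ (abs_nonneg _) (hcon k hk).le 2
        rw [Finset.sum_const, Finset.card_range, nsmul_eq_mul] at h1
        have h2 : ((2 ^ m : ℕ) : ℝ) * ((1 / 2 : ℝ) ^ m) ^ 2 = (1 / 2) ^ m := by
          push_cast
          rw [sq, ← mul_assoc, ← mul_pow]
          norm_num
        have h3 : ε ≤ |∑ k ∈ Finset.range (2 ^ m), (e m (J m) k ω - ρ m k ω) ^ 2| := hω
        rw [abs_of_nonneg (Finset.sum_nonneg fun k _ => sq_nonneg _)] at h3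
        linarith
    _ ≤ ∑ k ∈ Finset.range (2 ^ m), P {ω | (1 / 2 : ℝ) ^ m ≤ |e m (J m) k ω - ρ m k ω|} :=
        measure_biUnion_finset_le _ _
    _ ≤ ∑ k ∈ Finset.range (2 ^ m), (1 / 4 : ℝ≥0∞) ^ m := Finset.sum_le_sum (hJ m)
    _ = (1 / 2) ^ m := by
        rw [Finset.sum_const, Finset.card_range, nsmul_eq_mul]
        push_cast
        rw [← mul_pow]
        congr 1
        rw [one_div, one_div, show (4 : ℝ≥0∞) = 2 * 2 by norm_num,
          ENNReal.mul_inv (by simp) (by simp), ← mul_assoc,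
          ENNReal.mul_inv_cancel (by simp) (by simp), one_mul]

end Block

/-! ### Covariation with the Brownian motion -/

section Covariation

variable {Ω : Type*} [mΩ : MeasurableSpace Ω] {d : ℕ} {P : Measure Ω} {T : ℝ≥0}
  {B : ℝ≥0 → Ω → Eucl d}

lemma stratonovichSum_block {Ω : Type*} {d : ℕ} (B : ℝ≥0 → Ω → Eucl d) (T : ℝ≥0)
    (W : ℝ≥0 → Ω → ℝ) (i : Fin d) (m j k : ℕ) (ω : Ω) :
    stratonovichSum W (fun s ω => B s ω i) ((k + 1) * 2 ^ j) (gridPt T (m + j)) ω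
      - stratonovichSum W (fun s ω => B s ω i) (k * 2 ^ j) (gridPt T (m + j)) ω
    = W (gridPt T m k) ω * incr B T m k ω i
      + ∑ l ∈ block j k, (W (gridPt T (m + j) l) ω - W (gridPt T m k) ω)
        * incr B T (m + j) l ω i
      + 1 / 2 * ∑ l ∈ block j k, (W (gridPt T (m + j) (l + 1)) ω - W (gridPt T (m + j) l) ω)
        * incr B T (m + j) l ω i := by
  have hle : k * 2 ^ j ≤ (k + 1) * 2 ^ j := Nat.mul_le_mul_right _ (Nat.le_succ k)
  have htel : incr B T m k ω i = ∑ l ∈ block j k, incr B T (m + j) l ω i := by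
    unfold incr block
    rw [Finset.sum_Ico_sub (fun l => B (gridPt T (m + j) l) ω i) hle, gridPt_refine,
      gridPt_refine]
  unfold stratonovichSum
  rw [← Finset.sum_Ico_eq_sub _ hle, htel, Finset.mul_sum, Finset.mul_sum,
    ← Finset.sum_add_distrib, ← Finset.sum_add_distrib]
  refine Finset.sum_congr rfl fun l _ => ?_
  simp only [incr]
  ring

/-- A drift of bounded variation has no covariation with the Brownian motion. -/
lemma tendsto_drift_covariation [IsProbabilityMeasure P] (hB : IsBrownianMotionOn B T P)
    {D : ℝ≥0 → Ω → ℝ} {Γ : ℝ≥0 → ℝ}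
    (hD : ∀ s t, s ≤ t → t ≤ T → ∀ ω, |D t ω - D s ω| ≤ Γ t - Γ s) {K : ℕ → ℕ}
    (hK : ∀ m, K m ≤ 2 ^ m) (i : Fin d) :
    TendstoInMeasure P (fun m ω => ∑ k ∈ Finset.range (K m),
      (D (gridPt T m (k + 1)) ω - D (gridPt T m k) ω) * incr B T m k ω i) atTop (fun _ => 0) := by
  have hΓ : ∀ m k, k < 2 ^ m → 0 ≤ Γ (gridPt T m (k + 1)) - Γ (gridPt T m k) := fun m k hk => by
    have hne : Nonempty Ω := nonempty_of_isProbabilityMeasure P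
    obtain ⟨ω⟩ := hne
    exact (abs_nonneg _).trans (hD _ _ (gridPt_mono m (Nat.le_succ k)) (gridPt_le hk) ω)
  have hi1 : ∀ m k, k < 2 ^ m → Integrable (fun ω => |incr B T m k ω i|) P := fun m k hk =>
    ((memLp_incr hB hk i).integrable (by norm_num)).abs
  have hi : ∀ m, ∀ k ∈ Finset.range (2 ^ m), Integrable (fun ω =>
      (Γ (gridPt T m (k + 1)) - Γ (gridPt T m k)) * |incr B T m k ω i|) P := fun m k hk =>
    (hi1 m k (Finset.mem_range.1 hk)).const_mul _
  have hE : ∀ m k, k < 2 ^ m → ∫ ω, |incr B T m k ω i| ∂P ≤ Real.sqrt (mesh T m) := by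
    intro m k hk
    refine Real.le_sqrt_of_sq_le ?_
    have hL : MemLp (fun ω => |incr B T m k ω i|) 2 P := (memLp_incr hB hk i).abs
    have h1 := variance_nonneg (fun ω => |incr B T m k ω i|) P
    rw [variance_eq_sub hL] at h1
    have h2 : ∫ ω, ((fun ω => |incr B T m k ω i|) ^ 2) ω ∂P = mesh T m := by
      simp only [Pi.pow_apply, sq_abs]
      exact integral_incr_sq hB hk i
    linarith
  have hY : TendstoInMeasure P (fun m ω => ∑ k ∈ Finset.range (2 ^ m),
      (Γ (gridPt T m (k + 1)) - Γ (gridPt T m k)) * |incr B T m k ω i|) atTop (fun _ => 0) := by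
    refine tendsto_zero_of_integral (fun m => integrable_finsetSum _ (hi m))
      (fun m ω => Finset.sum_nonneg fun k hk =>
        mul_nonneg (hΓ m k (Finset.mem_range.1 hk)) (abs_nonneg _)) ?_
    have hlim : Tendsto (fun m => (Γ T - Γ 0) * Real.sqrt (mesh T m)) atTop (𝓝 0) := by
      have h1 := (Real.continuous_sqrt.tendsto 0).comp (NNReal.tendsto_coe.2 (tendsto_mesh T))
      simp only [Real.sqrt_zero] at h1
      simpa using h1.const_mul (Γ T - Γ 0)
    refine tendsto_of_tendsto_of_tendsto_of_le_of_le tendsto_const_nhds hlim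
      (fun m => integral_nonneg fun ω => Finset.sum_nonneg fun k hk =>
        mul_nonneg (hΓ m k (Finset.mem_range.1 hk)) (abs_nonneg _)) fun m => ?_
    beta_reduce
    rw [integral_finsetSum _ (hi m)]
    calc ∑ k ∈ Finset.range (2 ^ m), ∫ ω, (Γ (gridPt T m (k + 1)) - Γ (gridPt T m k))
            * |incr B T m k ω i| ∂P
        ≤ ∑ k ∈ Finset.range (2 ^ m), (Γ (gridPt T m (k + 1)) - Γ (gridPt T m k))
            * Real.sqrt (mesh T m) := by
          refine Finset.sum_le_sum fun k hk => ?_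
          rw [integral_const_mul]
          exact mul_le_mul_of_nonneg_left (hE m k (Finset.mem_range.1 hk))
            (hΓ m k (Finset.mem_range.1 hk))
      _ = (Γ T - Γ 0) * Real.sqrt (mesh T m) := by
          rw [← Finset.sum_mul, Finset.sum_range_sub fun k => Γ (gridPt T m k), gridPt_last,
            gridPt_zero]
  refine tendsto_zero_of_abs_le hY fun m => Eventually.of_forall fun ω => ?_
  have hn : ∀ k ∈ Finset.range (2 ^ m),
      0 ≤ (Γ (gridPt T m (k + 1)) - Γ (gridPt T m k)) * |incr B T m k ω i| := fun k hk =>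
    mul_nonneg (hΓ m k (Finset.mem_range.1 hk)) (abs_nonneg _)
  rw [abs_of_nonneg (Finset.sum_nonneg hn)]
  calc |∑ k ∈ Finset.range (K m), (D (gridPt T m (k + 1)) ω - D (gridPt T m k) ω)
          * incr B T m k ω i|
      ≤ ∑ k ∈ Finset.range (K m), (Γ (gridPt T m (k + 1)) - Γ (gridPt T m k))
          * |incr B T m k ω i| := by
        refine (Finset.abs_sum_le_sum_abs _ _).trans (Finset.sum_le_sum fun k hk => ?_)
        rw [abs_mul]
        exact mul_le_mul_of_nonneg_right (hD _ _ (gridPt_mono m (Nat.le_succ k))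
          (gridPt_le ((Finset.mem_range.1 hk).trans_le (hK m))) ω) (abs_nonneg _)
    _ ≤ _ := Finset.sum_le_sum_of_subset_of_nonneg
        (Finset.range_subset_range.2 (hK m)) fun k hk _ => hn k hk

/-- The law of large numbers `∑ W ΔBⁱ ΔBʲ ≈ δ_{ij} ∑ W Δt`. -/
lemma tendsto_sum_mul_centredProd [IsProbabilityMeasure P] (hB : IsBrownianMotionOn B T P) {C : ℝ}
    {W : ℝ≥0 → Ω → ℝ} (hW : IsRegularProcess P (brownianFiltration B T P) T C W) {K : ℕ → ℕ}
    (hK : ∀ m, K m ≤ 2 ^ m) (i j : Fin d) :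
    TendstoInMeasure P (fun m ω => ∑ k ∈ Finset.range (K m), W (gridPt T m k) ω
      * centredProd (mesh T m) i j (incr B T m k ω)) atTop (fun _ => 0) := by
  have hlt : ∀ m, ∀ k ∈ Finset.range (K m), k < 2 ^ m := fun m k hk =>
    (Finset.mem_range.1 hk).trans_le (hK m)
  refine tendsto_zero_of_sq (tendsto_zero_of_integral (fun m => ?_) (fun m ω => sq_nonneg _) ?_)
  · exact (memLp_sum_mul_incr hB (memLp_centredProd _ i j) _ (hlt m) (fun k hk =>
      hW.aestronglyMeasurable (gridPt_le (hlt m k hk).le)) fun k _ => hW.abs_le _).integrable_sq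
  have hlim : Tendsto (fun m => C ^ 2 * (2 * fourthMoment + 2) * T * mesh T m) atTop (𝓝 0) := by
    simpa using (NNReal.tendsto_coe.2 (tendsto_mesh T)).const_mul
      (C ^ 2 * (2 * fourthMoment + 2) * T)
  refine tendsto_of_tendsto_of_tendsto_of_le_of_le tendsto_const_nhds hlim
    (fun m => integral_nonneg fun ω => sq_nonneg _) fun m => ?_
  beta_reduce
  rw [integral_sum_mul_incr_sq hB (measurable_centredProd _ i j) (memLp_centredProd _ i j)
    (integral_centredProd _ i j) _ (hlt m)
    (fun k hk => hW.adapted _ (gridPt_le (hlt m k hk).le)) fun k _ => hW.abs_le _]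
  have hWsq : ∀ t, ∫ ω, W t ω ^ 2 ∂P ≤ C ^ 2 := fun t => by
    have h1 := abs_integral_le_of_abs_le (μ := P) (f := fun ω => W t ω ^ 2) (g := fun _ => C ^ 2)
      (integrable_const _) (Eventually.of_forall fun ω => by
        rw [abs_pow]
        exact pow_le_pow_left₀ (abs_nonneg _) (hW.abs_le t ω) 2)
    simpa using (le_abs_self _).trans h1
  have hQ0 : 0 ≤ ∫ x, centredProd (mesh T m) i j x ^ 2 ∂(gaussPi d (mesh T m)) :=
    integral_nonneg fun x => sq_nonneg _
  have hQ := integral_centredProd_sq_le (d := d) (mesh T m) i j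
  calc ∑ k ∈ Finset.range (K m), (∫ ω, W (gridPt T m k) ω ^ 2 ∂P)
        * ∫ x, centredProd (mesh T m) i j x ^ 2 ∂(gaussPi d (mesh T m))
      ≤ ∑ k ∈ Finset.range (K m), C ^ 2 * ((2 * fourthMoment + 2) * mesh T m ^ 2) :=
        Finset.sum_le_sum fun k _ => mul_le_mul (hWsq _) hQ hQ0 (sq_nonneg C)
    _ = K m * (C ^ 2 * ((2 * fourthMoment + 2) * mesh T m ^ 2)) := by
        rw [Finset.sum_const, Finset.card_range, nsmul_eq_mul]
    _ ≤ (2 ^ m : ℝ) * (C ^ 2 * ((2 * fourthMoment + 2) * mesh T m ^ 2)) := by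
        refine mul_le_mul_of_nonneg_right (by exact_mod_cast hK m) ?_
        have := fourthMoment_nonneg
        positivity
    _ = C ^ 2 * (2 * fourthMoment + 2) * T * mesh T m := by
        rw [← two_pow_mul_mesh (T := T) m]
        ring

/-- If `dZ = dD + ∑_j W_j ∘ dB^j`, with a drift `D` of bounded variation, then the covariation of
`Z` and `B^i` is `∫ W_i dt`. -/
lemma tendsto_covariation [IsProbabilityMeasure P] (hB : IsBrownianMotionOn B T P) {C : ℝ}
    {Z : ℝ≥0 → Ω → ℝ} {W : Fin d → ℝ≥0 → Ω → ℝ}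
    (hW : ∀ j, IsRegularProcess P (brownianFiltration B T P) T C (W j))
    {D : ℝ≥0 → Ω → ℝ} {Γ : ℝ≥0 → ℝ}
    (hD : ∀ s t, s ≤ t → t ≤ T → ∀ ω, |D t ω - D s ω| ≤ Γ t - Γ s)
    (hS : ∀ n k, k ≤ 2 ^ n → TendstoInMeasure P (fun j ω => ∑ i,
      stratonovichSum (W i) (fun s ω => B s ω i) (k * 2 ^ j) (gridPt T (n + j)) ω) atTop
      (fun ω => Z (gridPt T n k) ω - Z 0 ω - D (gridPt T n k) ω))
    {K : ℕ → ℕ} (hK : ∀ m, K m ≤ 2 ^ m) (i : Fin d) :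
    TendstoInMeasure P (fun m ω => ∑ k ∈ Finset.range (K m),
      ((Z (gridPt T m (k + 1)) ω - Z (gridPt T m k) ω) * incr B T m k ω i
        - W i (gridPt T m k) ω * mesh T m)) atTop (fun _ => 0) := by
  classical
  -- the increment of `Z` minus its drift and its principal part
  let ρ : ℕ → ℕ → Ω → ℝ := fun m k ω => (Z (gridPt T m (k + 1)) ω - Z (gridPt T m k) ω)
    - (D (gridPt T m (k + 1)) ω - D (gridPt T m k) ω)
    - ∑ j, W j (gridPt T m k) ω * incr B T m k ω j
  let E : ℕ → ℕ → ℕ → Fin d → Ω → ℝ := fun m j k i ω => ∑ l ∈ block j k,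
    (W i (gridPt T (m + j) l) ω - W i (gridPt T m k) ω) * incr B T (m + j) l ω i
  let X : ℕ → ℕ → ℕ → Fin d → Ω → ℝ := fun m j k i ω => ∑ l ∈ block j k,
    (W i (gridPt T (m + j) (l + 1)) ω - W i (gridPt T (m + j) l) ω) * incr B T (m + j) l ω i
  have hconv : ∀ m, ∀ k ∈ Finset.range (2 ^ m), TendstoInMeasure P
      (fun j ω => ∑ i, (E m j k i ω + 1 / 2 * X m j k i ω)) atTop (ρ m k) := by
    intro m k hk
    have hk' := Finset.mem_range.1 hk
    have h1 := tendstoInMeasure_sub_iff.1 (tendstoInMeasure_sub (hS m (k + 1) hk') (hS m k hk'.le))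
    refine tendstoInMeasure_sub_iff.2 (tendsto_zero_of_abs_le h1 fun j =>
      Eventually.of_forall fun ω => le_of_eq ?_)
    congr 1
    rw [← Finset.sum_sub_distrib]
    simp only [stratonovichSum_block, Finset.sum_add_distrib, ρ, E, X]
    ring
  obtain ⟨J, hJ⟩ := exists_level_tendsto hconv
  -- hence the sum of the squares of the residuals tends to zero
  have hρ : TendstoInMeasure P (fun m ω => ∑ k ∈ Finset.range (2 ^ m), ρ m k ω ^ 2) atTop
      (fun _ => 0) := by
    have hE := tendsto_zero_sum Finset.univ fun i _ => tendsto_block_adapted hB (hW i) J i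
    have hX := tendsto_zero_sum Finset.univ fun i _ => tendsto_block_cross hB (hW i).tight J i
    refine tendsto_zero_of_abs_le (tendsto_zero_add (tendsto_zero_const_mul 2 hJ)
      (tendsto_zero_add (tendsto_zero_const_mul (4 * d) hE) (tendsto_zero_const_mul d hX)))
      fun m => Eventually.of_forall fun ω => ?_
    rw [abs_of_nonneg (Finset.sum_nonneg fun k _ => sq_nonneg _)]
    refine le_trans ?_ (le_abs_self _)
    rw [Finset.sum_comm (t := Finset.range (2 ^ m)), Finset.sum_comm (t := Finset.range (2 ^ m)),
      Finset.mul_sum, Finset.mul_sum, Finset.mul_sum, ← Finset.sum_add_distrib,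
      ← Finset.sum_add_distrib]
    refine Finset.sum_le_sum fun k _ => ?_
    have h1 : (∑ i, (E m (J m) k i ω + 1 / 2 * X m (J m) k i ω)) ^ 2
        ≤ d * ∑ i, (E m (J m) k i ω + 1 / 2 * X m (J m) k i ω) ^ 2 := by
      have := sq_sum_le_card_mul_sum_sq (s := (Finset.univ : Finset (Fin d)))
        (f := fun i => E m (J m) k i ω + 1 / 2 * X m (J m) k i ω)
      simpa using this
    have h2 : ∑ i, (E m (J m) k i ω + 1 / 2 * X m (J m) k i ω) ^ 2
        ≤ 2 * ∑ i, E m (J m) k i ω ^ 2 + 1 / 2 * ∑ i, X m (J m) k i ω ^ 2 := by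
      rw [Finset.mul_sum, Finset.mul_sum, ← Finset.sum_add_distrib]
      refine Finset.sum_le_sum fun i _ => ?_
      nlinarith [sq_nonneg (E m (J m) k i ω - 1 / 2 * X m (J m) k i ω)]
    have h3 := mul_le_mul_of_nonneg_left h2 (Nat.cast_nonneg (α := ℝ) d)
    change ρ m k ω ^ 2 ≤ 2 * (∑ i, (E m (J m) k i ω + 1 / 2 * X m (J m) k i ω) - ρ m k ω) ^ 2
      + (4 * d * ∑ i, E m (J m) k i ω ^ 2 + d * ∑ i, X m (J m) k i ω ^ 2)
    nlinarith [sq_nonneg (2 * ∑ i, (E m (J m) k i ω + 1 / 2 * X m (J m) k i ω) - ρ m k ω)]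
  have hρB : TendstoInMeasure P (fun m ω => ∑ k ∈ Finset.range (K m),
      ρ m k ω * incr B T m k ω i) atTop (fun _ => 0) := by
    refine tendsto_zero_of_sq_le_mul hρ (isTightSeq_sum_incr_sq hB i)
      fun m => Eventually.of_forall fun ω => ?_
    rw [abs_of_nonneg (Finset.sum_nonneg fun k _ => sq_nonneg _),
      abs_of_nonneg (Finset.sum_nonneg fun k _ => sq_nonneg _)]
    have hsub := Finset.range_subset_range.2 (hK m)
    refine (Finset.sum_mul_sq_le_sq_mul_sq _ _ _).trans (mul_le_mul ?_ ?_ ?_ ?_)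
    · exact Finset.sum_le_sum_of_subset_of_nonneg hsub fun k _ _ => sq_nonneg _
    · exact Finset.sum_le_sum_of_subset_of_nonneg hsub fun k _ _ => sq_nonneg _
    · exact Finset.sum_nonneg fun k _ => sq_nonneg _
    · exact Finset.sum_nonneg fun k _ => sq_nonneg _
  -- the principal part `∑_j W_j ΔB^j` contributes `∑ W_i Δt` to the covariation, by the law of large
  -- numbers
  have hM := tendsto_zero_sum Finset.univ fun j _ => tendsto_sum_mul_centredProd hB (hW j) hK j i
  refine tendsto_zero_of_abs_le (tendsto_zero_add (tendsto_zero_add hρB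
    (tendsto_drift_covariation hB hD hK i)) hM) fun m => Eventually.of_forall fun ω => le_of_eq ?_
  congr 1
  rw [Finset.sum_comm, ← Finset.sum_add_distrib, ← Finset.sum_add_distrib]
  refine Finset.sum_congr rfl fun k _ => ?_
  have h1 : ∑ j, W j (gridPt T m k) ω * centredProd (mesh T m) j i (incr B T m k ω)
      = (∑ j, W j (gridPt T m k) ω * incr B T m k ω j) * incr B T m k ω i
        - W i (gridPt T m k) ω * mesh T m := by
    simp only [centredProd, mul_sub, mul_ite, mul_zero, Finset.sum_sub_distrib,
      Finset.sum_ite_eq', Finset.mem_univ, if_true, Finset.sum_mul, mul_assoc]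
  rw [h1]
  simp only [ρ]
  ring

end Covariation

/-! ### Expectations against stochastic exponentials -/

section Mean

variable {Ω : Type*} [mΩ : MeasurableSpace Ω] {d : ℕ} {P : Measure Ω} {T : ℝ≥0}
  {B : ℝ≥0 → Ω → Eucl d}

/-- A sequence bounded in `L²` and converging to zero in probability converges to zero weakly in
`L²`. -/
lemma tendsto_integral_mul_of_tendstoInMeasure {F : Ω → ℝ} (hF : MemLp F 2 P)
    [IsFiniteMeasure P] {R : ℕ → Ω → ℝ} (hR2 : ∀ n, MemLp (R n) 2 P) {K : ℝ}
    (hK : ∀ n, ∫ ω, R n ω ^ 2 ∂P ≤ K) (hR : TendstoInMeasure P R atTop (fun _ => 0)) :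
    Tendsto (fun n => ∫ ω, F ω * R n ω ∂P) atTop (𝓝 0) := by
  have hFi : Integrable F P := hF.integrable (by norm_num)
  have hK0 : 0 ≤ K := (integral_nonneg fun ω => sq_nonneg _).trans (hK 0)
  have hF0 : 0 ≤ ∫ ω, |F ω| ∂P := integral_nonneg fun ω => abs_nonneg _
  rw [Metric.tendsto_atTop']
  intro η hη
  set δ : ℝ := η / (2 * (K + 1)) with hδ
  set ε : ℝ := η / (4 * (∫ ω, |F ω| ∂P + 1)) with hε
  have hδ0 : 0 < δ := by positivity
  have hε0 : 0 < ε := by positivity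
  let A : ℕ → Set Ω := fun n => toMeasurable P {ω | ε ≤ |R n ω|}
  have hA : Tendsto (P ∘ A) atTop (𝓝 0) := by
    refine ((tendstoInMeasure_zero_iff.1 hR) ε hε0).congr fun n => ?_
    exact (measure_toMeasurable _).symm
  have hFA := hF.integrable_sq.tendsto_setIntegral_nhds_zero hA
  have hev : ∀ᶠ n in atTop, ∫ ω in A n, F ω ^ 2 ∂P < δ * η :=
    hFA.eventually (gt_mem_nhds (by positivity))
  obtain ⟨n₀, hn₀⟩ := eventually_atTop.1 hev
  refine ⟨n₀, fun n hn => ?_⟩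
  rw [Real.dist_eq, sub_zero]
  have hAm : MeasurableSet (A n) := measurableSet_toMeasurable _ _
  have i1 : Integrable (fun ω => ε * |F ω|) P := hFi.abs.const_mul ε
  have i2 : Integrable (fun ω => 1 / (2 * δ) * (A n).indicator (fun ω => F ω ^ 2) ω) P :=
    (hF.integrable_sq.indicator hAm).const_mul _
  have i3 : Integrable (fun ω => δ / 2 * R n ω ^ 2) P := (hR2 n).integrable_sq.const_mul _
  have i12 : Integrable (fun ω => ε * |F ω| + 1 / (2 * δ) * (A n).indicator (fun ω => F ω ^ 2) ω) P :=
    i1.add i2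
  have i123 : Integrable (fun ω => ε * |F ω| + 1 / (2 * δ) * (A n).indicator (fun ω => F ω ^ 2) ω
      + δ / 2 * R n ω ^ 2) P := i12.add i3
  have hle : ∀ ω, |F ω * R n ω| ≤ ε * |F ω| + 1 / (2 * δ) * (A n).indicator (fun ω => F ω ^ 2) ω
      + δ / 2 * R n ω ^ 2 := by
    intro ω
    rw [abs_mul]
    by_cases h : ω ∈ A n
    · rw [indicator_of_mem h]
      have h1 : 0 ≤ ε * |F ω| := by positivity
      have h2 : |F ω| * |R n ω| ≤ 1 / (2 * δ) * F ω ^ 2 + δ / 2 * R n ω ^ 2 := by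
        have h3 : 0 ≤ 1 / (2 * δ) * (|F ω| - δ * |R n ω|) ^ 2 := by positivity
        have h4 : 1 / (2 * δ) * (|F ω| - δ * |R n ω|) ^ 2
            = 1 / (2 * δ) * |F ω| ^ 2 - |F ω| * |R n ω| + δ / 2 * |R n ω| ^ 2 := by
          field_simp
          ring
        rw [sq_abs, sq_abs] at h4
        linarith
      linarith
    · rw [indicator_of_notMem h]
      have h1 : |R n ω| ≤ ε := by
        by_contra! hcon
        exact h (subset_toMeasurable P _ hcon.le)
      have h2 := mul_le_mul_of_nonneg_left h1 (abs_nonneg (F ω))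
      have h3 : 0 ≤ δ / 2 * R n ω ^ 2 := by positivity
      linarith
  have h1 := abs_integral_le_of_abs_le i123 (Eventually.of_forall hle)
  have h2 : ∫ ω, (ε * |F ω| + 1 / (2 * δ) * (A n).indicator (fun ω => F ω ^ 2) ω
      + δ / 2 * R n ω ^ 2) ∂P
      = ε * ∫ ω, |F ω| ∂P + 1 / (2 * δ) * ∫ ω in A n, F ω ^ 2 ∂P
        + δ / 2 * ∫ ω, R n ω ^ 2 ∂P := by
    rw [integral_add i12 i3, integral_add i1 i2, integral_const_mul, integral_const_mul,
      integral_const_mul, integral_indicator hAm]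
  rw [h2] at h1
  have h3 : ε * ∫ ω, |F ω| ∂P < η / 4 := by
    rw [hε, div_mul_eq_mul_div, div_lt_iff₀ (by positivity)]
    nlinarith
  have h4 : 1 / (2 * δ) * ∫ ω in A n, F ω ^ 2 ∂P < η / 2 := by
    rw [div_mul_eq_mul_div, one_mul, div_lt_iff₀ (by positivity)]
    linarith [hn₀ n hn.le]
  have h5 : δ / 2 * ∫ ω, R n ω ^ 2 ∂P ≤ η / 4 := by
    have h6 := mul_le_mul_of_nonneg_left (hK n) (by positivity : 0 ≤ δ / 2)
    have h7 : δ / 2 * K ≤ η / 4 := by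
      rw [hδ, div_div, div_mul_eq_mul_div, div_le_iff₀ (by positivity)]
      nlinarith
    linarith
  linarith

/-- The mean of a regular process against a square integrable variable is continuous in time. -/
lemma continuousOn_integral_mul [IsProbabilityMeasure P] {ℱ : Filtration ℝ≥0 mΩ} {C : ℝ}
    {W : ℝ≥0 → Ω → ℝ} (hW : IsRegularProcess P ℱ T C W) {F : Ω → ℝ} (hF : MemLp F 2 P) :
    ContinuousOn (fun s : ℝ => ∫ ω, F ω * W s.toNNReal ω ∂P) (Icc 0 T) := by
  rw [Metric.continuousOn_iff]
  intro s hs η hη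
  have hmem : ∀ t ≤ T, MemLp (W t) 2 P := fun t ht =>
    MemLp.of_bound (hW.aestronglyMeasurable ht) C (Eventually.of_forall fun ω => hW.abs_le t ω)
  set K := ∫ ω, F ω ^ 2 ∂P with hK
  have hK0 : 0 ≤ K := integral_nonneg fun ω => sq_nonneg _
  set a : ℝ := η / (K + 1) with ha
  have ha0 : 0 < a := by positivity
  obtain ⟨δ, hδ, hmod⟩ := hW.continuous (a * η) (by positivity)
  refine ⟨δ, hδ, fun t ht hst => ?_⟩
  have hsT : s.toNNReal ≤ T := Real.toNNReal_le_iff_le_coe.2 hs.2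
  have htT : t.toNNReal ≤ T := Real.toNNReal_le_iff_le_coe.2 ht.2
  have hd : dist s.toNNReal t.toNNReal < δ := by
    rw [NNReal.dist_eq, Real.coe_toNNReal _ hs.1, Real.coe_toNNReal _ ht.1, ← Real.dist_eq,
      dist_comm]
    exact hst
  have h1 := hmod _ _ hsT htT hd
  have hWs := hmem _ hsT
  have hWt := hmem _ htT
  have iS : Integrable (fun ω => F ω * W s.toNNReal ω) P := hF.integrable_mul hWs
  have iT : Integrable (fun ω => F ω * W t.toNNReal ω) P := hF.integrable_mul hWt
  rw [Real.dist_eq, ← integral_sub iT iS]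
  have i1 : Integrable (fun ω => a / 2 * F ω ^ 2) P := hF.integrable_sq.const_mul _
  have i2 : Integrable (fun ω => 1 / (2 * a) * (W t.toNNReal ω - W s.toNNReal ω) ^ 2) P :=
    (hWt.sub hWs).integrable_sq.const_mul _
  have i12 : Integrable (fun ω => a / 2 * F ω ^ 2
      + 1 / (2 * a) * (W t.toNNReal ω - W s.toNNReal ω) ^ 2) P := i1.add i2
  have h2 := abs_integral_le_of_abs_le (μ := P)
    (f := fun ω => F ω * W t.toNNReal ω - F ω * W s.toNNReal ω) i12
    (Eventually.of_forall fun ω => by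
      have h4 : ∀ x y : ℝ, |x * y| ≤ a / 2 * x ^ 2 + 1 / (2 * a) * y ^ 2 := fun x y => by
        have h3 : 0 ≤ 1 / (2 * a) * (|y| - a * |x|) ^ 2 := by positivity
        have h4 : 1 / (2 * a) * (|y| - a * |x|) ^ 2
            = 1 / (2 * a) * |y| ^ 2 - |x| * |y| + a / 2 * |x| ^ 2 := by
          field_simp
          ring
        rw [sq_abs, sq_abs] at h4
        rw [abs_mul]
        linarith
      rw [← mul_sub]
      exact h4 _ _)
  have h3 : ∫ ω, (a / 2 * F ω ^ 2
      + 1 / (2 * a) * (W t.toNNReal ω - W s.toNNReal ω) ^ 2) ∂P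
      = a / 2 * K + 1 / (2 * a) * ∫ ω, (W t.toNNReal ω - W s.toNNReal ω) ^ 2 ∂P := by
    rw [integral_add i1 i2, integral_const_mul, integral_const_mul]
  rw [h3] at h2
  refine h2.trans_lt ?_
  have h4 : 1 / (2 * a) * ∫ ω, (W t.toNNReal ω - W s.toNNReal ω) ^ 2 ∂P ≤ η / 2 := by
    rw [div_mul_eq_mul_div, one_mul, div_le_iff₀ (by positivity)]
    linarith
  have h5 : a / 2 * K < η / 2 := by
    rw [ha, div_div, div_mul_eq_mul_div, div_lt_iff₀ (by positivity)]
    nlinarith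
  linarith

/-- On the intervals of a refined grid, a dyadic step function is constant. -/
lemma stepFunction_eq {m p l : ℕ} (c : ℕ → Eucl d) (hl : l < 2 ^ (m + p)) {s : ℝ}
    (hs : s ∈ Ioc (gridPt T (m + p) l : ℝ) (gridPt T (m + p) (l + 1))) :
    stepFunction (2 ^ m) (gridPt T m) c s = c (l / 2 ^ p) := by
  have hp : 0 < 2 ^ p := by positivity
  have hk : l / 2 ^ p < 2 ^ m := by
    rw [Nat.div_lt_iff_lt_mul hp, ← pow_add]
    exact hl
  have hmem : s ∈ Ioc (gridPt T m (l / 2 ^ p) : ℝ) (gridPt T m (l / 2 ^ p + 1)) := by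
    rw [← gridPt_refine m p, ← gridPt_refine m p (l / 2 ^ p + 1)]
    refine ⟨lt_of_le_of_lt ?_ hs.1, hs.2.trans ?_⟩
    · exact_mod_cast gridPt_mono _ (Nat.div_mul_le_self l _)
    · have : l + 1 ≤ (l / 2 ^ p + 1) * 2 ^ p := by
        rw [mul_comm]
        exact Nat.lt_mul_div_succ l hp
      exact_mod_cast gridPt_mono _ this
  unfold stepFunction
  rw [Finset.sum_eq_single (l / 2 ^ p)]
  · exact indicator_of_mem hmem _
  · intro k _ hne
    refine indicator_of_notMem (fun hmem' => ?_) _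
    rcases lt_or_gt_of_ne hne with h | h
    · have h1 : (gridPt T m (k + 1) : ℝ) ≤ gridPt T m (l / 2 ^ p) := by
        exact_mod_cast gridPt_mono _ h
      linarith [hmem'.2, hmem.1]
    · have h1 : (gridPt T m (l / 2 ^ p + 1) : ℝ) ≤ gridPt T m k := by
        exact_mod_cast gridPt_mono _ h
      linarith [hmem'.1, hmem.2]
  · intro h
    exact absurd (Finset.mem_range.2 hk) h

/-- Convergence of weighted Riemann sums along dyadic grids. -/
lemma tendsto_riemann_sum {G h : ℝ → ℝ} (hG : ContinuousOn G (Icc 0 T)) {a : ℕ → ℕ → ℝ} {A : ℝ}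
    (hA : ∀ n k, |a n k| ≤ A) {n₀ k₀ : ℕ} (hk₀ : k₀ ≤ 2 ^ n₀)
    (hh : ∀ j l, l < 2 ^ (n₀ + j) →
      ∀ s ∈ Ioc (gridPt T (n₀ + j) l : ℝ) (gridPt T (n₀ + j) (l + 1)), h s = a j l) :
    Tendsto (fun j => ∑ l ∈ Finset.range (k₀ * 2 ^ j),
      G (gridPt T (n₀ + j) l) * a j l * mesh T (n₀ + j)) atTop
      (𝓝 (∫ s in (0 : ℝ)..gridPt T n₀ k₀, G s * h s)) := by
  have hA0 : 0 ≤ A := (abs_nonneg _).trans (hA 0 0)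
  have hlt : ∀ j, ∀ l, l < k₀ * 2 ^ j → l < 2 ^ (n₀ + j) := fun j l hl => by
    rw [pow_add]
    exact hl.trans_le (Nat.mul_le_mul_right _ hk₀)
  have hsub : ∀ j l, l < k₀ * 2 ^ j →
      Icc (gridPt T (n₀ + j) l : ℝ) (gridPt T (n₀ + j) (l + 1)) ⊆ Icc 0 (T : ℝ) := fun j l hl =>
    Icc_subset_Icc (NNReal.coe_nonneg _) (by exact_mod_cast gridPt_le (hlt j l hl))
  have hle : ∀ n l, (gridPt T n l : ℝ) ≤ gridPt T n (l + 1) := fun n l => by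
    exact_mod_cast gridPt_mono n (Nat.le_succ l)
  have hae : ∀ j l, l < k₀ * 2 ^ j →
      ∀ s ∈ uIoc (gridPt T (n₀ + j) l : ℝ) (gridPt T (n₀ + j) (l + 1)), G s * h s = G s * a j l := by
    intro j l hl s hs
    rw [uIoc_of_le (hle _ _)] at hs
    rw [hh j l (hlt j l hl) s hs]
  have hGi : ∀ j l, l < k₀ * 2 ^ j → IntervalIntegrable G volume
      (gridPt T (n₀ + j) l : ℝ) (gridPt T (n₀ + j) (l + 1)) := fun j l hl => by
    refine ContinuousOn.intervalIntegrable ?_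
    rw [uIcc_of_le (hle _ _)]
    exact hG.mono (hsub j l hl)
  have hint : ∀ j l, l < k₀ * 2 ^ j → IntervalIntegrable (fun s => G s * h s) volume
      (gridPt T (n₀ + j) l : ℝ) (gridPt T (n₀ + j) (l + 1)) := fun j l hl =>
    ((hGi j l hl).mul_const (a j l)).congr fun s hs => (hae j l hl s hs).symm
  have hu := isCompact_Icc.uniformContinuousOn_of_continuous hG
  rw [Metric.uniformContinuousOn_iff] at hu
  rw [Metric.tendsto_atTop']
  intro η hη
  set ε : ℝ := η / ((A + 1) * (T + 1)) with hε
  have hε0 : 0 < ε := by positivity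
  obtain ⟨δ, hδ, hmod⟩ := hu ε hε0
  have hmesh := (NNReal.tendsto_coe.2 (tendsto_mesh T)).eventually (gt_mem_nhds hδ)
  obtain ⟨m₀, hm₀⟩ := eventually_atTop.1 hmesh
  refine ⟨m₀, fun j hj => ?_⟩
  have h1 : ∫ s in (0 : ℝ)..gridPt T n₀ k₀, G s * h s
      = ∑ l ∈ Finset.range (k₀ * 2 ^ j),
        ∫ s in (gridPt T (n₀ + j) l : ℝ)..gridPt T (n₀ + j) (l + 1), G s * h s := by
    have := intervalIntegral.sum_integral_adjacent_intervals (μ := volume) (n := k₀ * 2 ^ j)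
      (a := fun l => (gridPt T (n₀ + j) l : ℝ)) (f := fun s => G s * h s) fun l hl => hint j l hl
    rw [this, gridPt_refine, gridPt_zero, NNReal.coe_zero]
  rw [h1, Real.dist_eq, ← Finset.sum_sub_distrib]
  have h2 : ∀ l ∈ Finset.range (k₀ * 2 ^ j),
      |G (gridPt T (n₀ + j) l) * a j l * mesh T (n₀ + j)
        - ∫ s in (gridPt T (n₀ + j) l : ℝ)..gridPt T (n₀ + j) (l + 1), G s * h s|
      ≤ ε * A * mesh T (n₀ + j) := by
    intro l hl
    have hl' := Finset.mem_range.1 hl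
    have h3 : G (gridPt T (n₀ + j) l) * a j l * mesh T (n₀ + j)
        = ∫ s in (gridPt T (n₀ + j) l : ℝ)..gridPt T (n₀ + j) (l + 1),
          G (gridPt T (n₀ + j) l) * a j l := by
      rw [intervalIntegral.integral_const, coe_gridPt_succ_sub, smul_eq_mul]
      ring
    rw [h3, ← intervalIntegral.integral_sub intervalIntegrable_const (hint j l hl')]
    have h4 := intervalIntegral.norm_integral_le_of_norm_le_const
      (a := (gridPt T (n₀ + j) l : ℝ)) (b := gridPt T (n₀ + j) (l + 1)) (C := ε * A)
      (f := fun s => G (gridPt T (n₀ + j) l) * a j l - G s * h s) fun s hs => by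
        rw [hae j l hl' s hs, ← sub_mul, Real.norm_eq_abs, abs_mul]
        rw [uIoc_of_le (hle _ _)] at hs
        refine mul_le_mul ?_ (hA _ _) (abs_nonneg _) hε0.le
        rw [← Real.dist_eq]
        refine (hmod _ (hsub j l hl' (left_mem_Icc.2 (hle _ _))) _
          (hsub j l hl' (Ioc_subset_Icc_self hs)) ?_).le
        rw [Real.dist_eq, abs_sub_comm, abs_of_pos (by linarith [hs.1])]
        have h5 := coe_gridPt_succ_sub (T := T) (n₀ + j) l
        have h6 := hm₀ (n₀ + j) (by omega)
        linarith [hs.2]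
    rw [coe_gridPt_succ_sub, abs_of_nonneg (NNReal.coe_nonneg _)] at h4
    exact h4
  refine (Finset.abs_sum_le_sum_abs _ _).trans_lt ((Finset.sum_le_sum h2).trans_lt ?_)
  rw [Finset.sum_const, Finset.card_range, nsmul_eq_mul]
  have h3 : ((k₀ * 2 ^ j : ℕ) : ℝ) ≤ 2 ^ (n₀ + j) := by
    have : k₀ * 2 ^ j ≤ 2 ^ (n₀ + j) := by
      rw [pow_add]
      exact Nat.mul_le_mul_right _ hk₀
    exact_mod_cast this
  calc ((k₀ * 2 ^ j : ℕ) : ℝ) * (ε * A * mesh T (n₀ + j))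
      ≤ 2 ^ (n₀ + j) * (ε * A * mesh T (n₀ + j)) :=
        mul_le_mul_of_nonneg_right h3 (by positivity)
    _ = ε * A * T := by rw [← two_pow_mul_mesh (T := T) (n₀ + j)]; ring
    _ < η := by
        rw [hε, div_mul_eq_mul_div, div_mul_eq_mul_div, div_lt_iff₀ (by positivity)]
        have hT := T.coe_nonneg
        nlinarith [mul_nonneg hA0 hT]

lemma stepExp_eq_exp {Ω : Type*} {d : ℕ} (B : ℝ≥0 → Ω → Eucl d) (T : ℝ≥0) (n : ℕ)
    (c : ℕ → Fin d → ℝ) (s : Finset ℕ) (ω : Ω) :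
    stepExp B T n c s ω
      = Real.exp (∑ k ∈ s, ∑ i, (c k i * incr B T n k ω i - c k i ^ 2 * mesh T n / 2)) := by
  simp only [stepExp, gaussExp]
  rw [← Real.exp_sum]

/-- A stochastic exponential on a dyadic grid is a stochastic exponential on each finer grid. -/
lemma stepExp_refine {Ω : Type*} {d : ℕ} (B : ℝ≥0 → Ω → Eucl d) (T : ℝ≥0) (m p : ℕ)
    (c : ℕ → Fin d → ℝ) (ω : Ω) :
    stepExp B T m c (Finset.range (2 ^ m)) ω
      = stepExp B T (m + p) (fun l => c (l / 2 ^ p)) (Finset.range (2 ^ (m + p))) ω := by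
  rw [stepExp_eq_exp, stepExp_eq_exp, sum_block]
  congr 1
  refine Finset.sum_congr rfl fun k _ => ?_
  have hdiv : ∀ l ∈ block p k, l / 2 ^ p = k := fun l hl => by
    have := Finset.mem_Ico.1 hl
    exact Nat.div_eq_of_lt_le this.1 this.2
  rw [Finset.sum_comm]
  refine Finset.sum_congr rfl fun i _ => ?_
  rw [Finset.sum_congr rfl fun l hl => by rw [hdiv l hl], Finset.sum_sub_distrib,
    ← Finset.mul_sum, Finset.sum_const, card_block, nsmul_eq_mul, ← two_pow_mul_mesh_add m p]
  have htel : incr B T m k ω i = ∑ l ∈ block p k, incr B T (m + p) l ω i := by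
    unfold incr block
    rw [Finset.sum_Ico_sub (fun l => B (gridPt T (m + p) l) ω i)
      (Nat.mul_le_mul_right _ (Nat.le_succ k)), gridPt_refine, gridPt_refine]
  rw [htel]
  push_cast
  ring

end Mean

/-! ### The equation in mean -/

section MeanEquation

variable {Ω : Type*} [mΩ : MeasurableSpace Ω] {d : ℕ} {P : Measure Ω} {T : ℝ≥0}
  {B : ℝ≥0 → Ω → Eucl d}

/-- `dZ = dD + ∑_i W_i ∘ dB^i` on `[0, T]`, along dyadic grids, with a drift `D` whose
variation is controlled by the deterministic function `Γ`. -/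
structure IsStratonovichDecomposition (P : Measure Ω) (T : ℝ≥0) (B : ℝ≥0 → Ω → Eucl d)
    (Z : ℝ≥0 → Ω → ℝ) (W : Fin d → ℝ≥0 → Ω → ℝ) (D : ℝ≥0 → Ω → ℝ) (Γ : ℝ≥0 → ℝ) : Prop where
  drift_measurable : ∀ t ≤ T, AEStronglyMeasurable (D t) P
  drift_zero : ∀ ω, D 0 ω = 0
  drift_le : ∀ s t, s ≤ t → t ≤ T → ∀ ω, |D t ω - D s ω| ≤ Γ t - Γ s
  tendsto : ∀ n k, k ≤ 2 ^ n → TendstoInMeasure P (fun j ω => ∑ i,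
    stratonovichSum (W i) (fun s ω => B s ω i) (k * 2 ^ j) (gridPt T (n + j)) ω) atTop
    (fun ω => Z (gridPt T n k) ω - Z 0 ω - D (gridPt T n k) ω)

/-- Conversion of the Stratonovich integral into an Itô integral: the correction is
`½ ∑_i ∫ W_{ii} dt`, where `W_{ii}` is the `i`-th diffusion coefficient of `W_i`. -/
lemma tendsto_ito_sum [IsProbabilityMeasure P] (hB : IsBrownianMotionOn B T P) {C : ℝ}
    {Z : ℝ≥0 → Ω → ℝ} {W : Fin d → ℝ≥0 → Ω → ℝ} {W₂ : Fin d → Fin d → ℝ≥0 → Ω → ℝ}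
    (hW₂ : ∀ i j, IsRegularProcess P (brownianFiltration B T P) T C (W₂ i j))
    {D : ℝ≥0 → Ω → ℝ} {Γ : ℝ≥0 → ℝ} (hZ : IsStratonovichDecomposition P T B Z W D Γ)
    {D₁ : Fin d → ℝ≥0 → Ω → ℝ} {Γ₁ : Fin d → ℝ≥0 → ℝ}
    (hW : ∀ i, IsStratonovichDecomposition P T B (W i) (W₂ i) (D₁ i) (Γ₁ i))
    {n k : ℕ} (hk : k ≤ 2 ^ n) :
    TendstoInMeasure P (fun j ω => (∑ i, ∑ l ∈ Finset.range (k * 2 ^ j),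
        W i (gridPt T (n + j) l) ω * incr B T (n + j) l ω i)
      + (1 / 2 * ∑ i, ∑ l ∈ Finset.range (k * 2 ^ j), W₂ i i (gridPt T (n + j) l) ω * mesh T (n + j))
      - (Z (gridPt T n k) ω - Z 0 ω - D (gridPt T n k) ω)) atTop (fun _ => 0) := by
  -- the number of intervals of the grid of level `m` before the time `gridPt T n k`
  let K : ℕ → ℕ := fun m => if n ≤ m then k * 2 ^ (m - n) else 0
  have hK : ∀ m, K m ≤ 2 ^ m := fun m => by
    simp only [K]
    split_ifs with h
    · calc k * 2 ^ (m - n) ≤ 2 ^ n * 2 ^ (m - n) := Nat.mul_le_mul_right _ hk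
        _ = 2 ^ m := by rw [← pow_add, Nat.add_sub_cancel' h]
    · exact Nat.zero_le _
  have hKj : ∀ j, K (n + j) = k * 2 ^ j := fun j => by simp [K]
  have hcov := tendsto_zero_sum Finset.univ fun i _ =>
    tendsto_covariation hB (hW₂ i) (hW i).drift_le (hW i).tendsto hK i
  have hcov' : TendstoInMeasure P (fun j ω => ∑ i, ∑ l ∈ Finset.range (k * 2 ^ j),
      ((W i (gridPt T (n + j) (l + 1)) ω - W i (gridPt T (n + j) l) ω) * incr B T (n + j) l ω i
        - W₂ i i (gridPt T (n + j) l) ω * mesh T (n + j))) atTop (fun _ => 0) := by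
    intro ε hε
    have h := (hcov ε hε).comp (tendsto_add_atTop_nat n)
    refine h.congr fun j => ?_
    simp only [Function.comp, add_comm j n, hKj]
  have hstrat := tendstoInMeasure_sub_iff.1 (hZ.tendsto n k hk)
  refine tendsto_zero_of_abs_le (tendsto_zero_add hstrat (tendsto_zero_const_mul (-(1 / 2)) hcov'))
    fun j => Eventually.of_forall fun ω => le_of_eq ?_
  congr 1
  have h1 : ∀ i, stratonovichSum (W i) (fun s ω => B s ω i) (k * 2 ^ j) (gridPt T (n + j)) ω
      = ∑ l ∈ Finset.range (k * 2 ^ j), W i (gridPt T (n + j) l) ω * incr B T (n + j) l ω i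
        + 1 / 2 * ∑ l ∈ Finset.range (k * 2 ^ j), (W i (gridPt T (n + j) (l + 1)) ω
          - W i (gridPt T (n + j) l) ω) * incr B T (n + j) l ω i := by
    intro i
    unfold stratonovichSum
    rw [Finset.mul_sum, ← Finset.sum_add_distrib]
    refine Finset.sum_congr rfl fun l _ => ?_
    simp only [incr]
    ring
  simp only [h1, Finset.sum_add_distrib, Finset.sum_sub_distrib, ← Finset.mul_sum]
  ring

lemma IsStratonovichDecomposition.abs_drift_le {Z : ℝ≥0 → Ω → ℝ} {W : Fin d → ℝ≥0 → Ω → ℝ}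
    {D : ℝ≥0 → Ω → ℝ} {Γ : ℝ≥0 → ℝ} (hZ : IsStratonovichDecomposition P T B Z W D Γ) {t : ℝ≥0}
    (ht : t ≤ T) (ω : Ω) : |D t ω| ≤ Γ t - Γ 0 := by
  have := hZ.drift_le 0 t zero_le ht ω
  rwa [hZ.drift_zero, sub_zero] at this

lemma mean_equation_gridPt [IsProbabilityMeasure P] (hB : IsBrownianMotionOn B T P) {C : ℝ}
    {Z : ℝ≥0 → Ω → ℝ} {W : Fin d → ℝ≥0 → Ω → ℝ} {W₂ : Fin d → Fin d → ℝ≥0 → Ω → ℝ}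
    (hZr : IsRegularProcess P (brownianFiltration B T P) T C Z)
    (hWr : ∀ i, IsRegularProcess P (brownianFiltration B T P) T C (W i))
    (hW₂ : ∀ i j, IsRegularProcess P (brownianFiltration B T P) T C (W₂ i j))
    {D : ℝ≥0 → Ω → ℝ} {Γ : ℝ≥0 → ℝ} (hZ : IsStratonovichDecomposition P T B Z W D Γ)
    {D₁ : Fin d → ℝ≥0 → Ω → ℝ} {Γ₁ : Fin d → ℝ≥0 → ℝ}
    (hW : ∀ i, IsStratonovichDecomposition P T B (W i) (W₂ i) (D₁ i) (Γ₁ i))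
    (m p k : ℕ) (hk : k ≤ 2 ^ (m + p)) (c : ℕ → Eucl d) {F : Ω → ℝ}
    (hF : F = stepExp B T m (fun l i => c l i) (Finset.range (2 ^ m))) :
    (∫ ω, F ω * Z (gridPt T (m + p) k) ω ∂P) - (∫ ω, F ω * Z 0 ω ∂P)
        - ∫ ω, F ω * D (gridPt T (m + p) k) ω ∂P
      = ∑ i, ((∫ s in (0 : ℝ)..gridPt T (m + p) k, (∫ ω, F ω * W i s.toNNReal ω ∂P)
          * stepFunction (2 ^ m) (gridPt T m) c s i)
        + 1 / 2 * ∫ s in (0 : ℝ)..gridPt T (m + p) k, ∫ ω, F ω * W₂ i i s.toNNReal ω ∂P) := by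
  set t := gridPt T (m + p) k with ht_def
  have htT : t ≤ T := gridPt_le hk
  have hF2 : MemLp F 2 P := hF ▸ memLp_stepExp hB _
  have hbdd : ∀ {X : Ω → ℝ} {K : ℝ}, AEStronglyMeasurable X P → (∀ ω, |X ω| ≤ K) → MemLp X 2 P :=
    fun hX hK => MemLp.of_bound hX _ (Eventually.of_forall hK)
  have hZ2 : ∀ s ≤ T, MemLp (Z s) 2 P := fun s hs =>
    hbdd (hZr.aestronglyMeasurable hs) (hZr.abs_le s)
  have hD2 : MemLp (D t) 2 P := hbdd (hZ.drift_measurable t htT) (hZ.abs_drift_le htT)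
  have hlt : ∀ j, ∀ l ∈ Finset.range (k * 2 ^ j), l < 2 ^ (m + p + j) := fun j l hl => by
    rw [pow_add]
    exact (Finset.mem_range.1 hl).trans_le (Nat.mul_le_mul_right _ hk)
  let I : ℕ → Fin d → Ω → ℝ := fun j i ω => ∑ l ∈ Finset.range (k * 2 ^ j),
    W i (gridPt T (m + p + j) l) ω * incr B T (m + p + j) l ω i
  let S : ℕ → Fin d → Ω → ℝ := fun j i ω => ∑ l ∈ Finset.range (k * 2 ^ j),
    W₂ i i (gridPt T (m + p + j) l) ω * mesh T (m + p + j)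
  let R₀ : Ω → ℝ := fun ω => Z t ω - Z 0 ω - D t ω
  have hI2 : ∀ j i, MemLp (I j i) 2 P := fun j i =>
    memLp_sum_mul_incr hB (memLp_coord_gaussPi _ i (by simp)) _ (hlt j)
      (fun l hl => (hWr i).aestronglyMeasurable (gridPt_le (hlt j l hl).le))
      fun l _ => (hWr i).abs_le _
  have hcard : ∀ j, ((k * 2 ^ j : ℕ) : ℝ) * mesh T (m + p + j) ≤ T := fun j => by
    have h1 : k * 2 ^ j ≤ 2 ^ (m + p + j) := by
      rw [pow_add]
      exact Nat.mul_le_mul_right _ hk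
    rw [← two_pow_mul_mesh (T := T) (m + p + j)]
    exact mul_le_mul_of_nonneg_right (by exact_mod_cast h1) (NNReal.coe_nonneg _)
  have hIle : ∀ j i, ∫ ω, I j i ω ^ 2 ∂P ≤ C ^ 2 * T := by
    intro j i
    simp only [I]
    rw [integral_sum_mul_incr_coord_sq hB i _ (hlt j)
      (fun l hl => (hWr i).adapted _ (gridPt_le (hlt j l hl).le)) fun l _ => (hWr i).abs_le _]
    have hWsq : ∀ s, ∫ ω, W i s ω ^ 2 ∂P ≤ C ^ 2 := fun s => by
      have h1 := abs_integral_le_of_abs_le (μ := P) (f := fun ω => W i s ω ^ 2)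
        (g := fun _ => C ^ 2) (integrable_const _) (Eventually.of_forall fun ω => by
          rw [abs_pow]
          exact pow_le_pow_left₀ (abs_nonneg _) ((hWr i).abs_le s ω) 2)
      simpa using (le_abs_self _).trans h1
    refine (Finset.sum_le_sum fun l _ =>
      mul_le_mul_of_nonneg_right (hWsq _) (NNReal.coe_nonneg _)).trans ?_
    rw [Finset.sum_const, Finset.card_range, nsmul_eq_mul]
    nlinarith [hcard j, sq_nonneg C]
  have hC0 : 0 ≤ C := by
    have hne : Nonempty Ω := nonempty_of_isProbabilityMeasure P
    obtain ⟨ω⟩ := hne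
    exact (abs_nonneg _).trans (hZr.abs_le 0 ω)
  have hSle : ∀ j i ω, |S j i ω| ≤ C * T := by
    intro j i ω
    refine (Finset.abs_sum_le_sum_abs _ _).trans ?_
    refine (Finset.sum_le_sum (g := fun _ => C * mesh T (m + p + j)) fun l _ => ?_).trans ?_
    · rw [abs_mul, abs_of_nonneg (NNReal.coe_nonneg _)]
      exact mul_le_mul_of_nonneg_right ((hW₂ i i).abs_le _ _) (NNReal.coe_nonneg _)
    · rw [Finset.sum_const, Finset.card_range, nsmul_eq_mul]
      nlinarith [hcard j]
  have hSm : ∀ j i, AEStronglyMeasurable (S j i) P := fun j i =>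
    Finset.aestronglyMeasurable_fun_sum _ fun l hl =>
      ((hW₂ i i).aestronglyMeasurable (gridPt_le (hlt j l hl).le)).mul_const _
  have hS2 : ∀ j i, MemLp (S j i) 2 P := fun j i => hbdd (hSm j i) (hSle j i)
  have hR₀2 : MemLp R₀ 2 P := ((hZ2 t htT).sub (hZ2 0 zero_le)).sub hD2
  have hΓ : 0 ≤ Γ t - Γ 0 := by
    have hne : Nonempty Ω := nonempty_of_isProbabilityMeasure P
    obtain ⟨ω⟩ := hne
    exact (abs_nonneg _).trans (hZ.abs_drift_le htT ω)
  have hR₀le : ∀ ω, |R₀ ω| ≤ 2 * C + (Γ t - Γ 0) := fun ω => by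
    refine (abs_sub _ _).trans (add_le_add ((abs_sub _ _).trans ?_) (hZ.abs_drift_le htT ω))
    linarith [hZr.abs_le t ω, hZr.abs_le 0 ω]
  have hsumI : ∀ j, MemLp (fun ω => ∑ i, I j i ω) 2 P := fun j =>
    memLp_finsetSum _ fun i _ => hI2 j i
  have hsumS : ∀ j, MemLp (fun ω => 1 / 2 * ∑ i, S j i ω) 2 P := fun j =>
    (memLp_finsetSum _ fun i _ => hS2 j i).const_mul _
  set A : ℝ := 1 / 2 * (d * (C * T)) + (2 * C + (Γ t - Γ 0)) with hA
  have hbd : ∀ j ω, |1 / 2 * ∑ i, S j i ω - R₀ ω| ≤ A := fun j ω => by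
    refine (abs_sub _ _).trans (add_le_add ?_ (hR₀le ω))
    rw [abs_mul, abs_of_pos (by norm_num : (0 : ℝ) < 1 / 2)]
    refine mul_le_mul_of_nonneg_left ((Finset.abs_sum_le_sum_abs _ _).trans
      ((Finset.sum_le_sum fun i _ => hSle j i ω).trans (le_of_eq ?_))) (by norm_num)
    simp
  -- the `L²` bound which makes the products with `F` uniformly integrable
  have hRle : ∀ j, ∫ ω, (∑ i, I j i ω + 1 / 2 * ∑ i, S j i ω - R₀ ω) ^ 2 ∂P
      ≤ 2 * (d * ∑ _i : Fin d, C ^ 2 * T) + 2 * A ^ 2 := by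
    intro j
    have i1 : Integrable (fun ω => 2 * (d * ∑ i, I j i ω ^ 2)) P :=
      ((integrable_finsetSum _ fun i _ => (hI2 j i).integrable_sq).const_mul _).const_mul _
    have h1 : ∫ ω, (∑ i, I j i ω + 1 / 2 * ∑ i, S j i ω - R₀ ω) ^ 2 ∂P
        ≤ ∫ ω, (2 * (d * ∑ i, I j i ω ^ 2) + 2 * A ^ 2) ∂P := by
      refine integral_mono (((hsumI j).add (hsumS j)).sub hR₀2).integrable_sq
        (i1.add (integrable_const _)) fun ω => ?_
      have h2 : (∑ i, I j i ω) ^ 2 ≤ d * ∑ i, I j i ω ^ 2 := by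
        have := sq_sum_le_card_mul_sum_sq (s := (Finset.univ : Finset (Fin d)))
          (f := fun i => I j i ω)
        simpa using this
      have h3 : (1 / 2 * ∑ i, S j i ω - R₀ ω) ^ 2 ≤ A ^ 2 := by
        rw [← sq_abs]
        exact pow_le_pow_left₀ (abs_nonneg _) (hbd j ω) 2
      nlinarith [sq_nonneg (∑ i, I j i ω - (1 / 2 * ∑ i, S j i ω - R₀ ω))]
    refine h1.trans (le_of_eq_of_le (integral_add i1 (integrable_const _)) ?_)
    rw [integral_const_mul, integral_const_mul,
      integral_finsetSum _ fun i _ => (hI2 j i).integrable_sq, integral_const, probReal_univ,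
      one_smul]
    have h4 : ∑ i, ∫ ω, I j i ω ^ 2 ∂P ≤ ∑ _i : Fin d, C ^ 2 * T :=
      Finset.sum_le_sum fun i _ => hIle j i
    have := mul_le_mul_of_nonneg_left h4 (Nat.cast_nonneg (α := ℝ) d)
    linarith
  have hlim := tendsto_integral_mul_of_tendstoInMeasure hF2
    (R := fun j ω => ∑ i, I j i ω + 1 / 2 * ∑ i, S j i ω - R₀ ω)
    (fun j => ((hsumI j).add (hsumS j)).sub hR₀2) hRle (tendsto_ito_sum hB hW₂ hZ hW hk)
  -- evaluation of the expectations of the Itô sums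
  have hFI : ∀ j i, ∫ ω, F ω * I j i ω ∂P = ∑ l ∈ Finset.range (k * 2 ^ j),
      (∫ ω, F ω * W i (gridPt T (m + p + j) l) ω ∂P) * c (l / 2 ^ (p + j)) i
        * mesh T (m + p + j) := by
    intro j i
    -- `F` is also an exponential on the finer grid, with the coefficients repeated in each block,
    -- so that the factor of the increment over each fine interval can be isolated
    have hFj : F = stepExp B T (m + p + j) (fun l i => c (l / 2 ^ (p + j)) i)
        (Finset.range (2 ^ (m + p + j))) := by
      rw [hF]
      ext ω
      rw [stepExp_refine B T m (p + j), add_assoc]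
    have hint : ∀ l ∈ Finset.range (k * 2 ^ j), Integrable (fun ω =>
        F ω * (W i (gridPt T (m + p + j) l) ω * incr B T (m + p + j) l ω i)) P := fun l hl => by
      have := memLp_sum_mul_incr (a := fun l => W i (gridPt T (m + p + j) l)) (C := C) hB
        (memLp_coord_gaussPi _ i (by simp)) {l}
        (fun l' hl' => by rw [Finset.mem_singleton.1 hl']; exact hlt j l hl)
        (fun l' hl' => by
          rw [Finset.mem_singleton.1 hl']
          exact (hWr i).aestronglyMeasurable (gridPt_le (hlt j l hl).le))
        fun l' _ => (hWr i).abs_le _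
      simp only [Finset.sum_singleton] at this
      exact hF2.integrable_mul this
    simp only [I, Finset.mul_sum]
    rw [integral_finsetSum _ hint]
    refine Finset.sum_congr rfl fun l hl => ?_
    have h1 := integral_stepExp_mul_incr hB (fun l i => c (l / 2 ^ (p + j)) i) (hlt j l hl)
      ((hWr i).adapted _ (gridPt_le (hlt j l hl).le)) i
    rw [← hFj] at h1
    rw [h1]
    ring
  have hFS : ∀ j i, ∫ ω, F ω * S j i ω ∂P = ∑ l ∈ Finset.range (k * 2 ^ j),
      (∫ ω, F ω * W₂ i i (gridPt T (m + p + j) l) ω ∂P) * 1 * mesh T (m + p + j) := by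
    intro j i
    have hint : ∀ l ∈ Finset.range (k * 2 ^ j), Integrable (fun ω =>
        F ω * (W₂ i i (gridPt T (m + p + j) l) ω * mesh T (m + p + j))) P := fun l hl =>
      hF2.integrable_mul ((hbdd ((hW₂ i i).aestronglyMeasurable (gridPt_le (hlt j l hl).le))
        ((hW₂ i i).abs_le _)).mul_const _)
    simp only [S, Finset.mul_sum]
    rw [integral_finsetSum _ hint]
    refine Finset.sum_congr rfl fun l _ => ?_
    rw [mul_one, ← integral_mul_const]
    refine integral_congr_ae (Eventually.of_forall fun ω => ?_)
    simp only
    ring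
  have hdec : ∀ j, ∫ ω, F ω * (∑ i, I j i ω + 1 / 2 * ∑ i, S j i ω - R₀ ω) ∂P
      = ∑ i, (∫ ω, F ω * I j i ω ∂P + 1 / 2 * ∫ ω, F ω * S j i ω ∂P)
        - ∫ ω, F ω * R₀ ω ∂P := by
    intro j
    have i1 : ∀ i ∈ (Finset.univ : Finset (Fin d)), Integrable (fun ω => F ω * I j i ω) P :=
      fun i _ => hF2.integrable_mul (hI2 j i)
    have i2 : ∀ i ∈ (Finset.univ : Finset (Fin d)), Integrable (fun ω => F ω * S j i ω) P :=
      fun i _ => hF2.integrable_mul (hS2 j i)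
    have i12 : ∀ i ∈ (Finset.univ : Finset (Fin d)), Integrable
        (fun ω => F ω * I j i ω + 1 / 2 * (F ω * S j i ω)) P :=
      fun i hi => (i1 i hi).add ((i2 i hi).const_mul _)
    have i3 : Integrable (fun ω => F ω * R₀ ω) P := hF2.integrable_mul hR₀2
    have h1 : ∀ ω, F ω * (∑ i, I j i ω + 1 / 2 * ∑ i, S j i ω - R₀ ω)
        = ∑ i, (F ω * I j i ω + 1 / 2 * (F ω * S j i ω)) - F ω * R₀ ω := fun ω => by
      rw [Finset.sum_add_distrib, ← Finset.mul_sum, ← Finset.mul_sum, ← Finset.mul_sum]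
      ring
    simp only [h1]
    rw [integral_sub (integrable_finsetSum _ i12) i3, integral_finsetSum _ i12]
    congr 1
    refine Finset.sum_congr rfl fun i hi => ?_
    rw [integral_add (i1 i hi) ((i2 i hi).const_mul _), integral_const_mul]
  obtain ⟨M, hM⟩ : ∃ M : ℝ, ∀ l (i : Fin d), |c (l % 2 ^ m) i| ≤ M := by
    refine ⟨∑ l ∈ Finset.range (2 ^ m), ∑ i, |c l i|, fun l i => ?_⟩
    have h1 : l % 2 ^ m ∈ Finset.range (2 ^ m) :=
      Finset.mem_range.2 (Nat.mod_lt _ (by positivity))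
    exact (Finset.single_le_sum (f := fun i => |c (l % 2 ^ m) i|) (fun i _ => abs_nonneg _)
      (Finset.mem_univ i)).trans (Finset.single_le_sum (f := fun l => ∑ i, |c l i|)
      (fun l _ => Finset.sum_nonneg fun i _ => abs_nonneg _) h1)
  have hidx : ∀ j l, l < 2 ^ (m + p + j) → l / 2 ^ (p + j) % 2 ^ m = l / 2 ^ (p + j) := by
    intro j l hl
    refine Nat.mod_eq_of_lt ?_
    rw [Nat.div_lt_iff_lt_mul (by positivity), ← pow_add, ← add_assoc]
    exact hl
  have hlimI : ∀ i, Tendsto (fun j => ∫ ω, F ω * I j i ω ∂P) atTop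
      (𝓝 (∫ s in (0 : ℝ)..t, (∫ ω, F ω * W i s.toNNReal ω ∂P)
        * stepFunction (2 ^ m) (gridPt T m) c s i)) := by
    intro i
    have h1 := tendsto_riemann_sum (G := fun s => ∫ ω, F ω * W i s.toNNReal ω ∂P)
      (h := fun s => stepFunction (2 ^ m) (gridPt T m) c s i)
      (a := fun j l => c (l / 2 ^ (p + j) % 2 ^ m) i) (continuousOn_integral_mul (hWr i) hF2)
      (A := M) (fun j l => hM _ i) hk
      (fun j l hl s hs => by
        simp only [hidx j l hl]
        rw [add_assoc] at hs hl
        rw [stepFunction_eq c hl hs])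
    refine h1.congr fun j => ?_
    rw [hFI]
    refine Finset.sum_congr rfl fun l hl => ?_
    rw [hidx j l (hlt j l hl), Real.toNNReal_coe]
  have hlimS : ∀ i, Tendsto (fun j => ∫ ω, F ω * S j i ω ∂P) atTop
      (𝓝 (∫ s in (0 : ℝ)..t, (∫ ω, F ω * W₂ i i s.toNNReal ω ∂P))) := by
    intro i
    have h1 := tendsto_riemann_sum (G := fun s => ∫ ω, F ω * W₂ i i s.toNNReal ω ∂P)
      (h := fun _ => 1) (a := fun _ _ => 1) (continuousOn_integral_mul (hW₂ i i) hF2)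
      (A := 1) (fun j l => by simp) hk (fun j l hl s hs => rfl)
    simp only [mul_one] at h1 hFS
    refine h1.congr fun j => ?_
    rw [hFS]
    refine Finset.sum_congr rfl fun l hl => ?_
    rw [Real.toNNReal_coe]
  have hlim2 : Tendsto (fun j => ∫ ω, F ω * (∑ i, I j i ω + 1 / 2 * ∑ i, S j i ω - R₀ ω) ∂P) atTop
      (𝓝 (∑ i, ((∫ s in (0 : ℝ)..t, (∫ ω, F ω * W i s.toNNReal ω ∂P)
        * stepFunction (2 ^ m) (gridPt T m) c s i)
        + 1 / 2 * ∫ s in (0 : ℝ)..t, (∫ ω, F ω * W₂ i i s.toNNReal ω ∂P))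
        - ∫ ω, F ω * R₀ ω ∂P)) := by
    simp only [hdec]
    exact (tendsto_finsetSum _ fun i _ => (hlimI i).add ((hlimS i).const_mul _)).sub_const _
  have heq := tendsto_nhds_unique hlim2 hlim
  have hR₀ : ∫ ω, F ω * R₀ ω ∂P = (∫ ω, F ω * Z t ω ∂P) - (∫ ω, F ω * Z 0 ω ∂P)
      - ∫ ω, F ω * D t ω ∂P := by
    have j1 : Integrable (fun ω => F ω * Z t ω) P := hF2.integrable_mul (hZ2 t htT)
    have j2 : Integrable (fun ω => F ω * Z 0 ω) P := hF2.integrable_mul (hZ2 0 zero_le)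
    have j3 : Integrable (fun ω => F ω * D t ω) P := hF2.integrable_mul hD2
    have j12 : Integrable (fun ω => F ω * Z t ω - F ω * Z 0 ω) P := j1.sub j2
    rw [← integral_sub j1 j2, ← integral_sub j12 j3]
    refine integral_congr_ae (Eventually.of_forall fun ω => ?_)
    simp only [R₀]
    ring
  rw [← hR₀]
  linarith

end MeanEquation

/-! ### Versions of the coefficients and of the solution -/

section Versions

variable {Ω : Type*} [mΩ : MeasurableSpace Ω] {d : ℕ} {P : Measure Ω} {T : ℝ≥0}
  {B : ℝ≥0 → Ω → Eucl d}

lemma ae_ae_ae_of_ae_prod [SFinite P] {p : Ω × ℝ × Eucl d → Prop}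
    (h : ∀ᵐ z ∂(P.prod ((timeMeasure T).prod volume)), p z) :
    ∀ᵐ ω ∂P, ∀ᵐ t ∂(timeMeasure T), ∀ᵐ x, p (ω, t, x) := by
  filter_upwards [Measure.ae_ae_of_ae_prod h] with ω hω
  exact Measure.ae_ae_of_ae_prod hω

lemma ae_prod_ae_of_ae_prod [SFinite P] {p : Ω × ℝ × Eucl d → Prop}
    (h : ∀ᵐ z ∂(P.prod ((timeMeasure T).prod volume)), p z) :
    ∀ᵐ z ∂((timeMeasure T).prod (volume : Measure (Eucl d))), ∀ᵐ ω ∂P, p (ω, z) := by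
  have h1 := (Measure.measurePreserving_swap (μ := (timeMeasure T).prod (volume : Measure (Eucl d)))
    (ν := P)).quasiMeasurePreserving.ae h
  exact Measure.ae_ae_of_ae_prod h1

/-- A property which holds almost everywhere on `Ω × [0, T] × ℝ^d` holds, for almost every time,
almost surely and for almost every point. -/
lemma ae_time_ae_ae_of_ae_prod [SFinite P] {p : Ω × ℝ × Eucl d → Prop}
    (h : ∀ᵐ z ∂(P.prod ((timeMeasure T).prod volume)), p z) :
    ∀ᵐ t ∂(timeMeasure T), ∀ᵐ ω ∂P, ∀ᵐ x, p (ω, t, x) := by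
  obtain ⟨N, hN, hNm, hN0⟩ := exists_measurable_superset_of_null (ae_iff.1 h)
  have h1 : ∀ᵐ z ∂(P.prod ((timeMeasure T).prod (volume : Measure (Eucl d)))), z ∉ N :=
    measure_eq_zero_iff_ae_notMem.1 hN0
  have h2 := Measure.ae_ae_of_ae_prod (ae_prod_ae_of_ae_prod h1)
  filter_upwards [h2] with t ht
  have hm : MeasurableSet {q : Eucl d × Ω | (q.2, t, q.1) ∉ N} := by
    have : Measurable fun q : Eucl d × Ω => (q.2, t, q.1) := by fun_prop
    exact this hNm.compl
  filter_upwards [(Measure.ae_ae_comm hm).1 ht] with ω hω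
  filter_upwards [hω] with x hx
  by_contra hcon
  exact hx (hN hcon)

/-- The notion of solution only depends on the coefficients up to null sets. -/
lemma IsQuasiregularSolution.congr_coeff {b b' : ℝ → Eucl d → Eucl d} {divb divb' : ℝ → Eucl d → ℝ}
    {u₀ : Eucl d → ℝ} {u : Ω → ℝ → Eucl d → ℝ}
    (hu : IsQuasiregularSolution P T B b divb u₀ u)
    (hb : ∀ᵐ z ∂((timeMeasure T).prod (volume : Measure (Eucl d))), b z.1 z.2 = b' z.1 z.2)
    (hdivb : ∀ᵐ z ∂((timeMeasure T).prod (volume : Measure (Eucl d))),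
      divb z.1 z.2 = divb' z.1 z.2) :
    IsQuasiregularSolution P T B b' divb' u₀ u := by
  refine ⟨hu.memLp_two, hu.memLp_top, hu.semimartingale, fun φ hφ t ht => ?_, hu.regular_in_mean⟩
  obtain ⟨S, hS, heq⟩ := hu.equation φ hφ t ht
  refine ⟨S, hS, ?_⟩
  have htT : (t : ℝ) ∈ Icc 0 (T : ℝ) := ⟨t.coe_nonneg, by exact_mod_cast ht⟩
  filter_upwards [heq] with ω hω
  rw [hω]
  congr 2
  · congr 1
    rw [integral_interval_eq_timeMeasure htT, integral_interval_eq_timeMeasure htT]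
    refine integral_congr_ae (ae_restrict_of_ae ?_)
    filter_upwards [Measure.ae_ae_of_ae_prod hb] with s hs
    refine integral_congr_ae ?_
    filter_upwards [hs] with x hx
    have hx' : b s x = b' s x := hx
    rw [hx']
  · rw [integral_interval_eq_timeMeasure htT, integral_interval_eq_timeMeasure htT]
    refine integral_congr_ae (ae_restrict_of_ae ?_)
    filter_upwards [Measure.ae_ae_of_ae_prod hdivb] with s hs
    refine integral_congr_ae ?_
    filter_upwards [hs] with x hx
    have hx' : divb s x = divb' s x := hx
    rw [hx']

/-- `U` is a measurable version of `u`, bounded by `C₀` everywhere. -/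
structure IsBoundedVersion (P : Measure Ω) (T : ℝ≥0) (u : Ω → ℝ → Eucl d → ℝ)
    (U : Ω × ℝ × Eucl d → ℝ) (C₀ : ℝ) : Prop where
  measurable : Measurable U
  abs_le : ∀ z, |U z| ≤ C₀
  ae_eq : ∀ᵐ z ∂(P.prod ((timeMeasure T).prod volume)), u z.1 z.2.1 z.2.2 = U z

lemma exists_isBoundedVersion {u : Ω → ℝ → Eucl d → ℝ}
    (hu : MemLp (fun z : Ω × ℝ × Eucl d => u z.1 z.2.1 z.2.2) ∞
      (P.prod ((timeMeasure T).prod volume))) :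
    ∃ U C₀, 0 ≤ C₀ ∧ IsBoundedVersion P T u U C₀ := by
  set f : Ω × ℝ × Eucl d → ℝ := fun z => u z.1 z.2.1 z.2.2 with hf
  set C₀ := (eLpNorm f ∞ (P.prod ((timeMeasure T).prod volume))).toReal with hC₀
  refine ⟨fun z => clip C₀ (hu.1.mk f z), C₀, ENNReal.toReal_nonneg,
    (continuous_clip C₀).measurable.comp hu.1.stronglyMeasurable_mk.measurable,
    fun z => abs_clip_le ENNReal.toReal_nonneg _, ?_⟩
  filter_upwards [hu.1.ae_eq_mk, ae_le_eLpNormEssSup (f := f)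
    (μ := P.prod ((timeMeasure T).prod volume))] with z h1 h2
  rw [← h1, clip_of_abs_le]
  have h3 : ‖f z‖ₑ ≤ eLpNorm f ∞ (P.prod ((timeMeasure T).prod volume)) := by
    rwa [eLpNorm_exponent_top]
  have h4 := ENNReal.toReal_mono hu.2.ne h3
  rwa [toReal_enorm, Real.norm_eq_abs] at h4

end Versions

/-! ### The drift of a solution -/

section Drift

variable {Ω : Type*} [mΩ : MeasurableSpace Ω] {d : ℕ} {P : Measure Ω} {T : ℝ≥0}

/-- The kernel `b · ∇φ + (div b) φ` of the drift in the weak formulation. -/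
def driftKernel (b : ℝ → Eucl d → Eucl d) (divb : ℝ → Eucl d → ℝ) (φ : Eucl d → ℝ) (s : ℝ)
    (x : Eucl d) : ℝ :=
  ∑ i, b s x i * partialD i φ x + divb s x * φ x

/-- The process `∫₀ᵗ ∫ U g dx ds`. -/
def driftIntegral (U : Ω × ℝ × Eucl d → ℝ) (g : ℝ → Eucl d → ℝ) (t : ℝ≥0) (ω : Ω) : ℝ :=
  ∫ s in (0 : ℝ)..t, ∫ x, U (ω, s, x) * g s x

variable {u : Ω → ℝ → Eucl d → ℝ} {U : Ω × ℝ × Eucl d → ℝ} {C₀ : ℝ} {g : ℝ → Eucl d → ℝ}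

lemma ae_abs_integral_mul_le (hU : IsBoundedVersion P T u U C₀)
    (hgi : Integrable (fun z : ℝ × Eucl d => g z.1 z.2) ((timeMeasure T).prod volume)) (ω : Ω) :
    ∀ᵐ s ∂(timeMeasure T), |∫ x, U (ω, s, x) * g s x| ≤ C₀ * ∫ x, |g s x| := by
  filter_upwards [hgi.prod_right_ae] with s hs
  have hs' : Integrable (g s) := hs
  rw [← integral_const_mul]
  refine abs_integral_le_of_abs_le (hs'.abs.const_mul C₀) (Eventually.of_forall fun x => ?_)
  rw [abs_mul]
  exact mul_le_mul_of_nonneg_right (hU.abs_le _) (abs_nonneg _)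

lemma measurable_integral_mul (hU : Measurable U)
    (hg : Measurable fun z : ℝ × Eucl d => g z.1 z.2) :
    Measurable fun q : Ω × ℝ => ∫ x, U (q.1, q.2, x) * g q.2 x := by
  have h1 : Measurable fun q : (Ω × ℝ) × Eucl d => U (q.1.1, q.1.2, q.2) * g q.1.2 q.2 := by
    have h2 : Measurable fun q : (Ω × ℝ) × Eucl d => U (q.1.1, q.1.2, q.2) :=
      hU.comp (by fun_prop)
    have h3 : Measurable fun q : (Ω × ℝ) × Eucl d => g q.1.2 q.2 :=
      hg.comp (f := fun q : (Ω × ℝ) × Eucl d => (q.1.2, q.2)) (by fun_prop)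
    exact h2.mul h3
  exact (h1.stronglyMeasurable.integral_prod_right' (ν := volume)).measurable

lemma integrable_integral_abs (hgi : Integrable (fun z : ℝ × Eucl d => g z.1 z.2)
    ((timeMeasure T).prod volume)) :
    Integrable (fun s => C₀ * ∫ x, |g s x|) (timeMeasure T) :=
  (hgi.abs.integral_prod_left).const_mul C₀

lemma integrable_integral_mul (hU : IsBoundedVersion P T u U C₀)
    (hg : Measurable fun z : ℝ × Eucl d => g z.1 z.2)
    (hgi : Integrable (fun z : ℝ × Eucl d => g z.1 z.2) ((timeMeasure T).prod volume)) (ω : Ω) :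
    Integrable (fun s => ∫ x, U (ω, s, x) * g s x) (timeMeasure T) :=
  (integrable_integral_abs hgi).mono'
    ((measurable_integral_mul hU.measurable hg).comp measurable_prodMk_left).aestronglyMeasurable
    (ae_abs_integral_mul_le hU hgi ω)

lemma intervalIntegrable_of_timeMeasure {f : ℝ → ℝ} (hf : Integrable f (timeMeasure T)) {s t : ℝ}
    (hs : s ∈ Icc 0 (T : ℝ)) (ht : t ∈ Icc 0 (T : ℝ)) : IntervalIntegrable f volume s t := by
  rw [intervalIntegrable_iff]
  have h1 : IntegrableOn f (Icc 0 (T : ℝ)) := hf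
  refine h1.mono_set ?_
  rw [uIoc]
  exact Ioc_subset_Icc_self.trans (Icc_subset_Icc (le_min hs.1 ht.1) (max_le hs.2 ht.2))

lemma measurable_driftIntegral (hU : Measurable U)
    (hg : Measurable fun z : ℝ × Eucl d => g z.1 z.2) (t : ℝ≥0) :
    Measurable (driftIntegral U g t) := by
  have h1 := ((measurable_integral_mul hU hg).stronglyMeasurable.integral_prod_right'
    (ν := volume.restrict (Ioc 0 (t : ℝ)))).measurable
  unfold driftIntegral
  simp only [intervalIntegral.integral_of_le t.coe_nonneg]
  exact h1

lemma coe_mem_Icc {t : ℝ≥0} (ht : t ≤ T) : (t : ℝ) ∈ Icc 0 (T : ℝ) :=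
  ⟨t.coe_nonneg, by exact_mod_cast ht⟩

lemma abs_driftIntegral_sub_le (hU : IsBoundedVersion P T u U C₀)
    (hg : Measurable fun z : ℝ × Eucl d => g z.1 z.2)
    (hgi : Integrable (fun z : ℝ × Eucl d => g z.1 z.2) ((timeMeasure T).prod volume))
    {s t : ℝ≥0} (hst : s ≤ t) (ht : t ≤ T) (ω : Ω) :
    |driftIntegral U g t ω - driftIntegral U g s ω|
      ≤ (∫ r in (0 : ℝ)..t, C₀ * ∫ x, |g r x|) - ∫ r in (0 : ℝ)..s, C₀ * ∫ x, |g r x| := by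
  have h0 : (0 : ℝ) ∈ Icc 0 (T : ℝ) := ⟨le_rfl, T.coe_nonneg⟩
  have hs' := coe_mem_Icc (hst.trans ht)
  have ht' := coe_mem_Icc ht
  have hi := integrable_integral_mul hU hg hgi ω
  have ha := integrable_integral_abs (C₀ := C₀) hgi
  unfold driftIntegral
  rw [intervalIntegral.integral_interval_sub_left (intervalIntegrable_of_timeMeasure hi h0 ht')
    (intervalIntegrable_of_timeMeasure hi h0 hs'), intervalIntegral.integral_interval_sub_left
    (intervalIntegrable_of_timeMeasure ha h0 ht') (intervalIntegrable_of_timeMeasure ha h0 hs')]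
  have hst' : (s : ℝ) ≤ t := by exact_mod_cast hst
  rw [← Real.norm_eq_abs]
  refine intervalIntegral.norm_integral_le_of_norm_le hst' ?_
    (intervalIntegrable_of_timeMeasure ha hs' ht')
  have h1 := (ae_restrict_iff' measurableSet_Icc).1 (ae_abs_integral_mul_le hU hgi ω)
  filter_upwards [h1] with r hr hr'
  exact hr ⟨hs'.1.trans hr'.1.le, hr'.2.trans ht'.2⟩

/-- The mean `E[F U(t, x)]`. -/
def meanField (P : Measure Ω) (F : Ω → ℝ) (U : Ω × ℝ × Eucl d → ℝ) (t : ℝ) (x : Eucl d) : ℝ :=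
  ∫ ω, F ω * U (ω, t, x) ∂P

lemma measurable_meanField [SFinite P] {F : Ω → ℝ} (hF : Measurable F) (hU : Measurable U) :
    Measurable fun z : ℝ × Eucl d => meanField P F U z.1 z.2 := by
  have h1 : Measurable fun q : (ℝ × Eucl d) × Ω => F q.2 * U (q.2, q.1.1, q.1.2) :=
    (hF.comp measurable_snd).mul (hU.comp (by fun_prop))
  exact (h1.stronglyMeasurable.integral_prod_right' (ν := P)).measurable

lemma abs_meanField_le {F : Ω → ℝ} (hF : Integrable F P) (hU : IsBoundedVersion P T u U C₀) (t : ℝ)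
    (x : Eucl d) : |meanField P F U t x| ≤ C₀ * ∫ ω, |F ω| ∂P := by
  rw [← integral_const_mul]
  refine abs_integral_le_of_abs_le (hF.abs.const_mul C₀) (Eventually.of_forall fun ω => ?_)
  rw [abs_mul, mul_comm]
  exact mul_le_mul_of_nonneg_right (hU.abs_le _) (abs_nonneg _)

/-- Exchange of the expectation and the space integral. -/
lemma integral_mul_integral_eq [SFinite P] {F : Ω → ℝ} (hF : Integrable F P)
    (hU : IsBoundedVersion P T u U C₀) {ψ : Eucl d → ℝ} (hψ : Integrable ψ) (t : ℝ) :
    ∫ ω, F ω * (∫ x, U (ω, t, x) * ψ x) ∂P = ∫ x, meanField P F U t x * ψ x := by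
  have hint : Integrable (fun q : Ω × Eucl d => F q.1 * (U (q.1, t, q.2) * ψ q.2))
      (P.prod volume) := by
    have h1 : Integrable (fun q : Ω × Eucl d => F q.1 * ψ q.2) (P.prod volume) := hF.mul_prod hψ
    have h2 : Integrable (fun q : Ω × Eucl d => U (q.1, t, q.2) * (F q.1 * ψ q.2))
        (P.prod volume) := h1.bdd_mul (c := C₀)
      (hU.measurable.comp (by fun_prop)).aestronglyMeasurable
      (Eventually.of_forall fun q => hU.abs_le _)
    refine h2.congr (Eventually.of_forall fun q => ?_)
    simp only
    ring
  simp only [← integral_const_mul]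
  rw [integral_integral_swap hint]
  refine integral_congr_ae (Eventually.of_forall fun x => ?_)
  simp only [meanField]
  rw [← integral_mul_const]
  refine integral_congr_ae (Eventually.of_forall fun ω => ?_)
  simp only
  ring

/-- The mean of the drift is the drift of the mean. -/
lemma integral_mul_driftIntegral [IsFiniteMeasure P] {F : Ω → ℝ} (hFm : Measurable F)
    (hF : Integrable F P)
    (hU : IsBoundedVersion P T u U C₀) (hg : Measurable fun z : ℝ × Eucl d => g z.1 z.2)
    (hgi : Integrable (fun z : ℝ × Eucl d => g z.1 z.2) ((timeMeasure T).prod volume)) {t : ℝ≥0}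
    (ht : t ≤ T) :
    ∫ ω, F ω * driftIntegral U g t ω ∂P
      = ∫ s in (0 : ℝ)..t, ∫ x, meanField P F U s x * g s x := by
  unfold driftIntegral
  simp only [integral_interval_eq_timeMeasure (coe_mem_Icc ht)]
  have hint : Integrable (fun q : Ω × ℝ => F q.1 * ∫ x, U (q.1, q.2, x) * g q.2 x)
      (P.prod ((timeMeasure T).restrict (Ioc 0 (t : ℝ)))) := by
    have h1 : Integrable (fun q : Ω × ℝ => F q.1 * (C₀ * ∫ x, |g q.2 x|))
        (P.prod ((timeMeasure T).restrict (Ioc 0 (t : ℝ)))) :=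
      hF.mul_prod (integrable_integral_abs hgi).restrict
    refine h1.mono ((hFm.comp measurable_fst).mul
      (measurable_integral_mul hU.measurable hg)).aestronglyMeasurable ?_
    have hm : MeasurableSet {q : Ω × ℝ | |∫ x, U (q.1, q.2, x) * g q.2 x|
        ≤ C₀ * ∫ x, |g q.2 x|} := by
      refine measurableSet_le (measurable_integral_mul hU.measurable hg).abs ?_
      have h2 : Measurable fun s : ℝ => ∫ x, |g s x| :=
        ((hg.abs).stronglyMeasurable.integral_prod_right' (ν := volume)).measurable
      exact (h2.comp measurable_snd).const_mul C₀
    have h3 := (Measure.ae_prod_iff_ae_ae (μ := P)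
      (ν := (timeMeasure T).restrict (Ioc 0 (t : ℝ))) hm).2
      (Eventually.of_forall fun ω => ae_restrict_of_ae (ae_abs_integral_mul_le hU hgi ω))
    filter_upwards [h3] with q hq
    rw [norm_mul, norm_mul]
    exact mul_le_mul_of_nonneg_left (hq.trans (le_abs_self _)) (norm_nonneg _)
  have hpull : ∀ ω, F ω * ∫ s in Ioc 0 (t : ℝ), (∫ x, U (ω, s, x) * g s x) ∂(timeMeasure T)
      = ∫ s in Ioc 0 (t : ℝ), F ω * (∫ x, U (ω, s, x) * g s x) ∂(timeMeasure T) :=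
    fun ω => (integral_const_mul _ _).symm
  simp only [hpull]
  rw [integral_integral_swap hint]
  refine integral_congr_ae (ae_restrict_of_ae ?_)
  filter_upwards [hgi.prod_right_ae] with s hs
  exact integral_mul_integral_eq hF hU hs s

end Drift

/-! ### Testing a quasiregular solution -/

section Solution

variable {Ω : Type*} [mΩ : MeasurableSpace Ω] {d : ℕ} {P : Measure Ω} {T : ℝ≥0}
  {B : ℝ≥0 → Ω → Eucl d} {b : ℝ → Eucl d → Eucl d} {divb : ℝ → Eucl d → ℝ} {u₀ : Eucl d → ℝ}
  {u : Ω → ℝ → Eucl d → ℝ} {U : Ω × ℝ × Eucl d → ℝ} {C₀ : ℝ}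

/-- Almost every property of time is satisfied along sequences converging to any given time. -/
lemma exists_seq_of_ae_timeMeasure (hT : 0 < T) {p : ℝ → Prop} (h : ∀ᵐ s ∂(timeMeasure T), p s)
    {t : ℝ} (ht : t ∈ Icc 0 (T : ℝ)) :
    ∃ s : ℕ → ℝ, (∀ n, s n ∈ Icc 0 (T : ℝ) ∧ p (s n)) ∧ Tendsto s atTop (𝓝 t) := by
  have hT' : (0 : ℝ) < T := by exact_mod_cast hT
  have hcl : t ∈ closure {s | s ∈ Icc 0 (T : ℝ) ∧ p s} := by
    rw [Metric.mem_closure_iff]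
    intro ε hε
    by_contra! hcon
    have h1 := (ae_restrict_iff' measurableSet_Icc).1 h
    have h2 : volume (Ioo (max 0 (t - ε)) (min (T : ℝ) (t + ε))) = 0 := by
      refine measure_mono_null (t := {s | ¬ (s ∈ Icc 0 (T : ℝ) → p s)}) (fun s hs => ?_) (ae_iff.1 h1)
      change ¬ (s ∈ Icc 0 (T : ℝ) → p s)
      intro hps
      have hs0 := (max_lt_iff.1 hs.1)
      have hs1 := (lt_min_iff.1 hs.2)
      have h3 := hcon s ⟨⟨hs0.1.le, hs1.1.le⟩, hps ⟨hs0.1.le, hs1.1.le⟩⟩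
      rw [Real.dist_eq] at h3
      have : |t - s| < ε := abs_lt.2 ⟨by linarith [hs1.2], by linarith [hs0.2]⟩
      linarith
    rw [Real.volume_Ioo, ENNReal.ofReal_eq_zero, sub_nonpos] at h2
    have h3 : max 0 (t - ε) < min (T : ℝ) (t + ε) :=
      max_lt (lt_min hT' (by linarith [ht.1])) (lt_min (by linarith [ht.2]) (by linarith))
    linarith
  obtain ⟨s, hs, hlim⟩ := mem_closure_iff_seq_limit.1 hcl
  exact ⟨s, hs, hlim⟩

/-- Against a test function, a solution is a bounded regular process. -/
lemma IsQuasiregularSolution.exists_process [IsProbabilityMeasure P] (hT : 0 < T)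
    (hu : IsQuasiregularSolution P T B b divb u₀ u) (hU : IsBoundedVersion P T u U C₀)
    (hC₀ : 0 ≤ C₀) {φ : Eucl d → ℝ} (hφ : IsTestFunction φ) {C : ℝ} (hC : C₀ * ∫ x, |φ x| ≤ C) :
    ∃ Z, IsRegularProcess P (brownianFiltration B T P) T C Z ∧
      ∀ t ≤ T, Z t =ᵐ[P] fun ω => ∫ x, u ω t x * φ x := by
  obtain ⟨X, hX, hXe⟩ := hu.semimartingale φ hφ
  have hC0 : 0 ≤ C := (mul_nonneg hC₀ (integral_nonneg fun x => abs_nonneg _)).trans hC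
  have hgood : ∀ᵐ s ∂(timeMeasure T), ∀ᵐ ω ∂P, |∫ x, u ω s x * φ x| ≤ C := by
    filter_upwards [ae_time_ae_ae_of_ae_prod hU.ae_eq] with s hs
    filter_upwards [hs] with ω hω
    refine le_trans ?_ hC
    rw [← integral_const_mul]
    refine abs_integral_le_of_abs_le (hφ.integrable.abs.const_mul C₀) ?_
    filter_upwards [hω] with x hx
    have hx' : u ω s x = U (ω, s, x) := hx
    rw [hx', abs_mul]
    exact mul_le_mul_of_nonneg_right (hU.abs_le _) (abs_nonneg _)
  have hcont : ∀ᵐ ω ∂P, ContinuousOn (fun t => X t ω) (Iic T) := by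
    obtain ⟨M, A, hMc, -, -, hAc, hXMA⟩ := hX
    filter_upwards [hMc, hAc, hXMA] with ω h1 h2 h3
    exact (h1.continuousOn.add h2.1).congr fun t ht => h3 t ht
  have hbd : ∀ t ≤ T, ∀ᵐ ω ∂P, |X t ω| ≤ C := by
    intro t ht
    obtain ⟨s, hs, hlim⟩ := exists_seq_of_ae_timeMeasure hT hgood (coe_mem_Icc ht)
    have hsT : ∀ n, (s n).toNNReal ≤ T := fun n => Real.toNNReal_le_iff_le_coe.2 (hs n).1.2
    have hall : ∀ᵐ ω ∂P, ∀ n, |X (s n).toNNReal ω| ≤ C := by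
      refine ae_all_iff.2 fun n => ?_
      filter_upwards [(hs n).2, hXe _ (hsT n)] with ω h1 h2
      rw [h2, Real.coe_toNNReal _ (hs n).1.1]
      exact h1
    filter_upwards [hall, hcont] with ω h1 h2
    have h3 : Tendsto (fun n => (s n).toNNReal) atTop (𝓝[Iic T] t) := by
      refine tendsto_nhdsWithin_iff.2 ⟨?_, Eventually.of_forall hsT⟩
      have := (continuous_real_toNNReal.tendsto (t : ℝ)).comp hlim
      rwa [Real.toNNReal_coe] at this
    have h4 := ((h2 t ht).tendsto.comp h3).abs
    exact le_of_tendsto h4 (Eventually.of_forall h1)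
  obtain ⟨Z, hZ, hZX⟩ := exists_isRegularProcess hX hC0 hbd
  exact ⟨Z, hZ, fun t ht => (hZX t ht).trans (hXe t ht)⟩

/-- The initial condition. -/
lemma IsQuasiregularSolution.ae_integral_zero
    (hu : IsQuasiregularSolution P T B b divb u₀ u) {φ : Eucl d → ℝ} (hφ : IsTestFunction φ) :
    ∀ᵐ ω ∂P, ∫ x, u ω (0 : ℝ≥0) x * φ x = ∫ x, u₀ x * φ x := by
  obtain ⟨S, hS, heq⟩ := hu.equation φ hφ 0 zero_le
  have hS0 : ∀ i, (fun _ => 0) =ᵐ[P] S i := by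
    intro i
    have h1 := hS i (fun _ => 0) (fun _ _ => 0)
      (fun n => ⟨monotone_const, rfl, rfl⟩) (by simp)
    have h2 : TendstoInMeasure P (fun _ => fun _ => (0 : ℝ)) (atTop : Filter ℕ) (fun _ : Ω => 0) :=
      tendstoInMeasure_zero_iff.2 fun ε hε => by simp [not_le.2 hε]
    refine tendstoInMeasure_ae_unique h2 (h1.congr_left fun n => ?_)
    refine Eventually.of_forall fun ω => ?_
    simp [stratonovichSum]
  filter_upwards [heq, ae_all_iff.2 hS0] with ω h1 h2
  rw [h1]
  simp [← h2]

lemma integrable_sum_mul_partialD (hb : MemL2Loc T b) {φ : Eucl d → ℝ} (hφ : IsTestFunction φ) :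
    Integrable (fun z : ℝ × Eucl d => ∑ i, b z.1 z.2 i * partialD i φ z.2)
      ((timeMeasure T).prod volume) := by
  refine integrable_finsetSum _ fun i _ => ?_
  have hi := hφ.partialD i
  obtain ⟨M, -, hM⟩ := hi.exists_bound
  have hK : IsCompact (tsupport (partialD i φ)) := hi.compactSupport
  have hfin : IsFiniteMeasure (volume.restrict (tsupport (partialD i φ))) :=
    ⟨by rw [Measure.restrict_apply_univ]; exact hK.measure_lt_top⟩
  have h1 : Integrable (fun z : ℝ × Eucl d => b z.1 z.2 i * partialD i φ z.2)
      ((timeMeasure T).prod (volume.restrict (tsupport (partialD i φ)))) := by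
    have h2 : Integrable (fun z : ℝ × Eucl d => b z.1 z.2 i)
      ((timeMeasure T).prod (volume.restrict (tsupport (partialD i φ)))) :=
      (MemLp.coord (hb _ hK) i).integrable (by norm_num)
    exact h2.mul_bdd (c := M) (hi.continuous.comp continuous_snd).aestronglyMeasurable
      (Eventually.of_forall fun z => hM z.2)
  have h3 : (timeMeasure T).prod (volume.restrict (tsupport (partialD i φ)))
      = ((timeMeasure T).prod volume).restrict (univ ×ˢ tsupport (partialD i φ)) := by
    rw [← Measure.prod_restrict, Measure.restrict_univ]
  rw [h3] at h1
  refine IntegrableOn.integrable_of_forall_notMem_eq_zero h1 fun z hz => ?_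
  have : partialD i φ z.2 = 0 := by
    by_contra hne
    exact hz ⟨mem_univ _, subset_tsupport _ hne⟩
  rw [this, mul_zero]

lemma integrable_divb_mul (hdivb : MemL1Linfty T volume divb)
    (hdm : Measurable fun z : ℝ × Eucl d => divb z.1 z.2) {φ : Eucl d → ℝ}
    (hφ : IsTestFunction φ) :
    Integrable (fun z : ℝ × Eucl d => divb z.1 z.2 * φ z.2) ((timeMeasure T).prod volume) := by
  have hm : Measurable fun z : ℝ × Eucl d => divb z.1 z.2 * φ z.2 :=
    hdm.mul (hφ.continuous.measurable.comp measurable_snd)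
  refine ⟨hm.aestronglyMeasurable, ?_⟩
  rw [HasFiniteIntegral, lintegral_prod _ hm.enorm.aemeasurable]
  calc ∫⁻ s, (∫⁻ x, ‖divb s x * φ x‖ₑ) ∂(timeMeasure T)
      ≤ ∫⁻ s, eLpNorm (divb s) ∞ volume * (∫⁻ x, ‖φ x‖ₑ) ∂(timeMeasure T) := by
        refine lintegral_mono fun s => ?_
        rw [← lintegral_const_mul _ hφ.continuous.measurable.enorm]
        refine lintegral_mono_ae ?_
        filter_upwards [ae_le_eLpNormEssSup (f := divb s) (μ := volume)] with x hx
        rw [enorm_mul, eLpNorm_exponent_top]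
        exact mul_le_mul_left hx _
    _ < ∞ := by
        rw [lintegral_mul_const' _ _ hφ.integrable.2.ne]
        exact ENNReal.mul_lt_top hdivb.2 hφ.integrable.2

lemma measurable_driftKernel (hbm : Measurable fun z : ℝ × Eucl d => b z.1 z.2)
    (hdm : Measurable fun z : ℝ × Eucl d => divb z.1 z.2) {φ : Eucl d → ℝ}
    (hφ : IsTestFunction φ) :
    Measurable fun z : ℝ × Eucl d => driftKernel b divb φ z.1 z.2 := by
  unfold driftKernel
  refine (Finset.measurable_fun_sum _ fun i _ => ?_).add
    (hdm.mul (hφ.continuous.measurable.comp measurable_snd))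
  have hc : Measurable fun x : Eucl d => x i := by fun_prop
  exact (hc.comp hbm).mul ((hφ.partialD i).continuous.measurable.comp measurable_snd)

lemma integrable_driftKernel (hb : MemL2Loc T b) (hdivb : MemL1Linfty T volume divb)
    (hdm : Measurable fun z : ℝ × Eucl d => divb z.1 z.2) {φ : Eucl d → ℝ}
    (hφ : IsTestFunction φ) :
    Integrable (fun z : ℝ × Eucl d => driftKernel b divb φ z.1 z.2)
      ((timeMeasure T).prod volume) :=
  (integrable_sum_mul_partialD hb hφ).add (integrable_divb_mul hdivb hdm hφ)

/-- The two drift terms of the weak formulation, expressed with the bounded version. -/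
lemma ae_drift_eq [SFinite P] (hU : IsBoundedVersion P T u U C₀) (hb : MemL2Loc T b)
    (hdivb : MemL1Linfty T volume divb)
    (hbm : Measurable fun z : ℝ × Eucl d => b z.1 z.2)
    (hdm : Measurable fun z : ℝ × Eucl d => divb z.1 z.2) {φ : Eucl d → ℝ}
    (hφ : IsTestFunction φ) {t : ℝ≥0} (ht : t ≤ T) :
    ∀ᵐ ω ∂P, (∫ s in (0 : ℝ)..t, ∫ x, u ω s x * ∑ i, b s x i * partialD i φ x)
      + (∫ s in (0 : ℝ)..t, ∫ x, divb s x * u ω s x * φ x)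
      = driftIntegral U (driftKernel b divb φ) t ω := by
  have hi1 := integrable_sum_mul_partialD hb hφ
  have hi2 := integrable_divb_mul hdivb hdm hφ
  have hm1 : Measurable fun z : ℝ × Eucl d => ∑ i, b z.1 z.2 i * partialD i φ z.2 := by
    refine Finset.measurable_fun_sum _ fun i _ => ?_
    have hc : Measurable fun x : Eucl d => x i := by fun_prop
    exact (hc.comp hbm).mul ((hφ.partialD i).continuous.measurable.comp measurable_snd)
  have hm2 : Measurable fun z : ℝ × Eucl d => divb z.1 z.2 * φ z.2 :=
    hdm.mul (hφ.continuous.measurable.comp measurable_snd)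
  filter_upwards [ae_ae_ae_of_ae_prod hU.ae_eq] with ω hω
  have j1 := integrable_integral_mul (g := fun s x => ∑ i, b s x i * partialD i φ x) hU hm1 hi1 ω
  have j2 := integrable_integral_mul (g := fun s x => divb s x * φ x) hU hm2 hi2 ω
  unfold driftIntegral
  simp only [integral_interval_eq_timeMeasure (coe_mem_Icc ht)]
  have e1 : ∫ s in Ioc 0 (t : ℝ), (∫ x, u ω s x * ∑ i, b s x i * partialD i φ x) ∂(timeMeasure T)
      = ∫ s in Ioc 0 (t : ℝ), (∫ x, U (ω, s, x) * ∑ i, b s x i * partialD i φ x)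
        ∂(timeMeasure T) := by
    refine integral_congr_ae (ae_restrict_of_ae ?_)
    filter_upwards [hω] with s hs
    refine integral_congr_ae ?_
    filter_upwards [hs] with x hx
    have hx' : u ω s x = U (ω, s, x) := hx
    rw [hx']
  have e2 : ∫ s in Ioc 0 (t : ℝ), (∫ x, divb s x * u ω s x * φ x) ∂(timeMeasure T)
      = ∫ s in Ioc 0 (t : ℝ), (∫ x, U (ω, s, x) * (divb s x * φ x)) ∂(timeMeasure T) := by
    refine integral_congr_ae (ae_restrict_of_ae ?_)
    filter_upwards [hω] with s hs
    refine integral_congr_ae ?_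
    filter_upwards [hs] with x hx
    have hx' : u ω s x = U (ω, s, x) := hx
    rw [hx']
    ring
  rw [e1, e2, ← integral_add j1.restrict j2.restrict]
  refine integral_congr_ae (ae_restrict_of_ae ?_)
  filter_upwards [hi1.prod_right_ae, hi2.prod_right_ae] with s h1 h2
  have hUm : AEStronglyMeasurable (fun x => U (ω, s, x)) (volume : Measure (Eucl d)) :=
    (hU.measurable.comp (by fun_prop : Measurable fun x => (ω, s, x))).aestronglyMeasurable
  have k1 : Integrable (fun x => U (ω, s, x) * ∑ i, b s x i * partialD i φ x) :=
    h1.bdd_mul (c := C₀) hUm (Eventually.of_forall fun x => hU.abs_le _)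
  have k2 : Integrable (fun x => U (ω, s, x) * (divb s x * φ x)) :=
    h2.bdd_mul (c := C₀) hUm (Eventually.of_forall fun x => hU.abs_le _)
  rw [← integral_add k1 k2]
  refine integral_congr_ae (Eventually.of_forall fun x => ?_)
  simp only [driftKernel]
  ring

/-- The weak formulation is a Stratonovich decomposition of the tested processes. -/
lemma IsQuasiregularSolution.isStratonovichDecomposition [IsProbabilityMeasure P]
    (hu : IsQuasiregularSolution P T B b divb u₀ u) (hU : IsBoundedVersion P T u U C₀)
    (hb : MemL2Loc T b) (hdivb : MemL1Linfty T volume divb)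
    (hbm : Measurable fun z : ℝ × Eucl d => b z.1 z.2)
    (hdm : Measurable fun z : ℝ × Eucl d => divb z.1 z.2) {φ : Eucl d → ℝ}
    (hφ : IsTestFunction φ) {Z : ℝ≥0 → Ω → ℝ} {W : Fin d → ℝ≥0 → Ω → ℝ}
    (hZ : ∀ t ≤ T, Z t =ᵐ[P] fun ω => ∫ x, u ω t x * φ x)
    (hW : ∀ i, ∀ t ≤ T, W i t =ᵐ[P] fun ω => ∫ x, u ω t x * partialD i φ x) :
    IsStratonovichDecomposition P T B Z W (driftIntegral U (driftKernel b divb φ))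
      (fun t => ∫ r in (0 : ℝ)..t, C₀ * ∫ x, |driftKernel b divb φ r x|) := by
  have hgm := measurable_driftKernel hbm hdm hφ
  have hgi := integrable_driftKernel hb hdivb hdm hφ
  refine ⟨fun t _ => (measurable_driftIntegral hU.measurable hgm t).aestronglyMeasurable,
    fun ω => by simp [driftIntegral],
    fun s t hst ht ω => abs_driftIntegral_sub_le hU hgm hgi hst ht ω, fun n k hk => ?_⟩
  obtain ⟨S, hS, heq⟩ := hu.equation φ hφ (gridPt T n k) (gridPt_le hk)
  have hgle : ∀ j, ∀ l ≤ k * 2 ^ j, gridPt T (n + j) l ≤ T := fun j l hl => by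
    refine gridPt_le (hl.trans ?_)
    rw [pow_add]
    exact Nat.mul_le_mul_right _ hk
  have hSi : ∀ i, TendstoInMeasure P (fun j => stratonovichSum (W i) (fun s ω => B s ω i)
      (k * 2 ^ j) (gridPt T (n + j))) atTop (S i) := by
    intro i
    have h1 := hS i (fun j => k * 2 ^ j) (fun j => gridPt T (n + j))
      (fun j => ⟨gridPt_mono _, gridPt_zero _, gridPt_refine n j k⟩) (by
        have h2 : Tendsto (fun j => mesh T (n + j)) atTop (𝓝 0) := by
          have := (tendsto_mesh T).comp (tendsto_add_atTop_nat n)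
          refine this.congr fun j => ?_
          simp only [Function.comp, add_comm]
        refine tendsto_of_tendsto_of_tendsto_of_le_of_le tendsto_const_nhds h2
          (fun _ => zero_le) fun j => ?_
        exact Finset.sup_le fun l _ => (gridPt_succ_sub _ _).le)
    refine h1.congr_left fun j => ?_
    have hall : ∀ᵐ ω ∂P, ∀ l : ℕ, l ≤ k * 2 ^ j → W i (gridPt T (n + j) l) ω
        = ∫ x, u ω (gridPt T (n + j) l) x * partialD i φ x := by
      refine ae_all_iff.2 fun l => ?_
      by_cases hl : l ≤ k * 2 ^ j
      · filter_upwards [hW i _ (hgle j l hl)] with ω hω _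
        exact hω
      · exact Eventually.of_forall fun ω h => absurd h hl
    filter_upwards [hall] with ω hω
    unfold stratonovichSum
    refine Finset.sum_congr rfl fun l hl => ?_
    have hl' := Finset.mem_range.1 hl
    rw [hω l hl'.le, hω (l + 1) hl']
  refine (tendstoInMeasure_sum Finset.univ fun i _ => hSi i).congr_right ?_
  filter_upwards [heq, ae_drift_eq hU hb hdivb hbm hdm hφ (gridPt_le hk),
    hZ _ (gridPt_le hk), hZ 0 zero_le, hu.ae_integral_zero hφ] with ω h1 h2 h3 h4 h5
  rw [h3, h4, h5, ← h2, h1]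
  ring

end Solution

/-! ### The parabolic equation for the means -/

section MeanWeak

variable {Ω : Type*} [mΩ : MeasurableSpace Ω] {d : ℕ} {P : Measure Ω} {T : ℝ≥0}
  {B : ℝ≥0 → Ω → Eucl d} {b : ℝ → Eucl d → Eucl d} {divb : ℝ → Eucl d → ℝ} {u₀ : Eucl d → ℝ}
  {u : Ω → ℝ → Eucl d → ℝ} {U : Ω × ℝ × Eucl d → ℝ} {C₀ : ℝ}

lemma tendsto_gridPt_floor (hT : 0 < T) (m : ℕ) {t : ℝ} (ht : t ∈ Icc 0 (T : ℝ)) :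
    (∀ p, ⌊t * 2 ^ (m + p) / T⌋₊ ≤ 2 ^ (m + p)) ∧
      Tendsto (fun p => (gridPt T (m + p) ⌊t * 2 ^ (m + p) / T⌋₊ : ℝ)) atTop (𝓝 t) := by
  have hT' : (0 : ℝ) < T := by exact_mod_cast hT
  constructor
  · intro p
    refine Nat.floor_le_of_le ?_
    rw [div_le_iff₀ hT']
    push_cast
    rw [mul_comm]
    exact mul_le_mul_of_nonneg_left ht.2 (by positivity)
  · have hm : Tendsto (fun p => t - (mesh T (m + p) : ℝ)) atTop (𝓝 (t - 0)) := by
      refine tendsto_const_nhds.sub ?_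
      have := (NNReal.tendsto_coe.2 (tendsto_mesh T)).comp (tendsto_add_atTop_nat m)
      refine this.congr fun p => ?_
      simp only [Function.comp, add_comm]
    rw [sub_zero] at hm
    refine tendsto_of_tendsto_of_tendsto_of_le_of_le hm tendsto_const_nhds (fun p => ?_) fun p => ?_
    · have h1 := (Nat.lt_floor_add_one (t * 2 ^ (m + p) / T)).le
      rw [div_le_iff₀ hT'] at h1
      simp only [gridPt, mesh]
      push_cast
      rw [sub_le_iff_le_add, ← add_div, le_div_iff₀ (by positivity)]
      linarith
    · have h1 := Nat.floor_le (a := t * 2 ^ (m + p) / T)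
        (div_nonneg (mul_nonneg ht.1 (by positivity)) hT'.le)
      rw [le_div_iff₀ hT'] at h1
      simp only [gridPt]
      push_cast
      rw [div_le_iff₀ (by positivity)]
      exact h1

/-- A continuous function on `[0, T]` is determined by its values at dyadic times. -/
lemma eq_of_eq_gridPt (hT : 0 < T) (m : ℕ) {f g : ℝ → ℝ} (hf : ContinuousOn f (Icc 0 T))
    (hg : ContinuousOn g (Icc 0 T))
    (h : ∀ p k, k ≤ 2 ^ (m + p) → f (gridPt T (m + p) k) = g (gridPt T (m + p) k)) {t : ℝ}
    (ht : t ∈ Icc 0 (T : ℝ)) : f t = g t := by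
  obtain ⟨h1, h2⟩ := tendsto_gridPt_floor hT m ht
  have h3 : Tendsto (fun p => (gridPt T (m + p) ⌊t * 2 ^ (m + p) / T⌋₊ : ℝ)) atTop
      (𝓝[Icc 0 (T : ℝ)] t) :=
    tendsto_nhdsWithin_iff.2 ⟨h2, Eventually.of_forall fun p => coe_mem_Icc (gridPt_le (h1 p))⟩
  refine tendsto_nhds_unique ((hf t ht).tendsto.comp h3) (((hg t ht).tendsto.comp h3).congr ?_)
  intro p
  exact (h p _ (h1 p)).symm

lemma continuousOn_primitive {f : ℝ → ℝ} (hf : Integrable f (timeMeasure T)) :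
    ContinuousOn (fun t => ∫ s in (0 : ℝ)..t, f s) (Icc 0 (T : ℝ)) := by
  have h0 : (0 : ℝ) ∈ Icc 0 (T : ℝ) := ⟨le_rfl, T.coe_nonneg⟩
  have h1 := intervalIntegral.continuousOn_primitive_interval'
    (intervalIntegrable_of_timeMeasure hf h0 ⟨T.coe_nonneg, le_rfl⟩) left_mem_uIcc
  rwa [uIcc_of_le T.coe_nonneg] at h1

lemma measurable_stepFunction (n : ℕ) (π : ℕ → ℝ≥0) (c : ℕ → Eucl d) :
    Measurable (stepFunction n π c) := by
  unfold stepFunction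
  exact Finset.measurable_fun_sum _ fun k _ => measurable_const.indicator measurableSet_Ioc

lemma norm_stepFunction_le (n : ℕ) (π : ℕ → ℝ≥0) (c : ℕ → Eucl d) (s : ℝ) :
    ‖stepFunction n π c s‖ ≤ ∑ k ∈ Finset.range n, ‖c k‖ := by
  refine (norm_sum_le _ _).trans (Finset.sum_le_sum fun k _ => ?_)
  exact norm_indicator_le_norm_self _ _

/-- The mean of a quasiregular solution against a stochastic exponential is a weak solution of a
parabolic equation, whose drift is `b` shifted by the step function of the exponential. -/
lemma IsQuasiregularSolution.mean_equation [IsProbabilityMeasure P] (hT : 0 < T)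
    (hB : IsBrownianMotionOn B T P)
    (hu : IsQuasiregularSolution P T B b divb u₀ u) (hU : IsBoundedVersion P T u U C₀)
    (hC₀ : 0 ≤ C₀) (hb : MemL2Loc T b) (hdivb : MemL1Linfty T volume divb)
    (hbm : Measurable fun z : ℝ × Eucl d => b z.1 z.2)
    (hdm : Measurable fun z : ℝ × Eucl d => divb z.1 z.2)
    (m : ℕ) (c : ℕ → Eucl d) {F : Ω → ℝ}
    (hF : F = stepExp B T m (fun l i => c l i) (Finset.range (2 ^ m))) {φ : Eucl d → ℝ}
    (hφ : IsTestFunction φ) :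
    ∀ᵐ t ∂(timeMeasure T), ∫ x, meanField P F U t x * φ x
      = (∫ ω, F ω ∂P) * (∫ x, u₀ x * φ x)
        + ∫ s in (0 : ℝ)..t, parabolicForm (fun x => b s x + stepFunction (2 ^ m) (gridPt T m) c s)
          (divb s) (meanField P F U s) φ := by
  set h : ℝ → Eucl d := stepFunction (2 ^ m) (gridPt T m) c with hh
  have hF2 : MemLp F 2 P := hF ▸ memLp_stepExp hB _
  have hFm : Measurable F := by
    rw [hF]
    exact ((stronglyMeasurable_stepExp hB _ le_rfl fun j hj => Finset.mem_range.1 hj).mono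
      ((brownianFiltration B T P).le _)).measurable
  have hFi : Integrable F P := hF2.integrable (by norm_num)
  -- regular versions of the tested processes, with a common bound
  set C : ℝ := C₀ * ((∫ x, |φ x|) + (∑ i, ∫ x, |partialD i φ x|)
    + ∑ i, ∑ j, ∫ x, |partialD j (partialD i φ) x|) with hC
  have n0 : ∀ ψ : Eucl d → ℝ, 0 ≤ ∫ x, |ψ x| := fun ψ => integral_nonneg fun x => abs_nonneg _
  have n1 : 0 ≤ ∑ i, ∫ x, |partialD i φ x| := Finset.sum_nonneg fun i _ => n0 _
  have n2 : ∀ i, 0 ≤ ∑ j, ∫ x, |partialD j (partialD i φ) x| := fun i =>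
    Finset.sum_nonneg fun i _ => n0 _
  have n3 : 0 ≤ ∑ i, ∑ j, ∫ x, |partialD j (partialD i φ) x| := Finset.sum_nonneg fun i _ => n2 i
  obtain ⟨Z, hZr, hZ⟩ := hu.exists_process hT hU hC₀ hφ (C := C) (by
    refine mul_le_mul_of_nonneg_left ?_ hC₀
    linarith)
  have hWex : ∀ i, ∃ W, IsRegularProcess P (brownianFiltration B T P) T C W ∧
      ∀ t ≤ T, W t =ᵐ[P] fun ω => ∫ x, u ω t x * partialD i φ x := fun i =>
    hu.exists_process hT hU hC₀ (hφ.partialD i) (by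
      refine mul_le_mul_of_nonneg_left ?_ hC₀
      have := Finset.single_le_sum (f := fun i => ∫ x, |partialD i φ x|) (fun i _ => n0 _)
        (Finset.mem_univ i)
      linarith [n0 φ])
  choose W hWr hW using hWex
  have hW₂ex : ∀ i j, ∃ W, IsRegularProcess P (brownianFiltration B T P) T C W ∧
      ∀ t ≤ T, W t =ᵐ[P] fun ω => ∫ x, u ω t x * partialD j (partialD i φ) x := fun i j =>
    hu.exists_process hT hU hC₀ ((hφ.partialD i).partialD j) (by
      refine mul_le_mul_of_nonneg_left ?_ hC₀
      have h1 := Finset.single_le_sum (f := fun j => ∫ x, |partialD j (partialD i φ) x|)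
        (fun i _ => n0 _) (Finset.mem_univ j)
      have h2 := Finset.single_le_sum (f := fun i => ∑ j, ∫ x, |partialD j (partialD i φ) x|)
        (fun i _ => n2 i) (Finset.mem_univ i)
      linarith [n0 φ])
  choose W₂ hW₂r hW₂ using hW₂ex
  have hZd := hu.isStratonovichDecomposition hU hb hdivb hbm hdm hφ hZ hW
  have hWd := fun i => hu.isStratonovichDecomposition hU hb hdivb hbm hdm (hφ.partialD i)
    (hW i) (hW₂ i)
  have hgm := measurable_driftKernel hbm hdm hφ
  have hgi := integrable_driftKernel hb hdivb hdm hφ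
  have hmean : ∀ {ψ : Eucl d → ℝ} (_ : IsTestFunction ψ) {Y : ℝ≥0 → Ω → ℝ},
      (∀ t ≤ T, Y t =ᵐ[P] fun ω => ∫ x, u ω t x * ψ x) →
      ∀ᵐ t ∂(timeMeasure T), ∫ ω, F ω * Y t.toNNReal ω ∂P = ∫ x, meanField P F U t x * ψ x := by
    intro ψ hψ Y hY
    filter_upwards [ae_time_ae_ae_of_ae_prod hU.ae_eq, ae_timeMeasure_mem T] with t h1 h2
    rw [← integral_mul_integral_eq hFi hU hψ.integrable]
    refine integral_congr_ae ?_
    filter_upwards [h1, hY _ (Real.toNNReal_le_iff_le_coe.2 h2.2)] with ω h3 h4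
    rw [h4, Real.coe_toNNReal _ h2.1]
    congr 1
    refine integral_congr_ae ?_
    filter_upwards [h3] with x hx
    have hx' : u ω t x = U (ω, t, x) := hx
    rw [hx']
  -- integrability of the terms on the right
  set V := meanField P F U with hV
  have hVm : Measurable fun z : ℝ × Eucl d => V z.1 z.2 := measurable_meanField hFm hU.measurable
  set CV : ℝ := C₀ * ∫ ω, |F ω| ∂P with hCV
  have hVle : ∀ t x, |V t x| ≤ CV := fun t x => abs_meanField_le hFi hU t x
  have hVs : ∀ s, AEStronglyMeasurable (V s) (volume : Measure (Eucl d)) := fun s =>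
    (hVm.comp measurable_prodMk_left).aestronglyMeasurable
  have hVg : Integrable (fun z : ℝ × Eucl d => V z.1 z.2 * driftKernel b divb φ z.1 z.2)
      ((timeMeasure T).prod volume) :=
    hgi.bdd_mul (c := CV) hVm.aestronglyMeasurable (Eventually.of_forall fun z => hVle _ _)
  have iA : Integrable (fun s => ∫ x, V s x * driftKernel b divb φ s x) (timeMeasure T) :=
    hVg.integral_prod_left
  have iY : ∀ {Y : ℝ≥0 → Ω → ℝ}, IsRegularProcess P (brownianFiltration B T P) T C Y →
      Integrable (fun s : ℝ => ∫ ω, F ω * Y s.toNNReal ω ∂P) (timeMeasure T) := fun hY =>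
    (continuousOn_integral_mul hY hF2).integrableOn_compact isCompact_Icc
  have hhm : ∀ i, Measurable fun s => h s i := fun i => by
    have hc : Measurable fun x : Eucl d => x i := by fun_prop
    exact hc.comp (measurable_stepFunction _ _ _)
  have iB : ∀ i, Integrable (fun s : ℝ => (∫ ω, F ω * W i s.toNNReal ω ∂P) * h s i)
      (timeMeasure T) := fun i =>
    (iY (hWr i)).mul_bdd (c := ∑ k ∈ Finset.range (2 ^ m), ‖c k‖) (hhm i).aestronglyMeasurable
      (Eventually.of_forall fun s => (PiLp.norm_apply_le (h s) i).trans
        (norm_stepFunction_le _ _ _ s))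
  -- the identity at dyadic times, extended by continuity
  have key : ∀ t ∈ Icc 0 (T : ℝ), ∫ ω, F ω * Z t.toNNReal ω ∂P
      = (∫ ω, F ω ∂P) * (∫ x, u₀ x * φ x)
        + ((∫ s in (0 : ℝ)..t, ∫ x, V s x * driftKernel b divb φ s x)
        + ∑ i, ((∫ s in (0 : ℝ)..t, (∫ ω, F ω * W i s.toNNReal ω ∂P) * h s i)
          + 1 / 2 * ∫ s in (0 : ℝ)..t, ∫ ω, F ω * W₂ i i s.toNNReal ω ∂P)) := by
    intro t ht
    refine eq_of_eq_gridPt hT m (continuousOn_integral_mul hZr hF2)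
      (g := fun t => (∫ ω, F ω ∂P) * (∫ x, u₀ x * φ x)
        + ((∫ s in (0 : ℝ)..t, ∫ x, V s x * driftKernel b divb φ s x)
        + ∑ i, ((∫ s in (0 : ℝ)..t, (∫ ω, F ω * W i s.toNNReal ω ∂P) * h s i)
          + 1 / 2 * ∫ s in (0 : ℝ)..t, ∫ ω, F ω * W₂ i i s.toNNReal ω ∂P)))
      (continuousOn_const.add ((continuousOn_primitive iA).add (continuousOn_finsetSum _
        fun i _ => (continuousOn_primitive (iB i)).add
          ((continuousOn_primitive (iY (hW₂r i i))).const_mul _)))) (fun p k hk => ?_) ht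
    have h1 := mean_equation_gridPt hB hZr hWr hW₂r hZd hWd m p k hk c hF
    have h2 : ∫ ω, F ω * Z 0 ω ∂P = (∫ ω, F ω ∂P) * ∫ x, u₀ x * φ x := by
      rw [← integral_mul_const]
      refine integral_congr_ae ?_
      filter_upwards [hZ 0 zero_le, hu.ae_integral_zero hφ] with ω h3 h4
      rw [h3, h4]
    rw [integral_mul_driftIntegral hFm hFi hU hgm hgi (gridPt_le hk), h2] at h1
    simp only [Real.toNNReal_coe]
    rw [← h1]
    ring
  have hgood : ∀ᵐ s ∂(timeMeasure T), (∫ x, V s x * driftKernel b divb φ s x)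
      + ∑ i, ((∫ ω, F ω * W i s.toNNReal ω ∂P) * h s i
        + 1 / 2 * ∫ ω, F ω * W₂ i i s.toNNReal ω ∂P)
      = parabolicForm (fun x => b s x + h s) (divb s) (V s) φ := by
    filter_upwards [ae_all_iff.2 fun i => hmean (hφ.partialD i) (hW i),
      ae_all_iff.2 fun i => hmean ((hφ.partialD i).partialD i) (hW₂ i i),
      hgi.prod_right_ae] with s h1 h2 h3
    simp only [h1, h2]
    have j1 : Integrable (fun x => V s x * driftKernel b divb φ s x) :=
      h3.bdd_mul (c := CV) (hVs s) (Eventually.of_forall fun x => hVle s x)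
    have j2 : ∀ i, Integrable (fun x => V s x * partialD i φ x) := fun i =>
      (hφ.partialD i).integrable.bdd_mul (c := CV) (hVs s) (Eventually.of_forall fun x => hVle s x)
    have j3 : ∀ i, Integrable (fun x => V s x * partialD i (partialD i φ) x) := fun i =>
      ((hφ.partialD i).partialD i).integrable.bdd_mul (c := CV) (hVs s)
        (Eventually.of_forall fun x => hVle s x)
    have j4 : ∀ i ∈ (Finset.univ : Finset (Fin d)), Integrable (fun x => V s x * partialD i φ x * h s i
        + 1 / 2 * (V s x * partialD i (partialD i φ) x)) := fun i _ =>
      ((j2 i).mul_const _).add ((j3 i).const_mul _)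
    have h4 : ∀ i, (∫ x, V s x * partialD i φ x) * h s i
        + 1 / 2 * ∫ x, V s x * partialD i (partialD i φ) x
        = ∫ x, (V s x * partialD i φ x * h s i
          + 1 / 2 * (V s x * partialD i (partialD i φ) x)) := fun i => by
      rw [integral_add ((j2 i).mul_const _) ((j3 i).const_mul _), integral_mul_const,
        integral_const_mul]
    simp only [h4]
    rw [← integral_finsetSum _ j4, ← integral_add j1 (integrable_finsetSum _ j4)]
    unfold parabolicForm
    refine integral_congr_ae (Eventually.of_forall fun x => ?_)
    simp only [driftKernel, PiLp.add_apply, add_mul, Finset.sum_add_distrib, Finset.mul_sum,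
      mul_add]
    have h5 : ∀ i, V s x * partialD i φ x * h s i = V s x * (h s i * partialD i φ x) :=
      fun i => by ring
    have h6 : ∀ i, 1 / 2 * (V s x * partialD i (partialD i φ) x)
        = V s x * (1 / 2 * partialD i (partialD i φ) x) := fun i => by ring
    simp only [h5, h6]
    ring
  filter_upwards [hmean hφ hZ, ae_timeMeasure_mem T] with t h1 ht
  rw [← h1, key t ht]
  congr 1
  simp only [integral_interval_eq_timeMeasure ht]
  rw [← integral_congr_ae (ae_restrict_of_ae hgood)]
  have k1 : ∀ i ∈ (Finset.univ : Finset (Fin d)), Integrable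
      (fun s : ℝ => (∫ ω, F ω * W i s.toNNReal ω ∂P) * h s i
        + 1 / 2 * ∫ ω, F ω * W₂ i i s.toNNReal ω ∂P) ((timeMeasure T).restrict (Ioc 0 t)) :=
    fun i _ => (iB i).restrict.add ((iY (hW₂r i i)).restrict.const_mul _)
  rw [integral_add iA.restrict (integrable_finsetSum _ k1), integral_finsetSum _ k1]
  congr 1
  refine Finset.sum_congr rfl fun i _ => ?_
  rw [integral_add (iB i).restrict ((iY (hW₂r i i)).restrict.const_mul _), integral_const_mul]

end MeanWeak

/-! ### Exponentials of step functions on dyadic grids -/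

section StepExponentials

variable {Ω : Type*} [mΩ : MeasurableSpace Ω] {d : ℕ} {P : Measure Ω} {T : ℝ≥0}
  {B : ℝ≥0 → Ω → Eucl d}

lemma memLp_stepFunction (n : ℕ) (π : ℕ → ℝ≥0) (c : ℕ → Eucl d) (p : ℝ≥0∞) {α : Type*}
    [MeasurableSpace α] (μ : Measure α) [IsFiniteMeasure μ] {f : α → ℝ} (hf : Measurable f) :
    MemLp (fun z => stepFunction n π c (f z)) p μ :=
  MemLp.of_bound ((measurable_stepFunction n π c).comp hf).aestronglyMeasurable _
    (Eventually.of_forall fun _ => norm_stepFunction_le n π c _)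

lemma integral_norm_stepFunction_sq (m : ℕ) (c : ℕ → Eucl d) :
    ∫ s, ‖stepFunction (2 ^ m) (gridPt T m) c s‖ ^ 2 ∂(timeMeasure T)
      = ∑ k ∈ Finset.range (2 ^ m), ‖c k‖ ^ 2 * mesh T m := by
  have hi : Integrable (fun s => ‖stepFunction (2 ^ m) (gridPt T m) c s‖ ^ 2) (timeMeasure T) :=
    (memLp_stepFunction (2 ^ m) (gridPt T m) c 2 (timeMeasure T) measurable_id).integrable_norm_pow
      (by norm_num)
  have h1 : ∫ s, ‖stepFunction (2 ^ m) (gridPt T m) c s‖ ^ 2 ∂(timeMeasure T)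
      = ∫ s in (gridPt T m 0 : ℝ)..(gridPt T m (2 ^ m) : ℝ),
        ‖stepFunction (2 ^ m) (gridPt T m) c s‖ ^ 2 := by
    rw [gridPt_zero, gridPt_last, NNReal.coe_zero,
      intervalIntegral.integral_of_le T.coe_nonneg, timeMeasure, integral_Icc_eq_integral_Ioc]
  rw [h1, ← intervalIntegral.sum_integral_adjacent_intervals
    (a := fun k => (gridPt T m k : ℝ)) fun k hk => intervalIntegrable_of_timeMeasure hi
      (coe_mem_Icc (gridPt_le hk.le)) (coe_mem_Icc (gridPt_le hk))]
  refine Finset.sum_congr rfl fun k hk => ?_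
  have hle : (gridPt T m k : ℝ) ≤ gridPt T m (k + 1) := by
    exact_mod_cast gridPt_mono m (Nat.le_succ k)
  have h2 : ∫ s in (gridPt T m k : ℝ)..(gridPt T m (k + 1) : ℝ),
      ‖stepFunction (2 ^ m) (gridPt T m) c s‖ ^ 2
      = ∫ _ in (gridPt T m k : ℝ)..(gridPt T m (k + 1) : ℝ), ‖c k‖ ^ 2 := by
    refine intervalIntegral.integral_congr_ae (Eventually.of_forall fun s hs => ?_)
    rw [uIoc_of_le hle] at hs
    have h3 := stepFunction_eq (T := T) (m := m) (p := 0) (l := k) c (Finset.mem_range.1 hk)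
      (s := s) hs
    simp only [h3, pow_zero, Nat.div_one]
  rw [h2, intervalIntegral.integral_const, smul_eq_mul, coe_gridPt_succ_sub, mul_comm]

/-- The exponentials of step functions on dyadic grids belong to the set of stochastic
exponentials. -/
lemma stepExp_mem_stochasticExponentials (hB : IsBrownianMotionOn B T P) (m : ℕ)
    (c : ℕ → Eucl d) :
    stepExp B T m (fun k i => c k i) (Finset.range (2 ^ m)) ∈ stochasticExponentials B T P := by
  refine ⟨stepFunction (2 ^ m) (gridPt T m) c, stepIntegral B (2 ^ m) (gridPt T m) c,
    memLp_stepFunction _ _ c 2 (timeMeasure T) measurable_id, ⟨?_, fun _ => 2 ^ m,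
    fun _ => gridPt T m, fun _ => c, fun _ => ⟨gridPt_mono m, (gridPt_last m).le⟩, ?_, ?_⟩, ?_⟩
  · unfold stepIntegral
    refine Finset.aestronglyMeasurable_fun_sum _ fun k hk => ?_
    have h1 := hB.measurable _ (gridPt_le (T := T) (Finset.mem_range.1 hk))
    have h2 := hB.measurable _ (gridPt_le (T := T) (Finset.mem_range.1 hk).le)
    exact ((h1.sub h2).const_inner (c := c k)).aestronglyMeasurable
  · simp
  · simp
  · funext ω
    rw [stepExp_eq_exp, integral_norm_stepFunction_sq, stepIntegral, Finset.mul_sum,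
      ← Finset.sum_sub_distrib]
    congr 1
    refine Finset.sum_congr rfl fun k _ => ?_
    rw [PiLp.inner_apply, EuclideanSpace.norm_sq_eq, Finset.sum_mul, Finset.mul_sum,
      ← Finset.sum_sub_distrib]
    refine Finset.sum_congr rfl fun i _ => ?_
    simp only [incr, PiLp.sub_apply, RCLike.inner_apply, conj_trivial, Real.norm_eq_abs, sq_abs]
    ring

end StepExponentials

/-! ### Totality of the exponentials of step functions -/

section Totality

/-- Finite measures which give the same, finite, integrals to the exponentials `exp (s Y)` give the
same law to `Y`. -/
lemma map_eq_of_mgf_eq {Ω : Type*} [MeasurableSpace Ω] {μ ν : Measure Ω} [IsFiniteMeasure μ]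
    [IsFiniteMeasure ν] {Y : Ω → ℝ} (hY : Measurable Y) (hμν : μ = 0 ↔ ν = 0)
    (hi : ∀ s : ℝ, Integrable (fun ω => Real.exp (s * Y ω)) μ) (h : mgf Y μ = mgf Y ν) :
    μ.map Y = ν.map Y := by
  have huniv : integrableExpSet Y μ = univ := eq_univ_of_forall hi
  refine Measure.ext_of_complexMGF_eq hY.aemeasurable hY.aemeasurable ?_
  funext z
  exact eqOn_complexMGF_of_mgf' h hμν (by simp [huniv])

lemma measurable_limUnder {Ω : Type*} {m : MeasurableSpace Ω} {d : ℕ} {f : ℕ → Ω → Eucl d}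
    (hf : ∀ n, Measurable[m] (f n)) : Measurable[m] fun ω => limUnder atTop fun n => f n ω :=
  (StronglyMeasurable.limUnder fun n => (hf n).stronglyMeasurable).measurable

section IncrementSpace

variable {Ω : Type*} {d : ℕ}

/-- The vector of the increments of `B` along the dyadic grid of level `m`. -/
def incrVec (B : ℝ≥0 → Ω → Eucl d) (T : ℝ≥0) (m : ℕ) (ω : Ω) : Fin (2 ^ m) → Fin d → ℝ :=
  fun k => incr B T m k ω

/-- A linear form of the vector of increments is the stochastic integral of a step function. -/
lemma exists_coeff_incrVec (B : ℝ≥0 → Ω → Eucl d) (T : ℝ≥0) (m : ℕ)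
    (L : StrongDual ℝ (Fin (2 ^ m) → Fin d → ℝ)) :
    ∃ c : ℕ → Eucl d, ∀ ω, L (incrVec B T m ω)
      = ∑ k ∈ Finset.range (2 ^ m), ∑ i, c k i * incr B T m k ω i := by
  refine ⟨fun k => WithLp.toLp 2 fun i =>
    if hk : k < 2 ^ m then L (Pi.single ⟨k, hk⟩ (Pi.single i 1)) else 0, fun ω => ?_⟩
  have h1 : incrVec B T m ω = ∑ k : Fin (2 ^ m), ∑ i : Fin d,
      incr B T m k ω i • (Pi.single k (Pi.single i 1) : Fin (2 ^ m) → Fin d → ℝ) := by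
    funext k i
    simp [Finset.sum_apply, Pi.single_apply, incrVec, apply_ite, ite_apply]
  rw [h1, Finset.sum_range, map_sum]
  refine Finset.sum_congr rfl fun k _ => ?_
  rw [map_sum]
  refine Finset.sum_congr rfl fun i _ => ?_
  simp [mul_comm]

/-- The σ-algebra generated by the increments along the dyadic grid of level `m`. -/
@[reducible] def incrSpace (B : ℝ≥0 → Ω → Eucl d) (T : ℝ≥0) (m : ℕ) : MeasurableSpace Ω :=
  MeasurableSpace.comap (incrVec B T m) inferInstance

lemma measurable_sub_incrSpace (B : ℝ≥0 → Ω → Eucl d) (T : ℝ≥0) {m k : ℕ} (hk : k ≤ 2 ^ m) :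
    Measurable[incrSpace B T m] fun ω => B (gridPt T m k) ω - B 0 ω := by
  have h1 : ∀ (l : Fin (2 ^ m)) (i : Fin d),
      Measurable[incrSpace B T m] fun ω => incr B T m l ω i := fun l i => by
    have h2 : Measurable[incrSpace B T m] (incrVec B T m) := comap_measurable _
    have h3 : Measurable fun x : Fin (2 ^ m) → Fin d → ℝ => x l i := by fun_prop
    exact h3.comp h2
  have h4 : Measurable[incrSpace B T m] fun ω (i : Fin d) => (B (gridPt T m k) ω - B 0 ω) i := by
    refine (@measurable_pi_iff Ω _ _ (incrSpace B T m) _ _).2 fun i => ?_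
    have h5 : ∀ ω, (B (gridPt T m k) ω - B 0 ω) i
        = ∑ l ∈ Finset.range k, incr B T m l ω i := fun ω => by
      unfold incr
      rw [Finset.sum_range_sub (fun l => B (gridPt T m l) ω i), gridPt_zero, PiLp.sub_apply]
    simp only [h5]
    refine Finset.measurable_fun_sum _ fun l hl => ?_
    exact h1 ⟨l, (Finset.mem_range.1 hl).trans_le hk⟩ i
  exact (WithLp.measurable_toLp 2 (Fin d → ℝ)).comp h4

lemma incrSpace_mono (B : ℝ≥0 → Ω → Eucl d) (T : ℝ≥0) : Monotone (incrSpace B T) := by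
  refine monotone_nat_of_le_succ fun m => ?_
  refine Measurable.comap_le ((@measurable_pi_iff Ω _ _ (incrSpace B T (m + 1)) _ _).2 fun k => ?_)
  have h1 : ∀ l ≤ 2 ^ m, Measurable[incrSpace B T (m + 1)]
      fun ω => B (gridPt T m l) ω - B 0 ω := fun l hl => by
    rw [← gridPt_refine m 1]
    exact measurable_sub_incrSpace B T (by rw [pow_succ]; omega)
  have h2 : incr B T m k = fun ω (i : Fin d) =>
      (B (gridPt T m (k + 1)) ω - B 0 ω) i - (B (gridPt T m k) ω - B 0 ω) i := by
    funext ω i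
    simp only [incr, PiLp.sub_apply]
    ring
  change Measurable[incrSpace B T (m + 1)] (incr B T m k)
  rw [h2]
  exact measurable_coord_sub (h1 _ k.2) (h1 _ k.2.le)

end IncrementSpace

variable {Ω : Type*} [mΩ : MeasurableSpace Ω] {d : ℕ} {P : Measure Ω} {T : ℝ≥0}
  {B : ℝ≥0 → Ω → Eucl d}

lemma measurable_incrVec (hB : IsBrownianMotionOn B T P) (m : ℕ) : Measurable (incrVec B T m) :=
  measurable_pi_iff.2 fun k => measurable_incr hB k.2

variable {μ ν : Measure Ω} [IsFiniteMeasure μ] [IsFiniteMeasure ν]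

/-- Two finite measures which agree on the exponentials of step functions give the same law to
the increments along a dyadic grid. -/
lemma map_incrVec_eq (hB : IsBrownianMotionOn B T P) (m : ℕ)
    (hi : ∀ c : ℕ → Eucl d,
      Integrable (stepExp B T m (fun k i => c k i) (Finset.range (2 ^ m))) μ)
    (heq : ∀ c : ℕ → Eucl d,
      ∫ ω, stepExp B T m (fun k i => c k i) (Finset.range (2 ^ m)) ω ∂μ
        = ∫ ω, stepExp B T m (fun k i => c k i) (Finset.range (2 ^ m)) ω ∂ν) :
    μ.map (incrVec B T m) = ν.map (incrVec B T m) := by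
  have hmeas := measurable_incrVec hB m
  have hexp : ∀ (L : StrongDual ℝ (Fin (2 ^ m) → Fin d → ℝ)) (s : ℝ), ∃ (c : ℕ → Eucl d) (a : ℝ),
      ∀ ω, Real.exp (s * L (incrVec B T m ω))
        = a * stepExp B T m (fun k i => c k i) (Finset.range (2 ^ m)) ω := by
    intro L s
    obtain ⟨c, hc⟩ := exists_coeff_incrVec B T m (s • L)
    refine ⟨c, Real.exp (∑ k ∈ Finset.range (2 ^ m), ∑ i, c k i ^ 2 * mesh T m / 2), fun ω => ?_⟩
    have h1 : s * L (incrVec B T m ω) = (s • L) (incrVec B T m ω) := rfl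
    rw [h1, hc, stepExp_eq_exp, ← Real.exp_add, ← Finset.sum_add_distrib]
    congr 1
    refine Finset.sum_congr rfl fun k _ => ?_
    rw [← Finset.sum_add_distrib]
    exact Finset.sum_congr rfl fun i _ => by ring
  -- the exponential with coefficient `0` is the constant `1`
  have hmass : μ.real univ = ν.real univ := by
    have h1 := heq 0
    simpa [stepExp_eq_exp] using h1
  have hzero : μ = 0 ↔ ν = 0 := by
    rw [← Measure.measure_univ_eq_zero, ← Measure.measure_univ_eq_zero (μ := ν),
      ← measureReal_eq_zero_iff, hmass, measureReal_eq_zero_iff]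
  refine Measure.ext_of_charFunDual ?_
  funext L
  have hL : Measurable fun ω => L (incrVec B T m ω) := L.continuous.measurable.comp hmeas
  rw [charFunDual_eq_charFun_map_one, charFunDual_eq_charFun_map_one,
    Measure.map_map L.continuous.measurable hmeas, Measure.map_map L.continuous.measurable hmeas]
  congr 1
  refine map_eq_of_mgf_eq hL hzero (fun s => ?_) ?_
  · obtain ⟨c, a, hc⟩ := hexp L s
    exact ((hi c).const_mul a).congr (Eventually.of_forall fun ω => (hc ω).symm)
  · funext s
    obtain ⟨c, a, hc⟩ := hexp L s
    simp only [mgf, Function.comp_apply, hc, integral_const_mul, heq]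

/-- The increments along the dyadic grids generate the Brownian filtration up to null sets, by
continuity of the paths. -/
lemma past_le_eventuallyMeasurableSpace (hT : 0 < T) (hB : IsBrownianMotionOn B T P) :
    past B T T ≤ eventuallyMeasurableSpace (⨆ m, incrSpace B T m) (ae P) := by
  refine iSup_le fun s => ?_
  obtain ⟨s, hs⟩ := s
  have hsT : s ≤ T := hs.trans (min_le_right _ _)
  obtain ⟨h1, h2⟩ := tendsto_gridPt_floor hT 0 (coe_mem_Icc hsT)
  set q : ℕ → ℝ≥0 := fun p => gridPt T (0 + p) ⌊(s : ℝ) * 2 ^ (0 + p) / T⌋₊ with hq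
  have hf : ∀ p, Measurable[⨆ m, incrSpace B T m] fun ω => B (q p) ω - B 0 ω := fun p =>
    (measurable_sub_incrSpace B T (h1 p)).mono (le_iSup (incrSpace B T) _) le_rfl
  have hg := measurable_limUnder hf
  have hae : B s =ᵐ[P] fun ω => limUnder atTop fun p => B (q p) ω - B 0 ω := by
    filter_upwards [hB.zero, hB.continuous] with ω h0 hc
    refine (Tendsto.limUnder_eq ?_).symm
    have h3 : Tendsto q atTop (𝓝[Iic T] s) :=
      tendsto_nhdsWithin_iff.2 ⟨NNReal.tendsto_coe.1 h2,
        Eventually.of_forall fun p => gridPt_le (h1 p)⟩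
    have h4 := (hc s hsT).tendsto.comp h3
    simpa [h0, Function.comp_def] using h4
  exact (hg.eventuallyMeasurable_of_eventuallyEq hae).comap_le

/-- The exponentials of step functions are total: a finite measure, absolutely continuous with
respect to `P`, is determined on the Brownian σ-algebra by its integrals of these exponentials. -/
lemma measure_eq_of_integral_stepExp_eq (hT : 0 < T) (hB : IsBrownianMotionOn B T P)
    (hΩ : mΩ ≤ brownianFiltration B T P T) (hμ : μ ≪ P) (hν : ν ≪ P)
    (hi : ∀ (m : ℕ) (c : ℕ → Eucl d),
      Integrable (stepExp B T m (fun k i => c k i) (Finset.range (2 ^ m))) μ)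
    (heq : ∀ (m : ℕ) (c : ℕ → Eucl d),
      ∫ ω, stepExp B T m (fun k i => c k i) (Finset.range (2 ^ m)) ω ∂μ
        = ∫ ω, stepExp B T m (fun k i => c k i) (Finset.range (2 ^ m)) ω ∂ν) :
    μ = ν := by
  have hle : ∀ m, incrSpace B T m ≤ mΩ := fun m => (measurable_incrVec hB m).comap_le
  have hm : ∀ m A, MeasurableSet[incrSpace B T m] A → μ A = ν A := by
    rintro m _ ⟨S, hS, rfl⟩
    have h1 := map_incrVec_eq hB m (hi m) (heq m)
    rw [← Measure.map_apply (measurable_incrVec hB m) hS, h1,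
      Measure.map_apply (measurable_incrVec hB m) hS]
  have hsup : ∀ A, MeasurableSet[⨆ m, incrSpace B T m] A → μ A = ν A := by
    intro A hA
    refine ext_on_measurableSpace_of_generate_finite (m₀ := mΩ) {A | ∃ m, MeasurableSet[incrSpace B T m] A}
      (fun A ⟨m, hA⟩ => hm m A hA) (iSup_le hle) (MeasurableSpace.measurableSpace_iSup_eq _) ?_
      (hm 0 univ MeasurableSet.univ) hA
    rintro A ⟨m, hA⟩ C ⟨n, hC⟩ -
    exact ⟨max m n, (incrSpace_mono B T (le_max_left m n) _ hA).inter
      (incrSpace_mono B T (le_max_right m n) _ hC)⟩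
  refine Measure.ext fun A hA => ?_
  obtain ⟨-, A', hA', hAA'⟩ := hΩ A hA
  obtain ⟨A'', hA'', hAA''⟩ := past_le_eventuallyMeasurableSpace hT hB A' hA'
  have h1 : A =ᵐ[P] A'' := hAA'.trans hAA''
  rw [measure_congr (hμ.ae_le h1), measure_congr (hν.ae_le h1), hsup A'' hA'']

end Totality

/-! ### Measurable versions of the coefficients -/

section Coefficients

variable {d : ℕ} {T : ℝ≥0}

lemma measurable_eLpNorm_top {F : Type*} [NormedAddCommGroup F] [MeasurableSpace F]
    [OpensMeasurableSpace F] {ν : Measure (Eucl d)} [SFinite ν] {f : ℝ → Eucl d → F}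
    (hf : Measurable fun z : ℝ × Eucl d => f z.1 z.2) :
    Measurable fun t => eLpNorm (f t) ∞ ν := by
  refine measurable_of_Iic fun a => ?_
  have h1 : (fun t => eLpNorm (f t) ∞ ν) ⁻¹' Iic a
      = (fun t => ν (Prod.mk t ⁻¹' {z : ℝ × Eucl d | a < ‖f z.1 z.2‖ₑ})) ⁻¹' {0} := by
    ext t
    have h2 : Prod.mk t ⁻¹' {z : ℝ × Eucl d | a < ‖f z.1 z.2‖ₑ} = {x | ¬ ‖f t x‖ₑ ≤ a} := by
      ext x
      simp
    rw [mem_preimage, mem_preimage, h2, mem_singleton_iff, ← ae_iff, mem_Iic, eLpNorm_exponent_top]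
    constructor
    · intro h
      filter_upwards [ae_le_eLpNormEssSup (f := f t) (μ := ν)] with x hx using hx.trans h
    · exact fun h => eLpNormEssSup_le_of_ae_enorm_bound h
  rw [h1]
  exact measurable_measure_prodMk_left (measurableSet_lt measurable_const hf.enorm)
    (measurableSet_singleton 0)

/-- An element of `L¹(0, T; L^∞)` is dominated by an integrable function of time. -/
lemma MemL1Linfty.exists_bound {F : Type*} [NormedAddCommGroup F] [MeasurableSpace F]
    [OpensMeasurableSpace F] {ν : Measure (Eucl d)} [SFinite ν] {f : ℝ → Eucl d → F}
    (h : MemL1Linfty T ν f) (hf : Measurable fun z : ℝ × Eucl d => f z.1 z.2) :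
    ∃ m : ℝ → ℝ, Integrable m (timeMeasure T) ∧
      ∀ᵐ t ∂(timeMeasure T), ∀ᵐ x ∂ν, ‖f t x‖ ≤ m t := by
  have hm := measurable_eLpNorm_top (ν := ν) hf
  refine ⟨fun t => (eLpNorm (f t) ∞ ν).toReal,
    integrable_toReal_of_lintegral_ne_top hm.aemeasurable h.2.ne, ?_⟩
  filter_upwards [ae_lt_top hm h.2.ne] with t ht
  filter_upwards [ae_le_eLpNormEssSup (f := f t) (μ := ν)] with x hx
  rw [← toReal_enorm]
  rw [← eLpNorm_exponent_top] at hx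
  exact ENNReal.toReal_mono ht.ne hx

lemma MemL1Linfty.congr {F : Type*} [NormedAddCommGroup F] {ν : Measure (Eucl d)} [SFinite ν]
    {f f' : ℝ → Eucl d → F} (h : MemL1Linfty T ν f)
    (hff : ∀ᵐ z ∂((timeMeasure T).prod ν), f z.1 z.2 = f' z.1 z.2) : MemL1Linfty T ν f' := by
  refine ⟨h.1.congr hff, ?_⟩
  rw [← lintegral_congr_ae]
  · exact h.2
  · filter_upwards [Measure.ae_ae_of_ae_prod hff] with t ht
    exact eLpNorm_congr_ae ht

lemma MemL2Loc.aestronglyMeasurable {b : ℝ → Eucl d → Eucl d} (hb : MemL2Loc T b) :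
    AEStronglyMeasurable (fun z : ℝ × Eucl d => b z.1 z.2) ((timeMeasure T).prod volume) := by
  have h1 : (timeMeasure T).prod (volume : Measure (Eucl d))
      = ((timeMeasure T).prod volume).restrict
        (⋃ n : ℕ, univ ×ˢ Metric.closedBall (0 : Eucl d) n) := by
    rw [← prod_iUnion, Metric.iUnion_closedBall_nat, univ_prod_univ, Measure.restrict_univ]
  rw [h1, aestronglyMeasurable_iUnion_iff]
  intro n
  rw [← Measure.prod_restrict, Measure.restrict_univ]
  exact (hb _ (isCompact_closedBall _ _)).1

lemma MemL2Loc.congr {b b' : ℝ → Eucl d → Eucl d} (hb : MemL2Loc T b)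
    (h : ∀ᵐ z ∂((timeMeasure T).prod (volume : Measure (Eucl d))), b z.1 z.2 = b' z.1 z.2) :
    MemL2Loc T b' := fun K hK => by
  refine (hb K hK).ae_eq ?_
  rw [← Measure.restrict_univ (μ := timeMeasure T), Measure.prod_restrict]
  exact ae_restrict_of_ae h

lemma MemL2Loc.add_stepFunction {b : ℝ → Eucl d → Eucl d} (hb : MemL2Loc T b) (n : ℕ)
    (π : ℕ → ℝ≥0) (c : ℕ → Eucl d) : MemL2Loc T fun t x => b t x + stepFunction n π c t :=
  fun K hK => by
  have hfin : IsFiniteMeasure ((volume : Measure (Eucl d)).restrict K) :=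
    isFiniteMeasure_restrict.2 hK.measure_lt_top.ne
  exact (hb K hK).add (memLp_stepFunction n π c 2 _ measurable_fst)

lemma IsWeakDivergence.congr {f f' : Eucl d → Eucl d} {g g' : Eucl d → ℝ}
    (h : IsWeakDivergence f g) (hf : ∀ᵐ x, f x = f' x) (hg : ∀ᵐ x, g x = g' x) :
    IsWeakDivergence f' g' := fun φ hφ => by
  have h1 : ∫ x, ∑ i, f' x i * partialD i φ x = ∫ x, ∑ i, f x i * partialD i φ x :=
    integral_congr_ae (by filter_upwards [hf] with x hx; rw [hx])
  have h2 : ∫ x, g' x * φ x = ∫ x, g x * φ x :=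
    integral_congr_ae (by filter_upwards [hg] with x hx; rw [hx])
  rw [h1, h2, h φ hφ]

/-- Adding a constant vector does not change the divergence. -/
lemma IsWeakDivergence.add_const {f : Eucl d → Eucl d} {g : Eucl d → ℝ}
    (h : IsWeakDivergence f g)
    (hf : ∀ r : ℝ, MemLp f 2 (volume.restrict (Metric.closedBall 0 r))) (a : Eucl d) :
    IsWeakDivergence (fun x => f x + a) g := fun φ hφ => by
  have hfin : ∀ r : ℝ,
      IsFiniteMeasure ((volume : Measure (Eucl d)).restrict (Metric.closedBall 0 r)) :=
    fun r => isFiniteMeasure_restrict.2 measure_closedBall_lt_top.ne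
  have h1 : ∀ i ∈ (Finset.univ : Finset (Fin d)), Integrable fun x => f x i * partialD i φ x :=
    fun i _ => by
    rw [← memLp_one_iff_integrable]
    exact MemLp.mul_testFunction
      (fun r => (MemLp.coord (hf r) i).mono_exponent (by norm_num)) (hφ.partialD i)
  have h2 : ∀ i ∈ (Finset.univ : Finset (Fin d)), Integrable fun x => a i * partialD i φ x :=
    fun i _ => (hφ.partialD i).integrable.const_mul _
  rw [← h φ hφ]
  simp only [PiLp.add_apply, add_mul, Finset.sum_add_distrib]
  rw [integral_add (integrable_finsetSum _ h1) (integrable_finsetSum _ h2),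
    integral_finsetSum _ h2]
  simp [integral_const_mul, integral_partialD hφ]

end Coefficients

/-! ### Uniqueness of the means -/

section MeanUniqueness

variable {Ω : Type*} [mΩ : MeasurableSpace Ω] {d : ℕ} {P : Measure Ω} {T : ℝ≥0}
  {B : ℝ≥0 → Ω → Eucl d} {b : ℝ → Eucl d → Eucl d} {divb : ℝ → Eucl d → ℝ} {u₀ : Eucl d → ℝ}
  {u v : Ω → ℝ → Eucl d → ℝ} {U W : Ω × ℝ × Eucl d → ℝ} {C₀ C₁ : ℝ}

lemma IsBoundedVersion.ae_integral_mul_eq [SFinite P] (hU : IsBoundedVersion P T u U C₀)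
    (F : Ω → ℝ) :
    ∀ᵐ z ∂((timeMeasure T).prod (volume : Measure (Eucl d))),
      ∫ ω, u ω z.1 z.2 * F ω ∂P = meanField P F U z.1 z.2 := by
  filter_upwards [ae_prod_ae_of_ae_prod hU.ae_eq] with z hz
  refine integral_congr_ae ?_
  filter_upwards [hz] with ω hω
  have hω' : u ω z.1 z.2 = U (ω, z) := hω
  rw [hω', mul_comm]

/-- The weak gradient of a mean, with a measurable representative. -/
lemma IsQuasiregularSolution.exists_gradient [SFinite P]
    (hu : IsQuasiregularSolution P T B b divb u₀ u) (hU : IsBoundedVersion P T u U C₀) {F : Ω → ℝ}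
    (hF : F ∈ stochasticExponentials B T P) :
    ∃ G : ℝ → Eucl d → Eucl d, Measurable (fun z : ℝ × Eucl d => G z.1 z.2) ∧
      MemLp (fun z : ℝ × Eucl d => G z.1 z.2) 2 ((timeMeasure T).prod volume) ∧
      ∀ᵐ t ∂(timeMeasure T), IsWeakGradient (meanField P F U t) (G t) := by
  obtain ⟨-, ⟨-, G, hG, hgrad⟩, -⟩ := hu.regular_in_mean F hF
  refine ⟨fun t x => hG.1.mk _ (t, x), hG.1.stronglyMeasurable_mk.measurable,
    hG.ae_eq hG.1.ae_eq_mk, ?_⟩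
  filter_upwards [hgrad, Measure.ae_ae_of_ae_prod hG.1.ae_eq_mk,
    Measure.ae_ae_of_ae_prod (hU.ae_integral_mul_eq F)] with t h1 h2 h3 φ hφ i
  have h4 : ∫ x, meanField P F U t x * partialD i φ x
      = ∫ x, (∫ ω, u ω t x * F ω ∂P) * partialD i φ x :=
    integral_congr_ae (by filter_upwards [h3] with x hx; rw [hx])
  have h5 : ∫ x, hG.1.mk _ (t, x) i * φ x = ∫ x, G t x i * φ x :=
    integral_congr_ae (by filter_upwards [h2] with x hx; rw [← hx])
  rw [h4, h1 φ hφ i, h5]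

/-- The energy of a mean is bounded in time, by continuity in `L²`. -/
lemma IsQuasiregularSolution.exists_energy_bound [SFinite P]
    (hu : IsQuasiregularSolution P T B b divb u₀ u) (hU : IsBoundedVersion P T u U C₀) {F : Ω → ℝ}
    (hF : F ∈ stochasticExponentials B T P) :
    ∃ E : ℝ, ∀ᵐ t ∂(timeMeasure T), MemLp (meanField P F U t) 2 volume ∧
      ∫ x, meanField P F U t x ^ 2 ≤ E := by
  obtain ⟨-, -, Z, hZ, hZe⟩ := hu.regular_in_mean F hF
  obtain ⟨A, hA⟩ := isCompact_Icc.exists_bound_of_continuousOn hZ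
  refine ⟨A ^ 2, ?_⟩
  filter_upwards [hZe, ae_timeMeasure_mem T,
    Measure.ae_ae_of_ae_prod (hU.ae_integral_mul_eq F)] with t h1 h2 h3
  have h4 : meanField P F U t =ᵐ[volume] Z t := by
    filter_upwards [h1, h3] with x hx1 hx3
    rw [← hx1, ← hx3]
  refine ⟨(Lp.memLp (Z t)).ae_eq h4.symm, ?_⟩
  have h5 : ∫ x, meanField P F U t x ^ 2 = ‖Z t‖ ^ 2 := by
    rw [← real_inner_self_eq_norm_sq, L2.inner_def]
    refine integral_congr_ae ?_
    filter_upwards [h4] with x hx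
    rw [hx, real_inner_self_eq_norm_sq, Real.norm_eq_abs, sq_abs]
  rw [h5]
  exact pow_le_pow_left₀ (norm_nonneg _) (hA t h2) 2

/-- The means of two solutions against the exponential of a step function agree: their difference
solves a parabolic equation with zero initial datum. -/
lemma IsQuasiregularSolution.ae_meanField_eq [IsProbabilityMeasure P] (hT : 0 < T)
    (hB : IsBrownianMotionOn B T P)
    (hu : IsQuasiregularSolution P T B b divb u₀ u)
    (hv : IsQuasiregularSolution P T B b divb u₀ v)
    (hU : IsBoundedVersion P T u U C₀) (hC₀ : 0 ≤ C₀)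
    (hW : IsBoundedVersion P T v W C₁) (hC₁ : 0 ≤ C₁)
    (hb : MemL2Loc T b) (hdivb : MemL1Linfty T volume divb)
    (hdiv : ∀ᵐ t ∂(timeMeasure T), IsWeakDivergence (b t) (divb t)) {R : ℝ}
    (hgrowth : MemL1Linfty T (volume.restrict (Metric.closedBall 0 R)ᶜ)
      (fun t x => (1 + ‖x‖)⁻¹ • b t x))
    (hbm : Measurable fun z : ℝ × Eucl d => b z.1 z.2)
    (hdm : Measurable fun z : ℝ × Eucl d => divb z.1 z.2) (m : ℕ) (c : ℕ → Eucl d) {F : Ω → ℝ}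
    (hF : F = stepExp B T m (fun l i => c l i) (Finset.range (2 ^ m))) :
    ∀ᵐ z ∂((timeMeasure T).prod (volume : Measure (Eucl d))),
      meanField P F U z.1 z.2 = meanField P F W z.1 z.2 := by
  have hFX : F ∈ stochasticExponentials B T P := hF ▸ stepExp_mem_stochasticExponentials hB m c
  have hF2 : MemLp F 2 P := hF ▸ memLp_stepExp hB _
  have hFm : Measurable F := by
    rw [hF]
    exact ((stronglyMeasurable_stepExp hB _ le_rfl fun j hj => Finset.mem_range.1 hj).mono
      ((brownianFiltration B T P).le _)).measurable
  have hFi : Integrable F P := hF2.integrable (by norm_num)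
  set h : ℝ → Eucl d := stepFunction (2 ^ m) (gridPt T m) c with hh
  have hbh : MemL2Loc T fun t x => b t x + h t := hb.add_stepFunction _ _ c
  have hhm : Measurable fun z : ℝ × Eucl d => h z.1 :=
    (measurable_stepFunction _ _ c).comp measurable_fst
  have hbhm : Measurable fun z : ℝ × Eucl d => b z.1 z.2 + h z.1 := hbm.add hhm
  obtain ⟨G₁, hG₁m, hG₁, hgrad₁⟩ := hu.exists_gradient hU hFX
  obtain ⟨G₂, hG₂m, hG₂, hgrad₂⟩ := hv.exists_gradient hW hFX
  obtain ⟨E₁, hE₁⟩ := hu.exists_energy_bound hU hFX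
  obtain ⟨E₂, hE₂⟩ := hv.exists_energy_bound hW hFX
  obtain ⟨μ, hμ, hdivμ⟩ := hdivb.exists_bound hdm
  obtain ⟨κ, hκ, hbκ⟩ := hgrowth.exists_bound (f := fun t x => (1 + ‖x‖)⁻¹ • b t x)
    (by fun_prop)
  set V₁ := meanField P F U with hV₁
  set V₂ := meanField P F W with hV₂
  have hV₁m : Measurable fun z : ℝ × Eucl d => V₁ z.1 z.2 := measurable_meanField hFm hU.measurable
  have hV₂m : Measurable fun z : ℝ × Eucl d => V₂ z.1 z.2 := measurable_meanField hFm hW.measurable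
  have hV₁le : ∀ t x, |V₁ t x| ≤ C₀ * ∫ ω, |F ω| ∂P := fun t x => abs_meanField_le hFi hU t x
  have hV₂le : ∀ t x, |V₂ t x| ≤ C₁ * ∫ ω, |F ω| ∂P := fun t x => abs_meanField_le hFi hW t x
  have hV₁s : ∀ t, AEStronglyMeasurable (V₁ t) (volume : Measure (Eucl d)) := fun t =>
    (hV₁m.comp measurable_prodMk_left).aestronglyMeasurable
  have hV₂s : ∀ t, AEStronglyMeasurable (V₂ t) (volume : Measure (Eucl d)) := fun t =>
    (hV₂m.comp measurable_prodMk_left).aestronglyMeasurable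
  have hL₁ : MemLp (fun z : ℝ × Eucl d => V₁ z.1 z.2) 2 ((timeMeasure T).prod volume) :=
    (hu.regular_in_mean F hFX).2.1.1.ae_eq (hU.ae_integral_mul_eq F)
  have hL₂ : MemLp (fun z : ℝ × Eucl d => V₂ z.1 z.2) 2 ((timeMeasure T).prod volume) :=
    (hv.regular_in_mean F hFX).2.1.1.ae_eq (hW.ae_integral_mul_eq F)
  have hbs : ∀ᵐ t ∂(timeMeasure T),
      ∀ r : ℝ, MemLp (b t) 2 (volume.restrict (Metric.closedBall 0 r)) := by
    have h1 : ∀ᵐ t ∂(timeMeasure T),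
        ∀ n : ℕ, MemLp (b t) 2 (volume.restrict (Metric.closedBall 0 (n : ℝ))) :=
      ae_all_iff.2 fun n =>
        IsParabolicSolution.ae_memLp_slice hbm (hb _ (isCompact_closedBall _ _))
    filter_upwards [h1] with t ht r
    obtain ⟨n, hn⟩ := exists_nat_ge r
    exact (ht n).mono_measure
      (Measure.restrict_mono (Metric.closedBall_subset_closedBall hn) le_rfl)
  have hsol : IsParabolicSolution T (fun t x => b t x + h t) (fun t x => G₁ t x - G₂ t x) divb
      (fun t x => V₁ t x - V₂ t x) μ (fun t => κ t + ∑ k ∈ Finset.range (2 ^ m), ‖c k‖)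
      (C₀ * (∫ ω, |F ω| ∂P) + C₁ * ∫ ω, |F ω| ∂P) R (2 * E₁ + 2 * E₂) := by
    refine ⟨hbhm, hG₁m.sub hG₂m, hdm, hV₁m.sub hV₂m, fun t x => ?_,
      fun r => hbh _ (isCompact_closedBall _ _), hG₁.sub hG₂, hL₁.sub hL₂, ?_, ?_, hμ, hdivμ,
      hκ.add (integrable_const _), ?_, ?_, fun φ hφ => ?_⟩
    · exact (abs_sub _ _).trans (add_le_add (hV₁le t x) (hV₂le t x))
    · filter_upwards [hgrad₁, hgrad₂, hE₁, hE₂,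
        IsParabolicSolution.ae_memLp_slice hG₁m hG₁,
        IsParabolicSolution.ae_memLp_slice hG₂m hG₂] with t h1 h2 h3 h4 h5 h6 φ hφ i
      have i1 : ∀ {f : Eucl d → ℝ} {ψ : Eucl d → ℝ}, MemLp f 2 volume → IsTestFunction ψ →
          Integrable fun x => f x * ψ x := fun hf hψ =>
        hf.integrable_mul (q := 2)
          (hψ.continuous.memLp_of_hasCompactSupport hψ.compactSupport)
      simp only [sub_mul, PiLp.sub_apply]
      rw [integral_sub (i1 h3.1 (hφ.partialD i)) (i1 h4.1 (hφ.partialD i)),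
        integral_sub (i1 (MemLp.coord h5 i) hφ) (i1 (MemLp.coord h6 i) hφ), h1 φ hφ i, h2 φ hφ i]
      ring
    · filter_upwards [hdiv, hbs] with t h1 h2 using h1.add_const h2 _
    · filter_upwards [hbκ] with t ht
      filter_upwards [(ae_restrict_iff' measurableSet_closedBall.compl).1 ht] with x hx hRx
      have h1 : (0 : ℝ) < 1 + ‖x‖ := by positivity
      have h2 := hx (by simpa using hRx)
      rw [norm_smul, norm_inv, Real.norm_of_nonneg h1.le, inv_mul_le_iff₀ h1] at h2
      have h3 := norm_stepFunction_le (2 ^ m) (gridPt T m) c t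
      have h4 := norm_nonneg (h t)
      calc ‖b t x + h t‖ ≤ ‖b t x‖ + ‖h t‖ := norm_add_le _ _
        _ ≤ (1 + ‖x‖) * κ t + (∑ k ∈ Finset.range (2 ^ m), ‖c k‖) * (1 + ‖x‖) := by
            refine add_le_add h2 (h3.trans (le_mul_of_one_le_right (h4.trans h3) ?_))
            linarith [norm_nonneg x]
        _ = _ := by ring
    · filter_upwards [hE₁, hE₂] with t h1 h2
      calc ∫ x, (V₁ t x - V₂ t x) ^ 2
          ≤ ∫ x, (2 * V₁ t x ^ 2 + 2 * V₂ t x ^ 2) := by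
            refine integral_mono_of_nonneg (Eventually.of_forall fun x => sq_nonneg _)
              ((h1.1.integrable_sq.const_mul 2).add (h2.1.integrable_sq.const_mul 2))
              (Eventually.of_forall fun x => ?_)
            simp only
            nlinarith [sq_nonneg (V₁ t x + V₂ t x)]
        _ = 2 * (∫ x, V₁ t x ^ 2) + 2 * ∫ x, V₂ t x ^ 2 := by
            rw [integral_add (h1.1.integrable_sq.const_mul 2) (h2.1.integrable_sq.const_mul 2),
              integral_const_mul, integral_const_mul]
        _ ≤ 2 * E₁ + 2 * E₂ := by linarith [h1.2, h2.2]
    · have hker : Integrable (fun z : ℝ × Eucl d => ∑ i, (b z.1 z.2 + h z.1) i * partialD i φ z.2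
          + divb z.1 z.2 * φ z.2 + 1 / 2 * ∑ i, partialD i (partialD i φ) z.2)
          ((timeMeasure T).prod volume) := by
        refine ((integrable_sum_mul_partialD hbh hφ).add (integrable_divb_mul hdivb hdm hφ)).add ?_
        have h1 : Integrable (fun x => 1 / 2 * ∑ i, partialD i (partialD i φ) x)
            (volume : Measure (Eucl d)) :=
          (integrable_finsetSum _ fun i _ => ((hφ.partialD i).partialD i).integrable).const_mul _
        exact h1.comp_snd _
      have hint : ∀ {V : ℝ → Eucl d → ℝ} {C : ℝ},
          Measurable (fun z : ℝ × Eucl d => V z.1 z.2) → (∀ t x, |V t x| ≤ C) →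
          Integrable (fun s => parabolicForm (fun x => b s x + h s) (divb s) (V s) φ)
            (timeMeasure T) := fun hVm hVC =>
        (hker.bdd_mul hVm.aestronglyMeasurable
          (Eventually.of_forall fun z => hVC z.1 z.2)).integral_prod_left
      have h0 : (0 : ℝ) ∈ Icc 0 (T : ℝ) := ⟨le_rfl, T.coe_nonneg⟩
      have hform : ∀ᵐ s ∂(timeMeasure T),
          parabolicForm (fun x => b s x + h s) (divb s) (fun x => V₁ s x - V₂ s x) φ
          = parabolicForm (fun x => b s x + h s) (divb s) (V₁ s) φ
            - parabolicForm (fun x => b s x + h s) (divb s) (V₂ s) φ := by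
        filter_upwards [hker.prod_right_ae] with s hs
        unfold parabolicForm
        simp only [sub_mul]
        exact integral_sub (hs.bdd_mul (hV₁s s) (Eventually.of_forall fun x => hV₁le s x))
          (hs.bdd_mul (hV₂s s) (Eventually.of_forall fun x => hV₂le s x))
      filter_upwards [hu.mean_equation hT hB hU hC₀ hb hdivb hbm hdm m c hF hφ,
        hv.mean_equation hT hB hW hC₁ hb hdivb hbm hdm m c hF hφ, ae_timeMeasure_mem T]
        with t h1 h2 ht
      have h3 : ∀ {V : ℝ → Eucl d → ℝ} {C : ℝ},
          Measurable (fun z : ℝ × Eucl d => V z.1 z.2) → (∀ t x, |V t x| ≤ C) →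
          Integrable (fun x => V t x * φ x) := fun {V C} hVm hVC =>
        hφ.integrable.bdd_mul (hVm.comp measurable_prodMk_left).aestronglyMeasurable
          (Eventually.of_forall fun x => hVC t x)
      simp only [sub_mul]
      rw [integral_sub (h3 hV₁m hV₁le) (h3 hV₂m hV₂le), h1, h2, add_sub_add_left_eq_sub,
        ← intervalIntegral.integral_sub (intervalIntegrable_of_timeMeasure (hint hV₁m hV₁le) h0 ht)
          (intervalIntegrable_of_timeMeasure (hint hV₂m hV₂le) h0 ht),
        integral_interval_eq_timeMeasure ht, integral_interval_eq_timeMeasure ht]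
      refine integral_congr_ae (ae_restrict_of_ae ?_)
      filter_upwards [hform] with s hs
      exact hs.symm
  filter_upwards [hsol.ae_eq_zero] with z hz
  exact sub_eq_zero.1 hz

end MeanUniqueness

/-! ### From the means to the processes -/

section Recovery

variable {Ω : Type*} [mΩ : MeasurableSpace Ω] {d : ℕ} {P : Measure Ω} {T : ℝ≥0}
  {B : ℝ≥0 → Ω → Eucl d}

/-- Two bounded processes with the same means against all exponentials of step functions are
almost everywhere equal. -/
lemma ae_eq_of_integral_stepExp_mul_eq [IsProbabilityMeasure P] (hT : 0 < T)
    (hB : IsBrownianMotionOn B T P) (hΩ : mΩ ≤ brownianFiltration B T P T) {Z : Type*}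
    [MeasurableSpace Z] {κ : Measure Z} [IsFiniteMeasure κ] {U W : Ω × Z → ℝ} {C : ℝ}
    (hU : Measurable U) (hW : Measurable W) (hUC : ∀ z, |U z| ≤ C) (hWC : ∀ z, |W z| ≤ C)
    (h : ∀ (m : ℕ) (c : ℕ → Eucl d), ∀ᵐ y ∂κ,
      ∫ ω, stepExp B T m (fun k i => c k i) (Finset.range (2 ^ m)) ω * U (ω, y) ∂P
        = ∫ ω, stepExp B T m (fun k i => c k i) (Finset.range (2 ^ m)) ω * W (ω, y) ∂P) :
    ∀ᵐ z ∂(P.prod κ), U z = W z := by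
  set F : ℕ → (ℕ → Eucl d) → Ω → ℝ :=
    fun m c => stepExp B T m (fun k i => c k i) (Finset.range (2 ^ m)) with hF
  have hF2 : ∀ m c, MemLp (F m c) 2 P := fun m c => memLp_stepExp hB _
  have hFi : ∀ m c, Integrable (F m c) P := fun m c => (hF2 m c).integrable (by norm_num)
  have hFm : ∀ m c, Measurable (F m c) := fun m c =>
    ((stronglyMeasurable_stepExp hB _ le_rfl fun j hj => Finset.mem_range.1 hj).mono
      ((brownianFiltration B T P).le _)).measurable
  -- the addition of `C` makes the densities nonnegative
  set δ : (Ω × Z → ℝ) → Ω × Z → ℝ≥0∞ := fun X z => ENNReal.ofReal (C + X z) with hδ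
  have hδm : ∀ {X : Ω × Z → ℝ}, Measurable X → Measurable (δ X) := fun hX =>
    (measurable_const.add hX).ennreal_ofReal
  have hδr : ∀ {X : Ω × Z → ℝ}, (∀ z, |X z| ≤ C) → ∀ z, (δ X z).toReal = C + X z := fun hXC z =>
    ENNReal.toReal_ofReal (by linarith [(abs_le.1 (hXC z)).1])
  have hfin : ∀ {X : Ω × Z → ℝ} (_ : ∀ z, |X z| ≤ C) (κ' : Measure Z) [IsFiniteMeasure κ'],
      ∫⁻ z, δ X z ∂(P.prod κ') ≠ ∞ := by
    intro X hXC κ' _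
    refine ((lintegral_mono (g := fun _ => ENNReal.ofReal (C + C)) fun z => ?_).trans_lt ?_).ne
    · exact ENNReal.ofReal_le_ofReal (by linarith [(abs_le.1 (hXC z)).2])
    · rw [lintegral_const]
      exact ENNReal.mul_lt_top ENNReal.ofReal_lt_top (measure_lt_top _ _)
  have hlift : ∀ m c (κ' : Measure Z) [IsFiniteMeasure κ'],
      Integrable (fun z : Ω × Z => F m c z.1) (P.prod κ') := fun m c κ' _ => (hFi m c).comp_fst _
  have hlift' : ∀ {X : Ω × Z → ℝ} (_ : Measurable X) (_ : ∀ z, |X z| ≤ C) m c (κ' : Measure Z)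
      [IsFiniteMeasure κ'], Integrable (fun z : Ω × Z => F m c z.1 * (C + X z)) (P.prod κ') := by
    intro X hX hXC m c κ' _
    refine (hlift m c κ').mul_bdd (c := C + C) (measurable_const.add hX).aestronglyMeasurable
      (Eventually.of_forall fun z => ?_)
    rw [Real.norm_eq_abs, abs_le]
    constructor <;> linarith [(abs_le.1 (hXC z)).1, (abs_le.1 (hXC z)).2]
  have hkey : (P.prod κ).withDensity (δ U) = (P.prod κ).withDensity (δ W) := by
    have : IsFiniteMeasure ((P.prod κ).withDensity (δ U)) :=
      isFiniteMeasure_withDensity (hfin hUC κ)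
    refine Measure.ext_prod fun {s t} hs ht => ?_
    set ν : (Ω × Z → ℝ) → Measure Ω :=
      fun X => ((P.prod (κ.restrict t)).withDensity (δ X)).map Prod.fst with hν
    have hνs : ∀ {X : Ω × Z → ℝ}, (P.prod κ).withDensity (δ X) (s ×ˢ t) = ν X s := by
      intro X
      rw [hν]
      simp only
      rw [Measure.map_apply measurable_fst hs, withDensity_apply _ (hs.prod ht),
        withDensity_apply _ (measurable_fst hs), ← Measure.prod_restrict, ← prod_univ,
        ← Measure.prod_restrict, Measure.restrict_univ]
    have hνac : ∀ X, ν X ≪ P := fun X =>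
      ((withDensity_absolutelyContinuous _ _).map measurable_fst).trans
        Measure.quasiMeasurePreserving_fst.absolutelyContinuous
    have hνi : ∀ {X : Ω × Z → ℝ} (_ : Measurable X) (_ : ∀ z, |X z| ≤ C) m c,
        Integrable (F m c) (ν X) := by
      intro X hX hXC m c
      refine (integrable_map_measure (hFm m c).aestronglyMeasurable
        measurable_fst.aemeasurable).2 ?_
      refine (integrable_withDensity_iff (hδm hX)
        (Eventually.of_forall fun _ => ENNReal.ofReal_lt_top)).2 ?_
      simp only [hδr hXC, Function.comp_apply]
      exact hlift' hX hXC m c _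
    have hνe : ∀ {X : Ω × Z → ℝ} (_ : Measurable X) (_ : ∀ z, |X z| ≤ C) m c,
        ∫ ω, F m c ω ∂(ν X) = ∫ y in t, (∫ ω, F m c ω * (C + X (ω, y)) ∂P) ∂κ := by
      intro X hX hXC m c
      rw [integral_map measurable_fst.aemeasurable (hFm m c).aestronglyMeasurable,
        integral_withDensity_eq_integral_toReal_smul (hδm hX)
          (Eventually.of_forall fun _ => ENNReal.ofReal_lt_top),
        ← integral_prod_symm _ (hlift' hX hXC m c _)]
      refine integral_congr_ae (Eventually.of_forall fun z => ?_)
      simp only [hδr hXC, smul_eq_mul]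
      ring
    have hνf : ∀ {X : Ω × Z → ℝ} (_ : ∀ z, |X z| ≤ C), IsFiniteMeasure (ν X) := fun hXC => by
      have := isFiniteMeasure_withDensity (hfin hXC (κ.restrict t))
      exact Measure.isFiniteMeasure_map _ _
    have := hνf hUC
    have := hνf hWC
    rw [hνs, hνs, measure_eq_of_integral_stepExp_eq hT hB hΩ (hνac U) (hνac W) (hνi hU hUC)
      fun m c => ?_]
    refine ((hνe hU hUC m c).trans ?_).trans (hνe hW hWC m c).symm
    refine integral_congr_ae (ae_restrict_of_ae ?_)
    filter_upwards [h m c] with y hy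
    have h1 : ∀ {X : Ω × Z → ℝ} (_ : Measurable X) (_ : ∀ z, |X z| ≤ C),
        ∫ ω, F m c ω * (C + X (ω, y)) ∂P
          = (∫ ω, F m c ω * C ∂P) + ∫ ω, F m c ω * X (ω, y) ∂P := fun {X} hX hXC => by
      simp only [mul_add]
      exact integral_add ((hFi m c).mul_const C) ((hFi m c).mul_bdd (c := C)
        (hX.comp measurable_prodMk_right).aestronglyMeasurable
        (Eventually.of_forall fun ω => hXC _))
    rw [h1 hU hUC, h1 hW hWC]
    exact congrArg _ hy
  have h2 := (withDensity_eq_iff (hδm hU).aemeasurable (hδm hW).aemeasurable (hfin hUC κ)).1 hkey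
  filter_upwards [h2] with z hz
  have h3 := congrArg ENNReal.toReal hz
  rw [hδr hUC, hδr hWC] at h3
  linarith

end Recovery

/-! ### Uniqueness of quasiregular solutions -/

section Uniqueness

variable {Ω : Type*} [mΩ : MeasurableSpace Ω] {d : ℕ} {P : Measure Ω} {T : ℝ≥0}
  {B : ℝ≥0 → Ω → Eucl d} {b : ℝ → Eucl d → Eucl d} {divb : ℝ → Eucl d → ℝ} {u₀ : Eucl d → ℝ}
  {u v : Ω → ℝ → Eucl d → ℝ}

lemma timeMeasure_zero : timeMeasure 0 = 0 := by
  simp [timeMeasure]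

/-- Uniqueness when the coefficients are given by measurable representatives. -/
lemma IsQuasiregularSolution.ae_eq_of_measurable [IsProbabilityMeasure P] (hT : 0 < T)
    (hB : IsBrownianMotionOn B T P) (hΩ : mΩ ≤ brownianFiltration B T P T)
    (hu : IsQuasiregularSolution P T B b divb u₀ u)
    (hv : IsQuasiregularSolution P T B b divb u₀ v)
    (hb : MemL2Loc T b) (hdivb : MemL1Linfty T volume divb)
    (hdiv : ∀ᵐ t ∂(timeMeasure T), IsWeakDivergence (b t) (divb t)) {R : ℝ}
    (hgrowth : MemL1Linfty T (volume.restrict (Metric.closedBall 0 R)ᶜ)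
      (fun t x => (1 + ‖x‖)⁻¹ • b t x))
    (hbm : Measurable fun z : ℝ × Eucl d => b z.1 z.2)
    (hdm : Measurable fun z : ℝ × Eucl d => divb z.1 z.2) :
    ∀ᵐ z : Ω × ℝ × Eucl d ∂(P.prod ((timeMeasure T).prod volume)),
      u z.1 z.2.1 z.2.2 = v z.1 z.2.1 z.2.2 := by
  obtain ⟨U, C₀, hC₀, hU⟩ := exists_isBoundedVersion hu.memLp_top
  obtain ⟨W, C₁, hC₁, hW⟩ := exists_isBoundedVersion hv.memLp_top
  have hball : ∀ n : ℕ, ∀ᵐ z ∂(P.prod ((timeMeasure T).prod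
      ((volume : Measure (Eucl d)).restrict (Metric.closedBall 0 (n : ℝ))))), U z = W z := by
    intro n
    have hfin : IsFiniteMeasure ((volume : Measure (Eucl d)).restrict
        (Metric.closedBall 0 (n : ℝ))) :=
      isFiniteMeasure_restrict.2 measure_closedBall_lt_top.ne
    refine ae_eq_of_integral_stepExp_mul_eq hT hB hΩ hU.measurable hW.measurable (C := max C₀ C₁)
      (fun z => (hU.abs_le z).trans (le_max_left _ _))
      (fun z => (hW.abs_le z).trans (le_max_right _ _)) fun m c => ?_
    rw [← Measure.restrict_univ (μ := timeMeasure T), Measure.prod_restrict]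
    exact ae_restrict_of_ae (hu.ae_meanField_eq hT hB hv hU hC₀ hW hC₁ hb hdivb hdiv hgrowth
      hbm hdm m c rfl)
  have hcover : P.prod ((timeMeasure T).prod (volume : Measure (Eucl d)))
      = (P.prod ((timeMeasure T).prod volume)).restrict
        (⋃ n : ℕ, univ ×ˢ univ ×ˢ Metric.closedBall (0 : Eucl d) n) := by
    rw [← prod_iUnion, ← prod_iUnion, Metric.iUnion_closedBall_nat, univ_prod_univ,
      univ_prod_univ, Measure.restrict_univ]
  have hUW : ∀ᵐ z ∂(P.prod ((timeMeasure T).prod (volume : Measure (Eucl d)))), U z = W z := by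
    rw [hcover, ae_restrict_iUnion_iff]
    intro n
    rw [← Measure.prod_restrict, ← Measure.prod_restrict, Measure.restrict_univ,
      Measure.restrict_univ]
    exact hball n
  filter_upwards [hU.ae_eq, hW.ae_eq, hUW] with z h1 h2 h3
  rw [h1, h2, h3]

end Uniqueness

end StochTransport

end

theorem theorem4p2 {Ω : Type*} [mΩ : MeasurableSpace Ω] (P : Measure Ω) [IsProbabilityMeasure P]
    (d : ℕ) (T : ℝ≥0)
    (B : ℝ≥0 → Ω → StochTransport.Eucl d)
    (hB : StochTransport.IsBrownianMotionOn B T P)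
    (hΩ : StochTransport.brownianFiltration B T P T = mΩ)
    (b : ℝ → StochTransport.Eucl d → StochTransport.Eucl d)
    (divb : ℝ → StochTransport.Eucl d → ℝ)
    (hb : StochTransport.MemL2Loc T b)
    (hdiv : ∀ᵐ t ∂(StochTransport.timeMeasure T),
      StochTransport.IsWeakDivergence (b t) (divb t))
    (hdivb : StochTransport.MemL1Linfty T volume divb)
    (hgrowth : ∃ R : ℝ, 0 < R ∧
      StochTransport.MemL1Linfty T (volume.restrict (Metric.closedBall 0 R)ᶜ)
        (fun t x => (1 + ‖x‖)⁻¹ • b t x))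
    (u₀ : StochTransport.Eucl d → ℝ)
    (hu₀ : MemLp u₀ 2 volume) (hu₀' : MemLp u₀ ∞ volume)
    (u v : Ω → ℝ → StochTransport.Eucl d → ℝ)
    (hu : StochTransport.IsQuasiregularSolution P T B b divb u₀ u)
    (hv : StochTransport.IsQuasiregularSolution P T B b divb u₀ v) :
    ∀ᵐ z : Ω × ℝ × StochTransport.Eucl d ∂(P.prod ((StochTransport.timeMeasure T).prod volume)),
      u z.1 z.2.1 z.2.2 = v z.1 z.2.1 z.2.2 := by
  rcases eq_or_lt_of_le (zero_le : 0 ≤ T) with rfl | hT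
  · simp [StochTransport.timeMeasure_zero]
  obtain ⟨R, -, hgrowth⟩ := hgrowth
  -- measurable representatives of the coefficients
  have hbs := hb.aestronglyMeasurable
  set b' : ℝ → StochTransport.Eucl d → StochTransport.Eucl d := fun t x => hbs.mk _ (t, x)
  set divb' : ℝ → StochTransport.Eucl d → ℝ := fun t x => hdivb.1.mk _ (t, x)
  have hbb : ∀ᵐ z ∂((StochTransport.timeMeasure T).prod
      (volume : Measure (StochTransport.Eucl d))), b z.1 z.2 = b' z.1 z.2 := hbs.ae_eq_mk
  have hdd : ∀ᵐ z ∂((StochTransport.timeMeasure T).prod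
      (volume : Measure (StochTransport.Eucl d))), divb z.1 z.2 = divb' z.1 z.2 :=
    hdivb.1.ae_eq_mk
  have hdiv' : ∀ᵐ t ∂(StochTransport.timeMeasure T),
      StochTransport.IsWeakDivergence (b' t) (divb' t) := by
    filter_upwards [hdiv, Measure.ae_ae_of_ae_prod hbb, Measure.ae_ae_of_ae_prod hdd]
      with t h1 h2 h3 using h1.congr h2 h3
  have hgrowth' : StochTransport.MemL1Linfty T (volume.restrict (Metric.closedBall 0 R)ᶜ)
      (fun t x => (1 + ‖x‖)⁻¹ • b' t x) := by
    refine hgrowth.congr ?_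
    rw [← Measure.restrict_univ (μ := StochTransport.timeMeasure T), Measure.prod_restrict]
    filter_upwards [ae_restrict_of_ae hbb] with z hz
    rw [hz]
  exact (hu.congr_coeff hbb hdd).ae_eq_of_measurable hT hB hΩ.ge (hv.congr_coeff hbb hdd)
    (hb.congr hbb) (hdivb.congr hdd) hdiv' hgrowth' hbs.stronglyMeasurable_mk.measurable
    hdivb.1.stronglyMeasurable_mk.measurable
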